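/- Let $n\ge 1$ and $\lambda\in\mathbb C$, and write $\mathbb N=\{0,1,2,\dots\}$, $\mathbb N_+=\{1,2,\dots\}$. Let $\mathfrak g=\mathfrak{so}(n+2,\mathbb C)$ be the orthogonal Lie algebra of the quadratic form $2x_0x_{n+1}+\sum_{i=1}^n x_i^2$ on $\mathbb C^{n+2}$ with standard basis $e_0,\dots,e_{n+1}$. Let $\mathfrak g'\simeq\mathfrak{so}(n+1,\mathbb C)$ be the annihilator of $e_n$ in $\mathfrak g$. Let $\mathfrak p=\mathfrak l+\mathfrak n_+$ be the parabolic subalgebra stabilizing the line $\mathbb Ce_0$, where $\mathfrak n_+$ is its nilradical and the Levi subalgebra $\mathfrak l\simeq\mathfrak{so}(n,\mathbb C)\oplus\mathbb C$ also stabilizes $\mathbb Ce_{n+1}$. Put $\mathfrak p'=\mathfrak p\cap\mathfrak g'=\mathfrak l'+\mathfrak n_+'$, where $\mathfrak l'=\mathfrak l\cap\mathfrak g'\simeq\mathfrak{so}(n-1,\mathbb C)\oplus\mathbb C$ and $\mathfrak n_+'=\mathfrak n_+\cap\mathfrak g'$. For $m\in\{n-1,n\}$ let $\mathbb S^m$ be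 the spin representation of $\mathfrak{so}(m,\mathbb C)$, of dimension $2^{\lfloor m/2\rfloor}$, and, for $m$ even, let $\mathbb S^m=\mathbb S^m_+\oplus\mathbb S^m_-$ be its decomposition into half-spin representations (with $\mathbb S^0_+=\mathbb C$ and $\mathbb S^0_-=0$). For $\mu\in\mathbb C$ let $\mathbb S^n_\mu=\mathbb S^n\otimes\mathbb C_\mu$ (and $\mathbb S^n_{\pm,\mu}=\mathbb S^n_\pm\otimes\mathbb C_\mu$ for $n$ even) be the $\mathfrak p$-module on which $\operatorname{diag}(1,0,\dots,0,-1)$ acts by $\mu$ and $\mathfrak n_+$ acts by $0$; define the $\mathfrak p'$-modules $\mathbb S^{n-1}_\mu$ and $\mathbb S^{n-1}_{\pm,\mu}$ in the same way. Write $M^{\mathfrak g}_{\mathfrak p}(F)=U(\mathfrak g)\otimes_{U(\mathfrak p)}F$ and $M^{\mathfrak g'}_{\mathfrak p'}(F')=U(\mathfrak g')\otimes_{U(\mathfrak p')}F'$. Let $\mathcal O^{\mathfrak p'}$ be the parabolic category $\mathcal O$ of finitely generated $\mathfrak g'$-modules that are sums of finite-dimensional simple $\mathfrak l'$-modules and locally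 $\mathfrak n_+'$-finite. Let $K(\mathcal O^{\mathfrak p'})$ be its Grothendieck group, in which formal sums of countably many classes of simple objects are allowed. A $\mathfrak g'$-module $X$ with finite Jordan–Hölder multiplicities that is the union of an increasing sequence of finite-length submodules belonging to $\mathcal O^{\mathfrak p'}$ has the class $\sum_S [X:S]\,\mathrm{Ch}(S)$, where $S$ runs over the simple objects of $\mathcal O^{\mathfrak p'}$ up to isomorphism. (1) The restriction to $\mathfrak g'$ of $M^{\mathfrak g}_{\mathfrak p}(\mathbb S^n_\lambda)$ ($n$ odd), respectively of $M^{\mathfrak g}_{\mathfrak p}(\mathbb S^n_{\pm,\lambda})$ ($n$ even, either sign), has a class in $K(\mathcal O^{\mathfrak p'})$, and in $K(\mathcal O^{\mathfrak p'})$ $$M^{\mathfrak g}_{\mathfrak p}(\mathbb S^n_\lambda)|_{\mathfrak g'}\simeq\bigoplus_{\epsilon=\pm}\bigoplus_{b=0}^\infty M^{\mathfrak g'}_{\mathfrak p'}(\mathbb S^{n-1}_{\epsilon,\lambda-b})\quad(n\text{ odd}),\qquad M^{\mathfrak g}_{\mathfrak p}(\mathbb S^n_{\pm,\lambda})|_{\mathfrak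 g'}\simeq\bigoplus_{b=0}^\infty M^{\mathfrak g'}_{\mathfrak p'}(\mathbb S^{n-1}_{\lambda-b})\quad(n\text{ even}).$$ (2) If $\lambda+n-\tfrac32\notin\mathbb N_+$ and $2\lambda+n-1\notin\mathbb N_+$, then the formulas in (1) are isomorphisms of $\mathfrak g'$-modules, and every summand on the right-hand side is an irreducible $\mathfrak g'$-module (for $n=1$ the zero summands, those with $\epsilon=-$, are omitted). -/

import Mathlib

open scoped TensorProduct DirectSum

namespace SpinBranch

noncomputable section

/-! ### The spin representation

`Spinor k` is the Fock space of dimension `2 ^ ⌊k / 2⌋`, with basis indexed by the occupation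
patterns of `⌊k / 2⌋` fermionic modes. The operators `gamma k i` satisfy the Clifford relations
(`gamma_clifford`), so that `Spinor k` is an irreducible module over the complex Clifford algebra
in `k` generators. -/

/-- The space of spinors of `so(k, ℂ)`. -/
abbrev Spinor (k : ℕ) : Type := (Fin (k / 2) → Bool) → ℂ

/-- Toggle the entry in position `a` (no effect if there is no such position). -/
def flip {m : ℕ} (s : Fin m → Bool) (a : ℕ) : Fin m → Bool :=
  fun j => if (j : ℕ) = a then !(s j) else s j

/-- The sign `(-1) ^ #{j < a : s j = true}`. -/
def fockSign {m : ℕ} (s : Fin m → Bool) (a : ℕ) : ℂ :=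
  ∏ j : Fin m, if (j : ℕ) < a ∧ s j = true then -1 else 1

/-- The Clifford generators, normalised by `γ_i ^ 2 = 1`. For `i = 2 a` this is creation plus
annihilation in the mode `a`, for `i = 2 a + 1` it is `√-1` times their difference, and for `k` odd
the last generator is the parity operator. -/
def gamma (k : ℕ) (i : Fin k) : Module.End ℂ (Spinor k) where
  toFun f := fun s =>
    (if Even (i : ℕ) then 1 else Complex.I) * fockSign s ((i + 1) / 2) * f (flip s (i / 2))
  map_add' f g := by funext s; simp [mul_add]
  map_smul' c f := by funext s; simp [mul_left_comm]

/-- The parity operator; for `k` even it is, up to a scalar, the product of all `gamma k i`. -/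
def parity (k : ℕ) : Module.End ℂ (Spinor k) where
  toFun f := fun s => fockSign s (k / 2) * f s
  map_add' f g := by funext s; simp [mul_add]
  map_smul' c f := by funext s; simp [mul_left_comm]

theorem flip_flip {m : ℕ} (s : Fin m → Bool) (a : ℕ) : flip (flip s a) a = s := by
  funext j; by_cases h : (j : ℕ) = a <;> simp [flip, h]

theorem flip_comm {m : ℕ} (s : Fin m → Bool) (a b : ℕ) :
    flip (flip s a) b = flip (flip s b) a := by
  funext j
  unfold flip
  split_ifs <;> rfl

theorem fockSign_sq {m : ℕ} (s : Fin m → Bool) (a : ℕ) : fockSign s a * fockSign s a = 1 := by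
  unfold fockSign
  rw [← Finset.prod_mul_distrib]
  refine Finset.prod_eq_one fun j _ => ?_
  split_ifs <;> norm_num

theorem fockSign_flip_lt {m : ℕ} (s : Fin m → Bool) (a b : ℕ) (h : a < b) (hm : a < m) :
    fockSign (flip s a) b = -fockSign s b := by
  unfold fockSign
  rw [← Finset.mul_prod_erase _ _ (Finset.mem_univ (⟨a, hm⟩ : Fin m)),
    ← Finset.mul_prod_erase Finset.univ (fun j : Fin m => if (j : ℕ) < b ∧ s j = true then (-1 : ℂ)
      else 1) (Finset.mem_univ (⟨a, hm⟩ : Fin m)), ← neg_mul]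
  congr 1
  · cases hs : s ⟨a, hm⟩ <;> simp [flip, h, hs]
  · refine Finset.prod_congr rfl fun j hj => ?_
    have : (j : ℕ) ≠ a := fun e => (Finset.ne_of_mem_erase hj) (Fin.ext e)
    simp [flip, this]

theorem fockSign_flip_ge {m : ℕ} (s : Fin m → Bool) (a b : ℕ) (h : b ≤ a) :
    fockSign (flip s a) b = fockSign s b := by
  unfold fockSign
  refine Finset.prod_congr rfl fun j _ => ?_
  by_cases hj : (j : ℕ) = a
  · have : ¬ (j : ℕ) < b := by omega
    simp [this]
  · simp [flip, hj]

theorem gamma_sq (k : ℕ) (i : Fin k) : gamma k i * gamma k i = 1 := by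
  refine LinearMap.ext fun f => funext fun s => ?_
  have hi := i.2
  simp only [Module.End.mul_apply, gamma, LinearMap.coe_mk, AddHom.coe_mk, flip_flip,
    Module.End.one_apply]
  by_cases h : Even (i : ℕ)
  · rw [fockSign_flip_ge _ _ _ (by grind)]
    simp only [h, if_true]
    linear_combination (f s) * fockSign_sq s ((i + 1) / 2)
  · rw [fockSign_flip_lt _ _ _ (by grind) (by grind)]
    simp only [h, if_false]
    linear_combination (f s) * fockSign_sq s ((i + 1) / 2) -
      (f s) * (fockSign s ((i + 1) / 2)) * fockSign s ((i + 1) / 2) * Complex.I_sq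

theorem gamma_anticomm_lt (k : ℕ) (i j : Fin k) (h : i < j) :
    gamma k i * gamma k j + gamma k j * gamma k i = 0 := by
  refine LinearMap.ext fun f => funext fun s => ?_
  have hj := j.2
  have hij : (i : ℕ) < j := h
  simp only [LinearMap.add_apply, Module.End.mul_apply, gamma, LinearMap.coe_mk, AddHom.coe_mk,
    Pi.add_apply, LinearMap.zero_apply, Pi.zero_apply]
  rw [fockSign_flip_lt s ((i : ℕ) / 2) (((j : ℕ) + 1) / 2) (by omega) (by omega),
    fockSign_flip_ge s ((j : ℕ) / 2) (((i : ℕ) + 1) / 2) (by omega),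
    flip_comm s ((j : ℕ) / 2)]
  ring

/-- The Clifford relations. -/
theorem gamma_clifford (k : ℕ) (i j : Fin k) :
    gamma k i * gamma k j + gamma k j * gamma k i = if i = j then 2 else 0 := by
  rcases lt_trichotomy i j with h | h | h
  · rw [gamma_anticomm_lt k i j h, if_neg h.ne]
  · subst h; rw [gamma_sq, if_pos rfl]; norm_num
  · rw [add_comm, gamma_anticomm_lt k j i h, if_neg h.ne']

theorem parity_gamma (k : ℕ) (hk : Even k) (i : Fin k) :
    parity k * gamma k i = -(gamma k i * parity k) := by
  refine LinearMap.ext fun f => funext fun s => ?_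
  have hi := i.2
  simp only [Module.End.mul_apply, gamma, parity, LinearMap.coe_mk, AddHom.coe_mk,
    LinearMap.neg_apply, Pi.neg_apply]
  rw [fockSign_flip_lt _ _ _ (by grind) (by grind)]
  ring

theorem clifford_comm {R : Type} [Ring R] [Algebra ℂ R] {k : ℕ} (g : Fin k → R)
    (hg : ∀ i j, g i * g j + g j * g i = if i = j then 2 else 0)
    (A : Fin k → Fin k → ℂ) (hA : ∀ i j, A i j = -A j i) (l : Fin k) :
    (∑ i, ∑ j, (A i j / 4) • (g i * g j)) * g l - g l * (∑ i, ∑ j, (A i j / 4) • (g i * g j))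
      = ∑ i, A i l • g i := by
  have key : ∀ i j : Fin k, g i * g j * g l - g l * (g i * g j)
      = (if j = l then (2 : ℂ) else 0) • g i - (if i = l then (2 : ℂ) else 0) • g j := by
    intro i j
    have : g i * g j * g l - g l * (g i * g j)
      = g i * (g j * g l + g l * g j) - (g i * g l + g l * g i) * g j := by noncomm_ring
    rw [this, hg, hg]
    split_ifs <;> simp [mul_two, two_mul, two_smul]
  simp only [Finset.sum_mul, Finset.mul_sum, smul_mul_assoc, mul_smul_comm]
  simp only [← Finset.sum_sub_distrib, ← smul_sub, key]
  simp only [smul_sub, Finset.sum_sub_distrib, smul_smul]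
  have e1 : ∑ i, ∑ j, (A i j / 4 * if j = l then (2 : ℂ) else 0) • g i
      = ∑ i, (A i l / 2) • g i := by
    refine Finset.sum_congr rfl fun i _ => ?_
    rw [Finset.sum_eq_single l]
    · simp only [if_true]; congr 1; ring
    · intro j _ hj; simp [hj]
    · simp
  have e2 : ∑ i, ∑ j, (A i j / 4 * if i = l then (2 : ℂ) else 0) • g j
      = -∑ i, (A i l / 2) • g i := by
    rw [Finset.sum_eq_single l, ← Finset.sum_neg_distrib]
    · refine Finset.sum_congr rfl fun j _ => ?_
      rw [hA l j, ← neg_smul]; simp only [if_true]; congr 1; ring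
    · intro i _ hi; simp [hi]
    · simp
  rw [e1, e2, sub_neg_eq_add, ← Finset.sum_add_distrib]
  refine Finset.sum_congr rfl fun i _ => ?_
  rw [← add_smul]; congr 1; ring

theorem clifford_lie {R : Type} [Ring R] [Algebra ℂ R] {k : ℕ} (g : Fin k → R)
    (hg : ∀ i j, g i * g j + g j * g i = if i = j then 2 else 0)
    (A B : Fin k → Fin k → ℂ) (hA : ∀ i j, A i j = -A j i) :
    (∑ i, ∑ j, ((∑ l, A i l * B l j - ∑ l, B i l * A l j) / 4) • (g i * g j))
      = (∑ i, ∑ j, (A i j / 4) • (g i * g j)) * (∑ i, ∑ j, (B i j / 4) • (g i * g j))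
        - (∑ i, ∑ j, (B i j / 4) • (g i * g j)) * (∑ i, ∑ j, (A i j / 4) • (g i * g j)) := by
  have comm := clifford_comm g hg A hA
  set a := ∑ i, ∑ j, (A i j / 4) • (g i * g j) with ha
  have key : ∀ i j : Fin k, a * (g i * g j) - g i * g j * a
      = ∑ l, A l i • (g l * g j) + ∑ l, A l j • (g i * g l) := by
    intro i j
    have : a * (g i * g j) - g i * g j * a
      = (a * g i - g i * a) * g j + g i * (a * g j - g j * a) := by noncomm_ring
    rw [this, comm, comm]
    simp only [Finset.sum_mul, Finset.mul_sum, smul_mul_assoc, mul_smul_comm]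
  have hB : a * (∑ i, ∑ j, (B i j / 4) • (g i * g j))
      - (∑ i, ∑ j, (B i j / 4) • (g i * g j)) * a
      = ∑ i, ∑ j, (B i j / 4) • (a * (g i * g j) - g i * g j * a) := by
    simp only [Finset.sum_mul, Finset.mul_sum, smul_mul_assoc, mul_smul_comm,
      ← Finset.sum_sub_distrib, ← smul_sub]
  rw [hB]
  simp only [key, smul_add, Finset.sum_add_distrib, Finset.smul_sum, smul_smul, sub_div, sub_smul,
    Finset.sum_sub_distrib]
  rw [sub_eq_add_neg]
  congr 1
  · simp only [Finset.sum_div, Finset.sum_smul]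
    symm
    rw [Finset.sum_congr rfl fun i _ => Finset.sum_comm, Finset.sum_comm]
    refine Finset.sum_congr rfl fun l _ => ?_
    rw [Finset.sum_comm]
    refine Finset.sum_congr rfl fun j _ => Finset.sum_congr rfl fun i _ => ?_
    congr 1; ring
  · simp only [Finset.sum_div, Finset.sum_smul, ← Finset.sum_neg_distrib]
    refine Finset.sum_congr rfl fun i _ => ?_
    rw [Finset.sum_comm]
    refine Finset.sum_congr rfl fun j _ => Finset.sum_congr rfl fun l _ => ?_
    rw [hA l j, ← neg_smul]; congr 1; ring

theorem clifford_parity {R : Type} [Ring R] [Algebra ℂ R] {k : ℕ} (g : Fin k → R) (p : R)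
    (hp : ∀ i, p * g i = -(g i * p)) (B : Fin k → Fin k → ℂ) :
    p * (∑ i, ∑ j, (B i j / 4) • (g i * g j)) = (∑ i, ∑ j, (B i j / 4) • (g i * g j)) * p := by
  simp only [Finset.sum_mul, Finset.mul_sum, smul_mul_assoc, mul_smul_comm]
  refine Finset.sum_congr rfl fun i _ => Finset.sum_congr rfl fun j _ => ?_
  rw [← mul_assoc, hp, neg_mul, mul_assoc, hp, mul_neg, neg_neg, mul_assoc]

/-- The action of a skew-symmetric `k × k` matrix `B` on spinors. With `e_i = √-1 γ_i` (so that
`e_i ^ 2 = -1`) the matrix `E_ij - E_ji` acts as `-(1 / 2) e_i e_j = (1 / 2) γ_i γ_j`. -/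
def spinAct (k : ℕ) : Matrix (Fin k) (Fin k) ℂ →ₗ[ℂ] Module.End ℂ (Spinor k) where
  toFun B := ∑ i, ∑ j, (B i j / 4) • (gamma k i * gamma k j)
  map_add' A B := by
    simp only [Matrix.add_apply, add_div, add_smul, Finset.sum_add_distrib]
  map_smul' c B := by
    simp only [Matrix.smul_apply, smul_eq_mul, mul_div_assoc, mul_smul, Finset.smul_sum,
      RingHom.id_apply]

/-- On skew-symmetric matrices `spinAct` is a Lie algebra representation. -/
theorem spinAct_lie (k : ℕ) (A B : Matrix (Fin k) (Fin k) ℂ) (hA : ∀ i j, A i j = -A j i) :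
    spinAct k (A * B - B * A) = spinAct k A * spinAct k B - spinAct k B * spinAct k A :=
  clifford_lie (gamma k) (gamma_clifford k) A B hA

/-- The half-spinors: the eigenspaces of the parity operator. -/
def halfSpinor (k : ℕ) (ε : ℤˣ) : Submodule ℂ (Spinor k) :=
  Module.End.eigenspace (parity k) ((ε : ℤ) : ℂ)

/-- The half-spinors as a vector space in their own right. -/
def HalfSpinor (k : ℕ) (ε : ℤˣ) : Type := ↥(halfSpinor k ε)

instance (k : ℕ) (ε : ℤˣ) : AddCommGroup (HalfSpinor k ε) :=
  inferInstanceAs (AddCommGroup ↥(halfSpinor k ε))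

instance (k : ℕ) (ε : ℤˣ) : Module ℂ (HalfSpinor k ε) :=
  inferInstanceAs (Module ℂ ↥(halfSpinor k ε))

theorem spinAct_parity (k : ℕ) (hk : Even k) (B : Matrix (Fin k) (Fin k) ℂ) :
    parity k * spinAct k B = spinAct k B * parity k :=
  clifford_parity (gamma k) (parity k) (parity_gamma k hk) B

theorem comm_shift {R : Type} [Ring R] [Algebra ℂ R] (x y : R) (a b : ℂ) :
    (x + a • (1 : R)) * (y + b • (1 : R)) - (y + b • (1 : R)) * (x + a • (1 : R))
      = x * y - y * x := by
  simp only [add_mul, mul_add, smul_mul_assoc, mul_smul_comm, one_mul, mul_one, smul_add, smul_smul,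
    mul_comm b a]
  abel

end

end SpinBranch

attribute [local instance 100] LieRing.ofAssociativeRing

namespace SpinBranch

noncomputable section

/-! ### The Lie algebras -/

/-- The Gram matrix of the quadratic form `2 x_0 x_{n+1} + x_1 ^ 2 + ⋯ + x_n ^ 2`. -/
def gram (n : ℕ) : Matrix (Fin (n + 2)) (Fin (n + 2)) ℂ :=
  Matrix.of fun i j =>
    if (i = 0 ∧ j = Fin.last (n + 1)) ∨ (i = Fin.last (n + 1) ∧ j = 0) then 1
    else if i = j ∧ i ≠ 0 ∧ i ≠ Fin.last (n + 1) then 1 else 0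

/-- `𝔤 = so(n + 2, ℂ)`. -/
abbrev soG (n : ℕ) : LieSubalgebra ℂ (Matrix (Fin (n + 2)) (Fin (n + 2)) ℂ) :=
  skewAdjointMatricesLieSubalgebra (gram n)

/-- The stabilizer in `so(n + 2, ℂ)` of the line spanned by the basis vector `e_t`. -/
def lineStab (n : ℕ) (t : Fin (n + 2)) : LieSubalgebra ℂ (soG n) where
  carrier := {A | ∀ i, i ≠ t → A.1 i t = 0}
  add_mem' {A B} hA hB i hi := by simp [hA i hi, hB i hi]
  zero_mem' i _ := by simp
  smul_mem' c A hA i hi := by simp [hA i hi]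
  lie_mem' {A B} hA hB i hi := by
    have h : ∀ C D : soG n, (∀ i, i ≠ t → C.1 i t = 0) → (∀ i, i ≠ t → D.1 i t = 0) →
        (C.1 * D.1) i t = 0 := by
      intro C D hC hD
      rw [Matrix.mul_apply]
      refine Finset.sum_eq_zero fun l _ => ?_
      by_cases hl : l = t
      · subst hl; simp [hC i hi]
      · simp [hD l hl]
    change (A.1 * B.1 - B.1 * A.1) i t = 0
    rw [Matrix.sub_apply, h A B hA hB, h B A hB hA, sub_zero]

/-- The parabolic subalgebra `𝔭`: the stabilizer of the isotropic line spanned by `e_0`. -/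
def parab (n : ℕ) : LieSubalgebra ℂ (soG n) := lineStab n 0

/-- The Levi subalgebra `𝔩 = 𝔭 ∩ 𝔭₋ ≃ so(n, ℂ) ⊕ ℂ`, with `𝔭₋` the stabilizer of the line spanned
by `e_{n+1}`. -/
def levi (n : ℕ) : LieSubalgebra ℂ (soG n) := lineStab n 0 ⊓ lineStab n (Fin.last (n + 1))

/-- The subalgebra `𝔤' ≃ so(n + 1, ℂ)` of all elements of `𝔤` that annihilate `e_n`. -/
def gPrime (n : ℕ) : LieSubalgebra ℂ (soG n) where
  carrier := {A | ∀ i, A.1 i ⟨n, by omega⟩ = 0}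
  add_mem' {A B} hA hB i := by simp [hA i, hB i]
  zero_mem' i := by simp
  smul_mem' c A hA i := by simp [hA i]
  lie_mem' {A B} hA hB i := by
    change (A.1 * B.1 - B.1 * A.1) i _ = 0
    rw [Matrix.sub_apply, Matrix.mul_apply, Matrix.mul_apply,
      Finset.sum_eq_zero fun l _ => by rw [hB l, mul_zero],
      Finset.sum_eq_zero fun l _ => by rw [hA l, mul_zero], sub_zero]

/-- The index in `{0, …, n + 1}` of the basis vector `e_{i+1}`, where `i < k ≤ n`. -/
def midIdx (n k : ℕ) (hk : k ≤ n) (i : Fin k) : Fin (n + 2) := ⟨i + 1, by omega⟩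

/-- The block of an element of `so(n + 2, ℂ)` on the span of `e_1, …, e_k`. -/
def midBlock (n k : ℕ) (hk : k ≤ n) : soG n →ₗ[ℂ] Matrix (Fin k) (Fin k) ℂ where
  toFun A := Matrix.of fun i j => A.1 (midIdx n k hk i) (midIdx n k hk j)
  map_add' A B := by ext i j; simp
  map_smul' c A := by ext i j; simp

theorem soG_skew (n : ℕ) (A : soG n) : A.1.transpose * gram n = -(gram n * A.1) := by
  have h := A.2
  rw [mem_skewAdjointMatricesLieSubalgebra, mem_skewAdjointMatricesSubmodule,
    Matrix.IsSkewAdjoint, Matrix.IsAdjointPair, Matrix.mul_neg] at h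
  exact h

/-- The index exchanging `0` and `n + 1`. -/
def dual (n : ℕ) (i : Fin (n + 2)) : Fin (n + 2) :=
  if i = 0 then Fin.last (n + 1) else if i = Fin.last (n + 1) then 0 else i

theorem gram_apply (n : ℕ) (i j : Fin (n + 2)) : gram n i j = if j = dual n i then 1 else 0 := by
  have h0 : (0 : Fin (n + 2)) ≠ Fin.last (n + 1) := by
    intro h; simpa using congrArg Fin.val h
  unfold gram dual
  rw [Matrix.of_apply]
  by_cases h1 : i = 0
  · subst h1; simp [h0]
  · by_cases h2 : i = Fin.last (n + 1)
    · subst h2; simp [h0.symm]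
    · simp [h1, h2, eq_comm]

theorem dual_dual (n : ℕ) (i : Fin (n + 2)) : dual n (dual n i) = i := by
  have h0 : (0 : Fin (n + 2)) ≠ Fin.last (n + 1) := by
    intro h; simpa using congrArg Fin.val h
  unfold dual
  by_cases h1 : i = 0
  · subst h1; simp [h0.symm]
  · by_cases h2 : i = Fin.last (n + 1)
    · subst h2; simp [h0.symm]
    · simp [h1, h2]

theorem soG_entry (n : ℕ) (A : soG n) (i j : Fin (n + 2)) :
    A.1 i j = -A.1 (dual n j) (dual n i) := by
  have h := congrFun (congrFun (soG_skew n A) j) (dual n i)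
  rw [Matrix.mul_apply, Matrix.neg_apply, Matrix.mul_apply] at h
  simp only [gram_apply, Matrix.transpose_apply] at h
  rw [Finset.sum_eq_single i, Finset.sum_eq_single (dual n j)] at h
  · simpa using h
  · intro l _ hl; simp [hl]
  · simp
  · intro l _ hl
    rw [if_neg, mul_zero]
    intro e
    exact hl (by rw [← dual_dual n l, ← e, dual_dual])
  · simp

theorem dual_midIdx (n k : ℕ) (hk : k ≤ n) (i : Fin k) :
    dual n (midIdx n k hk i) = midIdx n k hk i := by
  unfold dual midIdx
  have := i.2
  rw [if_neg (by simp [Fin.ext_iff]), if_neg (by simp [Fin.ext_iff]; omega)]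

theorem midBlock_skew (n k : ℕ) (hk : k ≤ n) (A : soG n) (i j : Fin k) :
    midBlock n k hk A i j = -midBlock n k hk A j i := by
  have := soG_entry n A (midIdx n k hk i) (midIdx n k hk j)
  rwa [dual_midIdx, dual_midIdx] at this

theorem parab_last (n : ℕ) (A : soG n) (hA : A ∈ parab n) (j : Fin (n + 2))
    (hj : j ≠ Fin.last (n + 1)) : A.1 (Fin.last (n + 1)) j = 0 := by
  rw [soG_entry, show dual n (Fin.last (n + 1)) = 0 by simp [dual], neg_eq_zero]
  refine hA _ fun h => hj ?_
  rw [← dual_dual n j, h]; simp [dual]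

theorem parab_zero_mul (n : ℕ) (A B : soG n) (hB : B ∈ parab n) :
    (A.1 * B.1) 0 0 = A.1 0 0 * B.1 0 0 := by
  rw [Matrix.mul_apply, Finset.sum_eq_single 0]
  · intro l _ hl; rw [hB l hl, mul_zero]
  · simp

theorem midBlock_mul (n k : ℕ) (hk : k ≤ n) (A B : soG n) (hA : A ∈ parab n) (hB : B ∈ parab n)
    (h : ∀ t : Fin (n + 2), k < (t : ℕ) → (t : ℕ) ≤ n → ∀ i, A.1 i t = 0) :
    Matrix.of (fun i j => (A.1 * B.1) (midIdx n k hk i) (midIdx n k hk j))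
      = midBlock n k hk A * midBlock n k hk B := by
  ext i j
  rw [Matrix.of_apply, Matrix.mul_apply, Matrix.mul_apply]
  symm
  refine Finset.sum_of_injOn (midIdx n k hk) ?_ (by simp) ?_ (fun _ _ => rfl)
  · intro a _ b _ hab
    simp only [midIdx, Fin.mk.injEq, add_left_inj] at hab
    exact Fin.ext hab
  · intro t _ ht
    by_cases h0 : t = 0
    · subst h0
      rw [hA _ (by simp [midIdx, Fin.ext_iff]), zero_mul]
    · by_cases h1 : t = Fin.last (n + 1)
      · subst h1
        rw [parab_last n B hB _ (by have := j.2; simp [midIdx, Fin.ext_iff]; omega), mul_zero]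
      · have ht0 : (t : ℕ) ≠ 0 := fun e => h0 (Fin.ext e)
        have ht1 : (t : ℕ) ≠ n + 1 := fun e => h1 (Fin.ext e)
        rw [h t ?_ (by omega), zero_mul]
        by_contra hlt
        apply ht
        refine ⟨⟨(t : ℕ) - 1, by omega⟩, by simp, ?_⟩
        apply Fin.ext
        simp only [midIdx]
        omega

/-- The nilradical `𝔫₊` of `𝔭`: the elements of `𝔭` with vanishing diagonal blocks. -/
def nilrad (n : ℕ) : LieSubalgebra ℂ (soG n) where
  carrier := {A | A ∈ parab n ∧ A.1 0 0 = 0 ∧ midBlock n n le_rfl A = 0}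
  add_mem' {A B} hA hB := ⟨add_mem hA.1 hB.1, by simp [hA.2.1, hB.2.1], by
    rw [map_add, hA.2.2, hB.2.2, add_zero]⟩
  zero_mem' := ⟨zero_mem _, by simp, map_zero _⟩
  smul_mem' c A hA := ⟨(parab n).smul_mem c hA.1, by simp [hA.2.1], by
    rw [map_smul, hA.2.2, smul_zero]⟩
  lie_mem' {A B} hA hB := by
    refine ⟨(parab n).lie_mem hA.1 hB.1, ?_, ?_⟩
    · change (A.1 * B.1 - B.1 * A.1) 0 0 = 0
      rw [Matrix.sub_apply, parab_zero_mul n A B hB.1, parab_zero_mul n B A hA.1, hA.2.1, hB.2.1]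
      simp
    · have h1 := midBlock_mul n n le_rfl A B hA.1 hB.1 (by intros; omega)
      have h2 := midBlock_mul n n le_rfl B A hB.1 hA.1 (by intros; omega)
      rw [hA.2.2, zero_mul] at h1
      rw [hA.2.2, mul_zero] at h2
      ext i j
      have e1 := congrFun (congrFun h1 i) j
      have e2 := congrFun (congrFun h2 i) j
      change (A.1 * B.1 - B.1 * A.1) _ _ = 0
      rw [Matrix.of_apply] at e1 e2
      rw [Matrix.sub_apply, e1, e2]
      simp

/-- `𝔭' = 𝔭 ∩ 𝔤'`. -/
def parab' (n : ℕ) : LieSubalgebra ℂ (gPrime n) := (parab n).comap (gPrime n).incl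

/-- `𝔩' = 𝔩 ∩ 𝔤' ≃ so(n - 1, ℂ) ⊕ ℂ`. -/
def levi' (n : ℕ) : LieSubalgebra ℂ (gPrime n) := (levi n).comap (gPrime n).incl

/-- `𝔫₊' = 𝔫₊ ∩ 𝔤'`. -/
def nilrad' (n : ℕ) : LieSubalgebra ℂ (gPrime n) := (nilrad n).comap (gPrime n).incl

/-! ### The inducing representations -/

/-- The operator on `Spinor k` by which an element of `𝔭` acts: the spin representation of its
block on `e_1, …, e_k`, plus `lam` times its `(0, 0)` entry. -/
def inflAct (n k : ℕ) (hk : k ≤ n) (lam : ℂ) : soG n →ₗ[ℂ] Module.End ℂ (Spinor k) where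
  toFun A := spinAct k (midBlock n k hk A) + (lam * A.1 0 0) • (1 : Module.End ℂ (Spinor k))
  map_add' A B := by
    have e : (A + B).1 0 0 = A.1 0 0 + B.1 0 0 := rfl
    rw [map_add, map_add, e, mul_add, add_smul]
    exact add_add_add_comm _ _ _ _
  map_smul' c A := by
    have e : (c • A).1 0 0 = c * A.1 0 0 := rfl
    rw [map_smul, map_smul, e, RingHom.id_apply, smul_add, smul_smul, mul_left_comm]

theorem inflAct_lie (n k : ℕ) (hk : k ≤ n) (lam : ℂ) (A B : soG n) (hA : A ∈ parab n)
    (hB : B ∈ parab n)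
    (h : ∀ t : Fin (n + 2), k < (t : ℕ) → (t : ℕ) ≤ n → ∀ i, A.1 i t = 0 ∧ B.1 i t = 0) :
    inflAct n k hk lam ⁅A, B⁆
      = inflAct n k hk lam A * inflAct n k hk lam B
        - inflAct n k hk lam B * inflAct n k hk lam A := by
  have e : midBlock n k hk ⁅A, B⁆ = midBlock n k hk A * midBlock n k hk B
      - midBlock n k hk B * midBlock n k hk A := by
    rw [← midBlock_mul n k hk A B hA hB fun t h1 h2 i => (h t h1 h2 i).1,
      ← midBlock_mul n k hk B A hB hA fun t h1 h2 i => (h t h1 h2 i).2]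
    rfl
  have e0 : (⁅A, B⁆ : soG n).1 0 0 = 0 := by
    change (A.1 * B.1 - B.1 * A.1) 0 0 = 0
    rw [Matrix.sub_apply, parab_zero_mul n A B hB, parab_zero_mul n B A hA]
    ring
  change spinAct k (midBlock n k hk ⁅A, B⁆) + (lam * (⁅A, B⁆ : soG n).1 0 0) • 1
    = (spinAct k (midBlock n k hk A) + (lam * A.1 0 0) • 1)
      * (spinAct k (midBlock n k hk B) + (lam * B.1 0 0) • 1)
      - (spinAct k (midBlock n k hk B) + (lam * B.1 0 0) • 1)
      * (spinAct k (midBlock n k hk A) + (lam * A.1 0 0) • 1)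
  rw [e, e0, spinAct_lie k _ _ (midBlock_skew n k hk A)]
  rw [mul_zero, zero_smul, add_zero, comm_shift]

/-- The `𝔭`-module `S^n_lam = S^n ⊗ ℂ_lam`: the spin representation of `so(n, ℂ)`, with
`diag(1, 0, …, 0, -1)` acting by `lam` and `𝔫₊` acting by zero. -/
def spinRep (n : ℕ) (lam : ℂ) : parab n →ₗ⁅ℂ⁆ Module.End ℂ (Spinor n) where
  toLinearMap := (inflAct n n le_rfl lam).comp (parab n).toSubmodule.subtype
  map_lie' {A B} := inflAct_lie n n le_rfl lam A.1 B.1 A.2 B.2 (by intros; omega)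

/-- The `𝔭'`-module `S^{n-1}_lam = S^{n-1} ⊗ ℂ_lam`. -/
def spinRep' (n : ℕ) (lam : ℂ) : parab' n →ₗ⁅ℂ⁆ Module.End ℂ (Spinor (n - 1)) where
  toLinearMap := ((inflAct n (n - 1) (by omega) lam).comp (gPrime n).toSubmodule.subtype).comp
    (parab' n).toSubmodule.subtype
  map_lie' {A B} := inflAct_lie n (n - 1) (by omega) lam A.1.1 B.1.1 A.2 B.2 (by
    intro t h1 h2 i
    have : t = ⟨n, by omega⟩ := Fin.ext (by simp only; omega)
    rw [this]
    exact ⟨A.1.2 i, B.1.2 i⟩)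

/-- The restriction of a representation to an invariant subspace. -/
def subRep {P S : Type} [LieRing P] [LieAlgebra ℂ P] [AddCommGroup S] [Module ℂ S]
    (ρ : P →ₗ⁅ℂ⁆ Module.End ℂ S) (W : Submodule ℂ S) (h : ∀ x, ∀ w ∈ W, ρ x w ∈ W) :
    P →ₗ⁅ℂ⁆ Module.End ℂ W where
  toFun x := (ρ x).restrict (h x)
  map_add' x y := by ext w; simp
  map_smul' c x := by ext w; simp
  map_lie' {x y} := by
    ext w
    simp [LieRing.of_associative_ring_bracket]

theorem inflAct_halfSpinor (n k : ℕ) (hk : k ≤ n) (he : Even k) (lam : ℂ) (ε : ℤˣ) (A : soG n)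
    (w : Spinor k) (hw : w ∈ halfSpinor k ε) : inflAct n k hk lam A w ∈ halfSpinor k ε := by
  have h := LinearMap.congr_fun (spinAct_parity k he (midBlock n k hk A)) w
  simp only [halfSpinor, Module.End.mem_eigenspace_iff, Module.End.mul_apply] at hw h ⊢
  simp only [inflAct, LinearMap.coe_mk, AddHom.coe_mk, LinearMap.add_apply, map_add, h, hw,
    map_smul, LinearMap.smul_apply, Module.End.one_apply, smul_add]
  rw [smul_comm]

/-- For `n` even, the `𝔭`-module `S^n_{ε,lam} = S^n_ε ⊗ ℂ_lam`. -/
def halfSpinRep (n : ℕ) (hn : Even n) (ε : ℤˣ) (lam : ℂ) :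
    parab n →ₗ⁅ℂ⁆ Module.End ℂ (HalfSpinor n ε) :=
  subRep (spinRep n lam) (halfSpinor n ε) fun A w hw =>
    inflAct_halfSpinor n n le_rfl hn lam ε A.1 w hw

/-- For `n` odd, the `𝔭'`-module `S^{n-1}_{ε,lam} = S^{n-1}_ε ⊗ ℂ_lam`. -/
def halfSpinRep' (n : ℕ) (hn : Odd n) (ε : ℤˣ) (lam : ℂ) :
    parab' n →ₗ⁅ℂ⁆ Module.End ℂ (HalfSpinor (n - 1) ε) :=
  subRep (spinRep' n lam) (halfSpinor (n - 1) ε) fun A w hw =>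
    inflAct_halfSpinor n (n - 1) (by omega) (Nat.Odd.sub_odd hn odd_one) lam ε A.1.1 w hw

/-! ### Generalized Verma modules -/

section Verma

variable {𝔤 : Type} [LieRing 𝔤] [LieAlgebra ℂ 𝔤]

/-- The relations `u x ⊗ v = u ⊗ x v` (`x ∈ 𝔭`) that turn `U(𝔤) ⊗_ℂ F` into `U(𝔤) ⊗_{U(𝔭)} F`. -/
def vermaRel (P : LieSubalgebra ℂ 𝔤) {F : Type} [AddCommGroup F] [Module ℂ F]
    (ρ : P →ₗ⁅ℂ⁆ Module.End ℂ F) :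
    Submodule (UniversalEnvelopingAlgebra ℂ 𝔤) (UniversalEnvelopingAlgebra ℂ 𝔤 ⊗[ℂ] F) :=
  Submodule.span _ {z | ∃ (u : UniversalEnvelopingAlgebra ℂ 𝔤) (x : P) (v : F),
    z = (u * UniversalEnvelopingAlgebra.ι ℂ (x : 𝔤)) ⊗ₜ[ℂ] v - u ⊗ₜ[ℂ] (ρ x v)}

/-- The generalized Verma module `M_𝔭^𝔤(F) = U(𝔤) ⊗_{U(𝔭)} F`. -/
def GenVerma (P : LieSubalgebra ℂ 𝔤) {F : Type} [AddCommGroup F] [Module ℂ F]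
    (ρ : P →ₗ⁅ℂ⁆ Module.End ℂ F) : Type :=
  (UniversalEnvelopingAlgebra ℂ 𝔤 ⊗[ℂ] F) ⧸ vermaRel P ρ

variable (P : LieSubalgebra ℂ 𝔤) {F : Type} [AddCommGroup F] [Module ℂ F]
  (ρ : P →ₗ⁅ℂ⁆ Module.End ℂ F)

instance : AddCommGroup (GenVerma P ρ) :=
  inferInstanceAs (AddCommGroup (_ ⧸ vermaRel P ρ))

instance : Module (UniversalEnvelopingAlgebra ℂ 𝔤) (GenVerma P ρ) :=
  inferInstanceAs (Module _ (_ ⧸ vermaRel P ρ))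

instance : Module ℂ (GenVerma P ρ) :=
  inferInstanceAs (Module ℂ (_ ⧸ vermaRel P ρ))

instance : IsScalarTower ℂ (UniversalEnvelopingAlgebra ℂ 𝔤) (GenVerma P ρ) :=
  inferInstanceAs (IsScalarTower ℂ _ (_ ⧸ vermaRel P ρ))

/-- `𝔤` acts on `U(𝔤) ⊗_{U(𝔭)} F` by left multiplication. -/
instance : LieRingModule 𝔤 (GenVerma P ρ) where
  bracket x m := UniversalEnvelopingAlgebra.ι ℂ x • m
  add_lie x y m := by
    rw [map_add, add_smul]
  lie_add x m m' := smul_add _ _ _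
  leibniz_lie x y m := by
    change UniversalEnvelopingAlgebra.ι ℂ x • UniversalEnvelopingAlgebra.ι ℂ y • m
      = UniversalEnvelopingAlgebra.ι ℂ ⁅x, y⁆ • m
        + UniversalEnvelopingAlgebra.ι ℂ y • UniversalEnvelopingAlgebra.ι ℂ x • m
    rw [LieHom.map_lie, LieRing.of_associative_ring_bracket, sub_smul, mul_smul, mul_smul,
      sub_add_cancel]

instance : LieModule ℂ 𝔤 (GenVerma P ρ) where
  smul_lie c x m := by
    change UniversalEnvelopingAlgebra.ι ℂ (c • x) • m = c • UniversalEnvelopingAlgebra.ι ℂ x • m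
    rw [map_smul, smul_assoc]
  lie_smul c x m := by
    change UniversalEnvelopingAlgebra.ι ℂ x • c • m = c • UniversalEnvelopingAlgebra.ι ℂ x • m
    rw [← IsScalarTower.algebraMap_smul (UniversalEnvelopingAlgebra ℂ 𝔤) c m,
      ← IsScalarTower.algebraMap_smul (UniversalEnvelopingAlgebra ℂ 𝔤) c
        (UniversalEnvelopingAlgebra.ι ℂ x • m), ← mul_smul, ← mul_smul, Algebra.commutes]

end Verma

/-! ### The parabolic category `𝓞^𝔭` and its Grothendieck group

Here `𝔭 = 𝔩 + 𝔫` is a parabolic subalgebra with Levi subalgebra `L` and nilradical `N`. -/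

section CatO

variable {𝔤 : Type} [LieRing 𝔤] [LieAlgebra ℂ 𝔤] (L N : LieSubalgebra ℂ 𝔤)

/-- `X` belongs to `𝓞^𝔭`: it is finitely generated, a sum of finite-dimensional simple `𝔩`-modules,
and locally `𝔫`-finite. -/
structure InCatO (X : Type) [AddCommGroup X] [Module ℂ X] [LieRingModule 𝔤 X]
    [LieModule ℂ 𝔤 X] : Prop where
  fg : ∃ s : Finset X, LieSubmodule.lieSpan ℂ 𝔤 (s : Set X) = ⊤
  levi_semisimple : sSup {Y : LieSubmodule ℂ L X |
    FiniteDimensional ℂ Y ∧ LieModule.IsIrreducible ℂ L Y} = ⊤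
  nil_finite : ∀ x : X, ∃ W : Submodule ℂ X, FiniteDimensional ℂ W ∧ x ∈ W ∧
    ∀ a ∈ N, ∀ w ∈ W, ⁅a, w⁆ ∈ W

/-- `X` is the union of an increasing sequence of submodules of finite length belonging to
`𝓞^𝔭`. -/
def DiscretelyDecomposable (X : Type) [AddCommGroup X] [Module ℂ X] [LieRingModule 𝔤 X]
    [LieModule ℂ 𝔤 X] : Prop :=
  ∃ Y : ℕ →o LieSubmodule ℂ 𝔤 X,
    (∀ j, WellFoundedLT (LieSubmodule ℂ 𝔤 (Y j)) ∧ WellFoundedGT (LieSubmodule ℂ 𝔤 (Y j)) ∧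
      InCatO L N (Y j)) ∧
    ∀ x, ∃ j, x ∈ Y j

/-- The simple objects of `𝓞^𝔭`. -/
structure SimpleObj where
  carrier : Type
  [addCommGroup : AddCommGroup carrier]
  [module : Module ℂ carrier]
  [lieRingModule : LieRingModule 𝔤 carrier]
  [lieModule : LieModule ℂ 𝔤 carrier]
  irreducible : LieModule.IsIrreducible ℂ 𝔤 carrier
  inCatO : InCatO L N carrier

attribute [instance] SimpleObj.addCommGroup SimpleObj.module SimpleObj.lieRingModule
  SimpleObj.lieModule

/-- Isomorphism of simple objects. -/
instance simpleSetoid : Setoid (SimpleObj L N) where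
  r S T := Nonempty (S.carrier ≃ₗ⁅ℂ,𝔤⁆ T.carrier)
  iseqv :=
    { refl := fun _ => ⟨LieModuleEquiv.refl⟩
      symm := fun ⟨e⟩ => ⟨e.symm⟩
      trans := fun ⟨e⟩ ⟨f⟩ => ⟨e.trans f⟩ }

/-- The set of isomorphism classes of simple objects of `𝓞^𝔭`. -/
def Irr : Type 1 := Quotient (simpleSetoid L N)

/-- The Jordan–Hölder multiplicity `[X : S]`: the largest number of subquotients isomorphic to `S`
in an increasing sequence of submodules of `X`. -/
def mult (X S : Type) [AddCommGroup X] [Module ℂ X] [LieRingModule 𝔤 X] [LieModule ℂ 𝔤 X]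
    [AddCommGroup S] [Module ℂ S] [LieRingModule 𝔤 S] : ℕ∞ :=
  ⨆ Y : ℕ →o LieSubmodule ℂ 𝔤 X,
    {i : ℕ | Nonempty
      ((Y (i + 1) ⧸ LieSubmodule.comap (Y (i + 1)).incl (Y i)) ≃ₗ⁅ℂ,𝔤⁆ S)}.encard

/-- The multiplicity of an isomorphism class. -/
def multIrr (X : Type) [AddCommGroup X] [Module ℂ X] [LieRingModule 𝔤 X] [LieModule ℂ 𝔤 X] :
    Irr L N → ℕ∞ :=
  Quotient.lift (fun S : SimpleObj L N => mult (𝔤 := 𝔤) X S.carrier) (by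
    rintro S T ⟨e⟩
    unfold mult
    refine iSup_congr fun Y => congrArg Set.encard (Set.ext fun i => ?_)
    exact ⟨fun ⟨f⟩ => ⟨f.trans e⟩, fun ⟨f⟩ => ⟨f.trans e.symm⟩⟩)

/-- The Grothendieck group `K(𝓞^𝔭)`, in which formal sums of countably many simple objects are
allowed: integer-valued functions of countable support on the set of isomorphism classes. -/
def grothendieck : AddSubgroup (Irr L N → ℤ) where
  carrier := {f | (Function.support f).Countable}
  add_mem' {f g} hf hg := (hf.union hg).mono (Function.support_add f g)
  zero_mem' := by simp
  neg_mem' {f} hf := by simpa [Function.support_neg] using hf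

/-- The class `Ch(X) = ∑ [X : S] Ch(S)` of a module with finite multiplicities. -/
def ch (X : Type) [AddCommGroup X] [Module ℂ X] [LieRingModule 𝔤 X] [LieModule ℂ 𝔤 X] :
    Irr L N → ℤ :=
  fun S => ((multIrr L N X S).toNat : ℤ)

/-- `X` has a well-defined class in `K(𝓞^𝔭)`. -/
structure HasClass (X : Type) [AddCommGroup X] [Module ℂ X] [LieRingModule 𝔤 X]
    [LieModule ℂ 𝔤 X] : Prop where
  discretelyDecomposable : DiscretelyDecomposable L N X
  mult_finite : ∀ S, multIrr L N X S ≠ ⊤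
  mem_grothendieck : ch L N X ∈ grothendieck L N

/-- The identity `X ≃ ⨁ᵢ Y i` in `K(𝓞^𝔭)`, for objects `Y i` of `𝓞^𝔭`: every multiplicity in `X` is
finite and the classes of the `Y i` add up to the class of `X`, in the topology of pointwise
convergence on `K(𝓞^𝔭)`, that is, only finitely many `Y i` contain a given simple object. -/
def EqInK {ι : Type} (X : Type) [AddCommGroup X] [Module ℂ X] [LieRingModule 𝔤 X]
    [LieModule ℂ 𝔤 X] (Y : ι → Type) [∀ i, AddCommGroup (Y i)] [∀ i, Module ℂ (Y i)]
    [∀ i, LieRingModule 𝔤 (Y i)] [∀ i, LieModule ℂ 𝔤 (Y i)] : Prop :=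
  HasClass L N X ∧ (∀ i, InCatO L N (Y i) ∧ HasClass L N (Y i)) ∧
    HasSum (fun i => ch L N (Y i)) (ch L N X)

end CatO

end

end SpinBranch

open SpinBranch

/-! Write m = n - 1. Everything is computed in an explicit model. Let 𝔤 be a conformal algebra with
coordinates (a, x, y, B) and basis H, X_i, Y_i, M_ij. The module M(F) becomes F-valued polynomials
(`exists_verma_equiv`): Y_i multiplies by y_i, H acts by μ - E with E the Euler operator, rotations
act by vector fields plus their action on F, and X_i acts by a second order operator (`xOp`). One
set of formulas serves both 𝔤 and 𝔤'.

Branching in the Grothendieck group. Sort polynomials in y_1, …, y_n by the power b of the last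
variable. As an so(m)-module, S^n (n odd) or S^n_± (n even) is the full spinor space S^m. In these
terms 𝔤' acts on the part y_n^b C[y_1, …, y_m] ⊗ S^m as on M(S^m_{λ-b}), except that X_i produces
extra terms with y_n^{b-1} and y_n^{b-2} (`ptEmb_x`). So the restriction is filtered with
subquotients M(S^m_{λ-b}); see `Splitting`. The H-weights of the b-th subquotient lie in λ - b - ℕ,
so a given simple module meets only finitely many of them, and multiplicities add up
(`Splitting.hasClass`). For m even each subquotient is the sum of its two half-spin parts
(`exists_halfSpinVerma_homs`).

Membership in the parabolic category. Finite length holds because ∑ Y_i X_i is injective in all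
large degrees, so that a submodule is determined by its part of small degree
(`wellFounded_of_model_aux`). Semisimplicity over the Levi subalgebra comes from the Fischer inner
product, for which the compact real form of so(m) is skew-adjoint (`finSocle_of_model`).

The direct sum. The Casimir operator of 𝔤' acts on M(S^m_μ) by μ² + mμ + m(m-1)/8. The values for μ
= λ - b and μ = λ - b' differ by (b' - b)(2λ + m - b - b'), which is nonzero for b ≠ b' when 2λ + n
- 1 is not a positive integer. An operator that commutes with 𝔤' and has distinct scalars on the
subquotients splits the filtration (`Splitting.exists_hom`).

Irreducibility. A proper nonzero submodule of M(F), with F irreducible, would contain a homogeneous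
vector v of positive degree killed by every X_i. For spinors, X_i can be written with the Dirac
operator D and Clifford multiplication by the position vector, here called the slash operator.
Contracting with the γ_i shows that Dv is an eigenvector of T = slash · D with a prescribed
eigenvalue. The relation D · slash + slash · D = 2E + m bounds the possible eigenvalues of T to two
explicit families (`slash_dirac_eigenvalue`), and each family contradicts one of the two genericity
hypotheses. Hence Dv = 0, and then v = 0 (`eq_zero_of_xOp_eq_zero`). -/

set_option linter.unusedSectionVars false

namespace SpinBranch

noncomputable section

/-! ### Jordan–Hölder multiplicities -/

section Multiplicity

variable {𝔤 : Type} [LieRing 𝔤] [LieAlgebra ℂ 𝔤]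
  {A B C X S : Type}
  [AddCommGroup A] [Module ℂ A] [LieRingModule 𝔤 A] [LieModule ℂ 𝔤 A]
  [AddCommGroup B] [Module ℂ B] [LieRingModule 𝔤 B] [LieModule ℂ 𝔤 B]
  [AddCommGroup C] [Module ℂ C] [LieRingModule 𝔤 C] [LieModule ℂ 𝔤 C]
  [AddCommGroup X] [Module ℂ X] [LieRingModule 𝔤 X] [LieModule ℂ 𝔤 X]
  [AddCommGroup S] [Module ℂ S] [LieRingModule 𝔤 S] [LieModule ℂ 𝔤 S]

/-- A homomorphism that kills the kernel of a surjection factors through it. -/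
theorem exists_factor (g : A →ₗ⁅ℂ,𝔤⁆ B) (hg : Function.Surjective g) (f : A →ₗ⁅ℂ,𝔤⁆ C)
    (h : ∀ a, g a = 0 → f a = 0) : ∃ k : B →ₗ⁅ℂ,𝔤⁆ C, ∀ a, k (g a) = f a := by
  have key : ∀ a b, g a = g b → f a = f b := fun a b e => by
    rw [← sub_eq_zero, ← map_sub]
    exact h _ (by rw [map_sub, e, sub_self])
  choose r hr using hg
  refine ⟨{ toFun := fun b => f (r b), map_add' := ?_, map_smul' := ?_, map_lie' := ?_ }, ?_⟩
  · intro x y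
    rw [← map_add]
    exact key _ _ (by simp [hr])
  · intro c x
    rw [RingHom.id_apply, ← map_smul]
    exact key _ _ (by simp [hr])
  · intro c x
    rw [← LieModuleHom.map_lie]
    exact key _ _ (by simp [hr])
  · intro a
    exact key _ _ (hr _)

/-- A bijective homomorphism of Lie modules as an equivalence. -/
def lieEquivOfBijective (f : A →ₗ⁅ℂ,𝔤⁆ B) (h : Function.Bijective f) : A ≃ₗ⁅ℂ,𝔤⁆ B :=
  { f with
    invFun := (Equiv.ofBijective f h).symm
    left_inv := (Equiv.ofBijective f h).left_inv
    right_inv := (Equiv.ofBijective f h).right_inv }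

/-- `U / (U ∩ V)` is isomorphic to `S`. -/
def Step (U V : LieSubmodule ℂ 𝔤 X) (S : Type) [AddCommGroup S] [Module ℂ S] [LieRingModule 𝔤 S] :
    Prop :=
  ∃ f : U →ₗ⁅ℂ,𝔤⁆ S, Function.Surjective f ∧ ∀ u : U, f u = 0 ↔ (u : X) ∈ V

/-- Trades an isomorphism with a quotient for a surjection with prescribed kernel, which is easily
transported along homomorphisms of the ambient module. -/
theorem step_iff (U V : LieSubmodule ℂ 𝔤 X) :
    Nonempty ((U ⧸ LieSubmodule.comap U.incl V) ≃ₗ⁅ℂ,𝔤⁆ S) ↔ Step U V S := by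
  have hk : ∀ u : U, LieSubmodule.Quotient.mk' (LieSubmodule.comap U.incl V) u = 0 ↔ (u : X) ∈ V :=
    fun u => by rw [LieSubmodule.Quotient.mk_eq_zero, LieSubmodule.mem_comap]; rfl
  constructor
  · rintro ⟨e⟩
    refine ⟨e.toLieModuleHom.comp (LieSubmodule.Quotient.mk' _), ?_, fun u => ?_⟩
    · exact e.surjective.comp (LieSubmodule.Quotient.surjective_mk' _)
    · rw [← hk u, LieModuleHom.comp_apply]
      exact map_eq_zero_iff e.toLieModuleHom e.injective
  · rintro ⟨f, hf, hV⟩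
    obtain ⟨k, hkf⟩ := exists_factor (LieSubmodule.Quotient.mk' (LieSubmodule.comap U.incl V))
      (LieSubmodule.Quotient.surjective_mk' _) f fun a ha => (hV a).2 ((hk a).1 ha)
    refine ⟨lieEquivOfBijective k ⟨?_, ?_⟩⟩
    · refine (injective_iff_map_eq_zero k).2 fun q hq => ?_
      obtain ⟨u, rfl⟩ := LieSubmodule.Quotient.surjective_mk' _ q
      rw [hkf] at hq
      exact (hk u).2 ((hV u).1 hq)
    · intro s
      obtain ⟨u, rfl⟩ := hf s
      exact ⟨_, hkf u⟩

theorem surjective_of_ne_zero [LieModule.IsIrreducible ℂ 𝔤 S] (f : A →ₗ⁅ℂ,𝔤⁆ S) (a : A)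
    (ha : f a ≠ 0) : Function.Surjective f := by
  rw [← LieModuleHom.range_eq_top]
  refine (IsSimpleOrder.eq_bot_or_eq_top f.range).resolve_left fun h => ha ?_
  have : f a ∈ f.range := ⟨a, rfl⟩
  rw [h] at this
  simpa using this

/-- The vector `a` witnesses that the composite from the preimage of `U` to `S` is nonzero;
simplicity of `S` then makes it onto. -/
theorem Step.comap [LieModule.IsIrreducible ℂ 𝔤 S] (i : A →ₗ⁅ℂ,𝔤⁆ B) {U V : LieSubmodule ℂ 𝔤 B}
    (h : Step U V S) (a : A) (ha : i a ∈ U) (ha' : i a ∉ V) :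
    Step (U.comap i) (V.comap i) S := by
  obtain ⟨f, -, hV⟩ := h
  let r : U.comap i →ₗ⁅ℂ,𝔤⁆ U := (i.comp (U.comap i).incl).codRestrict U fun m => m.2
  have hr : ∀ u : U.comap i, (r u : B) = i u := fun u => rfl
  refine ⟨f.comp r, surjective_of_ne_zero _ ⟨a, ha⟩ ?_, fun u => ?_⟩
  · rw [LieModuleHom.comp_apply, Ne, hV]
    exact ha'
  · rw [LieModuleHom.comp_apply, hV, LieSubmodule.mem_comap, hr]

theorem Step.comap_of_surjective (p : B →ₗ⁅ℂ,𝔤⁆ C) (hp : Function.Surjective p)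
    {U V : LieSubmodule ℂ 𝔤 C} (h : Step U V S) : Step (U.comap p) (V.comap p) S := by
  obtain ⟨f, hf, hV⟩ := h
  let r : U.comap p →ₗ⁅ℂ,𝔤⁆ U := (p.comp (U.comap p).incl).codRestrict U fun m => m.2
  refine ⟨f.comp r, ?_, fun u => ?_⟩
  · intro s
    obtain ⟨⟨c, hc⟩, rfl⟩ := hf s
    obtain ⟨b, rfl⟩ := hp c
    exact ⟨⟨b, hc⟩, rfl⟩
  · rw [LieModuleHom.comp_apply, hV]
    rfl

/-- The assumption `hker` says that the part of the kernel of `p` inside `U` is already in `V`, so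
nothing of the subquotient is lost in the image. -/
theorem Step.map (p : B →ₗ⁅ℂ,𝔤⁆ C) {U V : LieSubmodule ℂ 𝔤 B} (h : Step U V S)
    (hker : ∀ b ∈ U, p b = 0 → b ∈ V) (hVU : V ≤ U) : Step (U.map p) (V.map p) S := by
  obtain ⟨f, hf, hV⟩ := h
  let r : U →ₗ⁅ℂ,𝔤⁆ U.map p := (p.comp U.incl).codRestrict (U.map p) fun m => ⟨m, m.2, rfl⟩
  have hr : Function.Surjective r := by
    rintro ⟨_, u, hu, rfl⟩
    exact ⟨⟨u, hu⟩, rfl⟩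
  obtain ⟨k, hk⟩ := exists_factor r hr f fun u hu =>
    (hV u).2 (hker u u.2 (congrArg Subtype.val hu))
  refine ⟨k, fun s => ?_, fun w => ?_⟩
  · obtain ⟨u, rfl⟩ := hf s
    exact ⟨r u, hk u⟩
  · obtain ⟨u, rfl⟩ := hr w
    rw [hk, hV, LieSubmodule.mem_map]
    constructor
    · exact fun hu => ⟨u, hu, rfl⟩
    · rintro ⟨v, hv, e⟩
      have e' : p (u - v) = 0 := by rw [map_sub, e]; exact sub_self _
      have := hker _ (sub_mem u.2 (hVU hv)) e'
      simpa using add_mem this hv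

/-- A finite lower bound on a supremum in `ℕ∞` is attained: were every chain to give less than n +
1, the supremum would be at most n. All later estimates work with one chain and finitely many
positions in it. -/
theorem le_mult_iff (n : ℕ) : (n : ℕ∞) ≤ mult (𝔤 := 𝔤) X S ↔
    ∃ (Y : ℕ →o LieSubmodule ℂ 𝔤 X) (t : Finset ℕ), t.card = n ∧
      ∀ i ∈ t, Step (Y (i + 1)) (Y i) S := by
  unfold mult
  simp only [step_iff]
  constructor
  · intro h
    obtain ⟨Y, hY⟩ : ∃ Y : ℕ →o LieSubmodule ℂ 𝔤 X,
        (n : ℕ∞) ≤ {i : ℕ | Step (Y (i + 1)) (Y i) S}.encard := by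
      by_contra! hlt
      rcases n with _ | n
      · exact absurd (hlt ⟨fun _ => ⊥, fun _ _ _ => le_rfl⟩) (by simp)
      · have : (⨆ Y : ℕ →o LieSubmodule ℂ 𝔤 X,
            {i : ℕ | Step (Y (i + 1)) (Y i) S}.encard) ≤ (n : ℕ∞) :=
          iSup_le fun Y => by
            have := hlt Y
            rw [Nat.cast_succ] at this
            exact Order.le_of_lt_add_one this
        have := h.trans this
        rw [Nat.cast_le] at this
        omega
    obtain ⟨t, ht, hn⟩ := Set.exists_subset_encard_eq hY
    have hfin : t.Finite := Set.finite_of_encard_eq_coe hn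
    refine ⟨Y, hfin.toFinset, ?_, fun i hi => ht (hfin.mem_toFinset.1 hi)⟩
    have : ((hfin.toFinset.card : ℕ) : ℕ∞) = n := by
      rw [← Set.encard_coe_eq_coe_finsetCard, hfin.coe_toFinset, hn]
    exact_mod_cast this
  · rintro ⟨Y, t, rfl, ht⟩
    refine le_iSup_of_le Y ?_
    rw [← Set.encard_coe_eq_coe_finsetCard]
    exact Set.encard_le_encard fun i hi => ht i hi

theorem enat_le_of_forall_nat {a b : ℕ∞} (h : ∀ n : ℕ, (n : ℕ∞) ≤ a → (n : ℕ∞) ≤ b) : a ≤ b :=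
  ENat.forall_natCast_le_iff_le.1 h

theorem mult_le_of_injective (i : A →ₗ⁅ℂ,𝔤⁆ B) (hi : Function.Injective i) :
    mult (𝔤 := 𝔤) A S ≤ mult (𝔤 := 𝔤) B S := by
  refine enat_le_of_forall_nat fun n hn => ?_
  obtain ⟨Y, t, ht, hs⟩ := (le_mult_iff n).1 hn
  refine (le_mult_iff n).2 ⟨⟨fun j => (Y j).map i, fun a b h => LieSubmodule.map_mono (Y.mono h)⟩, t,
    ht, fun j hj => (hs j hj).map i (fun b _ hb => ?_) (Y.mono (Nat.le_succ j))⟩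
  rw [(map_eq_zero_iff i hi).1 hb]
  exact zero_mem _

theorem mult_le_of_surjective (p : B →ₗ⁅ℂ,𝔤⁆ C) (hp : Function.Surjective p) :
    mult (𝔤 := 𝔤) C S ≤ mult (𝔤 := 𝔤) B S := by
  refine enat_le_of_forall_nat fun n hn => ?_
  obtain ⟨Y, t, ht, hs⟩ := (le_mult_iff n).1 hn
  exact (le_mult_iff n).2 ⟨⟨fun j => (Y j).comap p, fun a b h x hx => Y.mono h hx⟩, t,
    ht, fun j hj => (hs j hj).comap_of_surjective p hp⟩

/-- Multiplicities are additive on short exact sequences. -/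
theorem mult_exact [LieModule.IsIrreducible ℂ 𝔤 S] (i : A →ₗ⁅ℂ,𝔤⁆ B) (hi : Function.Injective i)
    (p : B →ₗ⁅ℂ,𝔤⁆ C) (hp : Function.Surjective p) (hip : ∀ b, p b = 0 ↔ ∃ a, i a = b) :
    mult (𝔤 := 𝔤) B S = mult (𝔤 := 𝔤) A S + mult (𝔤 := 𝔤) C S := by
  classical
  apply le_antisymm
  · refine enat_le_of_forall_nat fun n hn => ?_
    obtain ⟨Y, t, ht, hs⟩ := (le_mult_iff n).1 hn
    -- Each step of a chain in `B` is charged to one end of the sequence. If some vector of `A`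
    -- enters at step j, then the step survives restriction to `A`; otherwise the kernel of `p`
    -- contributes nothing new there and the step survives in `C`.
    let q : ℕ → Prop := fun j => ∃ a, i a ∈ Y (j + 1) ∧ i a ∉ Y j
    have h1 : ((t.filter q).card : ℕ∞) ≤ mult (𝔤 := 𝔤) A S := by
      refine (le_mult_iff _).2 ⟨⟨fun j => (Y j).comap i, fun a b h x hx => Y.mono h hx⟩, _, rfl,
        fun j hj => ?_⟩
      obtain ⟨hj, a, ha, ha'⟩ := Finset.mem_filter.1 hj
      exact (hs j hj).comap i a ha ha'
    have h2 : ((t.filter fun j => ¬ q j).card : ℕ∞) ≤ mult (𝔤 := 𝔤) C S := by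
      refine (le_mult_iff _).2 ⟨⟨fun j => (Y j).map p, fun a b h => LieSubmodule.map_mono (Y.mono h)⟩,
        _, rfl, fun j hj => ?_⟩
      obtain ⟨hj, hq⟩ := Finset.mem_filter.1 hj
      refine (hs j hj).map p (fun b hb hpb => ?_) (Y.mono (Nat.le_succ j))
      obtain ⟨a, rfl⟩ := (hip b).1 hpb
      by_contra hb'
      exact hq ⟨a, hb, hb'⟩
    rw [← ht, ← Finset.card_filter_add_card_filter_not q, Nat.cast_add]
    exact add_le_add h1 h2
  · have key : ∀ n₁ n₂ : ℕ, (n₁ : ℕ∞) ≤ mult (𝔤 := 𝔤) A S → (n₂ : ℕ∞) ≤ mult (𝔤 := 𝔤) C S →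
        ((n₁ + n₂ : ℕ) : ℕ∞) ≤ mult (𝔤 := 𝔤) B S := by
      intro n₁ n₂ h₁ h₂
      obtain ⟨Y₁, t₁, ht₁, hs₁⟩ := (le_mult_iff _).1 h₁
      obtain ⟨Y₂, t₂, ht₂, hs₂⟩ := (le_mult_iff _).1 h₂
      obtain ⟨N, hN⟩ : ∃ N, ∀ j ∈ t₁, j < N := ⟨t₁.sup id + 1, fun j hj =>
        Nat.lt_succ_of_le (Finset.le_sup (f := id) hj)⟩
      -- The two chains are concatenated: images of the chain of `A` up to index N, past all the
      -- steps that count, then preimages of the chain of `C`, shifted by N + 1.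
      let Y : ℕ → LieSubmodule ℂ 𝔤 B := fun j =>
        if j ≤ N then (Y₁ j).map i else (Y₂ (j - (N + 1))).comap p
      have hY : Monotone Y := by
        intro a b hab
        by_cases hb : b ≤ N
        · simp only [Y, hb, hab.trans hb, if_true]
          exact LieSubmodule.map_mono (Y₁.mono hab)
        · by_cases ha : a ≤ N
          · simp only [Y, ha, hb, if_true, if_false]
            rintro _ ⟨x, -, rfl⟩
            rw [LieSubmodule.mem_comap]
            change p (i x) ∈ _
            rw [(hip (i x)).2 ⟨x, rfl⟩]
            exact zero_mem _
          · simp only [Y, ha, hb, if_false]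
            exact fun x hx => Y₂.mono (Nat.sub_le_sub_right hab _) hx
      refine (le_mult_iff _).2 ⟨⟨Y, hY⟩, t₁ ∪ t₂.map (addRightEmbedding (N + 1)), ?_, ?_⟩
      · rw [Finset.card_union_of_disjoint, Finset.card_map, ht₁, ht₂]
        refine Finset.disjoint_left.2 fun j hj hj' => ?_
        obtain ⟨k, -, rfl⟩ := Finset.mem_map.1 hj'
        have := hN _ hj
        simp only [addRightEmbedding_apply] at this
        omega
      · intro j hj
        rcases Finset.mem_union.1 hj with hj | hj
        · have := hN j hj
          have e1 : Y (j + 1) = (Y₁ (j + 1)).map i := if_pos (by omega)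
          have e2 : Y j = (Y₁ j).map i := if_pos (by omega)
          change Step (Y (j + 1)) (Y j) S
          rw [e1, e2]
          refine (hs₁ j hj).map i (fun b _ hb => ?_) (Y₁.mono (Nat.le_succ j))
          rw [(map_eq_zero_iff i hi).1 hb]
          exact zero_mem _
        · obtain ⟨k, hk, rfl⟩ := Finset.mem_map.1 hj
          have e1 : Y (k + (N + 1) + 1) = (Y₂ (k + 1)).comap p := by
            have : k + (N + 1) + 1 - (N + 1) = k + 1 := by omega
            simp only [Y, if_neg (show ¬ k + (N + 1) + 1 ≤ N by omega), this]
          have e2 : Y (k + (N + 1)) = (Y₂ k).comap p := by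
            simp only [Y, if_neg (show ¬ k + (N + 1) ≤ N by omega), Nat.add_sub_cancel]
          change Step (Y (k + (N + 1) + 1)) (Y (k + (N + 1))) S
          rw [e1, e2]
          exact (hs₂ k hk).comap_of_surjective p hp
    generalize mult (𝔤 := 𝔤) A S = x at key ⊢
    generalize mult (𝔤 := 𝔤) C S = y at key ⊢
    refine enat_le_of_forall_nat fun n hn => ?_
    induction x using ENat.recTopCoe with
    | top => exact le_trans (by simp) (key n 0 le_top (by simp))
    | coe a =>
      induction y using ENat.recTopCoe with
      | top => exact le_trans (by simp) (key 0 n (by simp) le_top)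
      | coe b =>
        refine hn.trans (le_trans ?_ (key a b le_rfl le_rfl))
        rw [Nat.cast_add]

/-- The multiplicity in a union of an increasing sequence of submodules. -/
theorem exists_le_mult [LieModule.IsIrreducible ℂ 𝔤 S] (F : ℕ →o LieSubmodule ℂ 𝔤 X)
    (hF : ∀ x, ∃ b, x ∈ F b) (n : ℕ) (hn : (n : ℕ∞) ≤ mult (𝔤 := 𝔤) X S) :
    ∃ b, (n : ℕ∞) ≤ mult (𝔤 := 𝔤) (F b) S := by
  obtain ⟨Y, t, ht, hs⟩ := (le_mult_iff n).1 hn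
  -- Finitely many steps are witnessed by finitely many vectors, and a single member of the
  -- exhaustion contains them all.
  have hx : ∀ j ∈ t, ∃ x, x ∈ Y (j + 1) ∧ x ∉ Y j := by
    intro j hj
    obtain ⟨f, hf, hV⟩ := hs j hj
    have : Nontrivial S := LieModule.nontrivial_of_isIrreducible ℂ 𝔤 S
    obtain ⟨s, hs⟩ := exists_ne (0 : S)
    obtain ⟨u, rfl⟩ := hf s
    exact ⟨u, u.2, fun h => hs ((hV u).2 h)⟩
  choose! x hx1 hx2 using hx
  choose b hb using hF
  refine ⟨t.sup fun j => b (x j), (le_mult_iff n).2 ⟨⟨fun j => (Y j).comap (F _).incl,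
    fun _ _ h _ hx => Y.mono h hx⟩, t, ht, fun j hj => ?_⟩⟩
  exact (hs j hj).comap (F _).incl ⟨x j, F.mono (Finset.le_sup (f := fun j => b (x j)) hj) (hb _)⟩
    (hx1 j hj) (hx2 j hj)

theorem mult_eq_zero_of_subsingleton [LieModule.IsIrreducible ℂ 𝔤 S] [Subsingleton X] :
    mult (𝔤 := 𝔤) X S = 0 := by
  by_contra h
  obtain ⟨Y, t, ht, hs⟩ := (le_mult_iff (S := S) (X := X) (𝔤 := 𝔤) 1).1
    (by simpa using Order.one_le_iff_ne_zero.2 h)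
  obtain ⟨j, hj⟩ := Finset.card_pos.1 (by omega : 0 < t.card)
  obtain ⟨f, hf, -⟩ := hs j hj
  have : Nontrivial S := LieModule.nontrivial_of_isIrreducible ℂ 𝔤 S
  exact not_subsingleton S hf.subsingleton

theorem exists_step_of_mult_ne_zero (h : mult (𝔤 := 𝔤) X S ≠ 0) :
    ∃ U V : LieSubmodule ℂ 𝔤 X, V ≤ U ∧ Step U V S := by
  obtain ⟨Y, t, ht, hs⟩ := (le_mult_iff (S := S) (X := X) (𝔤 := 𝔤) 1).1
    (by simpa using Order.one_le_iff_ne_zero.2 h)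
  obtain ⟨j, hj⟩ := Finset.card_pos.1 (by omega : 0 < t.card)
  exact ⟨_, _, Y.mono (Nat.le_succ j), hs j hj⟩

theorem Step.top_bot [LieModule.IsIrreducible ℂ 𝔤 S] [LieModule.IsIrreducible ℂ 𝔤 X]
    {U V : LieSubmodule ℂ 𝔤 X} (h : Step U V S) (hVU : V ≤ U) : U = ⊤ ∧ V = ⊥ := by
  obtain ⟨f, hf, hV⟩ := h
  have : Nontrivial S := LieModule.nontrivial_of_isIrreducible ℂ 𝔤 S
  obtain ⟨s, hs⟩ := exists_ne (0 : S)
  obtain ⟨u, rfl⟩ := hf s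
  have hne : U ≠ V := fun e => hs ((hV u).2 (e ▸ u.2))
  rcases IsSimpleOrder.eq_bot_or_eq_top U with hU | hU
  · exact absurd (le_antisymm (hU ▸ bot_le) hVU) hne
  · exact ⟨hU, (IsSimpleOrder.eq_bot_or_eq_top V).resolve_right fun h => hne (hU.trans h.symm)⟩

theorem mult_le_one [LieModule.IsIrreducible ℂ 𝔤 S] [LieModule.IsIrreducible ℂ 𝔤 X] :
    mult (𝔤 := 𝔤) X S ≤ 1 := by
  refine enat_le_of_forall_nat fun n hn => ?_
  obtain ⟨Y, t, rfl, hs⟩ := (le_mult_iff n).1 hn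
  have : t.card ≤ 1 := Finset.card_le_one.2 fun a ha b hb => by
    have key : ∀ a ∈ t, ∀ b ∈ t, ¬ a < b := fun a ha b hb hab => by
      have h1 := ((hs a ha).top_bot (Y.mono (Nat.le_succ a))).1
      have h2 := ((hs b hb).top_bot (Y.mono (Nat.le_succ b))).2
      have h3 : Y (a + 1) ≤ Y b := Y.mono hab
      rw [h1, h2] at h3
      exact bot_ne_top (le_antisymm bot_le h3)
    exact le_antisymm (not_lt.1 (key b hb a ha)) (not_lt.1 (key a ha b hb))
  exact_mod_cast this

theorem equiv_of_mult_ne_zero [LieModule.IsIrreducible ℂ 𝔤 S] [LieModule.IsIrreducible ℂ 𝔤 X]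
    (h : mult (𝔤 := 𝔤) X S ≠ 0) : Nonempty (X ≃ₗ⁅ℂ,𝔤⁆ S) := by
  obtain ⟨U, V, hVU, hs⟩ := exists_step_of_mult_ne_zero h
  obtain ⟨rfl, rfl⟩ := hs.top_bot hVU
  obtain ⟨f, hf, hV⟩ := hs
  obtain ⟨k, hk⟩ := exists_factor (⊤ : LieSubmodule ℂ 𝔤 X).incl (fun x => ⟨⟨x, trivial⟩, rfl⟩) f
    fun u hu => (hV u).2 (by simpa using hu)
  refine ⟨lieEquivOfBijective k ⟨(injective_iff_map_eq_zero k).2 fun x hx => ?_, fun s => ?_⟩⟩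
  · have := (hV ⟨x, trivial⟩).1 ((hk ⟨x, trivial⟩).symm.trans hx)
    simpa using this
  · obtain ⟨u, rfl⟩ := hf s
    exact ⟨_, hk u⟩

variable (L N : LieSubalgebra ℂ 𝔤)

instance (T : SimpleObj L N) : LieModule.IsIrreducible ℂ 𝔤 T.carrier := T.irreducible

/-- A module of finite length has finite multiplicities, almost all of which are zero. -/
theorem finite_mult_of_finite_length [WellFoundedLT (LieSubmodule ℂ 𝔤 X)]
    [WellFoundedGT (LieSubmodule ℂ 𝔤 X)] :
    (∀ T : Irr L N, multIrr L N X T ≠ ⊤) ∧ {T : Irr L N | multIrr L N X T ≠ 0}.Finite := by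
  suffices key : ∀ M : LieSubmodule ℂ 𝔤 X, (∀ T : Irr L N, multIrr L N M T ≠ ⊤) ∧
      {T : Irr L N | multIrr L N M T ≠ 0}.Finite by
    obtain ⟨h1, h2⟩ := key ⊤
    have hle : ∀ T : Irr L N, multIrr L N X T ≤ multIrr L N (⊤ : LieSubmodule ℂ 𝔤 X) T := by
      intro T
      induction T using Quotient.inductionOn with
      | h T =>
        exact mult_le_of_surjective (S := T.carrier) (⊤ : LieSubmodule ℂ 𝔤 X).incl
          fun x => ⟨⟨x, trivial⟩, rfl⟩
    refine ⟨fun T => ne_top_of_le_ne_top (h1 T) (hle T), h2.subset fun T hT h0 => hT ?_⟩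
    exact le_antisymm ((hle T).trans h0.le) zero_le
  intro M
  induction M using WellFoundedLT.induction with
  | ind M ih =>
    by_cases hM : M = ⊥
    · subst hM
      have h0 : ∀ T : Irr L N, multIrr L N (⊥ : LieSubmodule ℂ 𝔤 X) T = 0 := by
        intro T
        induction T using Quotient.inductionOn with
        | h T => exact mult_eq_zero_of_subsingleton (S := T.carrier)
      simp [h0]
    -- A maximal proper submodule of `M`: the quotient is simple, and the induction hypothesis
    -- applies to `M₁`.
    · obtain ⟨M₁, hM₁, hmax⟩ := WellFounded.has_min (wellFounded_gt (α := LieSubmodule ℂ 𝔤 X))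
        {M' | M' < M} ⟨⊥, bot_lt_iff_ne_bot.2 hM⟩
      have hmax' : ∀ K, M₁ ≤ K → K ≤ M → K = M₁ ∨ K = M := by
        intro K h1 h2
        by_contra! h
        exact hmax K (lt_of_le_of_ne h2 h.2) (lt_of_le_of_ne h1 h.1.symm)
      have hM₁ : M₁ < M := hM₁
      obtain ⟨i1, i2⟩ := ih M₁ hM₁
      let K := LieSubmodule.comap M.incl M₁
      let p := LieSubmodule.Quotient.mk' K
      have hp : Function.Surjective p := LieSubmodule.Quotient.surjective_mk' K
      have hpk : ∀ b : M, p b = 0 ↔ (b : X) ∈ M₁ := fun b => by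
        rw [LieSubmodule.Quotient.mk_eq_zero, LieSubmodule.mem_comap]; rfl
      have hnt : Nontrivial (M ⧸ K) := by
        obtain ⟨x, hx, hx'⟩ := Set.exists_of_ssubset hM₁
        exact ⟨p ⟨x, hx⟩, 0, fun h => hx' ((hpk _).1 h)⟩
      have hirr : LieModule.IsIrreducible ℂ 𝔤 (M ⧸ K) := by
        refine LieModule.IsIrreducible.mk fun Q hQ => ?_
        have hle : M₁ ≤ (Q.comap p).map M.incl := by
          intro x hx
          refine ⟨⟨x, hM₁.le hx⟩, ?_, rfl⟩
          change p _ ∈ Q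
          rw [(hpk _).2 hx]
          exact zero_mem _
        have hle' : (Q.comap p).map M.incl ≤ M := by
          rintro _ ⟨b, -, rfl⟩
          exact b.2
        rcases hmax' _ hle hle' with h | h
        · refine absurd ?_ hQ
          rw [LieSubmodule.eq_bot_iff]
          intro q hq
          obtain ⟨b, rfl⟩ := hp q
          rw [hpk, ← h]
          exact ⟨b, hq, rfl⟩
        · rw [eq_top_iff]
          intro q _
          obtain ⟨b, rfl⟩ := hp q
          have : (b : X) ∈ (Q.comap p).map M.incl := by
            rw [h]; exact b.2
          obtain ⟨b', hb', e⟩ := this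
          rwa [← Subtype.ext e]
      have hadd : ∀ T : SimpleObj L N, multIrr L N M ⟦T⟧
          = multIrr L N M₁ ⟦T⟧ + multIrr L N (M ⧸ K) ⟦T⟧ := fun T =>
        mult_exact (S := T.carrier) (LieSubmodule.inclusion hM₁.le)
          (LieSubmodule.inclusion_injective _) p hp fun b => by
            rw [hpk]
            exact ⟨fun hb => ⟨⟨b, hb⟩, rfl⟩, by rintro ⟨a, rfl⟩; exact a.2⟩
      have hone : ∀ T : SimpleObj L N, multIrr L N (M ⧸ K) ⟦T⟧ ≤ 1 := fun T =>
        mult_le_one (S := T.carrier)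
      constructor
      · intro T
        induction T using Quotient.inductionOn with
        | h T =>
          rw [hadd]
          exact WithTop.add_ne_top.2 ⟨i1 _, ne_top_of_le_ne_top ENat.one_ne_top (hone T)⟩
      -- Two simple objects that occur in the simple quotient are both isomorphic to it, so only one
      -- class is added.
      · have hsub : {T : Irr L N | multIrr L N (M ⧸ K) T ≠ 0}.Subsingleton := by
          intro T hT T' hT'
          induction T using Quotient.inductionOn with
          | h T =>
            induction T' using Quotient.inductionOn with
            | h T' =>
              obtain ⟨e⟩ := equiv_of_mult_ne_zero (S := T.carrier) (X := M ⧸ K) (𝔤 := 𝔤) hT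
              obtain ⟨e'⟩ := equiv_of_mult_ne_zero (S := T'.carrier) (X := M ⧸ K) (𝔤 := 𝔤) hT'
              exact Quotient.sound ⟨e.symm.trans e'⟩
        refine (i2.union hsub.finite).subset fun T hT => ?_
        by_contra hcon
        simp only [Set.mem_union, Set.mem_ofPred_eq, not_or, not_not] at hcon
        induction T using Quotient.inductionOn with
        | h T => exact hT (by rw [hadd, hcon.1, hcon.2, add_zero])

end Multiplicity

/-! ### Weights -/

section Weights

variable {𝔤 : Type} [LieRing 𝔤] [LieAlgebra ℂ 𝔤] {X S : Type}
  [AddCommGroup X] [Module ℂ X] [LieRingModule 𝔤 X] [LieModule ℂ 𝔤 X]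
  [AddCommGroup S] [Module ℂ S] [LieRingModule 𝔤 S] [LieModule ℂ 𝔤 S]

/-- Every vector is a sum of eigenvectors of `h` with eigenvalues in `W`. -/
def HasWeights (h : 𝔤) (W : Set ℂ) (X : Type) [AddCommGroup X] [Module ℂ X] [LieRingModule 𝔤 X] :
    Prop :=
  ∀ x : X, ∃ (s : Finset ℂ) (v : ℂ → X), (∀ w ∈ s, w ∈ W ∧ ⁅h, v w⁆ = w • v w) ∧ x = ∑ w ∈ s, v w

/-- Applying T - a removes the eigenvector for a and multiplies each of the others by the nonzero
scalar w - a, which reduces the number of summands. -/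
theorem mem_of_sum_eigenvectors_mem {V : Type} [AddCommGroup V] [Module ℂ V] (T : Module.End ℂ V)
    (p : Submodule ℂ V) (hp : ∀ x ∈ p, T x ∈ p) (s : Finset ℂ) (v : ℂ → V)
    (hv : ∀ w ∈ s, T (v w) = w • v w) (hs : ∑ w ∈ s, v w ∈ p) : ∀ w ∈ s, v w ∈ p := by
  classical
  induction s using Finset.induction_on generalizing v with
  | empty => simp
  | insert a s ha ih =>
    have h1 : ∑ w ∈ s, (w - a) • v w ∈ p := by
      have h2 : T (∑ w ∈ insert a s, v w) - a • ∑ w ∈ insert a s, v w ∈ p :=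
        sub_mem (hp _ hs) (p.smul_mem _ hs)
      rw [map_sum, Finset.sum_congr rfl hv, Finset.smul_sum, ← Finset.sum_sub_distrib,
        Finset.sum_insert ha, sub_self, zero_add] at h2
      simpa only [sub_smul] using h2
    have h3 := ih (fun w => (w - a) • v w) (fun w hw => by
      rw [map_smul, hv w (Finset.mem_insert_of_mem hw), smul_comm]) h1
    have h4 : ∀ w ∈ s, v w ∈ p := fun w hw => by
      have hne : w - a ≠ 0 := sub_ne_zero.2 fun e => ha (e ▸ hw)
      exact (p.smul_mem_iff hne).1 (h3 w hw)
    intro w hw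
    rcases Finset.mem_insert.1 hw with rfl | hw
    · rw [Finset.sum_insert ha] at hs
      exact (p.add_mem_iff_left (sum_mem h4)).1 hs
    · exact h4 w hw

theorem HasWeights.of_surjective {h : 𝔤} {W : Set ℂ} (hX : HasWeights h W X)
    (U : LieSubmodule ℂ 𝔤 X) (f : U →ₗ⁅ℂ,𝔤⁆ S) (hf : Function.Surjective f) :
    HasWeights h W S := by
  classical
  intro y
  obtain ⟨u, rfl⟩ := hf y
  obtain ⟨s, v, hv, hu⟩ := hX u
  have hU := mem_of_sum_eigenvectors_mem (LieModule.toEnd ℂ 𝔤 X h) U.toSubmodule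
    (fun x hx => U.lie_mem hx) s v (fun w hw => (hv w hw).2) (hu ▸ u.2)
  refine ⟨s, fun w => if hw : v w ∈ U then f ⟨v w, hw⟩ else 0, fun w hw => ⟨(hv w hw).1, ?_⟩, ?_⟩
  · have hw' : v w ∈ U := hU w hw
    simp only [hw', dif_pos]
    rw [← LieModuleHom.map_lie, ← map_smul]
    congr 1
    exact Subtype.ext (hv w hw).2
  · rw [← Finset.sum_attach s]
    have : u = ∑ w ∈ s.attach, (⟨v w.1, hU w.1 w.2⟩ : U) := by
      apply Subtype.ext
      rw [hu, ← Finset.sum_attach s]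
      exact (map_sum U.toSubmodule.subtype (fun w : s => (⟨v w.1, hU w.1 w.2⟩ : U)) s.attach).symm
    rw [this, map_sum]
    refine Finset.sum_congr rfl fun w _ => ?_
    rw [dif_pos (show v w.1 ∈ U from hU w.1 w.2)]

theorem HasWeights.exists_eigenvector {h : 𝔤} {W : Set ℂ} (hX : HasWeights h W X) [Nontrivial X] :
    ∃ w ∈ W, ∃ x : X, x ≠ 0 ∧ ⁅h, x⁆ = w • x := by
  obtain ⟨x, hx⟩ := exists_ne (0 : X)
  obtain ⟨s, v, hv, rfl⟩ := hX x
  obtain ⟨w, hw, hne⟩ := Finset.exists_ne_zero_of_sum_ne_zero hx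
  exact ⟨w, (hv w hw).1, v w, hne, (hv w hw).2⟩

theorem HasWeights.mem_of_eigenvector {h : 𝔤} {W : Set ℂ} (hX : HasWeights h W X) {w : ℂ} {x : X}
    (hx : x ≠ 0) (hw : ⁅h, x⁆ = w • x) : w ∈ W := by
  classical
  by_contra hW
  obtain ⟨s, v, hv, hs⟩ := hX x
  have hws : w ∉ s := fun h => hW (hv w h).1
  -- With the zero subspace as `p`, the lemma becomes linear independence: -x together with the
  -- components of x is a vanishing sum of eigenvectors for distinct eigenvalues, so x would be
  -- zero.
  have := mem_of_sum_eigenvectors_mem (LieModule.toEnd ℂ 𝔤 X h) ⊥ (by simp) (insert w s)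
    (fun z => if z = w then -x else v z) (fun z hz => ?_) ?_ w (Finset.mem_insert_self _ _)
  · simp at this
    exact hx this
  · rcases Finset.mem_insert.1 hz with rfl | hz
    · simp [hw]
    · have : z ≠ w := fun e => hws (e ▸ hz)
      simp [this, (hv z hz).2]
  · rw [Finset.sum_insert hws, if_pos rfl, Finset.sum_congr rfl fun z hz =>
      if_neg (fun e => hws (e ▸ hz) : ¬ z = w), ← hs]
    simp

end Weights

/-! ### Weyl algebra relations -/

/-- The elements `y i` and `d i` satisfy the relations of multiplication by the variables and of
partial differentiation. -/
structure WeylRel {R : Type} [Ring R] {m : ℕ} (y d : Fin m → R) : Prop where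
  yy : ∀ i j, y i * y j = y j * y i
  dd : ∀ i j, d i * d j = d j * d i
  dy : ∀ i j, d i * y j = y j * d i + if i = j then 1 else 0

/-- The Euler operator `∑ y_i d_i`. -/
def euler {R : Type} [Ring R] {m : ℕ} (y d : Fin m → R) : R := ∑ i, y i * d i

/-- The Laplace operator `∑ d_i ^ 2`. -/
def lapl {R : Type} [Ring R] {m : ℕ} (d : Fin m → R) : R := ∑ i, d i * d i

/-- The linear vector field `∑ B_ki y_k d_i`. -/
def vecField {R : Type} [Ring R] [Algebra ℂ R] {m : ℕ} (y d : Fin m → R)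
    (B : Matrix (Fin m) (Fin m) ℂ) : R := ∑ k, ∑ i, B k i • (y k * d i)

namespace WeylRel

variable {R : Type} [Ring R] [Algebra ℂ R] {m : ℕ} {y d : Fin m → R} (h : WeylRel y d)

include h

theorem euler_y (l : Fin m) : euler y d * y l = y l * euler y d + y l := by
  have : ∀ i, y i * d i * y l = y l * (y i * d i) + if i = l then y i else 0 := fun i => by
    rw [mul_assoc, h.dy, mul_add, ← mul_assoc, h.yy, mul_assoc]
    split_ifs <;> simp
  simp only [euler, Finset.sum_mul, Finset.mul_sum, this, Finset.sum_add_distrib,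
    Finset.sum_ite_eq', Finset.mem_univ, if_true]

theorem lapl_y (l : Fin m) : lapl d * y l = y l * lapl d + (2 : ℂ) • d l := by
  have : ∀ i, d i * d i * y l = y l * (d i * d i) + if i = l then (2 : ℂ) • d i else 0 :=
    fun i => by
      rw [mul_assoc, h.dy, mul_add, ← mul_assoc, h.dy, add_mul, mul_assoc]
      split_ifs
      · rw [two_smul, one_mul, mul_one, add_assoc]
      · simp
  simp only [lapl, Finset.sum_mul, Finset.mul_sum, this, Finset.sum_add_distrib,
    Finset.sum_ite_eq', Finset.mem_univ, if_true]

theorem vecField_y (B : Matrix (Fin m) (Fin m) ℂ) (l : Fin m) :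
    vecField y d B * y l = y l * vecField y d B + ∑ k, B k l • y k := by
  have : ∀ k i, y k * d i * y l = y l * (y k * d i) + if i = l then y k else 0 := fun k i => by
    rw [mul_assoc, h.dy, mul_add, ← mul_assoc, h.yy, mul_assoc]
    split_ifs <;> simp
  simp only [vecField, Finset.sum_mul, Finset.mul_sum, smul_mul_assoc, mul_smul_comm, this,
    smul_add, Finset.sum_add_distrib, smul_ite, smul_zero, Finset.sum_ite_eq', Finset.mem_univ,
    if_true]

end WeylRel

/-! ### The conformal Lie algebra in coordinates -/

/-- Coordinates on a Lie algebra isomorphic to `so(m + 2, ℂ)`: its elements are the matrices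
`[a, xᵀ, 0; y, B, -x; 0, -yᵀ, -a]` with `B` skew-symmetric. -/
structure ConfCoords (m : ℕ) (𝔤 : Type) [LieRing 𝔤] [LieAlgebra ℂ 𝔤] where
  a : 𝔤 →ₗ[ℂ] ℂ
  x : 𝔤 →ₗ[ℂ] (Fin m → ℂ)
  y : 𝔤 →ₗ[ℂ] (Fin m → ℂ)
  B : 𝔤 →ₗ[ℂ] Matrix (Fin m) (Fin m) ℂ
  skew : ∀ A i j, B A i j = -B A j i
  lie_a : ∀ A A', a ⁅A, A'⁆ = ∑ i, (x A i * y A' i - x A' i * y A i)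
  lie_x : ∀ A A' i, x ⁅A, A'⁆ i = a A * x A' i - a A' * x A i
    + ∑ j, (B A i j * x A' j - B A' i j * x A j)
  lie_y : ∀ A A' i, y ⁅A, A'⁆ i = a A' * y A i - a A * y A' i
    + ∑ j, (B A i j * y A' j - B A' i j * y A j)
  lie_B : ∀ A A' i j, B ⁅A, A'⁆ i j = ∑ k, (B A i k * B A' k j - B A' i k * B A k j)
    + (y A i * x A' j - x A' i * y A j + x A i * y A' j - y A' i * x A j)
  ext : ∀ A A', a A = a A' → x A = x A' → y A = y A' → B A = B A' → A = A'
  surj : ∀ (a₀ : ℂ) (x₀ y₀ : Fin m → ℂ) (B₀ : Matrix (Fin m) (Fin m) ℂ),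
    (∀ i j, B₀ i j = -B₀ j i) → ∃ A, a A = a₀ ∧ x A = x₀ ∧ y A = y₀ ∧ B A = B₀

/-- The skew-symmetric matrix `E_ij - E_ji`. -/
def skewUnit {m : ℕ} (i j : Fin m) : Matrix (Fin m) (Fin m) ℂ :=
  Matrix.single i j 1 - Matrix.single j i 1

theorem skewUnit_apply {m : ℕ} (i j k l : Fin m) : skewUnit i j k l
    = (if i = k ∧ j = l then 1 else 0) - (if j = k ∧ i = l then 1 else 0) := rfl

theorem skewUnit_skew {m : ℕ} (i j k l : Fin m) : skewUnit i j k l = -skewUnit i j l k := by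
  simp only [skewUnit_apply, and_comm]
  ring

namespace ConfCoords

variable {m : ℕ} {𝔤 : Type} [LieRing 𝔤] [LieAlgebra ℂ 𝔤] (c : ConfCoords m 𝔤)

/-- The grading element. -/
def H : 𝔤 := (c.surj 1 0 0 0 (by simp)).choose
/-- The basis of the nilradical. -/
def X (i : Fin m) : 𝔤 := (c.surj 0 (Pi.single i 1) 0 0 (by simp)).choose
/-- The basis of the opposite nilradical. -/
def Y (i : Fin m) : 𝔤 := (c.surj 0 0 (Pi.single i 1) 0 (by simp)).choose
/-- The rotations. -/
def M (i j : Fin m) : 𝔤 := (c.surj 0 0 0 (skewUnit i j) (skewUnit_skew i j)).choose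

theorem H_spec : c.a c.H = 1 ∧ c.x c.H = 0 ∧ c.y c.H = 0 ∧ c.B c.H = 0 :=
  (c.surj 1 0 0 0 (by simp)).choose_spec
theorem X_spec (i : Fin m) :
    c.a (c.X i) = 0 ∧ c.x (c.X i) = Pi.single i 1 ∧ c.y (c.X i) = 0 ∧ c.B (c.X i) = 0 :=
  (c.surj 0 (Pi.single i 1) 0 0 (by simp)).choose_spec
theorem Y_spec (i : Fin m) :
    c.a (c.Y i) = 0 ∧ c.x (c.Y i) = 0 ∧ c.y (c.Y i) = Pi.single i 1 ∧ c.B (c.Y i) = 0 :=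
  (c.surj 0 0 (Pi.single i 1) 0 (by simp)).choose_spec
theorem M_spec (i j : Fin m) :
    c.a (c.M i j) = 0 ∧ c.x (c.M i j) = 0 ∧ c.y (c.M i j) = 0 ∧ c.B (c.M i j) = skewUnit i j :=
  (c.surj 0 0 0 (skewUnit i j) (skewUnit_skew i j)).choose_spec

/-- The component of an element in the opposite nilradical. -/
def Ypart (A : 𝔤) : 𝔤 := ∑ i, c.y A i • c.Y i

theorem Ypart_spec (A : 𝔤) :
    c.a (c.Ypart A) = 0 ∧ c.x (c.Ypart A) = 0 ∧ c.y (c.Ypart A) = c.y A ∧ c.B (c.Ypart A) = 0 := by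
  refine ⟨?_, ?_, ?_, ?_⟩
  · simp [Ypart, c.Y_spec]
  · simp [Ypart, c.Y_spec]
  · ext j
    simp [Ypart, c.Y_spec, Finset.sum_apply, Pi.single_apply]
  · simp [Ypart, c.Y_spec]

theorem Ypart_add (A : 𝔤) : A = c.Ypart A + (A - c.Ypart A) := by abel

theorem y_sub_Ypart (A : 𝔤) : c.y (A - c.Ypart A) = 0 := by
  rw [map_sub, (c.Ypart_spec A).2.2.1, sub_self]

theorem lie_Y_Y (i j : Fin m) : ⁅c.Y i, c.Y j⁆ = 0 := by
  refine c.ext _ _ ?_ ?_ ?_ ?_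
  · simp [c.lie_a, c.Y_spec]
  · ext k; simp [c.lie_x, c.Y_spec]
  · ext k; simp [c.lie_y, c.Y_spec]
  · ext k l; simp [c.lie_B, c.Y_spec]

end ConfCoords

/-! ### The polynomial model of a generalized Verma module -/

/-- Polynomials in `m` variables with values in `F`. -/
def PolyTensor (m : ℕ) (F : Type) [AddCommGroup F] [Module ℂ F] : Type :=
  MvPolynomial (Fin m) ℂ ⊗[ℂ] F

section Model

variable {m : ℕ} {F : Type} [AddCommGroup F] [Module ℂ F]

instance : AddCommGroup (PolyTensor m F) :=
  inferInstanceAs (AddCommGroup (MvPolynomial (Fin m) ℂ ⊗[ℂ] F))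

instance : Module ℂ (PolyTensor m F) :=
  inferInstanceAs (Module ℂ (MvPolynomial (Fin m) ℂ ⊗[ℂ] F))

/-- The polynomial `p` times the constant `v`. -/
def pt (p : MvPolynomial (Fin m) ℂ) (v : F) : PolyTensor m F := p ⊗ₜ[ℂ] v

theorem pt_add_left (p q : MvPolynomial (Fin m) ℂ) (v : F) : pt (p + q) v = pt p v + pt q v :=
  TensorProduct.add_tmul p q v

theorem pt_add_right (p : MvPolynomial (Fin m) ℂ) (v w : F) : pt p (v + w) = pt p v + pt p w :=
  TensorProduct.tmul_add p v w

theorem pt_sub_right (p : MvPolynomial (Fin m) ℂ) (v w : F) : pt p (v - w) = pt p v - pt p w :=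
  TensorProduct.tmul_sub p v w

theorem pt_smul_right (t : ℂ) (p : MvPolynomial (Fin m) ℂ) (v : F) : pt p (t • v) = t • pt p v :=
  TensorProduct.tmul_smul t p v

theorem pt_smul_left (t : ℂ) (p : MvPolynomial (Fin m) ℂ) (v : F) : pt (t • p) v = t • pt p v :=
  TensorProduct.smul_tmul' t p v

@[simp] theorem pt_zero_left (v : F) : pt (0 : MvPolynomial (Fin m) ℂ) v = 0 :=
  TensorProduct.zero_tmul _ v

@[simp] theorem pt_zero_right (p : MvPolynomial (Fin m) ℂ) : pt p (0 : F) = 0 :=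
  TensorProduct.tmul_zero _ p

theorem pt_induction {p : PolyTensor m F → Prop} (add : ∀ u w, p u → p w → p (u + w))
    (pure : ∀ q v, p (pt q v)) (u : PolyTensor m F) : p u :=
  TensorProduct.induction_on u
    (by have h := pure 0 0; rw [pt_zero_left] at h; exact h) pure add

theorem pt_ext {W : Type} [AddCommGroup W] [Module ℂ W] {f g : PolyTensor m F →ₗ[ℂ] W}
    (h : ∀ q v, f (pt q v) = g (pt q v)) : f = g :=
  TensorProduct.ext' h

/-- The linear map out of `PolyTensor m F` given by a bilinear map. -/
def ptLift {W : Type} [AddCommGroup W] [Module ℂ W]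
    (f : MvPolynomial (Fin m) ℂ →ₗ[ℂ] F →ₗ[ℂ] W) : PolyTensor m F →ₗ[ℂ] W :=
  TensorProduct.lift f

@[simp] theorem ptLift_pt {W : Type} [AddCommGroup W] [Module ℂ W]
    (f : MvPolynomial (Fin m) ℂ →ₗ[ℂ] F →ₗ[ℂ] W) (p : MvPolynomial (Fin m) ℂ) (v : F) :
    ptLift f (pt p v) = f p v := TensorProduct.lift.tmul p v

/-- Multiplication by a variable. -/
def yOp (F : Type) [AddCommGroup F] [Module ℂ F] (i : Fin m) : Module.End ℂ (PolyTensor m F) :=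
  (LinearMap.mulLeft ℂ (MvPolynomial.X i)).rTensor F

/-- Partial differentiation. -/
def dOp (F : Type) [AddCommGroup F] [Module ℂ F] (i : Fin m) : Module.End ℂ (PolyTensor m F) :=
  (MvPolynomial.pderiv i).toLinearMap.rTensor F

/-- An operator acting on values. -/
def sOp (m : ℕ) : Module.End ℂ F →ₗ[ℂ] Module.End ℂ (PolyTensor m F) :=
  LinearMap.lTensorHom (MvPolynomial (Fin m) ℂ)

@[simp] theorem yOp_pt (i : Fin m) (p : MvPolynomial (Fin m) ℂ) (v : F) :
    yOp F i (pt p v) = pt (MvPolynomial.X i * p) v := rfl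

@[simp] theorem dOp_pt (i : Fin m) (p : MvPolynomial (Fin m) ℂ) (v : F) :
    dOp F i (pt p v) = pt (MvPolynomial.pderiv i p) v := rfl

@[simp] theorem sOp_pt (T : Module.End ℂ F) (p : MvPolynomial (Fin m) ℂ) (v : F) :
    sOp m T (pt p v) = pt p (T v) := rfl

theorem sOp_mul (S T : Module.End ℂ F) : sOp m (S * T) = sOp m S * sOp m T :=
  pt_ext fun _ _ => rfl

theorem sOp_one : sOp m (1 : Module.End ℂ F) = 1 := pt_ext fun _ _ => rfl

theorem sOp_y (T : Module.End ℂ F) (i : Fin m) : sOp m T * yOp F i = yOp F i * sOp m T :=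
  pt_ext fun _ _ => rfl

theorem sOp_d (T : Module.End ℂ F) (i : Fin m) : sOp m T * dOp F i = dOp F i * sOp m T :=
  pt_ext fun _ _ => rfl

theorem pderiv_X_mul (i j : Fin m) (p : MvPolynomial (Fin m) ℂ) :
    MvPolynomial.pderiv i (MvPolynomial.X j * p)
      = MvPolynomial.X j * MvPolynomial.pderiv i p + if i = j then p else 0 := by
  rw [Derivation.leibniz, MvPolynomial.pderiv_X, Pi.single_apply]
  by_cases h : i = j
  · simp [h]
  · simp [h, Ne.symm h]

theorem pderiv_comm (i j : Fin m) (p : MvPolynomial (Fin m) ℂ) :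
    MvPolynomial.pderiv i (MvPolynomial.pderiv j p)
      = MvPolynomial.pderiv j (MvPolynomial.pderiv i p) := by
  induction p using MvPolynomial.induction_on with
  | C a => rw [MvPolynomial.pderiv_C, MvPolynomial.pderiv_C, map_zero, map_zero]
  | add p q hp hq => rw [map_add, map_add, map_add, map_add, hp, hq]
  | mul_X p k hp =>
    rw [mul_comm, pderiv_X_mul, pderiv_X_mul, map_add, map_add, pderiv_X_mul, pderiv_X_mul, hp]
    split_ifs <;> (try simp only [map_zero]) <;> abel

theorem weylRel (m : ℕ) (F : Type) [AddCommGroup F] [Module ℂ F] :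
    WeylRel (yOp (m := m) F) (dOp F) where
  yy i j := pt_ext fun p v => by
    simp only [Module.End.mul_apply, yOp_pt]
    rw [mul_left_comm]
  dd i j := pt_ext fun p v => by
    simp only [Module.End.mul_apply, dOp_pt]
    rw [pderiv_comm]
  dy i j := pt_ext fun p v => by
    rw [LinearMap.add_apply]
    simp only [Module.End.mul_apply, dOp_pt, yOp_pt]
    rw [pderiv_X_mul, pt_add_left]
    split_ifs
    · rfl
    · rw [pt_zero_left]; rfl

theorem polyTensor_induction {p : PolyTensor m F → Prop} (add : ∀ u w, p u → p w → p (u + w))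
    (one : ∀ v : F, p (pt 1 v)) (mul : ∀ i u, p u → p (yOp F i u)) (u : PolyTensor m F) : p u := by
  induction u using pt_induction with
  | add u w hu hw => exact add u w hu hw
  | pure q v =>
    induction q using MvPolynomial.induction_on generalizing v with
    | C a =>
      have : pt (MvPolynomial.C a : MvPolynomial (Fin m) ℂ) v = pt 1 (a • v) := by
        rw [MvPolynomial.C_eq_smul_one, pt_smul_left, pt_smul_right]
      rw [this]
      exact one _
    | add q r hq hr => rw [pt_add_left]; exact add _ _ (hq v) (hr v)
    | mul_X q i hq => rw [mul_comm]; exact mul i _ (hq v)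

theorem polyTensor_ext {W : Type} [AddCommGroup W] [Module ℂ W] (T : Fin m → Module.End ℂ W)
    (f g : PolyTensor m F →ₗ[ℂ] W) (h1 : ∀ v : F, f (pt 1 v) = g (pt 1 v))
    (hf : ∀ i u, f (yOp F i u) = T i (f u)) (hg : ∀ i u, g (yOp F i u) = T i (g u)) : f = g := by
  refine LinearMap.ext fun u => ?_
  induction u using polyTensor_induction with
  | add u w hu hw => rw [map_add, map_add, hu, hw]
  | one v => exact h1 v
  | mul i u hu => rw [hf, hg, hu]

/-- A linear map out of `F` extends to polynomials, given commuting operators. -/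
theorem exists_polyTensor_lift {W : Type} [AddCommGroup W] [Module ℂ W]
    (T : Fin m → Module.End ℂ W) (hT : ∀ i j, T i * T j = T j * T i) (f : F →ₗ[ℂ] W) :
    ∃ g : PolyTensor m F →ₗ[ℂ] W, (∀ v, g (pt 1 v) = f v) ∧ ∀ i u, g (yOp F i u) = T i (g u) := by
  -- Evaluation of polynomials needs a commutative target, and the algebra generated by commuting
  -- operators is one.
  let S := Algebra.adjoin ℂ (Set.range T)
  have hS : IsMulCommutative S := Algebra.isMulCommutative_adjoin ℂ (by
    rintro _ ⟨i, rfl⟩ _ ⟨j, rfl⟩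
    exact hT i j)
  let _ : CommSemiring S := { S.toSemiring with mul_comm := hS.is_comm.comm }
  let φ : MvPolynomial (Fin m) ℂ →ₐ[ℂ] S :=
    MvPolynomial.aeval fun i => ⟨T i, Algebra.subset_adjoin ⟨i, rfl⟩⟩
  let ψ : MvPolynomial (Fin m) ℂ →ₐ[ℂ] Module.End ℂ W := S.val.comp φ
  have hψ : ∀ i, ψ (MvPolynomial.X i) = T i := fun i => by
    change (φ (MvPolynomial.X i)).1 = T i
    rw [MvPolynomial.aeval_X]
  refine ⟨ptLift ((LinearMap.lcomp ℂ W f).comp ψ.toLinearMap), fun v => ?_,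
    fun i u => ?_⟩
  · rw [ptLift_pt]
    change ψ 1 (f v) = f v
    rw [map_one]; rfl
  · induction u using pt_induction with
    | add u w hu hw => simp only [map_add, hu, hw]
    | pure p v =>
      rw [yOp_pt, ptLift_pt, ptLift_pt]
      change ψ (MvPolynomial.X i * p) (f v) = T i (ψ p (f v))
      rw [map_mul, hψ]; rfl

variable (σ : Matrix (Fin m) (Fin m) ℂ →ₗ[ℂ] Module.End ℂ F) (μ : ℂ)

/-- The action of a rotation. -/
def mOp : Matrix (Fin m) (Fin m) ℂ →ₗ[ℂ] Module.End ℂ (PolyTensor m F) where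
  toFun B := vecField (yOp F) (dOp F) B + sOp m (σ B)
  map_add' A B := by
    simp only [vecField, Matrix.add_apply, add_smul, Finset.sum_add_distrib, map_add]
    abel
  map_smul' t B := by
    simp only [vecField, Matrix.smul_apply, map_smul, smul_add, Finset.smul_sum, smul_smul,
      smul_eq_mul, RingHom.id_apply]

/-- The action of the grading element. -/
def hOp (m : ℕ) (F : Type) [AddCommGroup F] [Module ℂ F] (μ : ℂ) :
    Module.End ℂ (PolyTensor m F) := μ • 1 - euler (yOp F) (dOp F)

/-- The action of the nilradical. -/
def xOp (i : Fin m) : Module.End ℂ (PolyTensor m F) :=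
  hOp m F μ * dOp F i + (1 / 2 : ℂ) • (yOp F i * lapl (dOp F))
    + ∑ j, sOp m (σ (skewUnit i j)) * dOp F j

theorem mOp_y (B : Matrix (Fin m) (Fin m) ℂ) (l : Fin m) :
    mOp σ B * yOp F l = yOp F l * mOp σ B + ∑ k, B k l • yOp F k := by
  change (vecField (yOp F) (dOp F) B + sOp m (σ B)) * _
    = _ * (vecField (yOp F) (dOp F) B + sOp m (σ B)) + _
  rw [add_mul, mul_add, (weylRel m F).vecField_y, sOp_y]
  abel

theorem hOp_y (l : Fin m) : hOp m F μ * yOp F l = yOp F l * hOp m F μ - yOp F l := by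
  rw [hOp, sub_mul, mul_sub, (weylRel m F).euler_y, smul_mul_assoc, mul_smul_comm, one_mul, mul_one]
  abel

theorem vecField_skewUnit {R : Type} [Ring R] [Algebra ℂ R] (y d : Fin m → R) (i l : Fin m) :
    vecField y d (skewUnit i l) = y i * d l - y l * d i := by
  simp [vecField, skewUnit_apply, sub_smul, Finset.sum_sub_distrib, ite_and]

/-- The relation [X_i, Y_l] = δ_il H + M_il. Together with the vanishing of X_i on constants it
determines X_i on all polynomials, and `xOp` is the closed form of that recursion. -/
theorem xOp_y (i l : Fin m) : xOp σ μ i * yOp F l = yOp F l * xOp σ μ i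
    + ((if i = l then hOp m F μ else 0) + mOp σ (skewUnit i l)) := by
  have hw := weylRel m F
  have h1 : hOp m F μ * dOp F i * yOp F l = yOp F l * (hOp m F μ * dOp F i)
      + ((if i = l then hOp m F μ else 0) - yOp F l * dOp F i) := by
    rw [mul_assoc, hw.dy, mul_add, ← mul_assoc, hOp_y, sub_mul, mul_assoc]
    split_ifs <;> simp only [mul_one, mul_zero] <;> abel
  have h2 : yOp F i * lapl (dOp F) * yOp F l = yOp F l * (yOp F i * lapl (dOp F))
      + (2 : ℂ) • (yOp F i * dOp F l) := by
    rw [mul_assoc, hw.lapl_y, mul_add, ← mul_assoc, hw.yy, mul_assoc, mul_smul_comm]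
  have h3 : (∑ j, sOp m (σ (skewUnit i j)) * dOp F j) * yOp F l
      = yOp F l * (∑ j, sOp m (σ (skewUnit i j)) * dOp F j) + sOp m (σ (skewUnit i l)) := by
    have : ∀ j, sOp m (σ (skewUnit i j)) * dOp F j * yOp F l
        = yOp F l * (sOp m (σ (skewUnit i j)) * dOp F j)
          + if j = l then sOp m (σ (skewUnit i j)) else 0 := fun j => by
      rw [mul_assoc, hw.dy, mul_add, ← mul_assoc, sOp_y, mul_assoc]
      split_ifs <;> simp
    simp only [Finset.sum_mul, Finset.mul_sum, this, Finset.sum_add_distrib, Finset.sum_ite_eq',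
      Finset.mem_univ, if_true]
  have h4 : mOp σ (skewUnit i l) = yOp F i * dOp F l - yOp F l * dOp F i
      + sOp m (σ (skewUnit i l)) := by
    rw [← vecField_skewUnit]; rfl
  rw [xOp, add_mul, add_mul, h1, smul_mul_assoc, h2, h3, h4, smul_add, smul_smul, mul_add, mul_add,
    mul_smul_comm]
  norm_num
  abel

@[simp] theorem dOp_one (i : Fin m) (v : F) :
    dOp F i (pt (1 : MvPolynomial (Fin m) ℂ) v) = 0 := by
  rw [dOp_pt, MvPolynomial.pderiv_one, pt_zero_left]

@[simp] theorem euler_one (v : F) :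
    euler (yOp F) (dOp F) (pt (1 : MvPolynomial (Fin m) ℂ) v) = 0 := by
  simp [euler, LinearMap.sum_apply]

theorem hOp_one (v : F) :
    hOp m F μ (pt (1 : MvPolynomial (Fin m) ℂ) v) = μ • pt 1 v := by
  simp [hOp]

theorem mOp_one (B : Matrix (Fin m) (Fin m) ℂ) (v : F) :
    mOp σ B (pt (1 : MvPolynomial (Fin m) ℂ) v) = pt 1 (σ B v) := by
  simp [mOp, vecField, LinearMap.sum_apply]

theorem xOp_one (i : Fin m) (v : F) :
    xOp σ μ i (pt (1 : MvPolynomial (Fin m) ℂ) v) = 0 := by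
  simp [xOp, lapl, LinearMap.sum_apply]

variable {𝔤 : Type} [LieRing 𝔤] [LieAlgebra ℂ 𝔤] (c : ConfCoords m 𝔤)

/-- The action of the Lie algebra on the polynomial model. -/
def modelAct : 𝔤 →ₗ[ℂ] Module.End ℂ (PolyTensor m F) where
  toFun A := c.a A • hOp m F μ + ∑ i, c.x A i • xOp σ μ i + ∑ i, c.y A i • yOp F i + mOp σ (c.B A)
  map_add' A C := by
    simp only [map_add, Pi.add_apply, add_smul, Finset.sum_add_distrib]
    abel
  map_smul' t A := by
    simp only [map_smul, Pi.smul_apply, smul_eq_mul, mul_smul, smul_add, Finset.smul_sum,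
      RingHom.id_apply]

theorem modelAct_apply (A : 𝔤) : modelAct σ μ c A = c.a A • hOp m F μ + ∑ i, c.x A i • xOp σ μ i
    + ∑ i, c.y A i • yOp F i + mOp σ (c.B A) := rfl

theorem modelAct_Y (l : Fin m) : modelAct σ μ c (c.Y l) = yOp F l := by
  simp [modelAct_apply, c.Y_spec, Pi.single_apply]

theorem modelAct_X (l : Fin m) : modelAct σ μ c (c.X l) = xOp σ μ l := by
  simp [modelAct_apply, c.X_spec, Pi.single_apply]

theorem modelAct_H : modelAct σ μ c c.H = hOp m F μ := by
  simp [modelAct_apply, c.H_spec]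

theorem modelAct_M (i j : Fin m) : modelAct σ μ c (c.M i j) = mOp σ (skewUnit i j) := by
  simp [modelAct_apply, c.M_spec]

/-- The one family of brackets that is checked directly, for arbitrary linear `σ`. The general
bracket relation is reduced to it. -/
theorem modelAct_lie_Y (A : 𝔤) (l : Fin m) : modelAct σ μ c ⁅A, c.Y l⁆
    = modelAct σ μ c A * yOp F l - yOp F l * modelAct σ μ c A := by
  have h1 : c.a ⁅A, c.Y l⁆ = c.x A l := by
    simp [c.lie_a, c.Y_spec, Pi.single_apply]
  have h2 : c.x ⁅A, c.Y l⁆ = 0 := by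
    ext i; simp [c.lie_x, c.Y_spec]
  have h3 : ∀ i, c.y ⁅A, c.Y l⁆ i = c.B A i l - if i = l then c.a A else 0 := fun i => by
    simp [c.lie_y, c.Y_spec, Pi.single_apply]
    split_ifs <;> ring
  have h4 : c.B ⁅A, c.Y l⁆ = ∑ i, c.x A i • skewUnit i l := by
    ext i j
    simp [c.lie_B, c.Y_spec, Pi.single_apply, Matrix.sum_apply, skewUnit_apply, mul_sub, ite_and,
      Finset.sum_sub_distrib, eq_comm]
  have e1 : (∑ i, c.x A i • xOp σ μ i) * yOp F l = yOp F l * (∑ i, c.x A i • xOp σ μ i)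
      + (c.x A l • hOp m F μ + mOp σ (∑ i, c.x A i • skewUnit i l)) := by
    simp only [Finset.sum_mul, Finset.mul_sum, smul_mul_assoc, mul_smul_comm, xOp_y, smul_add,
      Finset.sum_add_distrib, map_sum, map_smul, smul_ite, smul_zero, Finset.sum_ite_eq',
      Finset.mem_univ, if_true]
  have e2 : (∑ i, c.y A i • yOp F i) * yOp F l = yOp F l * (∑ i, c.y A i • yOp F i) := by
    simp only [Finset.sum_mul, Finset.mul_sum, smul_mul_assoc, mul_smul_comm, (weylRel m F).yy _ l]
  rw [modelAct_apply, modelAct_apply, h1, h2, h4]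
  simp only [h3, add_mul, mul_add, smul_mul_assoc, mul_smul_comm, e1, e2, mOp_y, hOp_y, smul_sub,
    Pi.zero_apply, zero_smul, Finset.sum_const_zero, sub_smul, Finset.sum_sub_distrib, ite_smul,
    Finset.sum_ite_eq', Finset.mem_univ, if_true, zero_smul]
  abel

theorem modelAct_one (A : 𝔤) (v : F) : modelAct σ μ c A (pt (1 : MvPolynomial (Fin m) ℂ) v)
    = (∑ i, c.y A i • yOp F i (pt 1 v)) + pt 1 ((c.a A * μ) • v + σ (c.B A) v) := by
  rw [modelAct_apply]
  simp only [LinearMap.add_apply, LinearMap.smul_apply, LinearMap.sum_apply, hOp_one, mOp_one,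
    xOp_one, smul_zero, Finset.sum_const_zero, smul_smul, pt_add_right,
    pt_smul_right]
  abel

/-- Compatibility of `modelAct` with a bracket. -/
def ModelComm (A C : 𝔤) : Prop := modelAct σ μ c ⁅A, C⁆
  = modelAct σ μ c A * modelAct σ μ c C - modelAct σ μ c C * modelAct σ μ c A

theorem ModelComm.add_right {A C D : 𝔤} (h : ModelComm σ μ c A C) (h' : ModelComm σ μ c A D) :
    ModelComm σ μ c A (C + D) := by
  unfold ModelComm at *
  rw [lie_add, map_add, map_add, h, h', mul_add, add_mul]
  abel

theorem ModelComm.symm {A C : 𝔤} (h : ModelComm σ μ c A C) : ModelComm σ μ c C A := by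
  unfold ModelComm at *
  rw [← lie_skew, map_neg, h, neg_sub]

theorem modelComm_Ypart (A C : 𝔤) : ModelComm σ μ c A (c.Ypart C) := by
  unfold ModelComm ConfCoords.Ypart
  rw [lie_sum, map_sum, map_sum, Finset.mul_sum, Finset.sum_mul, ← Finset.sum_sub_distrib]
  refine Finset.sum_congr rfl fun i _ => ?_
  rw [lie_smul, map_smul, map_smul, modelAct_lie_Y, modelAct_Y, smul_sub, mul_smul_comm,
    smul_mul_assoc]

theorem modelComm_of_sub_Ypart {A C : 𝔤} (h : ModelComm σ μ c A (C - c.Ypart C)) :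
    ModelComm σ μ c A C := by
  rw [c.Ypart_add C]
  exact (modelComm_Ypart σ μ c A C).add_right σ μ c h

variable {σ} (hσ : ∀ A B : Matrix (Fin m) (Fin m) ℂ, (∀ i j, A i j = -A j i) →
  (∀ i j, B i j = -B j i) → σ (A * B - B * A) = σ A * σ B - σ B * σ A)

include hσ

/-- The defect of the bracket relation for A, C vanishes on constants, where `hσ` enters, and by the
Jacobi identity and the hypotheses it commutes with every multiplication y_l. Constants generate all
polynomials, so the defect is zero. -/
theorem modelComm_step {A C : 𝔤} (hA : c.y A = 0) (hC : c.y C = 0)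
    (h1 : ∀ l, ModelComm σ μ c A ⁅C, c.Y l⁆) (h2 : ∀ l, ModelComm σ μ c C ⁅A, c.Y l⁆) :
    ModelComm σ μ c A C := by
  have hYY : ∀ u : PolyTensor m F, (modelAct σ μ c ⁅A, C⁆ - (modelAct σ μ c A * modelAct σ μ c C
      - modelAct σ μ c C * modelAct σ μ c A)) u = 0 := by
    intro u
    induction u using polyTensor_induction with
    | add u w hu hw => rw [map_add, hu, hw, add_zero]
    | one v =>
      have hAC : c.y ⁅A, C⁆ = 0 := by
        ext i; simp [c.lie_y, hA, hC]
      have haAC : c.a ⁅A, C⁆ = 0 := by simp [c.lie_a, hA, hC]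
      have hBAC : c.B ⁅A, C⁆ = c.B A * c.B C - c.B C * c.B A := by
        ext i j
        simp [c.lie_B, hA, hC, Matrix.mul_apply]
      simp only [LinearMap.sub_apply, Module.End.mul_apply, modelAct_one, hA, hC, hAC,
        Pi.zero_apply, zero_smul, Finset.sum_const_zero, zero_add, haAC, hBAC,
        hσ _ _ (c.skew A) (c.skew C), zero_mul, map_add, map_smul]
      rw [← pt_sub_right, ← pt_sub_right]
      convert pt_zero_right (m := m) (F := F) 1 using 2
      simp only [smul_add]
      rw [smul_comm (c.a A * μ)]
      abel
    | mul l u hu =>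
      have e : modelAct σ μ c ⁅⁅A, C⁆, c.Y l⁆ = modelAct σ μ c ⁅A, ⁅C, c.Y l⁆⁆
          - modelAct σ μ c ⁅C, ⁅A, c.Y l⁆⁆ := by
        rw [lie_lie, map_sub]
      rw [h1 l, h2 l, modelAct_lie_Y, modelAct_lie_Y, modelAct_lie_Y] at e
      set a := modelAct σ μ c A
      set b := modelAct σ μ c C
      set d := modelAct σ μ c ⁅A, C⁆
      have e' : (d - (a * b - b * a)) * yOp F l = yOp F l * (d - (a * b - b * a)) := by
        rw [← sub_eq_zero] at e ⊢
        rw [← e]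
        noncomm_ring
      have := LinearMap.congr_fun e' u
      rw [Module.End.mul_apply, Module.End.mul_apply, hu, map_zero] at this
      exact this
  exact sub_eq_zero.1 (LinearMap.ext hYY)

/-- Bracketing with Y_l lowers the grading, from the nilradical to the Levi subalgebra to the
Y-part, where the relation is known. Hence one climbs through pairs in 𝔩 × 𝔩 (`s1`), 𝔭 × 𝔩 (`s2`)
and 𝔭 × 𝔭 (`s3`), splitting off Y-parts at each stage. -/
theorem modelAct_lie (A C : 𝔤) : ModelComm σ μ c A C := by
  have xY : ∀ (A : 𝔤) l, c.x ⁅A, c.Y l⁆ = 0 := fun A l => by ext i; simp [c.lie_x, c.Y_spec]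
  have aY : ∀ (A : 𝔤) l, c.x A = 0 → c.y A = 0 → c.a ⁅A, c.Y l⁆ = 0 ∧ c.B ⁅A, c.Y l⁆ = 0 :=
    fun A l hx hy => ⟨by simp [c.lie_a, hx, hy], by ext; simp [c.lie_B, hx, hy, c.Y_spec]⟩
  have nY : ∀ (A C : 𝔤) l, c.x C = 0 → c.y C = 0 → ModelComm σ μ c A ⁅C, c.Y l⁆ := by
    intro A C l hx hy
    have : ⁅C, c.Y l⁆ = c.Ypart ⁅C, c.Y l⁆ := by
      have := c.Ypart_spec ⁅C, c.Y l⁆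
      refine c.ext _ _ ?_ ?_ ?_ ?_
      · rw [this.1, (aY C l hx hy).1]
      · rw [this.2.1, xY]
      · rw [this.2.2.1]
      · rw [this.2.2.2, (aY C l hx hy).2]
    rw [this]
    exact modelComm_Ypart σ μ c A _
  have hx' : ∀ A : 𝔤, c.x A = 0 → c.x (A - c.Ypart A) = 0 := fun A h => by
    rw [map_sub, h, (c.Ypart_spec A).2.1, sub_self]
  have s1 : ∀ A C : 𝔤, c.x A = 0 → c.y A = 0 → c.x C = 0 → c.y C = 0 → ModelComm σ μ c A C :=
    fun A C a1 a2 c1 c2 => modelComm_step μ c hσ a2 c2 (fun l => nY _ _ _ c1 c2)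
      (fun l => nY _ _ _ a1 a2)
  have s2 : ∀ A C : 𝔤, c.y A = 0 → c.x C = 0 → c.y C = 0 → ModelComm σ μ c A C :=
    fun A C a2 c1 c2 => modelComm_step μ c hσ a2 c2 (fun l => nY _ _ _ c1 c2)
      (fun l => modelComm_of_sub_Ypart σ μ c (s1 _ _ c1 c2 (hx' _ (xY _ _)) (c.y_sub_Ypart _)))
  have s3 : ∀ A C : 𝔤, c.y A = 0 → c.y C = 0 → ModelComm σ μ c A C :=
    fun A C a2 c2 => modelComm_step μ c hσ a2 c2
      (fun l => modelComm_of_sub_Ypart σ μ c (s2 _ _ a2 (hx' _ (xY _ _)) (c.y_sub_Ypart _)))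
      (fun l => modelComm_of_sub_Ypart σ μ c (s2 _ _ c2 (hx' _ (xY _ _)) (c.y_sub_Ypart _)))
  refine modelComm_of_sub_Ypart σ μ c (ModelComm.symm σ μ c ?_)
  exact modelComm_of_sub_Ypart σ μ c (s3 _ _ (c.y_sub_Ypart _) (c.y_sub_Ypart _))

end Model

/-! ### The universal property of generalized Verma modules -/

section Universal

variable {𝔤 : Type} [LieRing 𝔤] [LieAlgebra ℂ 𝔤] (P : LieSubalgebra ℂ 𝔤)
  {F : Type} [AddCommGroup F] [Module ℂ F] (ρ : P →ₗ⁅ℂ⁆ Module.End ℂ F)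

/-- The inclusion of `F` into `U(𝔤) ⊗_{U(𝔭)} F`. -/
def vac : F →ₗ[ℂ] GenVerma P ρ where
  toFun v := Submodule.Quotient.mk (1 ⊗ₜ v)
  map_add' v w := by rw [TensorProduct.tmul_add]; rfl
  map_smul' t v := by rw [TensorProduct.tmul_smul]; rfl

theorem mk_tmul (u : UniversalEnvelopingAlgebra ℂ 𝔤) (v : F) :
    (Submodule.Quotient.mk (u ⊗ₜ v) : GenVerma P ρ) = u • vac P ρ v := by
  change _ = Submodule.Quotient.mk (u • (1 : UniversalEnvelopingAlgebra ℂ 𝔤) ⊗ₜ[ℂ] v)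
  rw [TensorProduct.smul_tmul', smul_eq_mul, mul_one]

theorem lie_vac (x : P) (v : F) : ⁅(x : 𝔤), vac P ρ v⁆ = vac P ρ (ρ x v) := by
  change UniversalEnvelopingAlgebra.ι ℂ (x : 𝔤) • vac P ρ v = _
  rw [← mk_tmul]
  refine (Submodule.Quotient.eq _).2 (Submodule.subset_span ⟨1, x, v, ?_⟩)
  rw [one_mul]

/-- The elements that preserve `p` form a subalgebra containing the image of 𝔤; the universal
property maps the enveloping algebra into this subalgebra, and the composite with the inclusion is
the identity. -/
theorem uea_smul_mem {W : Type} [AddCommGroup W] [Module ℂ W]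
    [Module (UniversalEnvelopingAlgebra ℂ 𝔤) W] [IsScalarTower ℂ (UniversalEnvelopingAlgebra ℂ 𝔤) W]
    (p : Submodule ℂ W) (h : ∀ (A : 𝔤), ∀ w ∈ p, UniversalEnvelopingAlgebra.ι ℂ A • w ∈ p)
    (u : UniversalEnvelopingAlgebra ℂ 𝔤) : ∀ w ∈ p, u • w ∈ p := by
  let S : Subalgebra ℂ (UniversalEnvelopingAlgebra ℂ 𝔤) :=
    { carrier := {u | ∀ w ∈ p, u • w ∈ p}
      mul_mem' := fun {a b} ha hb w hw => by rw [mul_smul]; exact ha _ (hb _ hw)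
      add_mem' := fun {a b} ha hb w hw => by rw [add_smul]; exact add_mem (ha _ hw) (hb _ hw)
      algebraMap_mem' := fun r w hw => by
        rw [algebraMap_smul]; exact p.smul_mem r hw }
  let j : 𝔤 →ₗ⁅ℂ⁆ S :=
    { toFun := fun A => ⟨UniversalEnvelopingAlgebra.ι ℂ A, fun w hw => h A w hw⟩
      map_add' := fun A B => Subtype.ext (map_add _ A B)
      map_smul' := fun t A => Subtype.ext (map_smul _ t A)
      map_lie' := fun {A B} => Subtype.ext (LieHom.map_lie _ A B) }
  have key : S.val.comp (UniversalEnvelopingAlgebra.lift ℂ j) = AlgHom.id ℂ _ := by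
    refine UniversalEnvelopingAlgebra.hom_ext ℂ (LieHom.ext fun A => ?_)
    change S.val (UniversalEnvelopingAlgebra.lift ℂ j (UniversalEnvelopingAlgebra.ι ℂ A)) = _
    rw [UniversalEnvelopingAlgebra.lift_ι_apply]
    rfl
  have : u = (UniversalEnvelopingAlgebra.lift ℂ j u : S) := (DFunLike.congr_fun key u).symm
  rw [this]
  exact (UniversalEnvelopingAlgebra.lift ℂ j u).2

theorem genVerma_induction {p : GenVerma P ρ → Prop} (add : ∀ z w, p z → p w → p (z + w))
    (smul : ∀ (t : ℂ) z, p z → p (t • z)) (one : ∀ v, p (vac P ρ v))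
    (lie : ∀ (A : 𝔤) z, p z → p ⁅A, z⁆) (z : GenVerma P ρ) : p z := by
  have h0 : p 0 := by simpa using one 0
  let q : Submodule ℂ (GenVerma P ρ) :=
    { carrier := {z | p z}, add_mem' := fun {a b} => add a b, zero_mem' := h0, smul_mem' := smul }
  obtain ⟨z, rfl⟩ := Submodule.Quotient.mk_surjective _ z
  induction z using TensorProduct.induction_on with
  | zero => exact h0
  | add z w hz hw => exact add _ _ hz hw
  | tmul u v =>
    have := uea_smul_mem q lie u _ (one v)
    rw [← mk_tmul] at this
    exact this

theorem genVerma_ext {W : Type} [AddCommGroup W] [Module ℂ W] (r : 𝔤 → Module.End ℂ W)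
    (f g : GenVerma P ρ →ₗ[ℂ] W) (h : ∀ v, f (vac P ρ v) = g (vac P ρ v))
    (hf : ∀ A z, f ⁅A, z⁆ = r A (f z)) (hg : ∀ A z, g ⁅A, z⁆ = r A (g z)) : f = g := by
  refine LinearMap.ext fun z => ?_
  induction z using genVerma_induction with
  | add z w hz hw => rw [map_add, map_add, hz, hw]
  | smul t z hz => rw [map_smul, map_smul, hz]
  | one v => exact h v
  | lie A z hz => rw [hf, hg, hz]

/-- The universal property of generalized Verma modules. -/
theorem exists_genVerma_lift {W : Type} [AddCommGroup W] [Module ℂ W]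
    (r : 𝔤 →ₗ⁅ℂ⁆ Module.End ℂ W) (f : F →ₗ[ℂ] W) (h : ∀ (x : P) v, r x (f v) = f (ρ x v)) :
    ∃ g : GenVerma P ρ →ₗ[ℂ] W, (∀ v, g (vac P ρ v) = f v) ∧ ∀ A z, g ⁅A, z⁆ = r A (g z) := by
  let φ : UniversalEnvelopingAlgebra ℂ 𝔤 →ₐ[ℂ] Module.End ℂ W := UniversalEnvelopingAlgebra.lift ℂ r
  have hφ : ∀ A, φ (UniversalEnvelopingAlgebra.ι ℂ A) = r A := fun A =>
    UniversalEnvelopingAlgebra.lift_ι_apply ℂ r A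
  let g₀ : UniversalEnvelopingAlgebra ℂ 𝔤 ⊗[ℂ] F →ₗ[ℂ] W :=
    TensorProduct.lift ((LinearMap.lcomp ℂ W f).comp φ.toLinearMap)
  have hg₀ : ∀ u v, g₀ (u ⊗ₜ v) = φ u (f v) := fun u v => TensorProduct.lift.tmul u v
  have hmul : ∀ u z, g₀ (u • z) = φ u (g₀ z) := by
    intro u z
    induction z using TensorProduct.induction_on with
    | zero => simp
    | add z w hz hw => rw [smul_add, map_add, map_add, map_add, hz, hw]
    | tmul u' v =>
      rw [TensorProduct.smul_tmul', hg₀, hg₀, smul_eq_mul, map_mul]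
      rfl
  have hker : ∀ z ∈ vermaRel P ρ, g₀ z = 0 := by
    intro z hz
    induction hz using Submodule.span_induction with
    | mem z hz =>
      obtain ⟨u, x, v, rfl⟩ := hz
      rw [map_sub, hg₀, hg₀, map_mul, Module.End.mul_apply, hφ, h, sub_self]
    | zero => exact map_zero _
    | add z w _ _ hz hw => rw [map_add, hz, hw, add_zero]
    | smul u z _ hz => rw [hmul, hz, map_zero]
  let g₁ : GenVerma P ρ →+ W := QuotientAddGroup.lift (vermaRel P ρ).toAddSubgroup
    g₀.toAddMonoidHom hker
  have hg₁ : ∀ z, g₁ (Submodule.Quotient.mk z) = g₀ z := fun z => rfl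
  refine ⟨{ toFun := g₁, map_add' := map_add g₁, map_smul' := ?_ }, ?_, ?_⟩
  · intro t z
    obtain ⟨z, rfl⟩ := Submodule.Quotient.mk_surjective _ z
    exact map_smul g₀ t z
  · intro v
    change g₀ (1 ⊗ₜ v) = f v
    rw [hg₀, map_one]; rfl
  · intro A z
    obtain ⟨z, rfl⟩ := Submodule.Quotient.mk_surjective _ z
    change g₀ (UniversalEnvelopingAlgebra.ι ℂ A • z) = r A (g₀ z)
    rw [hmul, hφ]

end Universal

/-! ### The polynomial model is the generalized Verma module -/

section VermaModel

variable {m : ℕ} {𝔤 : Type} [LieRing 𝔤] [LieAlgebra ℂ 𝔤] (c : ConfCoords m 𝔤)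
  {F : Type} [AddCommGroup F] [Module ℂ F]
  {σ : Matrix (Fin m) (Fin m) ℂ →ₗ[ℂ] Module.End ℂ F} (μ : ℂ)

/-- `σ` is a representation on skew-symmetric matrices. -/
def IsSkewRep (σ : Matrix (Fin m) (Fin m) ℂ →ₗ[ℂ] Module.End ℂ F) : Prop :=
  ∀ A B : Matrix (Fin m) (Fin m) ℂ, (∀ i j, A i j = -A j i) →
    (∀ i j, B i j = -B j i) → σ (A * B - B * A) = σ A * σ B - σ B * σ A

variable (hσ : IsSkewRep σ)

/-- The polynomial model as a representation. -/
def modelRep : 𝔤 →ₗ⁅ℂ⁆ Module.End ℂ (PolyTensor m F) :=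
  { modelAct σ μ c with map_lie' := fun {A C} => modelAct_lie μ c hσ A C }

theorem modelRep_apply (A : 𝔤) : modelRep c μ hσ A = modelAct σ μ c A := rfl

variable {P : LieSubalgebra ℂ 𝔤} (hP : ∀ A, A ∈ P ↔ c.y A = 0) {ρ : P →ₗ⁅ℂ⁆ Module.End ℂ F}
  (hρ : ∀ (A : P) v, ρ A v = (c.a A * μ) • v + σ (c.B A) v)

include hσ hP hρ

/-- The vector space structure of M(F) is obtained without the Poincaré–Birkhoff–Witt theorem. The
universal property gives a map to the model, the commuting operators Y_i give a map back, and both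
composites are the identity because each side is generated by F. -/
theorem exists_verma_equiv : ∃ e : GenVerma P ρ ≃ₗ[ℂ] PolyTensor m F,
    (∀ v, e (vac P ρ v) = pt 1 v) ∧ ∀ (A : 𝔤) z, e ⁅A, z⁆ = modelAct σ μ c A (e z) := by
  obtain ⟨g, hg1, hg⟩ := exists_genVerma_lift P ρ (modelRep c μ hσ)
    { toFun := fun v => pt 1 v
      map_add' := pt_add_right 1
      map_smul' := fun t v => pt_smul_right t 1 v } (fun x v => by
      change modelAct σ μ c x (pt 1 v) = pt 1 (ρ x v)
      rw [modelAct_one, hρ, (hP x).1 x.2]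
      simp)
  obtain ⟨θ, hθ1, hθy⟩ := exists_polyTensor_lift
    (fun i => LieModule.toEnd ℂ 𝔤 (GenVerma P ρ) (c.Y i)) (fun i j => by
      have := LieHom.map_lie (LieModule.toEnd ℂ 𝔤 (GenVerma P ρ)) (c.Y i) (c.Y j)
      rw [c.lie_Y_Y, map_zero, LieRing.of_associative_ring_bracket] at this
      exact (sub_eq_zero.1 this.symm)) (vac P ρ)
  -- Equivariance of the map back, by induction on the polynomial for all A at once: moving A past
  -- Y_l costs the bracket with Y_l, which is again an element of 𝔤 to which the induction
  -- hypothesis applies.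
  have hθ : ∀ u (A : 𝔤), θ (modelAct σ μ c A u) = ⁅A, θ u⁆ := by
    intro u
    induction u using polyTensor_induction with
    | add u w hu hw => intro A; rw [map_add, map_add, map_add, hu, hw, lie_add]
    | one v =>
      intro A
      have e1 : ⁅A, vac P ρ v⁆ = ⁅c.Ypart A, vac P ρ v⁆ + ⁅A - c.Ypart A, vac P ρ v⁆ := by
        rw [← add_lie, ← c.Ypart_add]
      have e2 := lie_vac P ρ ⟨A - c.Ypart A, (hP _).2 (c.y_sub_Ypart A)⟩ v
      rw [hρ] at e2
      simp only [map_sub, (c.Ypart_spec A).1, (c.Ypart_spec A).2.2.2, sub_zero] at e2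
      rw [modelAct_one, hθ1, e1, e2, map_add, hθ1, map_sum, ConfCoords.Ypart, sum_lie]
      congr 1
      refine Finset.sum_congr rfl fun i _ => ?_
      rw [map_smul, hθy, hθ1, smul_lie]
      rfl
    | mul l u hu =>
      intro A
      have e := LinearMap.congr_fun (modelAct_lie_Y σ μ c A l) u
      rw [LinearMap.sub_apply, Module.End.mul_apply, Module.End.mul_apply] at e
      rw [← sub_add_cancel (modelAct σ μ c A (yOp F l u)) (yOp F l (modelAct σ μ c A u)), ← e,
        map_add, hu, hθy, hu, hθy]
      change ⁅⁅A, c.Y l⁆, θ u⁆ + ⁅c.Y l, ⁅A, θ u⁆⁆ = ⁅A, ⁅c.Y l, θ u⁆⁆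
      rw [← leibniz_lie]
  refine ⟨LinearEquiv.ofLinearMap g θ ?_ ?_, hg1, hg⟩
  · refine polyTensor_ext (yOp F) _ _ (fun v => ?_) (fun i u => ?_) (fun i u => rfl)
    · rw [LinearMap.comp_apply, hθ1, hg1]; rfl
    · rw [LinearMap.comp_apply, hθy]
      change g ⁅c.Y i, θ u⁆ = _
      rw [hg, modelRep_apply, modelAct_Y]; rfl
  · refine genVerma_ext P ρ (fun A => LieModule.toEnd ℂ 𝔤 (GenVerma P ρ) A) _ _ (fun v => ?_)
      (fun A z => ?_) (fun A z => rfl)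
    · rw [LinearMap.comp_apply, hg1]; exact hθ1 v
    · rw [LinearMap.comp_apply, hg, modelRep_apply, hθ]; rfl

end VermaModel

/-! ### Coordinates on `so(n + 2)` and on `𝔤'` -/

section Coordinates

theorem zero_ne_last' (n : ℕ) : (0 : Fin (n + 2)) ≠ Fin.last (n + 1) := by
  intro h; simpa using congrArg Fin.val h

theorem dual_zero (n : ℕ) : dual n 0 = Fin.last (n + 1) := by simp [dual]

theorem dual_last (n : ℕ) : dual n (Fin.last (n + 1)) = 0 := by
  simp [dual, (zero_ne_last' n).symm]

theorem mem_soG_of_entry (n : ℕ) (A : Matrix (Fin (n + 2)) (Fin (n + 2)) ℂ)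
    (h : ∀ i j, A i j = -A (dual n j) (dual n i)) : A ∈ soG n := by
  rw [mem_skewAdjointMatricesLieSubalgebra, mem_skewAdjointMatricesSubmodule,
    Matrix.IsSkewAdjoint, Matrix.IsAdjointPair, Matrix.mul_neg]
  ext j i
  rw [Matrix.mul_apply, Matrix.neg_apply, Matrix.mul_apply]
  simp only [gram_apply, Matrix.transpose_apply]
  rw [Finset.sum_eq_single (dual n i), Finset.sum_eq_single (dual n j)]
  · rw [dual_dual, if_pos rfl, if_pos rfl, h]
    simp [dual_dual]
  · intro l _ hl; simp [hl]
  · simp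
  · intro l _ hl
    rw [if_neg, mul_zero]
    intro e
    exact hl (by rw [e, dual_dual])
  · simp

/-- A function on `{0, …, k - 1}` as a function of the middle indices. -/
def extMid (n : ℕ) {k : ℕ} (f : Fin k → ℂ) (t : Fin (n + 2)) : ℂ :=
  if h : 1 ≤ (t : ℕ) ∧ (t : ℕ) ≤ k then f ⟨t - 1, by omega⟩ else 0

variable {n k : ℕ} (hk : k ≤ n)

/-- The columns between the `k`-th and the last one vanish. -/
def GapZero (n k : ℕ) (A : Matrix (Fin (n + 2)) (Fin (n + 2)) ℂ) : Prop :=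
  ∀ t : Fin (n + 2), k < (t : ℕ) → (t : ℕ) ≤ n → ∀ i, A i t = 0

/-- Only two values of k matter below: k = n, where the last alternative is empty and the algebra is
𝔤, and k = n - 1, where it is the index n and the algebra is 𝔤'. The matrix computations are thus
done once for both. -/
theorem idx_cases (t : Fin (n + 2)) : t = 0 ∨ t = Fin.last (n + 1) ∨ (∃ i, t = midIdx n k hk i) ∨
    (k < (t : ℕ) ∧ (t : ℕ) ≤ n) := by
  by_cases h0 : (t : ℕ) = 0
  · exact Or.inl (Fin.ext h0)
  by_cases h1 : (t : ℕ) = n + 1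
  · exact Or.inr (Or.inl (Fin.ext h1))
  have := t.2
  by_cases h2 : (t : ℕ) ≤ k
  · refine Or.inr (Or.inr (Or.inl ⟨⟨t - 1, by omega⟩, Fin.ext ?_⟩))
    simp only [midIdx]
    omega
  · exact Or.inr (Or.inr (Or.inr ⟨by omega, by omega⟩))

theorem midIdx_ne_zero (i : Fin k) : midIdx n k hk i ≠ 0 := by simp [midIdx, Fin.ext_iff]

theorem midIdx_ne_last (i : Fin k) : midIdx n k hk i ≠ Fin.last (n + 1) := by
  have := i.2
  simp [midIdx, Fin.ext_iff]; omega

theorem midIdx_injective : Function.Injective (midIdx n k hk) := fun i j h => by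
  simp only [midIdx, Fin.mk.injEq, add_left_inj] at h
  exact Fin.ext h

theorem sum_idx (f : Fin (n + 2) → ℂ) (hf : ∀ t : Fin (n + 2), k < (t : ℕ) → (t : ℕ) ≤ n → f t = 0) :
    ∑ t, f t = f 0 + f (Fin.last (n + 1)) + ∑ i, f (midIdx n k hk i) := by
  classical
  rw [← Finset.sum_image (f := f) (s := Finset.univ) (g := midIdx n k hk)
      fun i _ j _ h => midIdx_injective hk h, ← Finset.sum_pair (zero_ne_last' n),
    ← Finset.sum_union]
  · refine (Finset.sum_subset (Finset.subset_univ _) fun t _ ht => ?_).symm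
    rcases idx_cases hk t with h | h | ⟨i, h⟩ | h
    · exact absurd (by simp [h]) ht
    · exact absurd (by simp [h]) ht
    · exact absurd (by simp [h]) ht
    · exact hf t h.1 h.2
  · rw [Finset.disjoint_left]
    intro t ht ht'
    obtain ⟨i, -, rfl⟩ := Finset.mem_image.1 ht'
    simp [midIdx_ne_zero, midIdx_ne_last] at ht

theorem soG_zero_last (A : soG n) : A.1 0 (Fin.last (n + 1)) = 0 := by
  have := soG_entry n A 0 (Fin.last (n + 1))
  rw [dual_zero, dual_last] at this
  exact self_eq_neg.1 this

theorem soG_last_zero (A : soG n) : A.1 (Fin.last (n + 1)) 0 = 0 := by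
  have := soG_entry n A (Fin.last (n + 1)) 0
  rw [dual_zero, dual_last] at this
  exact self_eq_neg.1 this

theorem soG_last_last (A : soG n) : A.1 (Fin.last (n + 1)) (Fin.last (n + 1)) = -A.1 0 0 := by
  rw [soG_entry, dual_last]

theorem soG_last_mid (A : soG n) (i : Fin k) :
    A.1 (Fin.last (n + 1)) (midIdx n k hk i) = -A.1 (midIdx n k hk i) 0 := by
  rw [soG_entry, dual_last, dual_midIdx]

theorem soG_mid_last (A : soG n) (i : Fin k) :
    A.1 (midIdx n k hk i) (Fin.last (n + 1)) = -A.1 0 (midIdx n k hk i) := by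
  rw [soG_entry, dual_last, dual_midIdx]

theorem extMid_mid (f : Fin k → ℂ) (i : Fin k) : extMid n f (midIdx n k hk i) = f i := by
  have : 1 ≤ ((midIdx n k hk i : Fin (n + 2)) : ℕ) ∧ ((midIdx n k hk i : Fin (n + 2)) : ℕ) ≤ k := by
    simp only [midIdx]; omega
  rw [extMid, dif_pos this]
  rfl

theorem extMid_zero (f : Fin k → ℂ) : extMid n f 0 = 0 := dif_neg (by simp)

include hk in
theorem extMid_last (f : Fin k → ℂ) : extMid n f (Fin.last (n + 1)) = 0 :=
  dif_neg (by simp; omega)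

theorem extMid_gap (f : Fin k → ℂ) (t : Fin (n + 2)) (h : k < (t : ℕ)) : extMid n f t = 0 :=
  dif_neg (by omega)

include hk in
theorem extMid_dual (f : Fin k → ℂ) (t : Fin (n + 2)) : extMid n f (dual n t) = extMid n f t := by
  by_cases h0 : t = 0
  · rw [h0, dual_zero, extMid_zero, extMid_last hk]
  · by_cases h1 : t = Fin.last (n + 1)
    · rw [h1, dual_last, extMid_zero, extMid_last hk]
    · simp [dual, h0, h1]

/-- The element of `so(n + 2)` with given coordinates. -/
def coordMatrix (n : ℕ) {k : ℕ} (a : ℂ) (x y : Fin k → ℂ) (B : Matrix (Fin k) (Fin k) ℂ) :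
    Matrix (Fin (n + 2)) (Fin (n + 2)) ℂ := Matrix.of fun s t =>
  (if s = 0 ∧ t = 0 then a else 0) - (if s = Fin.last (n + 1) ∧ t = Fin.last (n + 1) then a else 0)
    + (if s = 0 then extMid n x t else 0) + (if t = 0 then extMid n y s else 0)
    - (if t = Fin.last (n + 1) then extMid n x s else 0)
    - (if s = Fin.last (n + 1) then extMid n y t else 0)
    + extMid n (fun i => extMid n (fun j => B i j) t) s

theorem extMid_swap (B : Matrix (Fin k) (Fin k) ℂ) (hB : ∀ i j, B i j = -B j i)
    (s t : Fin (n + 2)) : extMid n (fun i => extMid n (fun j => B i j) t) s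
      = -extMid n (fun i => extMid n (fun j => B i j) s) t := by
  simp only [extMid]
  split_ifs
  · exact hB _ _
  all_goals simp

theorem dual_eq_zero (t : Fin (n + 2)) : dual n t = 0 ↔ t = Fin.last (n + 1) :=
  ⟨fun h => by rw [← dual_dual n t, h, dual_zero], fun h => by rw [h, dual_last]⟩

theorem dual_eq_last (t : Fin (n + 2)) : dual n t = Fin.last (n + 1) ↔ t = 0 :=
  ⟨fun h => by rw [← dual_dual n t, h, dual_last], fun h => by rw [h, dual_zero]⟩

include hk in
theorem coordMatrix_mem (a : ℂ) (x y : Fin k → ℂ) (B : Matrix (Fin k) (Fin k) ℂ)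
    (hB : ∀ i j, B i j = -B j i) : coordMatrix n a x y B ∈ soG n := by
  refine mem_soG_of_entry n _ fun s t => ?_
  simp only [coordMatrix, Matrix.of_apply, dual_eq_zero, dual_eq_last, extMid_dual hk]
  rw [extMid_swap B hB]
  simp only [and_comm]
  ring

/-! ### Entries of a commutator of two block matrices -/

section LieEntries

variable (A A' : soG n) (g : GapZero n k A.1) (g' : GapZero n k A'.1)

include g g' in
theorem lie_entry (s t : Fin (n + 2)) : (⁅A, A'⁆ : soG n).1 s t
    = (A.1 s 0 * A'.1 0 t + A.1 s (Fin.last (n + 1)) * A'.1 (Fin.last (n + 1)) t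
        + ∑ j, A.1 s (midIdx n k hk j) * A'.1 (midIdx n k hk j) t)
      - (A'.1 s 0 * A.1 0 t + A'.1 s (Fin.last (n + 1)) * A.1 (Fin.last (n + 1)) t
        + ∑ j, A'.1 s (midIdx n k hk j) * A.1 (midIdx n k hk j) t) := by
  change (A.1 * A'.1 - A'.1 * A.1) s t = _
  rw [Matrix.sub_apply, Matrix.mul_apply, Matrix.mul_apply,
    sum_idx hk _ fun t h1 h2 => by rw [g t h1 h2, zero_mul],
    sum_idx hk _ fun t h1 h2 => by rw [g' t h1 h2, zero_mul]]

include g g' in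
theorem lie_entry_zero_zero : (⁅A, A'⁆ : soG n).1 0 0 = ∑ i, (A.1 0 (midIdx n k hk i)
    * A'.1 (midIdx n k hk i) 0 - A'.1 0 (midIdx n k hk i) * A.1 (midIdx n k hk i) 0) := by
  rw [lie_entry hk A A' g g', Finset.sum_sub_distrib, soG_zero_last, soG_zero_last]
  ring

include g g' in
theorem lie_entry_zero_mid (i : Fin k) : (⁅A, A'⁆ : soG n).1 0 (midIdx n k hk i)
    = A.1 0 0 * A'.1 0 (midIdx n k hk i) - A'.1 0 0 * A.1 0 (midIdx n k hk i)
      + ∑ j, (midBlock n k hk A i j * A'.1 0 (midIdx n k hk j)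
        - midBlock n k hk A' i j * A.1 0 (midIdx n k hk j)) := by
  have e : ∀ C C' : soG n, ∑ j, C.1 0 (midIdx n k hk j) * C'.1 (midIdx n k hk j) (midIdx n k hk i)
      = -∑ j, midBlock n k hk C' i j * C.1 0 (midIdx n k hk j) := fun C C' => by
    rw [← Finset.sum_neg_distrib]
    refine Finset.sum_congr rfl fun j _ => ?_
    rw [midBlock_skew n k hk C' i j]
    change _ = -(-C'.1 (midIdx n k hk j) (midIdx n k hk i) * _)
    ring
  rw [lie_entry hk A A' g g', Finset.sum_sub_distrib, soG_zero_last, soG_zero_last, e, e]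
  ring

include g g' in
theorem lie_entry_mid_zero (i : Fin k) : (⁅A, A'⁆ : soG n).1 (midIdx n k hk i) 0
    = A'.1 0 0 * A.1 (midIdx n k hk i) 0 - A.1 0 0 * A'.1 (midIdx n k hk i) 0
      + ∑ j, (midBlock n k hk A i j * A'.1 (midIdx n k hk j) 0
        - midBlock n k hk A' i j * A.1 (midIdx n k hk j) 0) := by
  rw [lie_entry hk A A' g g', Finset.sum_sub_distrib, soG_last_zero, soG_last_zero]
  change _ = _ + (∑ j, A.1 (midIdx n k hk i) (midIdx n k hk j) * _
    - ∑ j, A'.1 (midIdx n k hk i) (midIdx n k hk j) * _)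
  ring

include g g' in
theorem lie_entry_mid_mid (i j : Fin k) : (⁅A, A'⁆ : soG n).1 (midIdx n k hk i) (midIdx n k hk j)
    = ∑ l, (midBlock n k hk A i l * midBlock n k hk A' l j
        - midBlock n k hk A' i l * midBlock n k hk A l j)
      + (A.1 (midIdx n k hk i) 0 * A'.1 0 (midIdx n k hk j)
        - A'.1 0 (midIdx n k hk i) * A.1 (midIdx n k hk j) 0
        + A.1 0 (midIdx n k hk i) * A'.1 (midIdx n k hk j) 0
        - A'.1 (midIdx n k hk i) 0 * A.1 0 (midIdx n k hk j)) := by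
  rw [lie_entry hk A A' g g', Finset.sum_sub_distrib, soG_mid_last, soG_mid_last, soG_last_mid,
    soG_last_mid]
  change _ = (∑ l, A.1 (midIdx n k hk i) (midIdx n k hk l) * A'.1 (midIdx n k hk l) (midIdx n k hk j)
    - ∑ l, A'.1 (midIdx n k hk i) (midIdx n k hk l) * A.1 (midIdx n k hk l) (midIdx n k hk j)) + _
  ring

end LieEntries

/-- Coordinates on a Lie algebra that is identified with the subalgebra of those elements of
`so(n + 2)` whose columns between the `k`-th and the last one vanish. -/
def confCoords {𝔤 : Type} [LieRing 𝔤] [LieAlgebra ℂ 𝔤] (φ : 𝔤 →ₗ⁅ℂ⁆ soG n)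
    (hφ : Function.Injective φ) (hr : ∀ A, (∃ D, φ D = A) ↔ GapZero n k A.1) : ConfCoords k 𝔤 where
  a := { toFun := fun D => (φ D).1 0 0
         map_add' := fun A B => by rw [map_add]; rfl
         map_smul' := fun t A => by rw [map_smul]; rfl }
  x := { toFun := fun D i => (φ D).1 0 (midIdx n k hk i)
         map_add' := fun A B => by rw [map_add]; rfl
         map_smul' := fun t A => by rw [map_smul]; rfl }
  y := { toFun := fun D i => (φ D).1 (midIdx n k hk i) 0
         map_add' := fun A B => by rw [map_add]; rfl
         map_smul' := fun t A => by rw [map_smul]; rfl }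
  B := (midBlock n k hk).comp (φ : 𝔤 →ₗ[ℂ] soG n)
  skew A i j := midBlock_skew n k hk (φ A) i j
  lie_a A A' := by
    have g := fun D => (hr (φ D)).1 ⟨D, rfl⟩
    refine (congrArg (fun D : soG n => D.1 0 0) (LieHom.map_lie φ A A')).trans ?_
    exact lie_entry_zero_zero hk (φ A) (φ A') (g A) (g A')
  lie_x A A' i := by
    have g := fun D => (hr (φ D)).1 ⟨D, rfl⟩
    refine (congrArg (fun D : soG n => D.1 0 (midIdx n k hk i)) (LieHom.map_lie φ A A')).trans ?_
    exact lie_entry_zero_mid hk (φ A) (φ A') (g A) (g A') i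
  lie_y A A' i := by
    have g := fun D => (hr (φ D)).1 ⟨D, rfl⟩
    refine (congrArg (fun D : soG n => D.1 (midIdx n k hk i) 0) (LieHom.map_lie φ A A')).trans ?_
    exact lie_entry_mid_zero hk (φ A) (φ A') (g A) (g A') i
  lie_B A A' i j := by
    have g := fun D => (hr (φ D)).1 ⟨D, rfl⟩
    refine (congrArg (fun D : soG n => D.1 (midIdx n k hk i) (midIdx n k hk j))
      (LieHom.map_lie φ A A')).trans ?_
    exact lie_entry_mid_mid hk (φ A) (φ A') (g A) (g A') i j
  ext A A' ha hx hy hB := by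
    have g := fun D => (hr (φ D)).1 ⟨D, rfl⟩
    have gr : ∀ D (s : Fin (n + 2)), k < (s : ℕ) → (s : ℕ) ≤ n → ∀ t, (φ D).1 s t = 0 := by
      intro D s h1 h2 t
      have hs : dual n s = s := by
        have e1 : s ≠ 0 := fun e => by rw [e] at h1; simp at h1
        have e2 : s ≠ Fin.last (n + 1) := fun e => by rw [e] at h2; simp at h2
        simp [dual, e1, e2]
      rw [soG_entry, hs, g D s h1 h2, neg_zero]
    apply hφ
    apply Subtype.ext
    have hx' : ∀ i, (φ A).1 0 (midIdx n k hk i) = (φ A').1 0 (midIdx n k hk i) := congrFun hx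
    have hy' : ∀ i, (φ A).1 (midIdx n k hk i) 0 = (φ A').1 (midIdx n k hk i) 0 := congrFun hy
    have hB' : ∀ i j, (φ A).1 (midIdx n k hk i) (midIdx n k hk j)
      = (φ A').1 (midIdx n k hk i) (midIdx n k hk j) := fun i j => congrFun (congrFun hB i) j
    have ha' : (φ A).1 0 0 = (φ A').1 0 0 := ha
    ext s t
    rcases idx_cases hk s with rfl | rfl | ⟨i, rfl⟩ | h
    · rcases idx_cases hk t with rfl | rfl | ⟨j, rfl⟩ | h'
      · exact ha'
      · rw [soG_zero_last, soG_zero_last]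
      · exact hx' j
      · rw [g A t h'.1 h'.2, g A' t h'.1 h'.2]
    · rcases idx_cases hk t with rfl | rfl | ⟨j, rfl⟩ | h'
      · rw [soG_last_zero, soG_last_zero]
      · rw [soG_last_last, soG_last_last, ha']
      · rw [soG_last_mid, soG_last_mid, hy']
      · rw [g A t h'.1 h'.2, g A' t h'.1 h'.2]
    · rcases idx_cases hk t with rfl | rfl | ⟨j, rfl⟩ | h'
      · exact hy' i
      · rw [soG_mid_last, soG_mid_last, hx']
      · exact hB' i j
      · rw [g A t h'.1 h'.2, g A' t h'.1 h'.2]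
    · rw [gr A s h.1 h.2, gr A' s h.1 h.2]
  surj a₀ x₀ y₀ B₀ hB := by
    obtain ⟨D, hD⟩ := (hr ⟨coordMatrix n a₀ x₀ y₀ B₀, coordMatrix_mem hk a₀ x₀ y₀ B₀ hB⟩).2 (by
      intro t h1 h2 i
      have e1 : t ≠ 0 := fun e => by rw [e] at h1; simp at h1
      have e2 : t ≠ Fin.last (n + 1) := fun e => by rw [e] at h2; simp at h2
      simp only [coordMatrix, Matrix.of_apply, e1, e2, extMid_gap _ t h1]
      simp [extMid])
    refine ⟨D, ?_, ?_, ?_, ?_⟩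
    · change (φ D).1 0 0 = _
      rw [hD]
      simp [coordMatrix, extMid_zero]
    · ext i
      change (φ D).1 0 (midIdx n k hk i) = _
      rw [hD]
      simp [coordMatrix, extMid_zero, extMid_mid, midIdx_ne_zero, midIdx_ne_last]
    · ext i
      change (φ D).1 (midIdx n k hk i) 0 = _
      rw [hD]
      simp [coordMatrix, extMid_zero, extMid_mid, midIdx_ne_zero, midIdx_ne_last]
    · ext i j
      change (φ D).1 (midIdx n k hk i) (midIdx n k hk j) = _
      rw [hD]
      simp [coordMatrix, extMid_mid, midIdx_ne_zero, midIdx_ne_last]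

end Coordinates

/-- The coordinates on `so(n + 2)`. -/
def coordsG (n : ℕ) : ConfCoords n (soG n) :=
  confCoords le_rfl (LieHom.id : soG n →ₗ⁅ℂ⁆ soG n) Function.injective_id fun A =>
    ⟨fun _ t h1 h2 => absurd h1 (by omega), fun _ => ⟨A, rfl⟩⟩

/-- The coordinates on `𝔤'`. -/
def coordsG' (n : ℕ) (hn : 1 ≤ n) : ConfCoords (n - 1) (gPrime n) :=
  confCoords (Nat.sub_le n 1) (gPrime n).incl Subtype.val_injective fun A => by
    constructor
    · rintro ⟨D, rfl⟩ t h1 h2 i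
      have : t = ⟨n, by omega⟩ := Fin.ext (by simp only; omega)
      rw [this]
      exact D.2 i
    · intro h
      refine ⟨⟨A, fun i => ?_⟩, rfl⟩
      exact h _ (by simp only; omega) le_rfl i

/-! ### The subalgebras and inducing representations in coordinates -/

section Subalgebras

variable {n k : ℕ} (hk : k ≤ n)

theorem mem_parab_iff (A : soG n) (g : GapZero n k A.1) :
    A ∈ parab n ↔ ∀ i, A.1 (midIdx n k hk i) 0 = 0 := by
  refine ⟨fun h i => h _ (midIdx_ne_zero hk i), fun h s hs => ?_⟩
  rcases idx_cases hk s with rfl | rfl | ⟨i, rfl⟩ | h'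
  · exact absurd rfl hs
  · exact soG_last_zero A
  · exact h i
  · have e2 : s ≠ Fin.last (n + 1) := fun e => by rw [e] at h'; simp at h'
    have : dual n s = s := by simp [dual, hs, e2]
    rw [soG_entry, this, g s h'.1 h'.2, neg_zero]

theorem mem_lineStab_last_iff (A : soG n) (g : GapZero n k A.1) :
    A ∈ lineStab n (Fin.last (n + 1)) ↔ ∀ i, A.1 0 (midIdx n k hk i) = 0 := by
  constructor
  · intro h i
    have := h _ (midIdx_ne_last hk i)
    rwa [soG_mid_last, neg_eq_zero] at this
  · intro h s hs
    rcases idx_cases hk s with rfl | rfl | ⟨i, rfl⟩ | h'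
    · exact soG_zero_last A
    · exact absurd rfl hs
    · rw [soG_mid_last, h, neg_zero]
    · have e2 : s ≠ 0 := fun e => by rw [e] at h'; simp at h'
      have : dual n s = s := by simp [dual, hs, e2]
      rw [soG_entry, this, g s h'.1 h'.2, neg_zero]

/-- The nilradical is defined by the n × n block, while the coordinates on 𝔤' see only the first k
rows and columns. The other columns vanish by assumption and the other rows by skewness. -/
theorem midBlock_eq_zero_iff (A : soG n) (g : GapZero n k A.1) :
    midBlock n n le_rfl A = 0 ↔ midBlock n k hk A = 0 := by
  constructor
  · intro h
    ext i j
    exact congrFun (congrFun h ⟨i, i.2.trans_le hk⟩) ⟨j, j.2.trans_le hk⟩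
  · intro h
    ext i j
    change A.1 (midIdx n n le_rfl i) (midIdx n n le_rfl j) = 0
    have hdual : ∀ i, dual n (midIdx n n le_rfl i) = midIdx n n le_rfl i := dual_midIdx n n le_rfl
    by_cases hj : (j : ℕ) < k
    · by_cases hi : (i : ℕ) < k
      · exact congrFun (congrFun h ⟨i, hi⟩) ⟨j, hj⟩
      · rw [soG_entry, hdual, hdual, g _ (by simp only [midIdx]; omega) (by
          have := i.2; simp only [midIdx]; omega), neg_zero]
    · exact g _ (by simp only [midIdx]; omega) (by have := j.2; simp only [midIdx]; omega) _

theorem gPrime_gapZero (A : gPrime n) : GapZero n (n - 1) A.1.1 := by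
  intro t h1 h2 i
  have : t = ⟨n, by omega⟩ := Fin.ext (by simp only; omega)
  rw [this]
  exact A.2 i

theorem mem_parab_coords (A : soG n) : A ∈ parab n ↔ (coordsG n).y A = 0 := by
  rw [mem_parab_iff le_rfl A fun t h1 h2 => absurd h1 (by omega)]
  exact ⟨fun h => funext h, fun h i => congrFun h i⟩

variable (hn : 1 ≤ n)

theorem mem_parab'_coords (A : gPrime n) : A ∈ parab' n ↔ (coordsG' n hn).y A = 0 := by
  change A.1 ∈ parab n ↔ _
  rw [mem_parab_iff (Nat.sub_le n 1) A.1 (gPrime_gapZero A)]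
  exact ⟨fun h => funext h, fun h i => congrFun h i⟩

theorem mem_levi'_coords (A : gPrime n) :
    A ∈ levi' n ↔ (coordsG' n hn).x A = 0 ∧ (coordsG' n hn).y A = 0 := by
  change A.1 ∈ parab n ∧ A.1 ∈ lineStab n (Fin.last (n + 1)) ↔ _
  rw [mem_parab_iff (Nat.sub_le n 1) A.1 (gPrime_gapZero A),
    mem_lineStab_last_iff (Nat.sub_le n 1) A.1 (gPrime_gapZero A), and_comm]
  exact ⟨fun h => ⟨funext h.1, funext h.2⟩, fun h => ⟨congrFun h.1, congrFun h.2⟩⟩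

theorem mem_nilrad'_coords (A : gPrime n) : A ∈ nilrad' n ↔
    (coordsG' n hn).y A = 0 ∧ (coordsG' n hn).a A = 0 ∧ (coordsG' n hn).B A = 0 := by
  change A.1 ∈ parab n ∧ A.1.1 0 0 = 0 ∧ midBlock n n le_rfl A.1 = 0 ↔ _
  rw [mem_parab_iff (Nat.sub_le n 1) A.1 (gPrime_gapZero A),
    midBlock_eq_zero_iff (Nat.sub_le n 1) A.1 (gPrime_gapZero A)]
  exact ⟨fun h => ⟨funext h.1, h.2⟩, fun h => ⟨congrFun h.1, h.2⟩⟩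

theorem spinRep_coords (lam : ℂ) (A : parab n) (v : Spinor n) :
    spinRep n lam A v = ((coordsG n).a A * lam) • v + spinAct n ((coordsG n).B A) v := by
  change spinAct n _ v + (lam * A.1.1 0 0) • v = _
  rw [add_comm, mul_comm]
  rfl

theorem spinRep'_coords (lam : ℂ) (A : parab' n) (v : Spinor (n - 1)) :
    spinRep' n lam A v
      = ((coordsG' n hn).a A * lam) • v + spinAct (n - 1) ((coordsG' n hn).B A) v := by
  change spinAct (n - 1) _ v + (lam * A.1.1.1 0 0) • v = _
  rw [add_comm, mul_comm]
  rfl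

end Subalgebras

/-! ### Homogeneous components -/

section Degree

variable {m : ℕ} {F : Type} [AddCommGroup F] [Module ℂ F]

/-- The constant polynomials. -/
def ptOne (m : ℕ) (F : Type) [AddCommGroup F] [Module ℂ F] : F →ₗ[ℂ] PolyTensor m F where
  toFun := pt 1
  map_add' := pt_add_right 1
  map_smul' t v := pt_smul_right t 1 v

/-- The homogeneous polynomials of degree `d`. -/
def degSpace (m : ℕ) (F : Type) [AddCommGroup F] [Module ℂ F] : ℕ → Submodule ℂ (PolyTensor m F)
  | 0 => LinearMap.range (ptOne m F)
  | d + 1 => ⨆ i : Fin m, (degSpace m F d).map (yOp F i)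

theorem yOp_mem_degSpace {d : ℕ} {u : PolyTensor m F} (hu : u ∈ degSpace m F d) (i : Fin m) :
    yOp F i u ∈ degSpace m F (d + 1) :=
  Submodule.mem_iSup_of_mem i ⟨u, hu, rfl⟩

theorem degSpace_induction {p : (d : ℕ) → PolyTensor m F → Prop} (zero : ∀ d, p d 0)
    (add : ∀ d u w, p d u → p d w → p d (u + w)) (one : ∀ v, p 0 (pt 1 v))
    (mul : ∀ d i u, u ∈ degSpace m F d → p d u → p (d + 1) (yOp F i u)) (d : ℕ)
    (u : PolyTensor m F) (hu : u ∈ degSpace m F d) : p d u := by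
  induction d generalizing u with
  | zero => obtain ⟨v, rfl⟩ := hu; exact one v
  | succ d ih =>
    refine Submodule.iSup_induction _ (motive := p (d + 1)) hu ?_ (zero _) (add _)
    rintro i _ ⟨w, hw, rfl⟩
    exact mul d i w hw (ih w hw)

instance finiteDimensional_degSpace [FiniteDimensional ℂ F] (d : ℕ) :
    FiniteDimensional ℂ (degSpace m F d) := by
  induction d with
  | zero => exact inferInstanceAs (FiniteDimensional ℂ (LinearMap.range (ptOne m F)))
  | succ d ih =>
    exact inferInstanceAs (FiniteDimensional ℂ
      (⨆ i : Fin m, (degSpace m F d).map (yOp F i) : Submodule ℂ (PolyTensor m F)))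

theorem euler_degSpace {d : ℕ} {u : PolyTensor m F} (hu : u ∈ degSpace m F d) :
    euler (yOp F) (dOp F) u = (d : ℂ) • u := by
  refine degSpace_induction (p := fun d u => euler (yOp F) (dOp F) u = (d : ℂ) • u) (by simp)
    (fun d u w hu hw => by rw [map_add, hu, hw, smul_add]) (fun v => by simp)
    (fun d i u _ hu => ?_) d u hu
  have := LinearMap.congr_fun ((weylRel m F).euler_y i) u
  rw [LinearMap.add_apply, Module.End.mul_apply, Module.End.mul_apply, hu, map_smul] at this
  rw [this, Nat.cast_succ, add_smul, one_smul]

/-- For d = 0 the truncated difference d - 1 is 0, and the claim still holds because constants have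
zero derivative. -/
theorem dOp_mem_degSpace {d : ℕ} {u : PolyTensor m F} (hu : u ∈ degSpace m F d) (i : Fin m) :
    dOp F i u ∈ degSpace m F (d - 1) := by
  refine degSpace_induction (p := fun d u => dOp F i u ∈ degSpace m F (d - 1)) (by simp)
    (fun d u w hu hw => by rw [map_add]; exact add_mem hu hw) (fun v => by simp)
    (fun d j u hu' hu => ?_) d u hu
  have := LinearMap.congr_fun ((weylRel m F).dy i j) u
  rw [LinearMap.add_apply, Module.End.mul_apply, Module.End.mul_apply] at this
  rw [this]
  refine add_mem ?_ ?_
  · rcases d with _ | d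
    · obtain ⟨v, rfl⟩ := hu'
      change yOp F j (dOp F i (pt 1 v)) ∈ _
      simp
    · exact yOp_mem_degSpace hu j
  · split_ifs
    · exact hu'
    · exact zero_mem _

theorem dOp_degSpace_zero {u : PolyTensor m F} (hu : u ∈ degSpace m F 0) (i : Fin m) :
    dOp F i u = 0 := by
  obtain ⟨v, rfl⟩ := hu
  exact dOp_one i v

theorem sOp_mem_degSpace {d : ℕ} {u : PolyTensor m F} (hu : u ∈ degSpace m F d)
    (T : Module.End ℂ F) : sOp m T u ∈ degSpace m F d := by
  refine degSpace_induction (p := fun d u => sOp m T u ∈ degSpace m F d) (by simp)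
    (fun d u w hu hw => by rw [map_add]; exact add_mem hu hw) (fun v => ⟨T v, rfl⟩)
    (fun d j u _ hu => ?_) d u hu
  have := LinearMap.congr_fun (sOp_y T j) u
  rw [Module.End.mul_apply, Module.End.mul_apply] at this
  rw [this]
  exact yOp_mem_degSpace hu j

theorem exists_sum_degSpace (u : PolyTensor m F) :
    ∃ (N : ℕ) (v : ℕ → PolyTensor m F), (∀ d, v d ∈ degSpace m F d) ∧
      u = ∑ d ∈ Finset.range N, v d := by
  have : u ∈ ⨆ d, degSpace m F d := by
    induction u using polyTensor_induction with
    | add u w hu hw => exact add_mem hu hw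
    | one v => exact Submodule.mem_iSup_of_mem 0 ⟨v, rfl⟩
    | mul i u hu =>
      refine Submodule.iSup_induction _ (motive := fun u => yOp F i u ∈ ⨆ d, degSpace m F d) hu
        (fun d w hw => Submodule.mem_iSup_of_mem (d + 1) (yOp_mem_degSpace hw i)) (by simp)
        (fun u w hu hw => by rw [map_add]; exact add_mem hu hw)
  obtain ⟨f, hf, rfl⟩ := (Submodule.mem_iSup_iff_exists_finsupp _ _).1 this
  refine ⟨f.support.sup id + 1, f, hf, ?_⟩
  refine Finset.sum_subset (fun d hd => ?_) (fun d _ hd => by simpa using hd)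
  exact Finset.mem_range.2 (Nat.lt_succ_of_le (Finset.le_sup (f := id) hd))

theorem hOp_degSpace (μ : ℂ) {d : ℕ} {u : PolyTensor m F} (hu : u ∈ degSpace m F d) :
    hOp m F μ u = (μ - d) • u := by
  rw [hOp, LinearMap.sub_apply, euler_degSpace hu, sub_smul]
  rfl

variable (σ : Matrix (Fin m) (Fin m) ℂ →ₗ[ℂ] Module.End ℂ F) (μ : ℂ)

theorem vecField_mem_degSpace (B : Matrix (Fin m) (Fin m) ℂ) {d : ℕ} {u : PolyTensor m F}
    (hu : u ∈ degSpace m F d) : vecField (yOp F) (dOp F) B u ∈ degSpace m F d := by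
  rw [vecField, LinearMap.sum_apply]
  refine sum_mem fun k _ => ?_
  rw [LinearMap.sum_apply]
  refine sum_mem fun i _ => ?_
  rw [LinearMap.smul_apply, Module.End.mul_apply]
  refine Submodule.smul_mem _ _ ?_
  rcases d with _ | d
  · rw [dOp_degSpace_zero hu, map_zero]; exact zero_mem _
  · exact yOp_mem_degSpace (dOp_mem_degSpace hu i) k

theorem mOp_mem_degSpace (B : Matrix (Fin m) (Fin m) ℂ) {d : ℕ} {u : PolyTensor m F}
    (hu : u ∈ degSpace m F d) : mOp σ B u ∈ degSpace m F d :=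
  add_mem (vecField_mem_degSpace B hu) (sOp_mem_degSpace hu _)

theorem xOp_mem_degSpace {d : ℕ} {u : PolyTensor m F} (hu : u ∈ degSpace m F d) (i : Fin m) :
    xOp σ μ i u ∈ degSpace m F (d - 1) := by
  simp only [xOp, LinearMap.add_apply, LinearMap.sum_apply, LinearMap.smul_apply,
    Module.End.mul_apply, lapl]
  refine add_mem (add_mem ?_ (Submodule.smul_mem _ _ ?_)) (sum_mem fun j _ => ?_)
  · rw [hOp_degSpace μ (dOp_mem_degSpace hu i)]
    exact Submodule.smul_mem _ _ (dOp_mem_degSpace hu i)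
  · rw [map_sum]
    refine sum_mem fun j _ => ?_
    rcases d with _ | _ | d
    · rw [dOp_degSpace_zero hu, map_zero, map_zero]; exact zero_mem _
    · rw [dOp_degSpace_zero (dOp_mem_degSpace hu j), map_zero]; exact zero_mem _
    · exact yOp_mem_degSpace (dOp_mem_degSpace (dOp_mem_degSpace hu j) j) i
  · exact sOp_mem_degSpace (dOp_mem_degSpace hu j) _

end Degree

/-! ### Functoriality of the model -/

section Functoriality

variable {m : ℕ} {F F' : Type} [AddCommGroup F] [Module ℂ F] [AddCommGroup F'] [Module ℂ F']

/-- The map on polynomials induced by a map of values. -/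
def ptMap (m : ℕ) (f : F →ₗ[ℂ] F') : PolyTensor m F →ₗ[ℂ] PolyTensor m F' :=
  f.lTensor (MvPolynomial (Fin m) ℂ)

theorem ptMap_injective (f : F →ₗ[ℂ] F') (hf : Function.Injective f) :
    Function.Injective (ptMap m f) :=
  Module.Flat.lTensor_preserves_injective_linearMap f hf

theorem ptMap_y (f : F →ₗ[ℂ] F') (i : Fin m) (u : PolyTensor m F) :
    ptMap m f (yOp F i u) = yOp F' i (ptMap m f u) :=
  LinearMap.congr_fun (pt_ext (f := ptMap m f ∘ₗ yOp F i) (g := yOp F' i ∘ₗ ptMap m f)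
    fun _ _ => rfl) u

theorem ptMap_d (f : F →ₗ[ℂ] F') (i : Fin m) (u : PolyTensor m F) :
    ptMap m f (dOp F i u) = dOp F' i (ptMap m f u) :=
  LinearMap.congr_fun (pt_ext (f := ptMap m f ∘ₗ dOp F i) (g := dOp F' i ∘ₗ ptMap m f)
    fun _ _ => rfl) u

theorem ptMap_s (f : F →ₗ[ℂ] F') (T : Module.End ℂ F) (T' : Module.End ℂ F')
    (h : ∀ v, f (T v) = T' (f v)) (u : PolyTensor m F) :
    ptMap m f (sOp m T u) = sOp m T' (ptMap m f u) :=
  LinearMap.congr_fun (pt_ext (f := ptMap m f ∘ₗ sOp m T) (g := sOp m T' ∘ₗ ptMap m f)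
    fun p v => by
      change pt p (f (T v)) = pt p (T' (f v))
      rw [h]) u

theorem ptMap_mem_degSpace (f : F →ₗ[ℂ] F') {d : ℕ} {u : PolyTensor m F}
    (hu : u ∈ degSpace m F d) : ptMap m f u ∈ degSpace m F' d := by
  refine degSpace_induction (p := fun d u => ptMap m f u ∈ degSpace m F' d) (by simp)
    (fun d u w hu hw => by rw [map_add]; exact add_mem hu hw) (fun v => ⟨f v, rfl⟩)
    (fun d j u _ hu => ?_) d u hu
  rw [ptMap_y]
  exact yOp_mem_degSpace hu j

variable {σ : Matrix (Fin m) (Fin m) ℂ →ₗ[ℂ] Module.End ℂ F}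
  {σ' : Matrix (Fin m) (Fin m) ℂ →ₗ[ℂ] Module.End ℂ F'} (f : F →ₗ[ℂ] F')
  (hf : ∀ B : Matrix (Fin m) (Fin m) ℂ, (∀ i j, B i j = -B j i) → ∀ v, f (σ B v) = σ' B (f v))

theorem ptMap_h (μ : ℂ) (u : PolyTensor m F) :
    ptMap m f (hOp m F μ u) = hOp m F' μ (ptMap m f u) := by
  simp only [hOp, euler, LinearMap.sub_apply, LinearMap.smul_apply, Module.End.one_apply,
    LinearMap.sum_apply, Module.End.mul_apply, map_sub, map_smul, map_sum, ptMap_y, ptMap_d]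

include hf

theorem ptMap_m (B : Matrix (Fin m) (Fin m) ℂ) (hB : ∀ i j, B i j = -B j i) (u : PolyTensor m F) :
    ptMap m f (mOp σ B u) = mOp σ' B (ptMap m f u) := by
  change ptMap m f ((vecField (yOp F) (dOp F) B + sOp m (σ B)) u)
    = (vecField (yOp F') (dOp F') B + sOp m (σ' B)) _
  simp only [vecField, LinearMap.add_apply, LinearMap.smul_apply,
    LinearMap.sum_apply, Module.End.mul_apply, map_add, map_smul, map_sum, ptMap_y, ptMap_d,
    ptMap_s f _ _ (hf B hB)]

theorem ptMap_x (μ : ℂ) (i : Fin m) (u : PolyTensor m F) :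
    ptMap m f (xOp σ μ i u) = xOp σ' μ i (ptMap m f u) := by
  simp only [xOp, lapl, LinearMap.add_apply, LinearMap.smul_apply,
    LinearMap.sum_apply, Module.End.mul_apply, map_add, map_smul, map_sum, ptMap_y, ptMap_d,
    ptMap_h, ptMap_s f _ _ (hf _ (skewUnit_skew i _))]

variable {𝔤 : Type} [LieRing 𝔤] [LieAlgebra ℂ 𝔤] (c : ConfCoords m 𝔤)

theorem ptMap_modelAct (μ : ℂ) (A : 𝔤) (u : PolyTensor m F) :
    ptMap m f (modelAct σ μ c A u) = modelAct σ' μ c A (ptMap m f u) := by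
  simp only [modelAct_apply, LinearMap.add_apply, LinearMap.smul_apply,
    LinearMap.sum_apply, map_add, map_smul, map_sum, ptMap_y, ptMap_h, ptMap_x f hf,
    ptMap_m f hf _ (c.skew A)]

end Functoriality

/-! ### The Dirac operator -/

section Dirac

variable {R : Type} [Ring R] [Algebra ℂ R] {m : ℕ} {y d g : Fin m → R}

/-- Generators of a Weyl and of a Clifford algebra that commute with each other. -/
structure DiracRel (y d g : Fin m → R) : Prop extends WeylRel y d where
  gg : ∀ i j, g i * g j + g j * g i = if i = j then 2 else 0
  gy : ∀ i j, g i * y j = y j * g i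
  gd : ∀ i j, g i * d j = d j * g i

/-- The Dirac operator. -/
def dirac (d g : Fin m → R) : R := ∑ i, g i * d i

/-- Clifford multiplication by the position vector. -/
def slash (y g : Fin m → R) : R := ∑ i, g i * y i

namespace DiracRel

variable (h : DiracRel y d g)

include h

theorem gg_self (i : Fin m) : g i * g i = 1 := by
  have h2 := h.gg i i
  rw [if_pos rfl, ← two_mul] at h2
  have h3 : (2 : ℂ) • (g i * g i) = (2 : ℂ) • (1 : R) := by
    rw [Algebra.smul_def, Algebra.smul_def, map_ofNat, h2, mul_one]
  exact (smul_right_injective R (two_ne_zero' ℂ)) h3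

/-- Since partial derivatives commute, averaging the double sum with its transpose replaces γ_i γ_j
by half the anticommutator, which is δ_ij. Doubling postpones the division. -/
theorem two_smul_dirac_sq : (2 : ℂ) • (dirac d g * dirac d g) = (2 : ℂ) • lapl d := by
  have e1 : dirac d g * dirac d g = ∑ i, ∑ j, g i * g j * (d i * d j) := by
    simp only [dirac, Finset.sum_mul, Finset.mul_sum]
    rw [Finset.sum_comm]
    refine Finset.sum_congr rfl fun i _ => Finset.sum_congr rfl fun j _ => ?_
    rw [mul_assoc, ← mul_assoc (d i), ← h.gd, mul_assoc, mul_assoc]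
  have e2 : dirac d g * dirac d g = ∑ i, ∑ j, g j * g i * (d i * d j) := by
    rw [e1, Finset.sum_comm]
    exact Finset.sum_congr rfl fun i _ => Finset.sum_congr rfl fun j _ => by rw [h.dd j i]
  rw [two_smul]
  nth_rewrite 1 [e1]
  rw [e2, ← Finset.sum_add_distrib, lapl, Finset.smul_sum]
  refine Finset.sum_congr rfl fun i _ => ?_
  rw [← Finset.sum_add_distrib]
  simp only [← add_mul, h.gg, ite_mul, zero_mul, Finset.sum_ite_eq, Finset.mem_univ, if_true]
  rw [two_smul, two_mul]

theorem dirac_sq : dirac d g * dirac d g = lapl d :=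
  smul_right_injective R (two_ne_zero' ℂ) h.two_smul_dirac_sq

/-- The basic relation of the osp(1|2) formed by the Dirac operator, the slash operator and the
Euler operator. The diagonal terms γ_i² = 1 produce the dimension m. -/
theorem dirac_slash : dirac d g * slash y g
    = (2 : ℂ) • euler y d + (m : ℂ) • 1 - slash y g * dirac d g := by
  have e1 : dirac d g * slash y g
      = ∑ i, ∑ j, (g i * g j * (y j * d i) + if i = j then 1 else 0) := by
    simp only [dirac, slash, Finset.sum_mul, Finset.mul_sum]
    rw [Finset.sum_comm]
    refine Finset.sum_congr rfl fun i _ => Finset.sum_congr rfl fun j _ => ?_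
    rw [mul_assoc, ← mul_assoc (d i), ← h.gd, mul_assoc, h.dy, mul_add, mul_add, mul_assoc]
    congr 1
    split_ifs with hij
    · rw [mul_one, ← hij, h.gg_self]
    · simp
  have e2 : slash y g * dirac d g = ∑ i, ∑ j, g j * g i * (y j * d i) := by
    simp only [dirac, slash, Finset.sum_mul, Finset.mul_sum]
    refine Finset.sum_congr rfl fun i _ => Finset.sum_congr rfl fun j _ => ?_
    rw [mul_assoc, ← mul_assoc (y j), ← h.gy, mul_assoc, mul_assoc]
  rw [eq_sub_iff_add_eq, e1, e2, ← Finset.sum_add_distrib]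
  have e3 : ∀ i, ∑ j, (g i * g j * (y j * d i) + if i = j then 1 else 0)
      + ∑ j, g j * g i * (y j * d i) = (2 : ℂ) • (y i * d i) + 1 := by
    intro i
    rw [Finset.sum_add_distrib, add_right_comm, ← Finset.sum_add_distrib]
    simp only [← add_mul, h.gg, ite_mul, zero_mul, Finset.sum_ite_eq, Finset.mem_univ, if_true]
    rw [two_smul, two_mul]
  rw [Finset.sum_congr rfl fun i _ => e3 i, Finset.sum_add_distrib, ← Finset.smul_sum, euler]
  simp [Algebra.smul_def]

theorem euler_slash : euler y d * slash y g = slash y g * euler y d + slash y g := by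
  simp only [slash, Finset.sum_mul, Finset.mul_sum, ← Finset.sum_add_distrib]
  refine Finset.sum_congr rfl fun i _ => ?_
  have : euler y d * g i = g i * euler y d := by
    simp only [euler, Finset.sum_mul, Finset.mul_sum]
    exact Finset.sum_congr rfl fun j _ => by rw [mul_assoc, ← h.gd, ← mul_assoc, ← h.gy, mul_assoc]
  rw [← mul_assoc, this, mul_assoc, h.euler_y, mul_add, mul_assoc]

theorem slash_sq : slash y g * slash y g = ∑ i, y i * y i := by
  have e1 : slash y g * slash y g = ∑ i, ∑ j, g i * g j * (y i * y j) := by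
    simp only [slash, Finset.sum_mul, Finset.mul_sum]
    rw [Finset.sum_comm]
    refine Finset.sum_congr rfl fun i _ => Finset.sum_congr rfl fun j _ => ?_
    rw [mul_assoc, ← mul_assoc (y i), ← h.gy, mul_assoc, mul_assoc]
  have e2 : slash y g * slash y g = ∑ i, ∑ j, g j * g i * (y i * y j) := by
    rw [e1, Finset.sum_comm]
    exact Finset.sum_congr rfl fun i _ => Finset.sum_congr rfl fun j _ => by rw [h.yy j i]
  refine smul_right_injective R (two_ne_zero' ℂ) ?_
  change (2 : ℂ) • _ = (2 : ℂ) • _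
  rw [two_smul]
  nth_rewrite 1 [e1]
  rw [e2, ← Finset.sum_add_distrib, Finset.smul_sum]
  refine Finset.sum_congr rfl fun i _ => ?_
  rw [← Finset.sum_add_distrib]
  simp only [← add_mul, h.gg, ite_mul, zero_mul, Finset.sum_ite_eq, Finset.mem_univ, if_true]
  rw [two_smul, two_mul]

end DiracRel

end Dirac

/-! ### The action on spinor-valued polynomials -/

section SpinModel

variable {m : ℕ}

theorem diracRel (m : ℕ) : DiracRel (yOp (m := m) (Spinor m)) (dOp (Spinor m))
    (fun i => sOp m (gamma m i)) :=
  { weylRel m (Spinor m) with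
    gg := fun i j => by
      rw [← sOp_mul, ← sOp_mul, ← map_add, gamma_clifford]
      split_ifs
      · have h2 : (2 : Module.End ℂ (Spinor m)) = 1 + 1 := one_add_one_eq_two.symm
        rw [h2, map_add, sOp_one, one_add_one_eq_two]
      · exact map_zero _
    gy := fun i j => sOp_y _ j
    gd := fun i j => sOp_d _ j }

/-- The Dirac operator on spinor-valued polynomials. -/
def diracOp (m : ℕ) : Module.End ℂ (PolyTensor m (Spinor m)) :=
  dirac (dOp (Spinor m)) fun i => sOp m (gamma m i)

/-- Clifford multiplication by the position vector. -/
def slashOp (m : ℕ) : Module.End ℂ (PolyTensor m (Spinor m)) :=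
  slash (yOp (Spinor m)) fun i => sOp m (gamma m i)

/-- The correction for i = j cancels γ_i² = 1, in accordance with the vanishing of the matrix in
that case. -/
theorem spinAct_skewUnit (m : ℕ) (i j : Fin m) : spinAct m (skewUnit i j)
    = (1 / 2 : ℂ) • (gamma m i * gamma m j) - if i = j then (1 / 2 : ℂ) • 1 else 0 := by
  have h1 : spinAct m (skewUnit i j)
      = (1 / 4 : ℂ) • (gamma m i * gamma m j) - (1 / 4 : ℂ) • (gamma m j * gamma m i) := by
    change ∑ k, ∑ l, (skewUnit i j k l / 4) • (gamma m k * gamma m l) = _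
    have : ∀ k l, (skewUnit i j k l / 4) • (gamma m k * gamma m l)
        = (if i = k then if j = l then (1 / 4 : ℂ) • (gamma m k * gamma m l) else 0 else 0)
          - if j = k then if i = l then (1 / 4 : ℂ) • (gamma m k * gamma m l) else 0 else 0 := by
      intro k l
      rw [skewUnit_apply, ite_and, ite_and]
      split_ifs <;> module
    simp only [this, Finset.sum_sub_distrib, Finset.sum_ite_eq, Finset.mem_univ, if_true,
      Finset.sum_ite_irrel, Finset.sum_const_zero]
  have h2 : gamma m j * gamma m i
      = (if i = j then (2 : ℂ) • 1 else 0) - gamma m i * gamma m j := by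
    rw [eq_sub_iff_add_eq, add_comm, gamma_clifford]
    split_ifs
    · rw [two_smul, one_add_one_eq_two]
    · rfl
  rw [h1, h2]
  split_ifs
  · rw [smul_sub, smul_smul]
    module
  · module

/-- For spinors the rotation term of `xOp` telescopes into ½ γ_i D - ½ d_i, and the Laplacian is D².
This brings the Dirac operator into the search for singular vectors. -/
theorem xOp_spin (μ : ℂ) (i : Fin m) : xOp (spinAct m) μ i
    = (μ - 1 / 2) • dOp (Spinor m) i - euler (yOp (Spinor m)) (dOp (Spinor m)) * dOp (Spinor m) i
      + (1 / 2 : ℂ) • (yOp (Spinor m) i * (diracOp m * diracOp m))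
      + (1 / 2 : ℂ) • (sOp m (gamma m i) * diracOp m) := by
  have h1 : ∑ j, sOp m (spinAct m (skewUnit i j)) * dOp (Spinor m) j
      = (1 / 2 : ℂ) • (sOp m (gamma m i) * diracOp m) - (1 / 2 : ℂ) • dOp (Spinor m) i := by
    have : ∀ j, sOp m (spinAct m (skewUnit i j)) * dOp (Spinor m) j
        = (1 / 2 : ℂ) • (sOp m (gamma m i) * (sOp m (gamma m j) * dOp (Spinor m) j))
          - if i = j then (1 / 2 : ℂ) • dOp (Spinor m) j else 0 := fun j => by
      rw [spinAct_skewUnit, map_sub, map_smul, sOp_mul, sub_mul, smul_mul_assoc, mul_assoc]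
      congr 1
      split_ifs
      · rw [map_smul, sOp_one, smul_mul_assoc, one_mul]
      · rw [map_zero, zero_mul]
    rw [Finset.sum_congr rfl fun j _ => this j, Finset.sum_sub_distrib, Finset.sum_ite_eq,
      if_pos (Finset.mem_univ _), diracOp, dirac, Finset.mul_sum, Finset.smul_sum]
  rw [xOp, h1, diracOp, (diracRel m).dirac_sq, hOp, sub_mul, smul_mul_assoc, one_mul]
  module

theorem sOp_euler {F : Type} [AddCommGroup F] [Module ℂ F] (T : Module.End ℂ F) :
    sOp m T * euler (yOp F) (dOp F) = euler (yOp F) (dOp F) * sOp m T := by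
  simp only [euler, Finset.mul_sum, Finset.sum_mul]
  refine Finset.sum_congr rfl fun i _ => ?_
  rw [← mul_assoc, sOp_y, mul_assoc, sOp_d, mul_assoc]

/-- Contraction with the γ_i removes the free index and leaves an operator in E, slash and D with D
as rightmost factor. For a vector killed by all X_i this is an equation on its image under D alone.
-/
theorem sum_gamma_xOp (μ : ℂ) : ∑ i, sOp m (gamma m i) * xOp (spinAct m) μ i
    = (μ + (m - 1) / 2) • diracOp m - euler (yOp (Spinor m)) (dOp (Spinor m)) * diracOp m
      + (1 / 2 : ℂ) • (slashOp m * diracOp m * diracOp m) := by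
  have : ∀ i, sOp m (gamma m i) * xOp (spinAct m) μ i
      = (μ - 1 / 2) • (sOp m (gamma m i) * dOp (Spinor m) i)
        - euler (yOp (Spinor m)) (dOp (Spinor m)) * (sOp m (gamma m i) * dOp (Spinor m) i)
        + (1 / 2 : ℂ) • (sOp m (gamma m i) * yOp (Spinor m) i * (diracOp m * diracOp m))
        + (1 / 2 : ℂ) • diracOp m := fun i => by
    rw [xOp_spin, mul_add, mul_add, mul_sub, mul_smul_comm, mul_smul_comm, mul_smul_comm,
      ← mul_assoc (sOp m (gamma m i)) (euler _ _), sOp_euler, mul_assoc (euler _ _),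
      ← mul_assoc (sOp m (gamma m i)) (sOp m (gamma m i)), (diracRel m).gg_self, one_mul,
      mul_assoc (sOp m (gamma m i)) (yOp _ i)]
  rw [Finset.sum_congr rfl fun i _ => this i]
  simp only [Finset.sum_add_distrib, Finset.sum_sub_distrib, ← Finset.smul_sum, ← Finset.mul_sum,
    ← Finset.sum_mul, Finset.sum_const, Finset.card_univ, Fintype.card_fin]
  change (μ - 1 / 2) • diracOp m - euler _ _ * diracOp m
    + (1 / 2 : ℂ) • (slashOp m * (diracOp m * diracOp m)) + (1 / 2 : ℂ) • (m • diracOp m) = _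
  rw [mul_assoc, ← Nat.cast_smul_eq_nsmul ℂ]
  module

/-- Expresses |y|² times the Laplacian through E and T = slash · D. As both preserve the degree,
`sum_yOp_xOp` then becomes, in a fixed degree, a quadratic polynomial in T. -/
theorem slash_slash_dirac_dirac : slashOp m * slashOp m * (diracOp m * diracOp m)
    = (2 : ℂ) • (euler (yOp (Spinor m)) (dOp (Spinor m)) * (slashOp m * diracOp m))
      + ((m : ℂ) - 2) • (slashOp m * diracOp m)
      - slashOp m * diracOp m * (slashOp m * diracOp m) := by
  have h := (diracRel m).dirac_slash
  have h2 := (diracRel m).euler_slash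
  have e1 : slashOp m * diracOp m * (slashOp m * diracOp m)
      = slashOp m * (diracOp m * slashOp m) * diracOp m := by noncomm_ring
  have h' : diracOp m * slashOp m = (2 : ℂ) • euler (yOp (Spinor m)) (dOp (Spinor m)) + (m : ℂ) • 1
      - slashOp m * diracOp m := h
  have h2' : slashOp m * euler (yOp (Spinor m)) (dOp (Spinor m))
      = euler (yOp (Spinor m)) (dOp (Spinor m)) * slashOp m - slashOp m :=
    eq_sub_of_add_eq h2.symm
  rw [e1, h', mul_sub, mul_add, sub_mul, add_mul, mul_smul_comm, mul_smul_comm, smul_mul_assoc,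
    smul_mul_assoc, h2', mul_one, sub_mul, mul_assoc (euler _ _)]
  rw [← mul_assoc (slashOp m) (slashOp m), mul_assoc (slashOp m * slashOp m)]
  module

theorem sum_yOp_xOp (μ : ℂ) : ∑ i, yOp (Spinor m) i * xOp (spinAct m) μ i
    = (μ + 1 / 2) • euler (yOp (Spinor m)) (dOp (Spinor m))
      - euler (yOp (Spinor m)) (dOp (Spinor m)) * euler (yOp (Spinor m)) (dOp (Spinor m))
      + euler (yOp (Spinor m)) (dOp (Spinor m)) * (slashOp m * diracOp m)
      + (((m : ℂ) - 1) / 2) • (slashOp m * diracOp m)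
      - (1 / 2 : ℂ) • (slashOp m * diracOp m * (slashOp m * diracOp m)) := by
  have hy : ∀ i, yOp (Spinor m) i * euler (yOp (Spinor m)) (dOp (Spinor m))
      = euler (yOp (Spinor m)) (dOp (Spinor m)) * yOp (Spinor m) i - yOp (Spinor m) i := fun i =>
    eq_sub_of_add_eq ((weylRel m (Spinor m)).euler_y i).symm
  have : ∀ i, yOp (Spinor m) i * xOp (spinAct m) μ i
      = (μ + 1 / 2) • (yOp (Spinor m) i * dOp (Spinor m) i)
        - euler (yOp (Spinor m)) (dOp (Spinor m)) * (yOp (Spinor m) i * dOp (Spinor m) i)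
        + (1 / 2 : ℂ) • (yOp (Spinor m) i * yOp (Spinor m) i * (diracOp m * diracOp m))
        + (1 / 2 : ℂ) • (sOp m (gamma m i) * yOp (Spinor m) i * diracOp m) := fun i => by
    rw [xOp_spin, mul_add, mul_add, mul_sub, mul_smul_comm, mul_smul_comm, mul_smul_comm,
      ← mul_assoc (yOp _ i) (euler _ _), hy, sub_mul, mul_assoc (euler _ _), sOp_y,
      mul_assoc (yOp _ i) (yOp _ i), mul_assoc (yOp _ i) (sOp m _)]
    module
  rw [Finset.sum_congr rfl fun i _ => this i]
  simp only [Finset.sum_add_distrib, Finset.sum_sub_distrib, ← Finset.smul_sum, ← Finset.mul_sum,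
    ← Finset.sum_mul]
  rw [← (diracRel m).slash_sq]
  change (μ + 1 / 2) • euler _ _ - euler _ _ * euler _ _
    + (1 / 2 : ℂ) • (slashOp m * slashOp m * (diracOp m * diracOp m))
    + (1 / 2 : ℂ) • (slashOp m * diracOp m) = _
  rw [slash_slash_dirac_dirac]
  module

theorem diracOp_mem_degSpace {d : ℕ} {u : PolyTensor m (Spinor m)}
    (hu : u ∈ degSpace m (Spinor m) d) : diracOp m u ∈ degSpace m (Spinor m) (d - 1) := by
  rw [diracOp, dirac, LinearMap.sum_apply]
  exact sum_mem fun i _ => sOp_mem_degSpace (dOp_mem_degSpace hu i) _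

theorem slashOp_mem_degSpace {d : ℕ} {u : PolyTensor m (Spinor m)}
    (hu : u ∈ degSpace m (Spinor m) d) : slashOp m u ∈ degSpace m (Spinor m) (d + 1) := by
  rw [slashOp, slash, LinearMap.sum_apply]
  exact sum_mem fun i _ => sOp_mem_degSpace (yOp_mem_degSpace hu i) _

theorem diracOp_degSpace_zero {u : PolyTensor m (Spinor m)}
    (hu : u ∈ degSpace m (Spinor m) 0) : diracOp m u = 0 := by
  rw [diracOp, dirac, LinearMap.sum_apply]
  exact Finset.sum_eq_zero fun i _ => by
    rw [Module.End.mul_apply, dOp_degSpace_zero hu, map_zero]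

theorem slash_dirac_mem_degSpace {d : ℕ} {u : PolyTensor m (Spinor m)}
    (hu : u ∈ degSpace m (Spinor m) d) :
    (slashOp m * diracOp m) u ∈ degSpace m (Spinor m) d := by
  rw [Module.End.mul_apply]
  rcases d with _ | d
  · rw [diracOp_degSpace_zero hu, map_zero]; exact zero_mem _
  · exact slashOp_mem_degSpace (diracOp_mem_degSpace hu)

/-- The eigenvalues of Clifford multiplication composed with the Dirac operator. -/
theorem slash_dirac_eigenvalue {d : ℕ} {w : PolyTensor m (Spinor m)}
    (hw : w ∈ degSpace m (Spinor m) d) (hw0 : w ≠ 0) {κ : ℂ}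
    (h : (slashOp m * diracOp m) w = κ • w) :
    (∃ s : ℕ, 2 * s ≤ d ∧ κ = 2 * s) ∨
      ∃ s : ℕ, 2 * s + 1 ≤ d ∧ κ = 2 * ((d : ℂ) - s - 1) + m := by
  induction d generalizing w κ with
  | zero =>
    rw [Module.End.mul_apply, diracOp_degSpace_zero hw, map_zero] at h
    exact Or.inl ⟨0, le_rfl, by simpa [hw0] using h.symm⟩
  | succ d ih =>
    by_cases hD : diracOp m w = 0
    · rw [Module.End.mul_apply, hD, map_zero] at h
      exact Or.inl ⟨0, by simp, by simpa [hw0] using h.symm⟩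
    · have hDw : diracOp m w ∈ degSpace m (Spinor m) d := diracOp_mem_degSpace hw
      -- By the anticommutation relation, Dw is again an eigenvector, one degree lower, with
      -- eigenvalue 2d + m - κ. Two such steps lower κ by 2, and the process starts at κ = 0 where
      -- Dw = 0. This is why the two families alternate.
      have e := LinearMap.congr_fun ((diracRel m).dirac_slash) (diracOp m w)
      have e' : diracOp m (slashOp m (diracOp m w))
          = (2 : ℂ) • (d : ℂ) • diracOp m w + (m : ℂ) • diracOp m w
            - slashOp m (diracOp m (diracOp m w)) := by
        rw [← euler_degSpace hDw]; exact e
      rw [Module.End.mul_apply] at h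
      rw [h, map_smul] at e'
      have key : (slashOp m * diracOp m) (diracOp m w) = (2 * (d : ℂ) + m - κ) • diracOp m w := by
        rw [Module.End.mul_apply, eq_comm, ← sub_eq_zero]
        rw [← sub_eq_zero] at e'
        rw [← neg_eq_zero, ← e']
        module
      rcases ih hDw hD key with ⟨s, hs, h1⟩ | ⟨s, hs, h1⟩
      · refine Or.inr ⟨s, by omega, ?_⟩
        push_cast
        linear_combination -h1
      · refine Or.inl ⟨s + 1, by omega, ?_⟩
        push_cast
        linear_combination -h1

variable (μ : ℂ)

/-- There are no singular vectors of positive degree for generic `μ`. -/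
theorem eq_zero_of_xOp_eq_zero (h1 : ∀ k : ℕ, 1 ≤ k → 2 * μ + m ≠ k)
    (h2 : ∀ k : ℕ, μ + m - 3 / 2 ≠ k) {d : ℕ} {v : PolyTensor m (Spinor m)}
    (hv : v ∈ degSpace m (Spinor m) (d + 1)) (hX : ∀ i, xOp (spinAct m) μ i v = 0) : v = 0 := by
  have hDv : diracOp m v ∈ degSpace m (Spinor m) d := diracOp_mem_degSpace hv
  have hD : diracOp m v = 0 := by
    by_contra hne
    -- The contracted equation says that Dv is an eigenvector of slash · D with eigenvalue 2d - 2μ -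
    -- (m - 1).
    have e := LinearMap.congr_fun (sum_gamma_xOp (m := m) μ) v
    rw [LinearMap.sum_apply, Finset.sum_eq_zero fun i _ => by
      rw [Module.End.mul_apply, hX, map_zero]] at e
    have e' : (0 : PolyTensor m (Spinor m)) = (μ + (m - 1) / 2) • diracOp m v
        - (d : ℂ) • diracOp m v + (1 / 2 : ℂ) • (slashOp m * diracOp m) (diracOp m v) := by
      rw [← euler_degSpace hDv]; exact e
    have key : (slashOp m * diracOp m) (diracOp m v)
        = (2 * (d : ℂ) - 2 * μ - (m - 1)) • diracOp m v := by
      rw [eq_comm, ← sub_eq_zero]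
      have e2 := congrArg (fun z => (-2 : ℂ) • z) e'
      simp only [smul_zero] at e2
      rw [e2]
      module
    -- Comparison with the two families gives 2μ + m = 2d + 1 - 2s, which is positive as 2s ≤ d, or
    -- μ + m - 3/2 = s. Each is excluded by one hypothesis.
    rcases slash_dirac_eigenvalue hDv hne key with ⟨s, hs, h⟩ | ⟨s, hs, h⟩
    · refine h1 (2 * d + 1 - 2 * s) (by omega) ?_
      rw [Nat.cast_sub (by omega)]
      push_cast
      linear_combination -h
    · refine h2 s ?_
      linear_combination -(1 / 2 : ℂ) * h
  -- Once Dv = 0, the operator X_i acts on v as (μ - 1/2 - d) d_i. A zero coefficient would mean 2μ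
  -- + m = 2d + 1 + m, so all partial derivatives vanish, and Euler's identity gives v = 0.
  have hd : ∀ i, dOp (Spinor m) i v = 0 := fun i => by
    have e := LinearMap.congr_fun (xOp_spin μ i) v
    have hdv : dOp (Spinor m) i v ∈ degSpace m (Spinor m) d := dOp_mem_degSpace hv i
    simp only [hX, LinearMap.add_apply, LinearMap.sub_apply, LinearMap.smul_apply,
      Module.End.mul_apply, hD, map_zero, smul_zero, add_zero, euler_degSpace hdv] at e
    rw [← sub_smul] at e
    refine (smul_eq_zero.1 e.symm).resolve_left fun h => ?_
    refine h1 (2 * d + 1 + m) (by omega) ?_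
    push_cast
    linear_combination 2 * h
  have e := euler_degSpace hv
  rw [euler, LinearMap.sum_apply, Finset.sum_eq_zero fun i _ => by
    rw [Module.End.mul_apply, hd, map_zero]] at e
  refine (smul_eq_zero.1 e.symm).resolve_left ?_
  exact_mod_cast Nat.succ_ne_zero d

/-- `∑ Y_i X_i` is injective on homogeneous polynomials of large degree. -/
theorem exists_sum_yOp_xOp_ne_zero : ∃ D : ℕ, ∀ d > D, ∀ v ∈ degSpace m (Spinor m) d,
    (∑ i, yOp (Spinor m) i * xOp (spinAct m) μ i) v = 0 → v = 0 := by
  -- The bound m + 2 Re μ is what the final inequality of real parts requires.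
  obtain ⟨D, hD⟩ := exists_nat_gt ((m : ℝ) + 2 * μ.re)
  refine ⟨D, fun d hd v hv h => ?_⟩
  by_contra hv0
  set T := slashOp m * diracOp m with hT
  have hTv : T v ∈ degSpace m (Spinor m) d := slash_dirac_mem_degSpace hv
  set α : ℂ := (2 * μ + 1) * d - 2 * d * d with hα
  -- On degree d the equation (∑ Y_i X_i) v = 0, doubled, is a quadratic equation for T on v, with
  -- roots κ and 2d + m - 1 - κ.
  have e : α • v + (2 * (d : ℂ) + m - 1) • T v - T (T v) = 0 := by
    rw [sum_yOp_xOp] at h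
    simp only [LinearMap.add_apply, LinearMap.sub_apply, LinearMap.smul_apply,
      Module.End.mul_apply, ← hT] at h
    have h3 := euler_degSpace hTv
    rw [euler_degSpace hv, map_smul, euler_degSpace hv, h3] at h
    have h2 := congrArg (fun z => (2 : ℂ) • z) h
    simp only [smul_zero] at h2
    rw [← h2]
    module
  obtain ⟨κ, hκ⟩ : ∃ κ : ℂ, κ * κ = (2 * (d : ℂ) + m - 1) * κ + α := by
    obtain ⟨r, hr⟩ := IsAlgClosed.exists_eq_mul_self ((2 * (d : ℂ) + m - 1) ^ 2 + 4 * α)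
    exact ⟨((2 * (d : ℂ) + m - 1) + r) / 2, by linear_combination -(1 / 4 : ℂ) * hr⟩
  -- Either v is an eigenvector for κ, or (T - κ)v is nonzero and an eigenvector for the other root.
  obtain ⟨w, κ', hw, hw0, hTw, hκ'⟩ : ∃ w, ∃ κ' : ℂ, w ∈ degSpace m (Spinor m) d ∧ w ≠ 0 ∧
      T w = κ' • w ∧ κ' * κ' = (2 * (d : ℂ) + m - 1) * κ' + α := by
    by_cases hw : T v - κ • v = 0
    · exact ⟨v, κ, hv, hv0, sub_eq_zero.1 hw, hκ⟩
    · refine ⟨_, 2 * (d : ℂ) + m - 1 - κ, sub_mem hTv (Submodule.smul_mem _ κ hv), hw, ?_,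
        by linear_combination hκ⟩
      rw [map_sub, map_smul, ← sub_eq_zero]
      have e3 : α = κ * κ - (2 * (d : ℂ) + m - 1) * κ := by linear_combination -hκ
      rw [← neg_eq_zero, ← e, e3]
      module
  -- In the first family κ' = r with r = 2s, in the second κ' = 2d + m - 1 - r with r = 2s + 1; the
  -- product is symmetric under this exchange, so one formula covers both.
  obtain ⟨r, hr, hrκ⟩ : ∃ r : ℕ, r ≤ d ∧
      κ' * (2 * (d : ℂ) + m - 1 - κ') = r * (2 * d + m - 1 - r) := by
    rcases slash_dirac_eigenvalue hw hw0 hTw with ⟨s, hs, h1⟩ | ⟨s, hs, h1⟩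
    · exact ⟨2 * s, hs, by rw [h1]; push_cast; ring⟩
    · exact ⟨2 * s + 1, hs, by rw [h1]; push_cast; ring⟩
  have e4 : ((r : ℂ) * (2 * d + m - 1 - r)) + α = 0 := by
    rw [← hrκ]; linear_combination -hκ'
  have e5 := congrArg Complex.re e4
  simp [hα] at e5
  have hr' : (r : ℝ) ≤ d := by exact_mod_cast hr
  have hd' : (D : ℝ) + 1 ≤ d := by exact_mod_cast hd
  -- This says r(2d + m - 1 - r) ≤ d² + (m - 1)d. Combined with `e5` it yields d ≤ m + 2 Re μ,
  -- against the choice of D. Integrality of d - r is used: for m = 0 the second factor is negative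
  -- when d = r, but then the first factor is zero.
  have hz : (0 : ℝ) ≤ ((d : ℝ) - r) * ((d : ℝ) - r + m - 1) := by
    obtain ⟨t, rfl⟩ := Nat.exists_eq_add_of_le hr
    rcases t with _ | t
    · simp
    · push_cast
      have : (0 : ℝ) ≤ (m : ℝ) := Nat.cast_nonneg m
      have : (0 : ℝ) ≤ (t : ℝ) := Nat.cast_nonneg t
      have h1 : (0 : ℝ) ≤ (r : ℝ) + (t + 1) - r := by linarith
      have h2 : (0 : ℝ) ≤ (r : ℝ) + (t + 1) - r + m - 1 := by linarith
      positivity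
  have hd0 : (0 : ℝ) < d := by
    have : (0 : ℝ) ≤ D := Nat.cast_nonneg D
    linarith
  have hneg : (d : ℝ) * ((m : ℝ) + 2 * μ.re - d) < 0 :=
    mul_neg_of_pos_of_neg hd0 (by linarith)
  nlinarith

end SpinModel

/-! ### Irreducibility of the spin representations -/

section SpinIrreducible

theorem gamma_apply (k : ℕ) (i : Fin k) (f : Spinor k) (s : Fin (k / 2) → Bool) : gamma k i f s
    = (if Even (i : ℕ) then 1 else Complex.I) * fockSign s ((i + 1) / 2) * f (flip s (i / 2)) := rfl

theorem parity_apply (k : ℕ) (f : Spinor k) (s : Fin (k / 2) → Bool) :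
    parity k f s = fockSign s (k / 2) * f s := rfl

theorem parity_sq (k : ℕ) (f : Spinor k) : parity k (parity k f) = f := by
  funext s
  rw [parity_apply, parity_apply, ← mul_assoc, fockSign_sq, one_mul]

theorem fockSign_ne_zero {m : ℕ} (s : Fin m → Bool) (a : ℕ) : fockSign s a ≠ 0 := fun h => by
  have := fockSign_sq s a
  rw [h, zero_mul] at this
  exact zero_ne_one this

theorem fockSign_eq_or {m : ℕ} (s : Fin m → Bool) (a : ℕ) : fockSign s a = 1 ∨ fockSign s a = -1 :=
  mul_self_eq_one_iff.1 (fockSign_sq s a)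

theorem fockSign_succ {m : ℕ} (s : Fin m → Bool) (a : Fin m) :
    fockSign s (a + 1) = fockSign s a * if s a = true then -1 else 1 := by
  have h : (if s a = true then (-1 : ℂ) else 1)
      = ∏ j : Fin m, if j = a then (if s j = true then -1 else 1) else 1 := by
    rw [Finset.prod_ite_eq' Finset.univ a]; simp
  rw [h, fockSign, fockSign, ← Finset.prod_mul_distrib]
  refine Finset.prod_congr rfl fun j _ => ?_
  by_cases hj : j = a
  · subst hj; simp
  · have : (j : ℕ) ≠ a := fun e => hj (Fin.ext e)
    have e : (j : ℕ) < a + 1 ↔ (j : ℕ) < a := by omega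
    simp [hj, e]

theorem flip_of_le {m : ℕ} (s : Fin m → Bool) {a : ℕ} (h : m ≤ a) : flip s a = s := by
  funext j
  have : (j : ℕ) ≠ a := by omega
  simp [flip, this]

theorem flip_eq_update {m : ℕ} (s : Fin m → Bool) (a : Fin m) :
    flip s a = Function.update s a (!(s a)) := by
  funext j
  by_cases h : j = a
  · subst h; simp [flip]
  · have : (j : ℕ) ≠ a := fun e => h (Fin.ext e)
    simp [flip, this, h]

/-- The operators in `hD` have distinct joint eigenvalues on the occupation patterns, so a nonzero
stable subspace contains the indicator of one pattern; the flips in `hT` carry it to every other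
pattern. -/
theorem eq_top_of_stable {k : ℕ} (W : Submodule ℂ ((Fin k → Bool) → ℂ))
    (hD : ∀ a, ∀ f ∈ W, (fun s => (if s a = true then -1 else 1) * f s) ∈ W)
    (hT : ∀ a : Fin k, ∃ c : (Fin k → Bool) → ℂ, (∀ s, c s ≠ 0) ∧
      ∀ f ∈ W, (fun s => c s * f (flip s a)) ∈ W) (h : W ≠ ⊥) : W = ⊤ := by
  classical
  obtain ⟨f, hf, hf0⟩ := W.exists_mem_ne_zero_of_ne_bot h
  obtain ⟨s₀, hs₀⟩ := Function.ne_iff.1 hf0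
  have h1 : ∀ A : Finset (Fin k), (fun s => if ∀ a ∈ A, s a = s₀ a then f s else 0) ∈ W := by
    intro A
    induction A using Finset.induction_on with
    | empty => simpa using hf
    | insert a A ha ih =>
      -- The average of the identity and the sign operator, with the sign adjusted to s₀, projects
      -- onto the patterns that agree with s₀ at the mode `a`.
      have := W.smul_mem (1 / 2 : ℂ) (W.add_mem ih
        (W.smul_mem (if s₀ a = true then -1 else 1 : ℂ) (hD a _ ih)))
      convert this using 1
      funext s
      simp only [Finset.mem_insert, forall_eq_or_imp, Pi.smul_apply, Pi.add_apply, smul_eq_mul,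
        ite_and]
      generalize (if ∀ a ∈ A, s a = s₀ a then f s else 0) = r
      cases s a <;> cases s₀ a <;> simp <;> ring
  have hs : ∀ s₁ : Fin k → Bool, ∀ t : ℂ, t ≠ 0 → Pi.single s₁ t ∈ W → ∀ r : ℂ,
      Pi.single s₁ r ∈ W := by
    intro s₁ t ht hm r
    have := W.smul_mem (r / t) hm
    rwa [← Pi.single_smul, smul_eq_mul, div_mul_cancel₀ _ ht] at this
  have h2 : ∀ r : ℂ, Pi.single s₀ r ∈ W := by
    refine hs s₀ (f s₀) hs₀ ?_
    convert h1 Finset.univ using 1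
    funext s
    rw [Pi.single_apply]
    by_cases e : s = s₀
    · subst e; simp
    · have : ¬∀ a ∈ (Finset.univ : Finset (Fin k)), s a = s₀ a := fun h =>
        e (funext fun a => h a (Finset.mem_univ a))
      rw [if_neg e, if_neg this]
  have h3 : ∀ (a : Fin k) (s₁ : Fin k → Bool), (∀ r : ℂ, Pi.single s₁ r ∈ W) →
      ∀ r : ℂ, Pi.single (flip s₁ a) r ∈ W := by
    intro a s₁ hs₁
    obtain ⟨c, hc, hcW⟩ := hT a
    refine hs _ (c (flip s₁ a)) (hc _) ?_
    convert hcW _ (hs₁ 1) using 1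
    funext s
    rw [Pi.single_apply, Pi.single_apply]
    by_cases e : s = flip s₁ a
    · subst e; simp [flip_flip]
    · have : flip s a ≠ s₁ := fun h => e (by rw [← h, flip_flip])
      simp [e, this]
  -- The pattern s₀ is turned into s₁ one mode at a time, flipping only where they differ.
  have h4 : ∀ (s₁ : Fin k → Bool) (A : Finset (Fin k)), ∀ r : ℂ,
      Pi.single (fun j => if j ∈ A then s₁ j else s₀ j) r ∈ W := by
    intro s₁ A
    induction A using Finset.induction_on with
    | empty => simpa using h2
    | insert a A ha ih =>
      by_cases e : s₁ a = s₀ a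
      · convert ih using 4 with r j
        by_cases hj : j = a
        · subst hj; simp [ha, e]
        · simp [hj]
      · convert h3 a _ ih using 3 with r
        rw [flip_eq_update]
        funext j
        by_cases hj : j = a
        · subst hj
          rw [Function.update_self]
          simp only [Finset.mem_insert_self, if_true, if_neg ha]
          cases e1 : s₁ j <;> cases e2 : s₀ j <;> simp_all
        · rw [Function.update_of_ne hj]
          simp [hj]
  rw [eq_top_iff]
  intro g _
  have : g = ∑ s, Pi.single s (g s) := by
    funext s
    simp [Finset.sum_apply, Pi.single_apply]
  rw [this]
  refine sum_mem fun s _ => ?_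
  simpa using h4 s Finset.univ (g s)

variable {m : ℕ}

/-- The two generators of one mode multiply, up to √-1, to the diagonal operator that records
whether the mode is occupied. -/
theorem gamma_gamma_diag (a : Fin (m / 2)) (f : Spinor m) (s : Fin (m / 2) → Bool) :
    Complex.I * gamma m ⟨2 * a, by omega⟩ (gamma m ⟨2 * a + 1, by omega⟩ f) s
      = (if s a = true then -1 else 1) * f s := by
  rw [gamma_apply, gamma_apply]
  have h1 : Even (2 * (a : ℕ)) := even_two_mul _
  have h2 : ¬Even (2 * (a : ℕ) + 1) := by simp
  have e1 : (2 * (a : ℕ) + 1) / 2 = a := by omega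
  have e2 : 2 * (a : ℕ) / 2 = a := by omega
  have e3 : (2 * (a : ℕ) + 1 + 1) / 2 = a + 1 := by omega
  simp only [h1, h2, if_true, if_false, e1, e2, e3, flip_flip]
  rw [fockSign_flip_lt s a (a + 1) (by omega) a.2, fockSign_succ]
  linear_combination (-f s * (if s a = true then -1 else 1) * fockSign s a * fockSign s a)
    * Complex.I_sq + (f s * (if s a = true then -1 else 1)) * fockSign_sq s a

/-- Products of two generators are, up to scalars and the identity, in the image of so(m), so only
odd elements of the Clifford algebra are out of reach. -/
theorem gamma_gamma_mem {W : Submodule ℂ (Spinor m)}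
    (hW : ∀ B : Matrix (Fin m) (Fin m) ℂ, (∀ i j, B i j = -B j i) → ∀ w ∈ W, spinAct m B w ∈ W)
    (i j : Fin m) {w : Spinor m} (hw : w ∈ W) : gamma m i (gamma m j w) ∈ W := by
  have h := hW _ (skewUnit_skew i j) w hw
  have e : gamma m i (gamma m j w)
      = (2 : ℂ) • spinAct m (skewUnit i j) w + if i = j then w else 0 := by
    rw [spinAct_skewUnit, LinearMap.sub_apply, LinearMap.smul_apply, Module.End.mul_apply]
    split_ifs
    · rw [LinearMap.smul_apply, Module.End.one_apply]; module
    · rw [LinearMap.zero_apply]; module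
  rw [e]
  refine W.add_mem (W.smul_mem _ h) ?_
  split_ifs
  · exact hw
  · exact zero_mem _

/-- The spin representation of `so(m)` is irreducible for odd `m`. -/
theorem spinor_irreducible (ho : Odd m) (W : Submodule ℂ (Spinor m))
    (hW : ∀ B : Matrix (Fin m) (Fin m) ℂ, (∀ i j, B i j = -B j i) → ∀ w ∈ W, spinAct m B w ∈ W)
    (h : W ≠ ⊥) : W = ⊤ := by
  refine eq_top_of_stable W (fun a f hf => ?_) (fun a => ?_) h
  · have := W.smul_mem Complex.I (gamma_gamma_mem hW ⟨2 * a, by omega⟩ ⟨2 * a + 1, by omega⟩ hf)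
    convert this using 1
    funext s
    exact (gamma_gamma_diag a f s).symm
  · have hm : 2 * (m / 2) < m := by obtain ⟨r, rfl⟩ := ho; omega
    refine ⟨fun s => fockSign s (m / 2) * fockSign s a,
      fun s => mul_ne_zero (fockSign_ne_zero _ _) (fockSign_ne_zero _ _), fun f hf => ?_⟩
    -- For odd m the last generator is the diagonal parity operator. Its product with γ_{2a} is
    -- even, hence available, and flips the mode `a` with a nonvanishing coefficient.
    convert gamma_gamma_mem hW ⟨2 * (m / 2), hm⟩ ⟨2 * a, by omega⟩ hf using 1
    funext s
    rw [gamma_apply, gamma_apply]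
    have e1 : (2 * (m / 2) + 1) / 2 = m / 2 := by omega
    have e2 : 2 * (m / 2) / 2 = m / 2 := by omega
    have e3 : (2 * (a : ℕ) + 1) / 2 = a := by omega
    have e4 : 2 * (a : ℕ) / 2 = a := by omega
    simp only [even_two_mul, if_true, e1, e2, e3, e4, flip_of_le s le_rfl]
    ring

theorem clifford_irreducible (W : Submodule ℂ (Spinor m))
    (hW : ∀ i, ∀ w ∈ W, gamma m i w ∈ W) (h : W ≠ ⊥) : W = ⊤ := by
  refine eq_top_of_stable W (fun a f hf => ?_) (fun a => ?_) h
  · have := W.smul_mem Complex.I (hW ⟨2 * a, by omega⟩ _ (hW ⟨2 * a + 1, by omega⟩ _ hf))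
    convert this using 1
    funext s
    exact (gamma_gamma_diag a f s).symm
  · refine ⟨fun s => fockSign s a, fun s => fockSign_ne_zero _ _, fun f hf => ?_⟩
    convert hW ⟨2 * a, by omega⟩ _ hf using 1
    funext s
    rw [gamma_apply]
    have e3 : (2 * (a : ℕ) + 1) / 2 = a := by omega
    have e4 : 2 * (a : ℕ) / 2 = a := by omega
    simp only [even_two_mul, if_true, e3, e4, one_mul]

theorem mem_halfSpinor_iff {ε : ℤˣ} {f : Spinor m} :
    f ∈ halfSpinor m ε ↔ ∀ s, fockSign s (m / 2) * f s = ((ε : ℤ) : ℂ) * f s := by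
  rw [halfSpinor, Module.End.mem_eigenspace_iff]
  exact ⟨fun h s => congrFun h s, fun h => funext h⟩

theorem sign_mul_self (ε : ℤˣ) : ((ε : ℤ) : ℂ) * ((ε : ℤ) : ℂ) = 1 := by
  rcases Int.units_eq_one_or ε with rfl | rfl <;> simp

/-- The half-spin representations are irreducible. -/
theorem halfSpinor_irreducible (he : Even m) (ε : ℤˣ) (W : Submodule ℂ (Spinor m))
    (hW : ∀ B : Matrix (Fin m) (Fin m) ℂ, (∀ i j, B i j = -B j i) → ∀ w ∈ W, spinAct m B w ∈ W)
    (hε : W ≤ halfSpinor m ε) (h : W ≠ ⊥) : W = halfSpinor m ε := by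
  rcases Nat.eq_zero_or_pos m with rfl | hm
  · refine le_antisymm hε ?_
    rw [clifford_irreducible W (fun i => i.elim0) h]
    exact le_top
  · set g := gamma m ⟨0, hm⟩ with hg
    have hgg : ∀ w, g (g w) = w := fun w => LinearMap.congr_fun (gamma_sq m ⟨0, hm⟩) w
    -- W + γ_0 W is stable under all generators because γ_i γ_0 and γ_0 γ_i preserve W, hence it is
    -- the whole space.
    have hU : W ⊔ W.map g = ⊤ := by
      refine clifford_irreducible _ (fun i w hw => ?_)
        (fun e => h (le_bot_iff.1 (e ▸ le_sup_left)))
      obtain ⟨u, hu, _, ⟨v, hv, rfl⟩, rfl⟩ := Submodule.mem_sup.1 hw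
      rw [map_add, add_comm]
      refine Submodule.add_mem_sup (gamma_gamma_mem hW i ⟨0, hm⟩ hv) ?_
      exact ⟨g (gamma m i u), gamma_gamma_mem hW _ _ hu, hgg _⟩
    refine le_antisymm hε fun x hx => ?_
    have hxU : x ∈ W ⊔ W.map g := hU ▸ Submodule.mem_top
    obtain ⟨u, hu, _, ⟨v, hv, rfl⟩, rfl⟩ := Submodule.mem_sup.1 hxU
    have h1 : g v ∈ halfSpinor m ε := by simpa using sub_mem hx (hε hu)
    -- γ_0 reverses parity, so its contribution to an element of the half-spinor space must vanish.
    have h2 : parity m (g v) = -g (parity m v) :=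
      LinearMap.congr_fun (parity_gamma m he ⟨0, hm⟩) v
    rw [Module.End.mem_eigenspace_iff.1 (hε hv), map_smul,
      Module.End.mem_eigenspace_iff.1 h1] at h2
    have h3 : (2 * ((ε : ℤ) : ℂ)) • g v = 0 := by
      rw [mul_smul, two_smul]
      nth_rewrite 1 [h2]
      rw [neg_add_cancel]
    have h4 : g v = 0 := (smul_eq_zero.1 h3).resolve_left
      (mul_ne_zero two_ne_zero fun e => by simpa [e] using sign_mul_self ε)
    rw [h4, add_zero]
    exact hu

/-- Flipping one mode changes parity, so both signs occur as soon as there is a mode; with no mode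
only the sign 1 does. -/
theorem halfSpinor_ne_bot {ε : ℤˣ} (h : m / 2 = 0 → ε = 1) : halfSpinor m ε ≠ ⊥ := by
  obtain ⟨s, hs⟩ : ∃ s : Fin (m / 2) → Bool, fockSign s (m / 2) = ((ε : ℤ) : ℂ) := by
    have h0 : fockSign (fun _ : Fin (m / 2) => false) (m / 2) = 1 := by simp [fockSign]
    rcases Int.units_eq_one_or ε with rfl | rfl
    · exact ⟨_, by simpa using h0⟩
    · have hm : 0 < m / 2 := Nat.pos_of_ne_zero fun e => by simpa using h e
      refine ⟨flip (fun _ => false) 0, ?_⟩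
      rw [fockSign_flip_lt _ _ _ hm hm, h0]
      simp
  intro e
  have : Pi.single s 1 ∈ halfSpinor m ε := by
    rw [mem_halfSpinor_iff]
    intro t
    by_cases ht : t = s
    · subst ht; rw [hs]
    · rw [Pi.single_eq_of_ne ht]; simp
  rw [e, Submodule.mem_bot] at this
  simpa using congrFun this s

end SpinIrreducible

/-! ### The half-spin representations as summands -/

section HalfSpin

variable (m : ℕ) (he : Even m) (ε : ℤˣ)

/-- The inclusion of the half-spinors. -/
def halfIncl : HalfSpinor m ε →ₗ[ℂ] Spinor m := (halfSpinor m ε).subtype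

theorem halfIncl_injective : Function.Injective (halfIncl m ε) :=
  (halfSpinor m ε).injective_subtype

theorem range_halfIncl : LinearMap.range (halfIncl m ε) = halfSpinor m ε :=
  (halfSpinor m ε).range_subtype

/-- The projection onto the half-spinors. -/
def halfProj : Spinor m →ₗ[ℂ] HalfSpinor m ε :=
  ((1 / 2 : ℂ) • ((1 : Module.End ℂ (Spinor m)) + ((ε : ℤ) : ℂ) • parity m)).codRestrict
    (halfSpinor m ε) fun f => by
      rw [halfSpinor, Module.End.mem_eigenspace_iff]
      simp only [LinearMap.smul_apply, LinearMap.add_apply, Module.End.one_apply, map_smul, map_add,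
        parity_sq]
      rw [smul_comm ((ε : ℤ) : ℂ) (1 / 2 : ℂ), smul_add ((ε : ℤ) : ℂ),
        smul_smul ((ε : ℤ) : ℂ) ((ε : ℤ) : ℂ), sign_mul_self, one_smul, add_comm]

theorem halfIncl_halfProj (f : Spinor m) : halfIncl m ε (halfProj m ε f)
    = (1 / 2 : ℂ) • (f + ((ε : ℤ) : ℂ) • parity m f) := rfl

theorem halfProj_halfIncl (f : HalfSpinor m ε) : halfProj m ε (halfIncl m ε f) = f := by
  apply halfIncl_injective
  have h : parity m (halfIncl m ε f) = ((ε : ℤ) : ℂ) • halfIncl m ε f :=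
    Module.End.mem_eigenspace_iff.1 f.2
  rw [halfIncl_halfProj, h, smul_smul, sign_mul_self]
  module

theorem add_halfProj (f : Spinor m) :
    halfIncl m ε (halfProj m ε f) + halfIncl m (-ε) (halfProj m (-ε) f) = f := by
  rw [halfIncl_halfProj, halfIncl_halfProj, Units.val_neg, Int.cast_neg]
  module

theorem halfProj_neg_halfIncl (f : HalfSpinor m ε) : halfProj m (-ε) (halfIncl m ε f) = 0 := by
  apply halfIncl_injective
  rw [map_zero, ← sub_eq_zero.2 (add_halfProj m ε (halfIncl m ε f)), halfProj_halfIncl]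
  abel

variable {m}

/-- The action of skew-symmetric matrices on half-spinors. -/
def halfAct : Matrix (Fin m) (Fin m) ℂ →ₗ[ℂ] Module.End ℂ (HalfSpinor m ε) where
  toFun B := (spinAct m B).restrict fun w hw => by
    have h := LinearMap.congr_fun (spinAct_parity m he B) w
    simp only [halfSpinor, Module.End.mem_eigenspace_iff, Module.End.mul_apply] at hw h ⊢
    rw [h, hw, map_smul]
  map_add' A B := LinearMap.ext fun w => Subtype.ext (by
    change spinAct m (A + B) w.1 = spinAct m A w.1 + spinAct m B w.1
    rw [map_add]; rfl)
  map_smul' t A := LinearMap.ext fun w => Subtype.ext (by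
    change spinAct m (t • A) w.1 = t • spinAct m A w.1
    rw [map_smul]; rfl)

theorem halfIncl_halfAct (B : Matrix (Fin m) (Fin m) ℂ) (w : HalfSpinor m ε) :
    halfIncl m ε (halfAct he ε B w) = spinAct m B (halfIncl m ε w) := rfl

theorem halfProj_spinAct (B : Matrix (Fin m) (Fin m) ℂ) (w : Spinor m) :
    halfProj m ε (spinAct m B w) = halfAct he ε B (halfProj m ε w) := by
  apply halfIncl_injective
  have h : parity m (spinAct m B w) = spinAct m B (parity m w) :=
    LinearMap.congr_fun (spinAct_parity m he B) w
  rw [halfIncl_halfAct, halfIncl_halfProj, halfIncl_halfProj, h, map_smul, map_add, map_smul]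

theorem isSkewRep_spinAct (m : ℕ) : IsSkewRep (spinAct m) := fun A B hA _ => spinAct_lie m A B hA

theorem isSkewRep_halfAct : IsSkewRep (halfAct he ε) := fun A B hA _ => LinearMap.ext fun w => by
  apply halfIncl_injective
  rw [halfIncl_halfAct, spinAct_lie m A B hA]
  rfl

instance : FiniteDimensional ℂ (HalfSpinor m ε) :=
  inferInstanceAs (FiniteDimensional ℂ (halfSpinor m ε))

end HalfSpin

/-! ### Restriction of spinors -/

section RestrictSpin

variable {m n : ℕ}

/-- Spinors for the first `m` coordinates as spinors for `n ≥ m` coordinates. -/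
def pullSpinor (h : m ≤ n) : Spinor m →ₗ[ℂ] Spinor n where
  toFun g s := g fun j => s (Fin.castLE (Nat.div_le_div_right h) j)
  map_add' _ _ := rfl
  map_smul' _ _ := rfl

theorem fockSign_castLE {a b c : ℕ} (h : a ≤ b) (s : Fin b → Bool) (hc : c ≤ a) :
    fockSign (fun j => s (Fin.castLE h j)) c = fockSign s c := by
  unfold fockSign
  refine Finset.prod_of_injOn (Fin.castLE h) (fun x _ y _ e => Fin.castLE_injective h e) (by simp)
    (fun j _ hj => ?_) fun _ _ => rfl
  rw [if_neg]
  rintro ⟨h1, -⟩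
  exact hj ⟨⟨j, by omega⟩, by simp, rfl⟩

theorem pullSpinor_gamma (h : m ≤ n) (i : Fin m) (g : Spinor m) :
    pullSpinor h (gamma m i g) = gamma n (Fin.castLE h i) (pullSpinor h g) := by
  funext s
  change (if Even (i : ℕ) then 1 else Complex.I) * fockSign (fun j => s (Fin.castLE _ j))
    ((i + 1) / 2) * g (flip (fun j => s (Fin.castLE _ j)) (i / 2))
    = (if Even (i : ℕ) then 1 else Complex.I) * fockSign s ((i + 1) / 2)
      * g (fun j => flip s (i / 2) (Fin.castLE _ j))
  rw [fockSign_castLE _ _ (by omega)]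
  rfl

theorem pullSpinor_spinAct (h : m ≤ m + 1) (B : Matrix (Fin m) (Fin m) ℂ)
    (B' : Matrix (Fin (m + 1)) (Fin (m + 1)) ℂ)
    (h1 : ∀ i j : Fin m, B' i.castSucc j.castSucc = B i j)
    (h2 : ∀ i, B' i (Fin.last m) = 0) (h3 : ∀ i, B' (Fin.last m) i = 0) (g : Spinor m) :
    pullSpinor h (spinAct m B g) = spinAct (m + 1) B' (pullSpinor h g) := by
  change pullSpinor h ((∑ i, ∑ j, (B i j / 4) • (gamma m i * gamma m j)) g)
    = (∑ i, ∑ j, (B' i j / 4) • (gamma (m + 1) i * gamma (m + 1) j)) (pullSpinor h g)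
  simp only [Fin.sum_univ_castSucc, h1, h2, h3, zero_div, zero_smul, Finset.sum_const_zero,
    add_zero, LinearMap.sum_apply, map_sum, LinearMap.smul_apply, map_smul, Module.End.mul_apply]
  refine Finset.sum_congr rfl fun i _ => Finset.sum_congr rfl fun j _ => ?_
  rw [pullSpinor_gamma, pullSpinor_gamma]
  rfl

/-- For even m the passage to m + 1 adds the parity operator as a generator but no new mode. -/
theorem pullSpinor_bijective (h : m ≤ m + 1) (he : Even m) :
    Function.Bijective (pullSpinor h) := by
  have hd : (m + 1) / 2 ≤ m / 2 := by obtain ⟨r, rfl⟩ := he; omega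
  constructor
  · intro g g' e
    funext s
    exact congrFun e fun j => s (Fin.castLE hd j)
  · intro f
    exact ⟨fun s => f fun j => s (Fin.castLE hd j), rfl⟩

/-- For odd m there is exactly one new mode. A half-spinor is supported on patterns of one parity,
and each pattern of the old modes has exactly one extension of that parity, so half-spinors are the
same as functions of the old modes. -/
theorem halfProj_pullSpinor_bijective (h : m ≤ m + 1) (ho : Odd m) (δ : ℤˣ) :
    Function.Bijective (halfProj (m + 1) δ ∘ₗ pullSpinor h) := by
  have hd : (m + 1) / 2 = m / 2 + 1 := by obtain ⟨r, rfl⟩ := ho; omega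
  have hle : m / 2 ≤ (m + 1) / 2 := by omega
  have hsgn : ∀ s : Fin ((m + 1) / 2) → Bool, fockSign (flip s (m / 2)) ((m + 1) / 2)
      = -fockSign s ((m + 1) / 2) := fun s => fockSign_flip_lt _ _ _ (by omega) (by omega)
  have hres : ∀ s : Fin ((m + 1) / 2) → Bool,
      (fun j => flip s (m / 2) (Fin.castLE hle j)) = fun j => s (Fin.castLE hle j) := fun s => by
    funext j
    have : ((Fin.castLE hle j : Fin _) : ℕ) ≠ m / 2 := by simp; omega
    simp only [flip, this, if_false]
  have hval : ∀ (g : Spinor m) (s : Fin ((m + 1) / 2) → Bool),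
      halfIncl (m + 1) δ (halfProj (m + 1) δ (pullSpinor h g)) s
        = (1 / 2 : ℂ) * (g (fun j => s (Fin.castLE hle j))
          + ((δ : ℤ) : ℂ) * (fockSign s ((m + 1) / 2) * g fun j => s (Fin.castLE hle j))) :=
    fun _ _ => rfl
  have hδ : ((δ : ℤ) : ℂ) = 1 ∨ ((δ : ℤ) : ℂ) = -1 := by
    rcases Int.units_eq_one_or δ with rfl | rfl <;> simp
  let ext : (Fin (m / 2) → Bool) → Fin ((m + 1) / 2) → Bool := fun s' j =>
    if hj : (j : ℕ) < m / 2 then s' ⟨j, hj⟩ else false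
  have hext : ∀ s', (fun j => ext s' (Fin.castLE hle j)) = s' := fun s' => by
    funext j
    simp [ext]
  have hs : ∀ s : Fin ((m + 1) / 2) → Bool, ext (fun j => s (Fin.castLE hle j)) = s ∨
      ext (fun j => s (Fin.castLE hle j)) = flip s (m / 2) := fun s => by
    have key : ∀ j : Fin ((m + 1) / 2), (j : ℕ) = m / 2 → j = ⟨m / 2, by omega⟩ :=
      fun j hj => Fin.ext hj
    cases hb : s ⟨m / 2, by omega⟩
    · left
      funext j
      by_cases hj : (j : ℕ) < m / 2
      · simp [ext, hj]
      · rw [key j (by omega)]; simp [ext, hb]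
    · right
      funext j
      by_cases hj : (j : ℕ) < m / 2
      · simp [ext, hj, flip, hj.ne]
      · rw [key j (by omega)]; simp [ext, hb, flip]
  constructor
  · rw [← LinearMap.ker_eq_bot, LinearMap.ker_eq_bot']
    intro g hg
    funext s'
    have hg' : ∀ s, halfIncl (m + 1) δ (halfProj (m + 1) δ (pullSpinor h g)) s = 0 := fun s => by
      rw [show halfProj (m + 1) δ (pullSpinor h g) = 0 from hg, map_zero]; rfl
    have h1 := hg' (ext s')
    have h2 := hg' (flip (ext s') (m / 2))
    rw [hval, hext] at h1
    rw [hval, hres, hext, hsgn] at h2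
    change g s' = 0
    -- The two extensions have opposite sign, so the parity terms cancel in the sum.
    linear_combination h1 + h2
  · intro f
    -- One of the two values is zero by parity; summing over both extensions avoids choosing the
    -- right one.
    refine ⟨fun s' => halfIncl _ δ f (ext s') + halfIncl _ δ f (flip (ext s') (m / 2)), ?_⟩
    apply halfIncl_injective
    funext s
    have hf := mem_halfSpinor_iff.1 (show halfIncl (m + 1) δ f ∈ halfSpinor (m + 1) δ from f.2)
    have h1 := hf s
    have h2 := hf (flip s (m / 2))
    rw [hsgn] at h2
    have hg : halfIncl _ δ f (ext fun j => s (Fin.castLE hle j))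
        + halfIncl _ δ f (flip (ext fun j => s (Fin.castLE hle j)) (m / 2))
        = halfIncl _ δ f s + halfIncl _ δ f (flip s (m / 2)) := by
      rcases hs s with e | e
      · rw [e]
      · rw [e, flip_flip, add_comm]
    rw [LinearMap.comp_apply, hval]
    simp only [hg]
    rcases hδ with e | e <;> rw [e] at h1 h2 ⊢
    · linear_combination (1 / 2 : ℂ) * h1 - (1 / 2 : ℂ) * h2
    · linear_combination -(1 / 2 : ℂ) * h1 + (1 / 2 : ℂ) * h2

end RestrictSpin

/-! ### Modules isomorphic to the polynomial model -/

theorem mem_of_sum_range_mem {V : Type} [AddCommGroup V] [Module ℂ V] (T : Module.End ℂ V)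
    (p : Submodule ℂ V) (hp : ∀ x ∈ p, T x ∈ p) (a : ℕ → ℂ) (ha : Function.Injective a) (N : ℕ)
    (v : ℕ → V) (hv : ∀ d, T (v d) = a d • v d) (hs : ∑ d ∈ Finset.range N, v d ∈ p) :
    ∀ d < N, v d ∈ p := by
  classical
  have key := mem_of_sum_eigenvectors_mem T p hp ((Finset.range N).image a) (Function.extend a v 0)
    (fun w hw => by
      obtain ⟨d, -, rfl⟩ := Finset.mem_image.1 hw
      rw [ha.extend_apply, hv])
    (by
      rw [Finset.sum_image fun x _ y _ h => ha h]
      simpa only [ha.extend_apply] using hs)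
  intro d hd
  have := key (a d) (Finset.mem_image_of_mem a (Finset.mem_range.2 hd))
  rwa [ha.extend_apply] at this

section ModelModule

variable {m : ℕ} {𝔤 : Type} [LieRing 𝔤] [LieAlgebra ℂ 𝔤] {c : ConfCoords m 𝔤}
  {F : Type} [AddCommGroup F] [Module ℂ F]
  {σ : Matrix (Fin m) (Fin m) ℂ →ₗ[ℂ] Module.End ℂ F} {μ : ℂ}
  {X : Type} [AddCommGroup X] [Module ℂ X] [LieRingModule 𝔤 X] [LieModule ℂ 𝔤 X]
  (e : X ≃ₗ[ℂ] PolyTensor m F) (he : ∀ (A : 𝔤) z, e ⁅A, z⁆ = modelAct σ μ c A (e z))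

theorem sub_natCast_injective (μ : ℂ) : Function.Injective fun d : ℕ => μ - (d : ℂ) :=
  fun a b h => by simpa using h

include he

/-- The homogeneous components are eigenvectors of H for the distinct eigenvalues μ - d, so every
submodule is graded. -/
theorem homogeneous_mem (N : LieSubmodule ℂ 𝔤 X) {x : X} (hx : x ∈ N) :
    ∃ (k : ℕ) (v : ℕ → X), (∀ d, e (v d) ∈ degSpace m F d) ∧ x = ∑ d ∈ Finset.range k, v d ∧
      ∀ d < k, v d ∈ N := by
  obtain ⟨k, w, hw, hs⟩ := exists_sum_degSpace (e x)
  have hs' : x = ∑ d ∈ Finset.range k, e.symm (w d) := by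
    rw [← map_sum, ← hs, e.symm_apply_apply]
  refine ⟨k, fun d => e.symm (w d), fun d => by rw [e.apply_symm_apply]; exact hw d, hs', ?_⟩
  refine mem_of_sum_range_mem (LieModule.toEnd ℂ 𝔤 X c.H) N.toSubmodule
    (fun x hx => N.lie_mem hx) (fun d => μ - d) (sub_natCast_injective μ) k _ (fun d => ?_)
    (by rw [← hs']; exact hx)
  apply e.injective
  change e ⁅c.H, e.symm (w d)⁆ = _
  rw [he, modelAct_H, e.apply_symm_apply, map_smul, e.apply_symm_apply, hOp_degSpace μ (hw d)]

/-- A vector of least degree in which `N'` exceeds `N`. If that degree is positive, every X_i sends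
it into `N`; this drives both irreducibility, with `N` zero, and finite length. -/
theorem exists_homogeneous {N N' : LieSubmodule ℂ 𝔤 X} (h : ¬N' ≤ N) :
    ∃ d x, x ∈ N' ∧ x ∉ N ∧ e x ∈ degSpace m F d ∧
      ∀ d' < d, ∀ y ∈ N', e y ∈ degSpace m F d' → y ∈ N := by
  classical
  have hex : ∃ d x, x ∈ N' ∧ x ∉ N ∧ e x ∈ degSpace m F d := by
    obtain ⟨x, hx, hxN⟩ := SetLike.not_le_iff_exists.1 h
    obtain ⟨k, v, hv, rfl, hv'⟩ := homogeneous_mem e he N' hx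
    by_contra hne
    refine hxN (sum_mem fun d hd => ?_)
    by_contra hd'
    exact hne ⟨d, v d, hv' d (Finset.mem_range.1 hd), hd', hv d⟩
  obtain ⟨x, hx, hxN, hxd⟩ := Nat.find_spec hex
  refine ⟨Nat.find hex, x, hx, hxN, hxd, fun d' hd' y hy hyd => ?_⟩
  by_contra hyN
  exact Nat.find_min hex hd' ⟨y, hy, hyN, hyd⟩

theorem hasWeights_of_model : HasWeights c.H (Set.range fun d : ℕ => μ - (d : ℂ)) X := by
  classical
  intro x
  obtain ⟨k, v, hv, hx, -⟩ := homogeneous_mem e he ⊤ (LieSubmodule.mem_top x)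
  have ha := sub_natCast_injective μ
  refine ⟨(Finset.range k).image fun d : ℕ => μ - (d : ℂ),
    Function.extend (fun d : ℕ => μ - (d : ℂ)) v 0, fun w hw => ?_, ?_⟩
  · obtain ⟨d, -, rfl⟩ := Finset.mem_image.1 hw
    refine ⟨⟨d, rfl⟩, ?_⟩
    rw [ha.extend_apply v 0 d]
    apply e.injective
    rw [he, modelAct_H, hOp_degSpace μ (hv d), map_smul]
  · rw [Finset.sum_image fun x _ y _ h => ha h, hx]
    exact Finset.sum_congr rfl fun d _ => (ha.extend_apply v 0 d).symm

theorem lie_X_mem (i : Fin m) {d : ℕ} {x : X} (hx : e x ∈ degSpace m F d) :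
    e ⁅c.X i, x⁆ ∈ degSpace m F (d - 1) := by
  rw [he, modelAct_X]
  exact xOp_mem_degSpace σ μ hx i

/-- The nilradical acts locally finitely. -/
theorem nil_finite_of_model [FiniteDimensional ℂ F] (x : X) :
    ∃ W : Submodule ℂ X, FiniteDimensional ℂ W ∧ x ∈ W ∧
      ∀ A : 𝔤, c.y A = 0 → c.a A = 0 → c.B A = 0 → ∀ w ∈ W, ⁅A, w⁆ ∈ W := by
  obtain ⟨k, v, hv, hx⟩ := exists_sum_degSpace (e x)
  let W := (⨆ d : Fin k, degSpace m F d).comap e.toLinearMap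
  have hW : ∀ x, x ∈ W ↔ e x ∈ ⨆ d : Fin k, degSpace m F d := fun x => Iff.rfl
  refine ⟨W, ?_, ?_, ?_⟩
  · exact Module.Finite.of_injective (e.toLinearMap.restrict fun x hx => (hW x).1 hx)
      fun x y h => Subtype.ext (e.injective (congrArg Subtype.val h))
  · rw [hW, hx]
    exact sum_mem fun d hd => Submodule.mem_iSup_of_mem (⟨d, Finset.mem_range.1 hd⟩ : Fin k) (hv d)
  · intro A h1 h2 h3 w hw
    rw [hW] at hw ⊢
    rw [he, modelAct_apply, h1, h2, h3]
    simp only [zero_smul, Pi.zero_apply, Finset.sum_const_zero, map_zero, add_zero, zero_add,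
      LinearMap.sum_apply, LinearMap.smul_apply]
    refine sum_mem fun i _ => Submodule.smul_mem _ _ ?_
    refine Submodule.iSup_induction _ (motive := fun u => xOp σ μ i u ∈ _)
      hw (fun d u hu => ?_) (by simp)
      (fun u u' h h' => by rw [map_add]; exact add_mem h h')
    exact Submodule.mem_iSup_of_mem (⟨d - 1, by omega⟩ : Fin k) (xOp_mem_degSpace σ μ hu i)

/-- Generic generalized Verma modules are irreducible. -/
theorem irreducible_of_model [Nontrivial F] (j : F →ₗ[ℂ] Spinor m) (hj : Function.Injective j)
    (hjσ : ∀ B : Matrix (Fin m) (Fin m) ℂ, (∀ i j, B i j = -B j i) →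
      ∀ v, j (σ B v) = spinAct m B (j v))
    (hF : ∀ W : Submodule ℂ F, (∀ B : Matrix (Fin m) (Fin m) ℂ, (∀ i j, B i j = -B j i) →
      ∀ w ∈ W, σ B w ∈ W) → W ≠ ⊥ → W = ⊤)
    (h1 : ∀ k : ℕ, 1 ≤ k → 2 * μ + m ≠ k) (h2 : ∀ k : ℕ, μ + m - 3 / 2 ≠ k) :
    LieModule.IsIrreducible ℂ 𝔤 X := by
  have hinj : Function.Injective fun v : F => e.symm (pt 1 v) := by
    intro v w h
    have h' : pt (1 : MvPolynomial (Fin m) ℂ) v = pt 1 w := e.symm.injective h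
    -- Evaluation of the polynomial at the origin recovers the constant, so F embeds in the module.
    have := congrArg (ptLift (m := m) (F := F) ((LinearMap.lsmul ℂ F).comp
      (MvPolynomial.aeval (fun _ => (0 : ℂ))).toLinearMap)) h'
    rw [ptLift_pt, ptLift_pt] at this
    simpa using this
  have : Nontrivial X := hinj.nontrivial
  refine LieModule.IsIrreducible.mk fun N hN => ?_
  obtain ⟨d, x, hx, hx0, hxd, hmin⟩ := exists_homogeneous e he (N := ⊥) (N' := N)
    (fun h => hN (le_bot_iff.1 h))
  rw [LieSubmodule.mem_bot] at hx0
  have hX : d ≠ 0 → ∀ i, ⁅c.X i, x⁆ = 0 := fun hd i =>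
    (LieSubmodule.mem_bot _).1 (hmin (d - 1) (by omega) _ (N.lie_mem hx) (lie_X_mem e he i hxd))
  rcases d with _ | d
  swap
  -- A lowest vector of positive degree is singular. Mapping values to the full spinors by `j`
  -- brings it within the reach of `eq_zero_of_xOp_eq_zero`.
  · refine absurd ?_ hx0
    apply e.injective
    rw [map_zero]
    apply ptMap_injective j hj
    rw [map_zero]
    refine eq_zero_of_xOp_eq_zero μ h1 h2 (ptMap_mem_degSpace j hxd) fun i => ?_
    rw [← ptMap_x j hjσ, ← modelAct_X σ μ c, ← he, hX (Nat.succ_ne_zero d), map_zero, map_zero]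
  obtain ⟨v, hv⟩ := hxd
  -- The constants in `N` form a subspace stable under rotations, hence are all of F, and F
  -- generates the module under the Y_i.
  let W : Submodule ℂ F := N.toSubmodule.comap (e.symm.toLinearMap ∘ₗ ptOne m F)
  have hW : W = ⊤ := by
    refine hF W (fun B hB w hw => ?_) fun h => ?_
    · obtain ⟨A, hA1, hA2, hA3, hA4⟩ := c.surj 0 0 0 B hB
      change e.symm (pt 1 (σ B w)) ∈ N
      have : e.symm (pt 1 (σ B w)) = ⁅A, e.symm (pt 1 w)⁆ := by
        apply e.injective
        rw [he, e.apply_symm_apply, e.apply_symm_apply, modelAct_one, hA1, hA3, hA4]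
        simp
      rw [this]
      exact N.lie_mem hw
    · have hvW : v ∈ W := by
        change e.symm (ptOne m F v) ∈ N
        rw [hv, e.symm_apply_apply]
        exact hx
      rw [h, Submodule.mem_bot] at hvW
      rw [hvW, map_zero] at hv
      exact hx0 (e.injective (by rw [← hv, map_zero]))
  rw [eq_top_iff]
  intro z _
  have : ∀ u : PolyTensor m F, e.symm u ∈ N := by
    intro u
    induction u using polyTensor_induction with
    | add u w hu hw => rw [map_add]; exact add_mem hu hw
    | one v => exact (hW ▸ Submodule.mem_top : v ∈ W)
    | mul i u hu =>
      have : e.symm (yOp F i u) = ⁅c.Y i, e.symm u⁆ := by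
        apply e.injective
        rw [he, e.apply_symm_apply, e.apply_symm_apply, modelAct_Y]
      rw [this]
      exact N.lie_mem hu
  simpa using this (e z)

/-- A submodule is determined, relative to a larger one, by its part of degree at most D. Thus the
submodules map strictly monotonically to subspaces of a finite-dimensional space, which gives both
chain conditions. -/
theorem wellFounded_of_model_aux [FiniteDimensional ℂ F] (hZ : ∃ D : ℕ, ∀ d > D,
    ∀ v ∈ degSpace m F d, (∑ i, yOp F i * xOp σ μ i) v = 0 → v = 0) :
    WellFoundedLT (LieSubmodule ℂ 𝔤 X) ∧ WellFoundedGT (LieSubmodule ℂ 𝔤 X) := by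
  obtain ⟨D, hD⟩ := hZ
  let W : Submodule ℂ (PolyTensor m F) := ⨆ d : Fin (D + 1), degSpace m F d
  let f : LieSubmodule ℂ 𝔤 X → Submodule ℂ W := fun N =>
    (N.toSubmodule.comap e.symm.toLinearMap).comap W.subtype
  have hf : StrictMono f := by
    intro N N' hN
    refine lt_of_le_of_ne (fun x hx => hN.le hx) fun hff => ?_
    obtain ⟨d, x, hx, hxN, hxd, hmin⟩ := exists_homogeneous e he hN.not_ge
    by_cases hd : d ≤ D
    · have hxW : e x ∈ W :=
        Submodule.mem_iSup_of_mem (⟨d, Nat.lt_succ_of_le hd⟩ : Fin (D + 1)) hxd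
      have : (⟨e x, hxW⟩ : W) ∈ f N' := by
        change e.symm (e x) ∈ N'
        rwa [e.symm_apply_apply]
      rw [← hff] at this
      change e.symm (e x) ∈ N at this
      rw [e.symm_apply_apply] at this
      exact hxN this
    · push Not at hd
      let Z : PolyTensor m F →ₗ[ℂ] PolyTensor m F := ∑ i, yOp F i * xOp σ μ i
      have hZe : ∀ x, Z (e x) = e (∑ i, ⁅c.Y i, ⁅c.X i, x⁆⁆) := fun x => by
        rw [map_sum, LinearMap.sum_apply]
        refine Finset.sum_congr rfl fun i _ => ?_
        rw [he, he, modelAct_X, modelAct_Y]; rfl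
      have hZd : ∀ u ∈ degSpace m F d, Z u ∈ degSpace m F d := fun u hu => by
        rw [LinearMap.sum_apply]
        refine sum_mem fun i _ => ?_
        have := yOp_mem_degSpace (xOp_mem_degSpace σ μ hu i) i
        rwa [Nat.sub_add_cancel (by omega)] at this
      -- In degree d > D the operator Z = ∑ Y_i X_i is injective, hence bijective on the
      -- finite-dimensional degree d part K of N. The minimality of d puts Zx in K, so Zx = Zu with
      -- u in K, and injectivity forces x = u.
      let K : Submodule ℂ (PolyTensor m F) :=
        N.toSubmodule.comap e.symm.toLinearMap ⊓ degSpace m F d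
      have : FiniteDimensional ℂ K := Submodule.finiteDimensional_of_le inf_le_right
      have hZK : ∀ u ∈ K, Z u ∈ K := fun u hu => by
        refine ⟨?_, hZd u hu.2⟩
        change e.symm (Z u) ∈ N
        have hu1 : e.symm u ∈ N := hu.1
        rw [← e.apply_symm_apply u, hZe, e.symm_apply_apply]
        exact sum_mem fun i _ => N.lie_mem (N.lie_mem hu1)
      have hsurj : Function.Surjective (Z.restrict hZK) := by
        apply LinearMap.surjective_of_injective
        rw [← LinearMap.ker_eq_bot, LinearMap.ker_eq_bot']
        intro u hu
        exact Subtype.ext (hD d hd u u.2.2 (congrArg Subtype.val hu))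
      have hZx : Z (e x) ∈ K := by
        refine ⟨?_, hZd _ hxd⟩
        change e.symm (Z (e x)) ∈ N
        rw [hZe, e.symm_apply_apply]
        exact sum_mem fun i _ => N.lie_mem
          (hmin (d - 1) (by omega) _ (N'.lie_mem hx) (lie_X_mem e he i hxd))
      obtain ⟨u, hu⟩ := hsurj ⟨_, hZx⟩
      have hu' : Z (u : PolyTensor m F) = Z (e x) := congrArg Subtype.val hu
      have : e x - u = 0 := hD d hd _ (sub_mem hxd u.2.2) (by
        change Z _ = 0
        rw [map_sub, hu', sub_self])
      have hux : e.symm (u : PolyTensor m F) ∈ N := u.2.1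
      rw [← sub_eq_zero.1 this, e.symm_apply_apply] at hux
      exact hxN hux
  exact ⟨hf.wellFoundedLT, hf.wellFoundedGT⟩

end ModelModule

section ModelSpinor

variable {m : ℕ} {𝔤 : Type} [LieRing 𝔤] [LieAlgebra ℂ 𝔤] {c : ConfCoords m 𝔤} {μ : ℂ}
  {X : Type} [AddCommGroup X] [Module ℂ X] [LieRingModule 𝔤 X] [LieModule ℂ 𝔤 X]
  (e : X ≃ₗ[ℂ] PolyTensor m (Spinor m))
  (he : ∀ (A : 𝔤) z, e ⁅A, z⁆ = modelAct (spinAct m) μ c A (e z))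

include he

/-- Generalized Verma modules induced from spinors have finite length. -/
theorem wellFounded_of_model :
    WellFoundedLT (LieSubmodule ℂ 𝔤 X) ∧ WellFoundedGT (LieSubmodule ℂ 𝔤 X) :=
  wellFounded_of_model_aux e he (exists_sum_yOp_xOp_ne_zero μ)

end ModelSpinor

/-! ### Sums of irreducible submodules -/

section SumIrreducible

variable {𝔩 : Type} [LieRing 𝔩] [LieAlgebra ℂ 𝔩] {X X' : Type}
  [AddCommGroup X] [Module ℂ X] [LieRingModule 𝔩 X] [LieModule ℂ 𝔩 X]
  [AddCommGroup X'] [Module ℂ X'] [LieRingModule 𝔩 X'] [LieModule ℂ 𝔩 X']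

/-- The sum of all finite-dimensional irreducible submodules. -/
def finSocle (𝔩 X : Type) [LieRing 𝔩] [LieAlgebra ℂ 𝔩] [AddCommGroup X] [Module ℂ X]
    [LieRingModule 𝔩 X] : LieSubmodule ℂ 𝔩 X :=
  sSup {Y : LieSubmodule ℂ 𝔩 X | FiniteDimensional ℂ Y ∧ LieModule.IsIrreducible ℂ 𝔩 Y}

theorem isIrreducible_of_forall {N : LieSubmodule ℂ 𝔩 X} (h0 : N ≠ ⊥)
    (h : ∀ U ≤ N, U = ⊥ ∨ U = N) : LieModule.IsIrreducible ℂ 𝔩 N := by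
  have : Nontrivial N := (LieSubmodule.nontrivial_iff_ne_bot ℂ 𝔩 X).2 h0
  refine LieModule.IsIrreducible.mk fun U hU => ?_
  have hle : U.map N.incl ≤ N := by
    rintro _ ⟨u, -, rfl⟩
    exact u.2
  rcases h _ hle with h | h
  · refine absurd ((LieSubmodule.eq_bot_iff U).2 fun u hu => ?_) hU
    have : N.incl u ∈ U.map N.incl := ⟨u, hu, rfl⟩
    rw [h, LieSubmodule.mem_bot] at this
    exact Subtype.ext this
  · rw [eq_top_iff]
    intro u _
    have hu : (u : X) ∈ U.map N.incl := by rw [h]; exact u.2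
    obtain ⟨w, hw, e⟩ := hu
    have : w = u := Subtype.ext e
    exact this ▸ hw

/-- Complete reducibility by induction on dimension: a submodule that is neither zero nor
irreducible is the sum of two proper ones. -/
theorem le_finSocle (D : LieSubmodule ℂ 𝔩 X) [hD : FiniteDimensional ℂ D]
    (h : ∀ N ≤ D, ∀ U ≤ N, ∃ U' ≤ N, U ⊔ U' = N ∧ U ⊓ U' = ⊥) : D ≤ finSocle 𝔩 X := by
  have hfin : ∀ N ≤ D, FiniteDimensional ℂ N := fun N hN =>
    Submodule.finiteDimensional_of_le (S₂ := D.toSubmodule) hN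
  suffices key : ∀ k : ℕ, ∀ N ≤ D, Module.finrank ℂ N ≤ k → N ≤ finSocle 𝔩 X from
    key _ D le_rfl le_rfl
  intro k
  induction k with
  | zero =>
    intro N hN hk
    have := hfin N hN
    have h0 : N.toSubmodule = ⊥ := Submodule.finrank_eq_zero.1 (Nat.le_zero.1 hk)
    intro x hx
    have hx' : x ∈ N.toSubmodule := hx
    rw [h0, Submodule.mem_bot] at hx'
    rw [hx']
    exact zero_mem _
  | succ k ih =>
    intro N hN hk
    have := hfin N hN
    by_cases hirr : ∀ U ≤ N, U = ⊥ ∨ U = N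
    · by_cases h0 : N = ⊥
      · rw [h0]; exact bot_le
      · exact le_sSup ⟨hfin N hN, isIrreducible_of_forall h0 hirr⟩
    · push Not at hirr
      obtain ⟨U, hU, hU0, hUN⟩ := hirr
      obtain ⟨U', hU', hsup, hinf⟩ := h N hN U hU
      have hlt : ∀ V ≤ N, V ≠ N → V ≤ finSocle 𝔩 X := fun V hV hne => by
        have hVN : V.toSubmodule < N.toSubmodule :=
          lt_of_le_of_ne hV fun e => hne (LieSubmodule.toSubmodule_injective e)
        have := Submodule.finrank_lt_finrank_of_lt hVN
        exact ih V (hV.trans hN) (by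
          have h1 : Module.finrank ℂ V < Module.finrank ℂ N := this
          omega)
      rw [← hsup]
      refine sup_le (hlt U hU hUN) (hlt U' hU' fun e => hU0 ?_)
      rw [← hinf, e, inf_eq_left.2 hU]

/-- The image of an irreducible submodule is zero or irreducible. -/
theorem map_mem_finSocle (f : X →ₗ⁅ℂ,𝔩⁆ X') {x : X} (hx : x ∈ finSocle 𝔩 X) :
    f x ∈ finSocle 𝔩 X' := by
  suffices h : finSocle 𝔩 X ≤ (finSocle 𝔩 X').comap f from h hx
  refine sSup_le fun Y hY => ?_
  obtain ⟨hfin, hirr⟩ := hY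
  by_cases h0 : Y.map f = ⊥
  · intro y hy
    have : f y ∈ Y.map f := ⟨y, hy, rfl⟩
    rw [h0, LieSubmodule.mem_bot] at this
    change f y ∈ finSocle 𝔩 X'
    rw [this]
    exact zero_mem _
  · refine LieSubmodule.map_le_iff_le_comap.1 (le_sSup ⟨?_, isIrreducible_of_forall h0 ?_⟩)
    · exact inferInstanceAs (FiniteDimensional ℂ (Y.toSubmodule.map f.toLinearMap))
    · intro U hU
      rcases IsSimpleOrder.eq_bot_or_eq_top ((U.comap f).comap Y.incl) with h | h
      · left
        rw [LieSubmodule.eq_bot_iff]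
        intro u hu
        obtain ⟨y, hy, rfl⟩ := hU hu
        have : (⟨y, hy⟩ : Y) ∈ (U.comap f).comap Y.incl := hu
        rw [h, LieSubmodule.mem_bot] at this
        rw [show y = 0 from congrArg Subtype.val this]
        exact map_zero f
      · right
        refine le_antisymm hU ?_
        rintro _ ⟨y, hy, rfl⟩
        have : (⟨y, hy⟩ : Y) ∈ (U.comap f).comap Y.incl := h ▸ LieSubmodule.mem_top _
        exact this

end SumIrreducible

/-! ### The Fischer form -/

section Fischer

theorem exists_orthogonal {V : Type} [AddCommGroup V] [Module ℂ V] [FiniteDimensional ℂ V]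
    (core : InnerProductSpace.Core ℂ V) (U : Submodule ℂ V) (x : V) :
    ∃ u ∈ U, ∀ w ∈ U, core.inner w (x - u) = 0 := by
  let _ : NormedAddCommGroup V := core.toNormedAddCommGroup
  let _ : InnerProductSpace ℂ V := InnerProductSpace.ofCore core.toCore
  have : x ∈ U ⊔ Uᗮ := by
    rw [Submodule.sup_orthogonal_of_hasOrthogonalProjection]; exact Submodule.mem_top
  obtain ⟨u, hu, w, hw, rfl⟩ := Submodule.mem_sup.1 this
  refine ⟨u, hu, fun z hz => ?_⟩
  rw [add_sub_cancel_left]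
  exact hw z hz

open scoped ComplexOrder

variable {m : ℕ}

/-- The constant term of a polynomial. -/
def ptConst (m : ℕ) (F : Type) [AddCommGroup F] [Module ℂ F] : PolyTensor m F →ₗ[ℂ] F :=
  ptLift ((LinearMap.lsmul ℂ F).comp
    (MvPolynomial.aeval (R := ℂ) (fun _ : Fin m => (0 : ℂ))).toLinearMap)

theorem ptConst_pt_one {F : Type} [AddCommGroup F] [Module ℂ F] (v : F) :
    ptConst m F (pt 1 v) = v := by
  rw [ptConst, ptLift_pt]
  simp

/-- The Fischer form on spinor-valued polynomials of degree `d`, for which multiplication by a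
variable is adjoint to differentiation up to a factor. -/
def fischer (m : ℕ) : ℕ → PolyTensor m (Spinor m) → PolyTensor m (Spinor m) →ₗ[ℂ] ℂ
  | 0 => fun u => ∑ s, (starRingEnd ℂ (ptConst m (Spinor m) u s)) •
      (LinearMap.proj s ∘ₗ ptConst m (Spinor m))
  | d + 1 => fun u => ∑ i, fischer m d (dOp (Spinor m) i u) ∘ₗ dOp (Spinor m) i

theorem fischer_zero (u w : PolyTensor m (Spinor m)) : fischer m 0 u w
    = ∑ s, starRingEnd ℂ (ptConst m (Spinor m) u s) * ptConst m (Spinor m) w s := by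
  simp [fischer, LinearMap.sum_apply]

theorem fischer_succ (d : ℕ) (u w : PolyTensor m (Spinor m)) : fischer m (d + 1) u w
    = ∑ i, fischer m d (dOp (Spinor m) i u) (dOp (Spinor m) i w) := by
  simp [fischer, LinearMap.sum_apply]

theorem fischer_conj (d : ℕ) (u w : PolyTensor m (Spinor m)) :
    starRingEnd ℂ (fischer m d u w) = fischer m d w u := by
  induction d generalizing u w with
  | zero =>
    rw [fischer_zero, fischer_zero, map_sum]
    exact Finset.sum_congr rfl fun s _ => by rw [map_mul, Complex.conj_conj, mul_comm]
  | succ d ih =>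
    rw [fischer_succ, fischer_succ, map_sum]
    exact Finset.sum_congr rfl fun i _ => ih _ _

theorem fischer_add_left (d : ℕ) (u u' w : PolyTensor m (Spinor m)) :
    fischer m d (u + u') w = fischer m d u w + fischer m d u' w := by
  rw [← fischer_conj, map_add, map_add, fischer_conj, fischer_conj]

theorem fischer_smul_left (d : ℕ) (t : ℂ) (u w : PolyTensor m (Spinor m)) :
    fischer m d (t • u) w = starRingEnd ℂ t * fischer m d u w := by
  rw [← fischer_conj, map_smul, smul_eq_mul, map_mul, fischer_conj]

theorem fischer_sum_left {ι : Type} (s : Finset ι) (d : ℕ) (u : ι → PolyTensor m (Spinor m))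
    (w : PolyTensor m (Spinor m)) : fischer m d (∑ i ∈ s, u i) w = ∑ i ∈ s, fischer m d (u i) w := by
  rw [← fischer_conj, map_sum, map_sum]
  exact Finset.sum_congr rfl fun i _ => fischer_conj _ _ _

theorem fischer_self_nonneg (d : ℕ) (u : PolyTensor m (Spinor m)) : 0 ≤ fischer m d u u := by
  induction d generalizing u with
  | zero =>
    rw [fischer_zero]
    exact Finset.sum_nonneg fun s _ => by
      rw [mul_comm, Complex.mul_conj]
      exact_mod_cast Complex.normSq_nonneg _
  | succ d ih =>
    rw [fischer_succ]
    exact Finset.sum_nonneg fun i _ => ih _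

/-- The form for degree d is definite only on that degree: a vanishing square makes all partial
derivatives vanish, and Euler's identity with d > 0 then kills the polynomial. -/
theorem fischer_self_eq_zero {d : ℕ} {u : PolyTensor m (Spinor m)}
    (hu : u ∈ degSpace m (Spinor m) d) (h : fischer m d u u = 0) : u = 0 := by
  induction d generalizing u with
  | zero =>
    obtain ⟨v, rfl⟩ := hu
    change fischer m 0 (pt 1 v) (pt 1 v) = 0 at h
    rw [fischer_zero, ptConst_pt_one, Finset.sum_eq_zero_iff_of_nonneg fun s _ => by
      rw [mul_comm, Complex.mul_conj]
      exact_mod_cast Complex.normSq_nonneg _] at h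
    have : v = 0 := by
      funext s
      have hs := h s (Finset.mem_univ s)
      rw [mul_comm, Complex.mul_conj] at hs
      exact Complex.normSq_eq_zero.1 (by exact_mod_cast hs)
    rw [this, map_zero]
  | succ d ih =>
    rw [fischer_succ, Finset.sum_eq_zero_iff_of_nonneg fun i _ => fischer_self_nonneg _ _] at h
    have hd : ∀ i, dOp (Spinor m) i u = 0 := fun i =>
      ih (dOp_mem_degSpace hu i) (h i (Finset.mem_univ i))
    have e := euler_degSpace hu
    rw [euler, LinearMap.sum_apply, Finset.sum_eq_zero fun i _ => by
      rw [Module.End.mul_apply, hd, map_zero]] at e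
    refine (smul_eq_zero.1 e.symm).resolve_left ?_
    exact_mod_cast Nat.succ_ne_zero d

/-- The Fischer form as an inner product. -/
@[reducible] def fischerCore (m d : ℕ) : InnerProductSpace.Core ℂ (degSpace m (Spinor m) d) where
  inner u w := fischer m d u.1 w.1
  conj_inner_symm _ _ := fischer_conj d _ _
  re_inner_nonneg u := (Complex.le_def.1 (fischer_self_nonneg d u.1)).1
  add_left _ _ _ := fischer_add_left d _ _ _
  smul_left _ _ _ := fischer_smul_left d _ _ _
  definite u h := Subtype.ext (fischer_self_eq_zero u.2 h)

/-- The generators are self-adjoint for the standard inner product: reindex by the flip. For odd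
indices the change of sign under the flip compensates the conjugation of √-1. -/
theorem gamma_adjoint (k : ℕ) (i : Fin k) (f g : Spinor k) :
    ∑ s, starRingEnd ℂ (gamma k i f s) * g s = ∑ s, starRingEnd ℂ (f s) * gamma k i g s := by
  have hfs : ∀ (s : Fin (k / 2) → Bool) a, starRingEnd ℂ (fockSign s a) = fockSign s a :=
    fun s a => by rcases fockSign_eq_or s a with h | h <;> rw [h] <;> simp
  let φ : (Fin (k / 2) → Bool) ≃ (Fin (k / 2) → Bool) :=
    ⟨fun s => flip s (i / 2), fun s => flip s (i / 2), fun s => flip_flip _ _, fun s => flip_flip _ _⟩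
  rw [← Equiv.sum_comp φ]
  refine Finset.sum_congr rfl fun s _ => ?_
  change starRingEnd ℂ (gamma k i f (flip s (i / 2))) * g (flip s (i / 2)) = _
  rw [gamma_apply, gamma_apply, flip_flip, map_mul, map_mul, hfs]
  have hi := i.2
  by_cases h : Even (i : ℕ)
  · rw [fockSign_flip_ge _ _ _ (by grind)]
    simp only [h, if_true, map_one]
    ring
  · rw [fockSign_flip_lt _ _ _ (by grind) (by grind)]
    simp only [h, if_false, Complex.conj_I]
    ring

theorem spinAct_dot (k : ℕ) (B : Matrix (Fin k) (Fin k) ℂ) (f g : Spinor k) :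
    ∑ s, starRingEnd ℂ (f s) * spinAct k B g s
      = ∑ i, ∑ j, B i j / 4 * ∑ s, starRingEnd ℂ (f s) * gamma k i (gamma k j g) s := by
  have hval : ∀ s, spinAct k B g s = ∑ i, ∑ j, B i j / 4 * gamma k i (gamma k j g) s := fun s => by
    change (∑ i, ∑ j, (B i j / 4) • (gamma k i * gamma k j)) g s = _
    simp [LinearMap.sum_apply, Finset.sum_apply]
  simp only [hval, Finset.mul_sum]
  rw [Finset.sum_comm]
  refine Finset.sum_congr rfl fun i _ => ?_
  rw [Finset.sum_comm]
  exact Finset.sum_congr rfl fun j _ => Finset.sum_congr rfl fun s _ => by ring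

/-- The adjoint of the action of B is minus that of its complex conjugate, since taking adjoints
reverses the product γ_i γ_j and B is skew. Real skew matrices thus act skew-adjointly. -/
theorem spinAct_adjoint (k : ℕ) (B B' : Matrix (Fin k) (Fin k) ℂ) (hB : ∀ i j, B i j = -B j i)
    (hB' : ∀ i j, B' i j = starRingEnd ℂ (B i j)) (f g : Spinor k) :
    ∑ s, starRingEnd ℂ (spinAct k B' f s) * g s
      = -∑ s, starRingEnd ℂ (f s) * spinAct k B g s := by
  have hconj : ∀ f g : Spinor k, ∑ s, starRingEnd ℂ (f s) * g s
      = starRingEnd ℂ (∑ s, starRingEnd ℂ (g s) * f s) := fun f g => by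
    rw [map_sum]
    exact Finset.sum_congr rfl fun s _ => by rw [map_mul, Complex.conj_conj, mul_comm]
  rw [hconj, spinAct_dot, spinAct_dot, map_sum, ← Finset.sum_neg_distrib]
  simp only [map_sum, ← Finset.sum_neg_distrib]
  rw [Finset.sum_comm]
  refine Finset.sum_congr rfl fun i _ => Finset.sum_congr rfl fun j _ => ?_
  rw [map_mul, ← hconj, gamma_adjoint, gamma_adjoint, hB', map_div₀, Complex.conj_conj, hB i j,
    map_ofNat]
  ring

theorem dOp_mOp {F : Type} [AddCommGroup F] [Module ℂ F]
    (σ : Matrix (Fin m) (Fin m) ℂ →ₗ[ℂ] Module.End ℂ F) (B : Matrix (Fin m) (Fin m) ℂ) (l : Fin m)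
    (u : PolyTensor m F) :
    dOp F l (mOp σ B u) = mOp σ B (dOp F l u) + ∑ i, B l i • dOp F i u := by
  have hw := weylRel m F
  have h1 : dOp F l * vecField (yOp F) (dOp F) B
      = vecField (yOp F) (dOp F) B * dOp F l + ∑ i, B l i • dOp F i := by
    have : ∀ k i, dOp F l * (yOp F k * dOp F i)
        = yOp F k * dOp F i * dOp F l + if l = k then dOp F i else 0 := fun k i => by
      rw [← mul_assoc, hw.dy, add_mul, mul_assoc, hw.dd l i, mul_assoc]
      split_ifs <;> simp
    simp only [vecField, Finset.sum_mul, Finset.mul_sum, smul_mul_assoc, mul_smul_comm, this,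
      smul_add, Finset.sum_add_distrib, smul_ite, smul_zero]
    congr 1
    rw [Finset.sum_comm]
    simp
  have h2 := LinearMap.congr_fun h1 u
  have h3 := LinearMap.congr_fun (sOp_d (σ B) l) u
  simp only [Module.End.mul_apply, LinearMap.add_apply, LinearMap.sum_apply,
    LinearMap.smul_apply] at h2 h3
  change dOp F l ((vecField (yOp F) (dOp F) B + sOp m (σ B)) u)
    = (vecField (yOp F) (dOp F) B + sOp m (σ B)) (dOp F l u) + _
  rw [LinearMap.add_apply, LinearMap.add_apply, map_add, h2, h3]
  abel

/-- Induction through the partial derivatives: the extra terms in the commutator of d_l with a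
rotation on the two sides match by skewness of B. -/
theorem fischer_mOp {d : ℕ} {u w : PolyTensor m (Spinor m)} (hu : u ∈ degSpace m (Spinor m) d)
    (hw : w ∈ degSpace m (Spinor m) d) (B B' : Matrix (Fin m) (Fin m) ℂ)
    (hB : ∀ i j, B i j = -B j i) (hB' : ∀ i j, B' i j = starRingEnd ℂ (B i j)) :
    fischer m d (mOp (spinAct m) B' u) w = -fischer m d u (mOp (spinAct m) B w) := by
  induction d generalizing u w with
  | zero =>
    obtain ⟨f, rfl⟩ := hu
    obtain ⟨g, rfl⟩ := hw
    change fischer m 0 (mOp (spinAct m) B' (pt 1 f)) (pt 1 g)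
      = -fischer m 0 (pt 1 f) (mOp (spinAct m) B (pt 1 g))
    rw [mOp_one, mOp_one, fischer_zero, fischer_zero]
    simp only [ptConst_pt_one]
    exact spinAct_adjoint m B B' hB hB' f g
  | succ d ih =>
    rw [fischer_succ, fischer_succ]
    simp only [dOp_mOp, fischer_add_left, map_add, Finset.sum_add_distrib, map_sum, map_smul,
      fischer_sum_left, fischer_smul_left, hB', Complex.conj_conj, neg_add, smul_eq_mul]
    congr 1
    · rw [← Finset.sum_neg_distrib]
      exact Finset.sum_congr rfl fun i _ => ih (dOp_mem_degSpace hu i) (dOp_mem_degSpace hw i)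
    · rw [Finset.sum_comm, ← Finset.sum_neg_distrib]
      refine Finset.sum_congr rfl fun i _ => ?_
      rw [← Finset.sum_neg_distrib]
      exact Finset.sum_congr rfl fun j _ => by rw [hB j i]; ring

variable {𝔤 : Type} [LieRing 𝔤] [LieAlgebra ℂ 𝔤] {c : ConfCoords m 𝔤} {μ : ℂ}
  {X : Type} [AddCommGroup X] [Module ℂ X] [LieRingModule 𝔤 X] [LieModule ℂ 𝔤 X]
  (e : X ≃ₗ[ℂ] PolyTensor m (Spinor m))
  (he : ∀ (A : 𝔤) z, e ⁅A, z⁆ = modelAct (spinAct m) μ c A (e z))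
  (L : LieSubalgebra ℂ 𝔤) (hL : ∀ A, A ∈ L ↔ c.x A = 0 ∧ c.y A = 0)

include he hL

theorem lie_levi (A : L) {d : ℕ} {x : X} (hx : e x ∈ degSpace m (Spinor m) d) : e ⁅A, x⁆
    = (c.a A * (μ - d)) • e x + mOp (spinAct m) (c.B A) (e x) := by
  obtain ⟨h1, h2⟩ := (hL A).1 A.2
  change e ⁅(A : 𝔤), x⁆ = _
  rw [he, modelAct_apply, h1, h2]
  simp [hOp_degSpace μ hx, smul_smul]

/-- Generalized Verma modules induced from spinors are semisimple over the Levi subalgebra. -/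
theorem finSocle_of_model : finSocle L X = ⊤ := by
  have hD : ∀ d, ∀ x, e x ∈ degSpace m (Spinor m) d → x ∈ finSocle L X := by
    intro d
    let D : LieSubmodule ℂ L X :=
      { (degSpace m (Spinor m) d).comap e.toLinearMap with
        lie_mem := fun {A x} hx => by
          change e ⁅A, x⁆ ∈ degSpace m (Spinor m) d
          rw [lie_levi e he L hL A hx]
          exact add_mem (Submodule.smul_mem _ _ hx) (mOp_mem_degSpace _ _ hx) }
    have hDmem : ∀ x, x ∈ D ↔ e x ∈ degSpace m (Spinor m) d := fun x => Iff.rfl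
    have : FiniteDimensional ℂ D := Module.Finite.of_injective
      (e.toLinearMap.restrict (p := D.toSubmodule) fun x hx => (hDmem x).1 hx)
      fun x y h => Subtype.ext (e.injective (congrArg Subtype.val h))
    suffices D ≤ finSocle L X from fun x hx => this hx
    refine le_finSocle D fun N hN U hU => ?_
    -- The orthogonal complement of U in N. The grading part acts by a scalar in a fixed degree, and
    -- the adjoint of the rotation part comes from the conjugate matrix, which is again realized in
    -- the Levi subalgebra and so preserves U.
    let U' : LieSubmodule ℂ L X :=
      { carrier := {x | x ∈ N ∧ ∀ w ∈ U, fischer m d (e w) (e x) = 0}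
        add_mem' := fun {x y} hx hy => ⟨add_mem hx.1 hy.1, fun w hw => by
          rw [map_add, map_add, hx.2 w hw, hy.2 w hw, add_zero]⟩
        zero_mem' := ⟨zero_mem _, fun w hw => by rw [map_zero, map_zero]⟩
        smul_mem' := fun t x hx => ⟨N.smul_mem t hx.1, fun w hw => by
          rw [map_smul, map_smul, hx.2 w hw, smul_zero]⟩
        lie_mem := fun {A x} hx => ⟨N.lie_mem hx.1, fun w hw => by
          have hxd := (hDmem x).1 (hN hx.1)
          have hwd := (hDmem w).1 (hN (hU hw))
          obtain ⟨C, hC1, hC2, hC3, hC4⟩ := c.surj 0 0 0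
            (Matrix.of fun i j => starRingEnd ℂ (c.B (A : 𝔤) i j)) (fun i j => by
              rw [Matrix.of_apply, Matrix.of_apply, c.skew, map_neg])
          have hwC := lie_levi e he L hL ⟨C, (hL C).2 ⟨hC2, hC3⟩⟩ hwd
          simp only [hC1, zero_mul, zero_smul, zero_add, hC4] at hwC
          have key := fischer_mOp hwd hxd (c.B (A : 𝔤))
            (Matrix.of fun i j => starRingEnd ℂ (c.B (A : 𝔤) i j)) (c.skew A) fun i j => rfl
          rw [lie_levi e he L hL A hxd, map_add, map_smul, hx.2 w hw, smul_zero, zero_add,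
            ← neg_eq_zero, ← key, ← hwC]
          exact hx.2 _ (U.lie_mem hw)⟩ }
    have hU' : U' ≤ N := fun x hx => hx.1
    refine ⟨U', hU', le_antisymm (sup_le hU hU') fun x hx => ?_, ?_⟩
    · obtain ⟨u, hu, hxu⟩ := exists_orthogonal (fischerCore m d)
        ((U.toSubmodule.comap e.symm.toLinearMap).comap (degSpace m (Spinor m) d).subtype)
        ⟨e x, hN hx⟩
      have huU : e.symm (u : PolyTensor m (Spinor m)) ∈ U := hu
      have : x = e.symm u + (x - e.symm u) := by abel
      rw [this]
      refine add_mem ((le_sup_left : U ≤ U ⊔ U') huU) ((le_sup_right : U' ≤ U ⊔ U') ⟨?_, ?_⟩)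
      · exact sub_mem hx (hU huU)
      · intro w hw
        have := hxu ⟨e w, hN (hU hw)⟩ (by
          change e.symm (e w) ∈ U
          rwa [e.symm_apply_apply])
        rw [map_sub, e.apply_symm_apply]
        exact this
    · rw [LieSubmodule.eq_bot_iff]
      intro x hx
      have hx1 : x ∈ U := ((LieSubmodule.mem_inf _ _ _).1 hx).1
      have hx2 : x ∈ U' := ((LieSubmodule.mem_inf _ _ _).1 hx).2
      apply e.injective
      rw [map_zero]
      exact fischer_self_eq_zero (hN (hU hx1)) (hx2.2 x hx1)
  rw [eq_top_iff]
  intro x _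
  obtain ⟨k, v, hv, rfl, -⟩ := homogeneous_mem e he ⊤ (LieSubmodule.mem_top x)
  exact sum_mem fun d _ => hD d _ (hv d)

end Fischer

/-! ### Objects of finite length in the parabolic category -/

section FiniteLength

variable {𝔤 : Type} [LieRing 𝔤] [LieAlgebra ℂ 𝔤] (L N : LieSubalgebra ℂ 𝔤)
  {A B C X X' : Type}
  [AddCommGroup A] [Module ℂ A] [LieRingModule 𝔤 A] [LieModule ℂ 𝔤 A]
  [AddCommGroup B] [Module ℂ B] [LieRingModule 𝔤 B] [LieModule ℂ 𝔤 B]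
  [AddCommGroup C] [Module ℂ C] [LieRingModule 𝔤 C] [LieModule ℂ 𝔤 C]
  [AddCommGroup X] [Module ℂ X] [LieRingModule 𝔤 X] [LieModule ℂ 𝔤 X]
  [AddCommGroup X'] [Module ℂ X'] [LieRingModule 𝔤 X'] [LieModule ℂ 𝔤 X']

/-- Every vector lies in a finite-dimensional subspace stable under `N`. -/
def LocallyFinite (X : Type) [AddCommGroup X] [Module ℂ X] [LieRingModule 𝔤 X] : Prop :=
  ∀ x : X, ∃ W : Submodule ℂ X, FiniteDimensional ℂ W ∧ x ∈ W ∧ ∀ a ∈ N, ∀ w ∈ W, ⁅a, w⁆ ∈ W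

/-- Objects of finite length of the parabolic category. -/
structure FiniteLengthObj (X : Type) [AddCommGroup X] [Module ℂ X] [LieRingModule 𝔤 X]
    [LieModule ℂ 𝔤 X] : Prop where
  wellFoundedLT : WellFoundedLT (LieSubmodule ℂ 𝔤 X)
  wellFoundedGT : WellFoundedGT (LieSubmodule ℂ 𝔤 X)
  socle : finSocle L X = ⊤
  nil_finite : LocallyFinite N X

theorem LocallyFinite.of_injective {N : LieSubalgebra ℂ 𝔤} (h : LocallyFinite N X)
    (f : X' →ₗ⁅ℂ,𝔤⁆ X) (hf : Function.Injective f) : LocallyFinite N X' := by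
  intro x
  obtain ⟨W, hW, hx, hN⟩ := h (f x)
  refine ⟨W.comap f.toLinearMap, ?_, hx, fun a ha w hw => ?_⟩
  · exact Module.Finite.of_injective
      ((f.toLinearMap.restrict (p := W.comap f.toLinearMap) (q := W) fun x hx => hx))
      fun x y e => Subtype.ext (hf (congrArg Subtype.val e))
  · change f ⁅a, w⁆ ∈ W
    rw [LieModuleHom.map_lie]
    exact hN a ha _ hw

theorem LocallyFinite.of_surjective {N : LieSubalgebra ℂ 𝔤} (h : LocallyFinite N X)
    (f : X →ₗ⁅ℂ,𝔤⁆ X') (hf : Function.Surjective f) : LocallyFinite N X' := by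
  intro x
  obtain ⟨x, rfl⟩ := hf x
  obtain ⟨W, hW, hx, hN⟩ := h x
  refine ⟨W.map f.toLinearMap, inferInstance, ⟨x, hx, rfl⟩, ?_⟩
  rintro a ha _ ⟨w, hw, rfl⟩
  exact ⟨⁅a, w⁆, hN a ha w hw, LieModuleHom.map_lie f a w⟩

/-- The restriction of a homomorphism to a subalgebra. -/
def restrictHom (f : X →ₗ⁅ℂ,𝔤⁆ X') : X →ₗ⁅ℂ,L⁆ X' :=
  { f.toLinearMap with map_lie' := fun {a x} => LieModuleHom.map_lie f (a : 𝔤) x }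

/-- A maximal finitely generated submodule exists by the ascending chain condition, and it contains
every vector, as otherwise it could be enlarged by one generator. -/
theorem exists_finset_lieSpan [WellFoundedGT (LieSubmodule ℂ 𝔤 X)] :
    ∃ s : Finset X, LieSubmodule.lieSpan ℂ 𝔤 (s : Set X) = ⊤ := by
  classical
  obtain ⟨M, ⟨s, rfl⟩, hM⟩ := WellFounded.has_min
    (wellFounded_gt (α := LieSubmodule ℂ 𝔤 X))
    (Set.range fun s : Finset X => LieSubmodule.lieSpan ℂ 𝔤 (s : Set X)) ⟨_, ∅, rfl⟩
  refine ⟨s, eq_top_iff.2 fun x _ => ?_⟩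
  by_contra hx
  refine hM _ ⟨insert x s, rfl⟩ (lt_of_le_of_ne (LieSubmodule.lieSpan_mono (by simp)) fun e => ?_)
  have hxs : x ∈ LieSubmodule.lieSpan ℂ 𝔤 ((insert x s : Finset X) : Set X) :=
    LieSubmodule.subset_lieSpan (by simp)
  change LieSubmodule.lieSpan ℂ 𝔤 (s : Set X) = LieSubmodule.lieSpan ℂ 𝔤 _ at e
  rw [← e] at hxs
  exact hx hxs

/-- A submodule of the middle term is compared through its trace on `A` and its image in `C`; nested
submodules that agree in both are equal. -/
theorem wellFounded_of_exact (i : A →ₗ⁅ℂ,𝔤⁆ B) (p : B →ₗ⁅ℂ,𝔤⁆ C)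
    (hip : ∀ b, p b = 0 → ∃ a, i a = b)
    (hA : WellFoundedLT (LieSubmodule ℂ 𝔤 A) ∧ WellFoundedGT (LieSubmodule ℂ 𝔤 A))
    (hC : WellFoundedLT (LieSubmodule ℂ 𝔤 C) ∧ WellFoundedGT (LieSubmodule ℂ 𝔤 C)) :
    WellFoundedLT (LieSubmodule ℂ 𝔤 B) ∧ WellFoundedGT (LieSubmodule ℂ 𝔤 B) := by
  obtain ⟨hA1, hA2⟩ := hA
  obtain ⟨hC1, hC2⟩ := hC
  let f : LieSubmodule ℂ 𝔤 B → LieSubmodule ℂ 𝔤 A × LieSubmodule ℂ 𝔤 C := fun M =>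
    (M.comap i, M.map p)
  have hf : StrictMono f := by
    intro M M' h
    refine lt_of_le_of_ne ⟨fun a ha => h.le ha, LieSubmodule.map_mono h.le⟩ fun e => h.not_ge ?_
    intro b hb
    have h1 : M.comap i = M'.comap i := congrArg Prod.fst e
    have h2 : M.map p = M'.map p := congrArg Prod.snd e
    have hpb : p b ∈ M.map p := h2 ▸ ⟨b, hb, rfl⟩
    obtain ⟨b', hb', e'⟩ := hpb
    have e'' : p b' = p b := e'
    obtain ⟨a, ha⟩ := hip (b - b') (by rw [map_sub, e'', sub_self])
    have haM : a ∈ M'.comap i := by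
      change i a ∈ M'
      rw [ha]
      exact sub_mem hb (h.le hb')
    rw [← h1] at haM
    have : i a ∈ M := haM
    rw [ha] at this
    simpa using add_mem this hb'
  exact ⟨hf.wellFoundedLT, hf.wellFoundedGT⟩

theorem wellFounded_of_subsingleton [Subsingleton X] :
    WellFoundedLT (LieSubmodule ℂ 𝔤 X) ∧ WellFoundedGT (LieSubmodule ℂ 𝔤 X) :=
  ⟨Finite.to_wellFoundedLT, Finite.to_wellFoundedGT⟩

variable {L N}

theorem FiniteLengthObj.of_surjective (h : FiniteLengthObj L N X) (f : X →ₗ⁅ℂ,𝔤⁆ X')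
    (hf : Function.Surjective f) : FiniteLengthObj L N X' := by
  have h1 := h.wellFoundedLT
  have h2 := h.wellFoundedGT
  have hs : StrictMono fun M : LieSubmodule ℂ 𝔤 X' => M.comap f := by
    intro M M' hM
    refine lt_of_le_of_ne (fun a ha => hM.le ha) fun e => hM.not_ge fun x hx => ?_
    obtain ⟨x, rfl⟩ := hf x
    have : x ∈ M'.comap f := hx
    change M.comap f = M'.comap f at e
    rw [← e] at this
    exact this
  refine ⟨hs.wellFoundedLT, hs.wellFoundedGT, ?_, h.nil_finite.of_surjective f hf⟩
  rw [eq_top_iff]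
  intro x _
  obtain ⟨x, rfl⟩ := hf x
  exact map_mem_finSocle (restrictHom L f) (h.socle ▸ LieSubmodule.mem_top x)

theorem FiniteLengthObj.inCatO (h : FiniteLengthObj L N X) : InCatO L N X :=
  have := h.wellFoundedGT
  ⟨exists_finset_lieSpan, h.socle, h.nil_finite⟩

theorem FiniteLengthObj.top (h : FiniteLengthObj L N X) :
    FiniteLengthObj L N (⊤ : LieSubmodule ℂ 𝔤 X) :=
  h.of_surjective ((LieModuleHom.id : X →ₗ⁅ℂ,𝔤⁆ X).codRestrict ⊤ fun _ => LieSubmodule.mem_top _)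
    fun x => ⟨x, rfl⟩

theorem FiniteLengthObj.hasClass (h : FiniteLengthObj L N X) : HasClass L N X := by
  have := h.wellFoundedLT
  have := h.wellFoundedGT
  obtain ⟨h1, h2⟩ := finite_mult_of_finite_length (X := X) L N
  refine ⟨⟨OrderHom.const ℕ ⊤, fun j => ⟨h.top.wellFoundedLT, h.top.wellFoundedGT, h.top.inCatO⟩,
    fun x => ⟨0, LieSubmodule.mem_top x⟩⟩, h1, ?_⟩
  refine (h2.subset fun T hT => ?_).countable
  intro e
  exact hT (by simp [ch, e])

end FiniteLength

/-! ### Filtrations that split as vector spaces -/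

section Filtration

variable {𝔤 : Type} [LieRing 𝔤] [LieAlgebra ℂ 𝔤] {X : Type}
  [AddCommGroup X] [Module ℂ X] [LieRingModule 𝔤 X] [LieModule ℂ 𝔤 X]
  {V : ℕ → Type} [∀ c, AddCommGroup (V c)] [∀ c, Module ℂ (V c)] [∀ c, LieRingModule 𝔤 (V c)]
  [∀ c, LieModule ℂ 𝔤 (V c)]

/-- The sum of the images of the first `b` maps. -/
def partialSum (emb : ∀ c, V c →ₗ[ℂ] X) (b : ℕ) : Submodule ℂ X :=
  ⨆ c : Fin b, LinearMap.range (emb c)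

/-- A vector space decomposition that is compatible with the action up to smaller terms. -/
structure Splitting (𝔤 : Type) [LieRing 𝔤] [LieAlgebra ℂ 𝔤] {X : Type}
    [AddCommGroup X] [Module ℂ X] [LieRingModule 𝔤 X]
    {V : ℕ → Type} [∀ c, AddCommGroup (V c)] [∀ c, Module ℂ (V c)] [∀ c, LieRingModule 𝔤 (V c)]
    (emb : ∀ c, V c →ₗ[ℂ] X) : Prop where
  bijective : Function.Bijective (DirectSum.toModule ℂ ℕ X emb)
  lie : ∀ (A : 𝔤) c z, ⁅A, emb c z⁆ - emb c ⁅A, z⁆ ∈ partialSum emb c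

theorem partialSum_mono (emb : ∀ c, V c →ₗ[ℂ] X) : Monotone (partialSum emb) := fun _ _ h =>
  iSup_le fun c => le_iSup (fun c : Fin _ => LinearMap.range (emb c)) (Fin.castLE h c)

theorem emb_mem_partialSum (emb : ∀ c, V c →ₗ[ℂ] X) {b c : ℕ} (h : c < b) (z : V c) :
    emb c z ∈ partialSum emb b :=
  Submodule.mem_iSup_of_mem (⟨c, h⟩ : Fin b) ⟨z, rfl⟩

theorem partialSum_induction (emb : ∀ c, V c →ₗ[ℂ] X) {b : ℕ} {p : X → Prop} (zero : p 0)
    (add : ∀ x y, p x → p y → p (x + y)) (mem : ∀ c < b, ∀ z, p (emb c z)) {x : X}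
    (hx : x ∈ partialSum emb b) : p x := by
  refine Submodule.iSup_induction _ (motive := p) hx ?_ zero add
  rintro c _ ⟨z, rfl⟩
  exact mem c c.2 z

theorem exists_of_mem_partialSum_succ (emb : ∀ c, V c →ₗ[ℂ] X) {b : ℕ} {x : X}
    (hx : x ∈ partialSum emb (b + 1)) : ∃ z, x - emb b z ∈ partialSum emb b := by
  refine partialSum_induction emb (p := fun x => ∃ z, x - emb b z ∈ partialSum emb b)
    ⟨0, by simp⟩ ?_ ?_ hx
  · rintro x y ⟨z, hz⟩ ⟨w, hw⟩
    exact ⟨z + w, by rw [map_add, add_sub_add_comm]; exact add_mem hz hw⟩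
  · intro c hc z
    rcases Nat.lt_succ_iff_lt_or_eq.1 hc with h | rfl
    · exact ⟨0, by rw [map_zero, sub_zero]; exact emb_mem_partialSum emb h z⟩
    · exact ⟨z, by rw [sub_self]; exact zero_mem _⟩

namespace Splitting

variable {emb : ∀ c, V c →ₗ[ℂ] X} (h : Splitting 𝔤 emb)

include h

theorem exists_mem (x : X) : ∃ b, x ∈ partialSum emb b := by
  classical
  obtain ⟨f, rfl⟩ := h.bijective.2 x
  induction f using DirectSum.induction_on with
  | zero => exact ⟨0, by rw [map_zero]; exact zero_mem _⟩
  | of c z =>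
    refine ⟨c + 1, ?_⟩
    change DirectSum.toModule ℂ ℕ X emb (DirectSum.lof ℂ ℕ V c z) ∈ _
    rw [DirectSum.toModule_lof]
    exact emb_mem_partialSum emb (Nat.lt_succ_self c) z
  | add f g hf hg =>
    obtain ⟨b, hb⟩ := hf
    obtain ⟨b', hb'⟩ := hg
    exact ⟨max b b', by
      rw [map_add]
      exact add_mem (partialSum_mono emb (le_max_left _ _) hb)
        (partialSum_mono emb (le_max_right _ _) hb')⟩

/-- Each summand has a projection that vanishes on the smaller summands. -/
theorem exists_proj (b : ℕ) : ∃ p : X →ₗ[ℂ] V b, (∀ z, p (emb b z) = z) ∧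
    ∀ c, c ≠ b → ∀ z, p (emb c z) = 0 := by
  classical
  let E := LinearEquiv.ofBijective (DirectSum.toModule ℂ ℕ X emb) h.bijective
  have hE : ∀ c z, E.symm (emb c z) = DirectSum.lof ℂ ℕ V c z := fun c z => by
    rw [LinearEquiv.symm_apply_eq]
    exact (DirectSum.toModule_lof ℂ c z).symm
  refine ⟨DirectSum.component ℂ ℕ V b ∘ₗ E.symm.toLinearMap, fun z => ?_, fun c hc z => ?_⟩
  · change DirectSum.component ℂ ℕ V b (E.symm (emb b z)) = z
    rw [hE, DirectSum.component.lof_self]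
  · change DirectSum.component ℂ ℕ V b (E.symm (emb c z)) = 0
    rw [hE, DirectSum.component.of, dif_neg hc]

theorem lie_mem (A : 𝔤) {b : ℕ} {x : X} (hx : x ∈ partialSum emb b) :
    ⁅A, x⁆ ∈ partialSum emb b := by
  refine partialSum_induction emb (p := fun x => ⁅A, x⁆ ∈ partialSum emb b) (by simp)
    (fun x y hx hy => by rw [lie_add]; exact add_mem hx hy) (fun c hc z => ?_) hx
  rw [← sub_add_cancel ⁅A, emb c z⁆ (emb c ⁅A, z⁆)]
  exact add_mem (partialSum_mono emb hc.le (h.lie A c z)) (emb_mem_partialSum emb hc _)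

/-- The filtration by submodules. -/
def filt : ℕ →o LieSubmodule ℂ 𝔤 X where
  toFun b := { partialSum emb b with lie_mem := fun {A _} hx => h.lie_mem A hx }
  monotone' := partialSum_mono emb

/-- The linear projection to the b-th summand is not equivariant, but on the (b + 1)-st filtration
step its defect comes from the b-th step, which it kills. -/
theorem exists_quotient (b : ℕ) : ∃ p : h.filt (b + 1) →ₗ⁅ℂ,𝔤⁆ V b, Function.Surjective p ∧
    ∀ x, p x = 0 ↔ (x : X) ∈ h.filt b := by
  obtain ⟨p, hp1, hp2⟩ := h.exists_proj b
  have hp3 : ∀ x ∈ partialSum emb b, p x = 0 := fun x hx =>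
    partialSum_induction emb (p := fun x => p x = 0) (map_zero p)
      (fun x y hx hy => by rw [map_add, hx, hy, add_zero]) (fun c hc z => hp2 c hc.ne z) hx
  have hp4 : ∀ x z, x - emb b z ∈ partialSum emb b → p x = z := fun x z hx => by
    have := hp3 _ hx
    rwa [map_sub, hp1, sub_eq_zero] at this
  refine ⟨{ p ∘ₗ (h.filt (b + 1)).toSubmodule.subtype with map_lie' := ?_ }, ?_, fun x => ?_⟩
  · intro A x
    obtain ⟨z, hz⟩ := exists_of_mem_partialSum_succ emb x.2
    have e1 : p (x : X) = z := hp4 _ _ hz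
    change p ⁅A, (x : X)⁆ = ⁅A, p (x : X)⁆
    rw [e1]
    refine hp4 _ _ ?_
    have : ⁅A, (x : X)⁆ - emb b ⁅A, z⁆ = ⁅A, (x : X) - emb b z⁆ + (⁅A, emb b z⁆ - emb b ⁅A, z⁆) := by
      rw [lie_sub]; abel
    rw [this]
    exact add_mem (h.lie_mem A hz) (h.lie A b z)
  · intro z
    exact ⟨⟨emb b z, emb_mem_partialSum emb (Nat.lt_succ_self b) z⟩, hp1 z⟩
  · change p (x : X) = 0 ↔ _
    refine ⟨fun hx => ?_, fun hx => hp3 _ hx⟩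
    obtain ⟨z, hz⟩ := exists_of_mem_partialSum_succ emb x.2
    rw [← hp4 _ _ hz, hx, map_zero, sub_zero] at hz
    exact hz

theorem subsingleton_filt_zero : Subsingleton (h.filt 0) := by
  have : ∀ x : h.filt 0, x = 0 := fun x => Subtype.ext (by
    refine partialSum_induction emb (b := 0) (p := fun x => x = 0) rfl
      (fun x y hx hy => by rw [hx, hy, add_zero]) (fun c hc => absurd hc (by omega)) x.2)
  exact ⟨fun x y => by rw [this x, this y]⟩

theorem mult_filt (S : Type) [AddCommGroup S] [Module ℂ S] [LieRingModule 𝔤 S] [LieModule ℂ 𝔤 S]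
    [LieModule.IsIrreducible ℂ 𝔤 S] (b : ℕ) :
    mult (𝔤 := 𝔤) (h.filt b) S = ∑ c ∈ Finset.range b, mult (𝔤 := 𝔤) (V c) S := by
  induction b with
  | zero =>
    have := h.subsingleton_filt_zero
    rw [mult_eq_zero_of_subsingleton, Finset.range_zero, Finset.sum_empty]
  | succ b ih =>
    obtain ⟨p, hp, hpk⟩ := h.exists_quotient b
    have hle : h.filt b ≤ h.filt (b + 1) := h.filt.mono (Nat.le_succ b)
    rw [Finset.sum_range_succ, ← ih]
    refine mult_exact (LieSubmodule.inclusion hle) (LieSubmodule.inclusion_injective hle) p hp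
      fun x => ?_
    rw [hpk]
    exact ⟨fun hx => ⟨⟨x, hx⟩, rfl⟩, fun ⟨a, ha⟩ => ha ▸ a.2⟩

theorem mult_eq (S : Type) [AddCommGroup S] [Module ℂ S] [LieRingModule 𝔤 S] [LieModule ℂ 𝔤 S]
    [LieModule.IsIrreducible ℂ 𝔤 S] {b : ℕ} (hb : ∀ c, b ≤ c → mult (𝔤 := 𝔤) (V c) S = 0) :
    mult (𝔤 := 𝔤) X S = ∑ c ∈ Finset.range b, mult (𝔤 := 𝔤) (V c) S := by
  apply le_antisymm
  · refine enat_le_of_forall_nat fun k hk => ?_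
    obtain ⟨b', hb'⟩ := exists_le_mult h.filt h.exists_mem k hk
    rw [h.mult_filt] at hb'
    refine hb'.trans ?_
    rcases le_total b' b with hle | hle
    · exact Finset.sum_le_sum_of_subset (Finset.range_mono hle)
    · rw [Finset.sum_subset (Finset.range_mono hle) fun c _ hc => hb c (by simpa using hc)]
  · rw [← h.mult_filt]
    exact mult_le_of_injective (h.filt b).incl Subtype.val_injective

/-- If S occurs in some `V c₀`, it has an eigenvalue lam - c₀ - d₀. This would have to be of the
form lam - c - d in any other `V c` containing S, which forces c ≤ c₀ + d₀. -/
theorem exists_bound (S : Type) [AddCommGroup S] [Module ℂ S] [LieRingModule 𝔤 S]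
    [LieModule ℂ 𝔤 S] [LieModule.IsIrreducible ℂ 𝔤 S] (x : 𝔤) (lam : ℂ)
    (hw : ∀ c : ℕ, HasWeights x (Set.range fun d : ℕ => lam - c - (d : ℂ)) (V c)) :
    ∃ b, ∀ c, b ≤ c → mult (𝔤 := 𝔤) (V c) S = 0 := by
  by_cases h0 : ∀ c, mult (𝔤 := 𝔤) (V c) S = 0
  · exact ⟨0, fun c _ => h0 c⟩
  push Not at h0
  obtain ⟨c₀, hc₀⟩ := h0
  have key : ∀ c : ℕ, mult (𝔤 := 𝔤) (V c) S ≠ 0 →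
      HasWeights x (Set.range fun d : ℕ => lam - c - (d : ℂ)) S := fun c hc => by
    obtain ⟨U, U', -, f, hf, -⟩ := exists_step_of_mult_ne_zero hc
    exact (hw c).of_surjective U f hf
  have : Nontrivial S := LieModule.nontrivial_of_isIrreducible ℂ 𝔤 S
  obtain ⟨w, ⟨d₀, rfl⟩, s, hs, hxs⟩ := (key c₀ hc₀).exists_eigenvector
  refine ⟨c₀ + d₀ + 1, fun c hc => ?_⟩
  by_contra hne
  obtain ⟨d, hd⟩ := (key c hne).mem_of_eigenvector hs hxs
  have : ((c + d : ℕ) : ℂ) = ((c₀ + d₀ : ℕ) : ℂ) := by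
    push_cast
    linear_combination -hd
  have := Nat.cast_injective this
  omega

variable {L N : LieSubalgebra ℂ 𝔤} (hL : ∀ (A : L) c z, ⁅(A : 𝔤), emb c z⁆ = emb c ⁅(A : 𝔤), z⁆)
  (hN : LocallyFinite N X) (hV : ∀ c, FiniteLengthObj L N (V c))

include hL hN hV

/-- Although the embeddings are 𝔤-equivariant only up to smaller terms, `hL` makes them exactly
equivariant over the Levi subalgebra, so semisimplicity passes from the summands to the filtration
steps. -/
theorem finiteLengthObj_filt (b : ℕ) : FiniteLengthObj L N (h.filt b) := by
  have hwf : WellFoundedLT (LieSubmodule ℂ 𝔤 (h.filt b)) ∧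
      WellFoundedGT (LieSubmodule ℂ 𝔤 (h.filt b)) := by
    induction b with
    | zero =>
      have := h.subsingleton_filt_zero
      exact wellFounded_of_subsingleton
    | succ b ih =>
      obtain ⟨p, -, hpk⟩ := h.exists_quotient b
      have hle : h.filt b ≤ h.filt (b + 1) := h.filt.mono (Nat.le_succ b)
      exact wellFounded_of_exact (LieSubmodule.inclusion hle) p
        (fun x hx => ⟨⟨x, (hpk x).1 hx⟩, rfl⟩) ih ⟨(hV b).wellFoundedLT, (hV b).wellFoundedGT⟩
  refine ⟨hwf.1, hwf.2, ?_, hN.of_injective (h.filt b).incl Subtype.val_injective⟩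
  rw [eq_top_iff]
  rintro ⟨x, hx⟩ -
  have hx' : x ∈ (finSocle L (h.filt b)).toSubmodule.map (h.filt b).toSubmodule.subtype := by
    refine partialSum_induction emb
      (p := fun x => x ∈ (finSocle L (h.filt b)).toSubmodule.map (h.filt b).toSubmodule.subtype)
      (zero_mem _) (fun x y => add_mem) (fun c hc z => ?_) hx
    let f : V c →ₗ⁅ℂ,L⁆ h.filt b :=
      { (emb c).codRestrict (h.filt b).toSubmodule fun z => emb_mem_partialSum emb hc z with
        map_lie' := fun {A z} => Subtype.ext (hL A c z).symm }
    exact ⟨f z, map_mem_finSocle f ((hV c).socle ▸ LieSubmodule.mem_top z), rfl⟩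
  obtain ⟨y, hy, e⟩ := hx'
  have : y = ⟨x, hx⟩ := Subtype.ext e
  exact this ▸ hy

theorem hasClass (x : 𝔤) (lam : ℂ)
    (hw : ∀ c : ℕ, HasWeights x (Set.range fun d : ℕ => lam - c - (d : ℂ)) (V c)) :
    HasClass L N X ∧ ∀ T : Irr L N, ∃ b, (∀ c, b ≤ c → multIrr L N (V c) T = 0) ∧
      multIrr L N X T = ∑ c ∈ Finset.range b, multIrr L N (V c) T := by
  have key : ∀ T : Irr L N, ∃ b, (∀ c, b ≤ c → multIrr L N (V c) T = 0) ∧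
      multIrr L N X T = ∑ c ∈ Finset.range b, multIrr L N (V c) T := by
    intro T
    induction T using Quotient.inductionOn with
    | h S =>
      obtain ⟨b, hb⟩ := h.exists_bound S.carrier x lam hw
      exact ⟨b, hb, h.mult_eq S.carrier hb⟩
  refine ⟨⟨⟨h.filt, fun j => ?_, h.exists_mem⟩, fun T => ?_, ?_⟩, key⟩
  · have := h.finiteLengthObj_filt hL hN hV j
    exact ⟨this.wellFoundedLT, this.wellFoundedGT, this.inCatO⟩
  · obtain ⟨b, -, hb⟩ := key T
    rw [hb]
    exact WithTop.sum_ne_top.2 fun c _ => (hV c).hasClass.mult_finite T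
  · have hc : (⋃ c, Function.support (ch L N (V c))).Countable :=
      Set.countable_iUnion fun c => (hV c).hasClass.mem_grothendieck
    refine hc.mono fun T hT => ?_
    obtain ⟨b, -, hb⟩ := key T
    by_contra hne
    simp only [Set.mem_iUnion, Function.mem_support, not_exists, not_not] at hne
    refine hT ?_
    have h0 : ∀ c, multIrr L N (V c) T = 0 := fun c => by
      have h1 : (multIrr L N (V c) T).toNat = 0 := Int.natCast_eq_zero.1 (hne c)
      exact (ENat.toNat_eq_zero.1 h1).resolve_right ((hV c).hasClass.mult_finite T)
    simp [ch, hb, h0]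

end Splitting

end Filtration

/-! ### Direct sum decompositions -/

section DirectSumDecomposition

variable {𝔤 : Type} [LieRing 𝔤] [LieAlgebra ℂ 𝔤] {X : Type}
  [AddCommGroup X] [Module ℂ X] [LieRingModule 𝔤 X] [LieModule ℂ 𝔤 X]

theorem nonempty_equiv_directSum {ι : Type} {Y : ι → Type} [∀ i, AddCommGroup (Y i)]
    [∀ i, Module ℂ (Y i)] [∀ i, LieRingModule 𝔤 (Y i)] [∀ i, LieModule ℂ 𝔤 (Y i)]
    (φ : ∀ i, Y i →ₗ⁅ℂ,𝔤⁆ X)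
    (hq : ∀ i, ∃ q : X →ₗ[ℂ] Y i, (∀ z, q (φ i z) = z) ∧ ∀ j, j ≠ i → ∀ z, q (φ j z) = 0)
    (hs : ∀ x, x ∈ ⨆ i, LinearMap.range (φ i).toLinearMap) :
    Nonempty (X ≃ₗ⁅ℂ,𝔤⁆ ⨁ i, Y i) := by
  classical
  let Φ : (⨁ i, Y i) →ₗ[ℂ] X := DirectSum.toModule ℂ ι X fun i => (φ i).toLinearMap
  have hΦ : ∀ i z, Φ (DirectSum.of Y i z) = φ i z := fun i z => DirectSum.toModule_lof ℂ i z
  have hlie : ∀ (A : 𝔤) f, Φ ⁅A, f⁆ = ⁅A, Φ f⁆ := by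
    intro A f
    induction f using DirectSum.induction_on with
    | zero => simp
    | of i z =>
      have : ⁅A, DirectSum.of Y i z⁆ = DirectSum.of Y i ⁅A, z⁆ :=
        ((DirectSum.lieModuleOf ℂ ι 𝔤 Y i).map_lie A z).symm
      rw [this, hΦ, hΦ, LieModuleHom.map_lie]
    | add f g hf hg => rw [lie_add, map_add, hf, hg, map_add, lie_add]
  have hbij : Function.Bijective Φ := by
    constructor
    · rw [← LinearMap.ker_eq_bot, LinearMap.ker_eq_bot']
      intro f hf
      refine DFinsupp.ext fun i => ?_
      obtain ⟨q, hq1, hq2⟩ := hq i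
      have key : ∀ f : ⨁ i, Y i, q (Φ f) = f i := by
        intro f
        induction f using DirectSum.induction_on with
        | zero => simp
        | of j z =>
          rw [hΦ]
          by_cases h : j = i
          · subst h; rw [hq1, DirectSum.of_eq_same]
          · rw [hq2 j h, DirectSum.of_eq_of_ne _ _ _ (Ne.symm h)]
        | add f g hf hg => rw [map_add, map_add, hf, hg]; rfl
      rw [← key, hf, map_zero]
      rfl
    · intro x
      refine Submodule.iSup_induction _ (motive := fun x => ∃ f, Φ f = x) (hs x) ?_
        ⟨0, map_zero Φ⟩ ?_
      · rintro i _ ⟨z, rfl⟩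
        exact ⟨DirectSum.of Y i z, hΦ i z⟩
      · rintro x y ⟨f, rfl⟩ ⟨g, rfl⟩
        exact ⟨f + g, map_add Φ f g⟩
  let Φ' : (⨁ i, Y i) →ₗ⁅ℂ,𝔤⁆ X := { Φ with map_lie' := fun {A f} => hlie A f }
  exact ⟨(lieEquivOfBijective Φ' hbij).symm⟩

variable {V : ℕ → Type} [∀ c, AddCommGroup (V c)] [∀ c, Module ℂ (V c)]
  [∀ c, LieRingModule 𝔤 (V c)] [∀ c, LieModule ℂ 𝔤 (V c)] {emb : ∀ c, V c →ₗ[ℂ] X}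

/-- An operator that commutes with the action and acts by distinct scalars on the subquotients
splits the filtration. -/
theorem Splitting.exists_hom (h : Splitting 𝔤 emb) (Ω : Module.End ℂ X)
    (hΩ : ∀ (A : 𝔤) x, Ω ⁅A, x⁆ = ⁅A, Ω x⁆) (a : ℕ → ℂ) (ha : Function.Injective a)
    (hΩa : ∀ c z, Ω (emb c z) - a c • emb c z ∈ partialSum emb c) :
    ∃ φ : ∀ c, V c →ₗ⁅ℂ,𝔤⁆ X,
      (∀ i, ∃ q : X →ₗ[ℂ] V i, (∀ z, q (φ i z) = z) ∧ ∀ j, j ≠ i → ∀ z, q (φ j z) = 0) ∧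
      ∀ x, x ∈ ⨆ i, LinearMap.range (φ i).toLinearMap := by
  classical
  have hΩp : ∀ b, ∀ x ∈ partialSum emb b, Ω x ∈ partialSum emb b := fun b x hx =>
    partialSum_induction emb (p := fun x => Ω x ∈ partialSum emb b) (by simp)
      (fun x y hx hy => by rw [map_add]; exact add_mem hx hy) (fun c hc z => by
        rw [← sub_add_cancel (Ω (emb c z)) (a c • emb c z)]
        exact add_mem (partialSum_mono emb hc.le (hΩa c z))
          (Submodule.smul_mem _ _ (emb_mem_partialSum emb hc z))) hx
  -- Q b k is the product of (Ω - a_j)/(a_b - a_j) over j < k. It commutes with the action,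
  -- annihilates the k-th filtration step, and for k ≤ b is the identity on the b-th summand modulo
  -- smaller terms. It is used at k = b.
  let Q : ℕ → ℕ → Module.End ℂ X := fun b k =>
    Nat.rec 1 (fun k q => (a b - a k)⁻¹ • ((Ω - a k • 1) * q)) k
  have hQs : ∀ b k x, Q b (k + 1) x = (a b - a k)⁻¹ • (Ω (Q b k x) - a k • Q b k x) :=
    fun _ _ _ => rfl
  have hQΩ : ∀ b k x, Q b k (Ω x) = Ω (Q b k x) := by
    intro b k
    induction k with
    | zero => intro x; rfl
    | succ k ih => intro x; rw [hQs, hQs, ih, map_smul, map_sub, map_smul]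
  have hQA : ∀ b k (A : 𝔤) x, Q b k ⁅A, x⁆ = ⁅A, Q b k x⁆ := by
    intro b k A
    induction k with
    | zero => intro x; rfl
    | succ k ih => intro x; rw [hQs, hQs, ih, hΩ, lie_smul, lie_sub, lie_smul]
  have hQ0 : ∀ b k, ∀ x ∈ partialSum emb k, Q b k x = 0 := by
    intro b k
    induction k with
    | zero =>
      intro x hx
      have := h.subsingleton_filt_zero
      have : (⟨x, hx⟩ : h.filt 0) = 0 := Subsingleton.elim _ _
      rw [show x = 0 from congrArg Subtype.val this, map_zero]
    | succ k ih =>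
      intro x hx
      obtain ⟨z, hz⟩ := exists_of_mem_partialSum_succ emb hx
      rw [hQs, ← hQΩ, ← map_smul, ← map_sub, ih, smul_zero]
      have : Ω x - a k • x = (Ω (emb k z) - a k • emb k z)
          + (Ω (x - emb k z) - a k • (x - emb k z)) := by
        rw [map_sub]; module
      rw [this]
      exact add_mem (hΩa k z) (sub_mem (hΩp k _ hz) (Submodule.smul_mem _ _ hz))
  have hQe : ∀ b k, k ≤ b → ∀ z, Q b k (emb b z) - emb b z ∈ partialSum emb b := by
    intro b k
    induction k with
    | zero => intro _ z; rw [show Q b 0 (emb b z) = emb b z from rfl, sub_self]; exact zero_mem _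
    | succ k ih =>
      intro hk z
      have hne : a b - a k ≠ 0 := sub_ne_zero.2 fun e => by have := ha e; omega
      have h1 := ih (by omega) z
      set r := Q b k (emb b z) - emb b z with hr
      have hQr : Q b k (emb b z) = emb b z + r := by rw [hr]; abel
      have : Q b (k + 1) (emb b z) - emb b z = (a b - a k)⁻¹ •
          ((Ω (emb b z) - a b • emb b z) + (Ω r - a k • r)) := by
        rw [hQs, hQr, map_add]
        have e1 : emb b z = (a b - a k)⁻¹ • (a b - a k) • emb b z := by
          rw [smul_smul, inv_mul_cancel₀ hne, one_smul]
        nth_rewrite 3 [e1]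
        rw [← smul_sub]
        congr 1
        module
      rw [this]
      exact Submodule.smul_mem _ _ (add_mem (hΩa b z)
        (sub_mem (hΩp b _ h1) (Submodule.smul_mem _ _ h1)))
  -- The failure of `emb b` to be equivariant lies in the b-th filtration step, which Q b b
  -- annihilates.
  let φ : ∀ c, V c →ₗ⁅ℂ,𝔤⁆ X := fun b =>
    { Q b b ∘ₗ emb b with
      map_lie' := fun {A z} => by
        change Q b b (emb b ⁅A, z⁆) = ⁅A, Q b b (emb b z)⁆
        rw [← hQA, ← sub_eq_zero, ← map_sub, ← neg_sub, map_neg, hQ0 b b _ (h.lie A b z), neg_zero] }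
  have hφ : ∀ b z, φ b z - emb b z ∈ partialSum emb b := fun b z => hQe b b le_rfl z
  have hφm : ∀ b z, φ b z ∈ partialSum emb (b + 1) := fun b z => by
    rw [← sub_add_cancel (φ b z) (emb b z)]
    exact add_mem (partialSum_mono emb (Nat.le_succ b) (hφ b z))
      (emb_mem_partialSum emb (Nat.lt_succ_self b) z)
  have hspan : ∀ b, ∀ x ∈ partialSum emb b, x ∈ ⨆ i, LinearMap.range (φ i).toLinearMap := by
    intro b
    induction b with
    | zero =>
      intro x hx
      have := h.subsingleton_filt_zero
      have : (⟨x, hx⟩ : h.filt 0) = 0 := Subsingleton.elim _ _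
      rw [show x = 0 from congrArg Subtype.val this]
      exact zero_mem _
    | succ b ih =>
      intro x hx
      obtain ⟨z, hz⟩ := exists_of_mem_partialSum_succ emb hx
      have : x = φ b z + ((x - emb b z) - (φ b z - emb b z)) := by abel
      rw [this]
      exact add_mem (Submodule.mem_iSup_of_mem b ⟨z, rfl⟩) (ih _ (sub_mem hz (hφ b z)))
  -- The maps φ differ from the given embeddings by strictly smaller terms, so they are
  -- unitriangular: injectivity is read off at the largest index in the support.
  have hbij : Function.Bijective
      (DirectSum.toModule ℂ ℕ X fun c => (φ c).toLinearMap : (⨁ c, V c) →ₗ[ℂ] X) := by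
    set Φ : (⨁ c, V c) →ₗ[ℂ] X := DirectSum.toModule ℂ ℕ X fun c => (φ c).toLinearMap with hΦd
    have hΦ : ∀ i z, Φ (DirectSum.of V i z) = φ i z := fun i z => DirectSum.toModule_lof ℂ i z
    constructor
    · rw [← LinearMap.ker_eq_bot, LinearMap.ker_eq_bot']
      intro f hf
      by_contra hne
      have hsupp : (DFinsupp.support f).Nonempty := by
        rw [Finset.nonempty_iff_ne_empty]
        exact fun e => hne (DFinsupp.support_eq_empty.1 e)
      set b := (DFinsupp.support f).max' hsupp with hb
      have hbf : f b ≠ 0 := DFinsupp.mem_support_iff.1 (Finset.max'_mem _ hsupp)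
      obtain ⟨p, hp1, hp2⟩ := h.exists_proj b
      have hp3 : ∀ x ∈ partialSum emb b, p x = 0 := fun x hx =>
        partialSum_induction emb (p := fun x => p x = 0) (map_zero p)
          (fun x y hx hy => by rw [map_add, hx, hy, add_zero]) (fun c hc z => hp2 c hc.ne z) hx
      have hsum : f = ∑ c ∈ DFinsupp.support f, DirectSum.of V c (f c) :=
        (DirectSum.sum_support_of f).symm
      have : p (Φ f) = f b := by
        rw [hsum, map_sum, map_sum]
        simp only [hΦ]
        rw [← hsum, Finset.sum_eq_single b]
        · rw [← sub_add_cancel (φ b (f b)) (emb b (f b)), map_add, hp3 _ (hφ b _), hp1, zero_add]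
        · intro c hc hcb
          have hlt : c < b := lt_of_le_of_ne (Finset.le_max' _ c hc) hcb
          exact hp3 _ (partialSum_mono emb hlt (hφm c _))
        · intro hb'
          exact absurd (Finset.max'_mem _ hsupp) hb'
      rw [hf, map_zero] at this
      exact hbf this.symm
    · intro x
      obtain ⟨b, hb⟩ := h.exists_mem x
      refine Submodule.iSup_induction _ (motive := fun x => ∃ f, Φ f = x) (hspan b x hb) ?_
        ⟨0, map_zero Φ⟩ ?_
      · rintro i _ ⟨z, rfl⟩
        exact ⟨DirectSum.of V i z, hΦ i z⟩
      · rintro x y ⟨f, rfl⟩ ⟨g, rfl⟩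
        exact ⟨f + g, map_add Φ f g⟩
  have h' : Splitting 𝔤 fun c => (φ c).toLinearMap := ⟨hbij, fun A c z => by
    change ⁅A, φ c z⁆ - φ c ⁅A, z⁆ ∈ _
    rw [LieModuleHom.map_lie, sub_self]
    exact zero_mem _⟩
  refine ⟨φ, fun i => h'.exists_proj i, fun x => ?_⟩
  obtain ⟨b, hb⟩ := h.exists_mem x
  exact hspan b x hb

end DirectSumDecomposition

/-! ### The Casimir operator -/

section Casimir

/-- Stated for abstract elements so as to apply both to (P, Q, s) = (X, Y, 1) and to (Y, X, -1). The
contributions of the mixed terms cancel against those of H² and of the rotations. -/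
theorem casimir_comm {R : Type} [Ring R] [Algebra ℂ R] {m : ℕ} (s : ℂ) (H : R) (P Q : Fin m → R)
    (M : Fin m → Fin m → R) (l : Fin m)
    (hH : H * P l - P l * H = s • P l) (hP : ∀ i, P i * P l - P l * P i = 0)
    (hQ : ∀ i, Q i * P l - P l * Q i = (if i = l then -s • H else 0) + M i l)
    (hM : ∀ i j, M i j * P l - P l * M i j
      = (if j = l then P i else 0) - if i = l then P j else 0)
    (hMs : ∀ i j, M i j = -M j i) :
    (H * H + ∑ i, (P i * Q i + Q i * P i) - (1 / 2 : ℂ) • ∑ i, ∑ j, M i j * M i j) * P l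
      = P l * (H * H + ∑ i, (P i * Q i + Q i * P i) - (1 / 2 : ℂ) • ∑ i, ∑ j, M i j * M i j) := by
  have e1 : H * H * P l - P l * (H * H) = s • (H * P l + P l * H) := by
    have : H * H * P l - P l * (H * H) = H * (H * P l - P l * H) + (H * P l - P l * H) * H := by
      noncomm_ring
    rw [this, hH, mul_smul_comm, smul_mul_assoc, smul_add]
  have e2 : ∀ i, (P i * Q i + Q i * P i) * P l - P l * (P i * Q i + Q i * P i)
      = (if i = l then -s • (H * P l + P l * H) else 0) + (M i l * P i + P i * M i l) := by
    intro i
    have : (P i * Q i + Q i * P i) * P l - P l * (P i * Q i + Q i * P i)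
        = P i * (Q i * P l - P l * Q i) + (P i * P l - P l * P i) * Q i
          + Q i * (P i * P l - P l * P i) + (Q i * P l - P l * Q i) * P i := by noncomm_ring
    rw [this, hP, hQ]
    split_ifs with h
    · subst h
      rw [mul_add, add_mul, mul_smul_comm, smul_mul_assoc, smul_add]
      simp only [zero_mul, mul_zero]
      abel
    · simp only [zero_mul, mul_zero, zero_add, add_zero]
      abel
  have e3 : ∀ i j, M i j * M i j * P l - P l * (M i j * M i j)
      = (if j = l then M i j * P i + P i * M i j else 0)
        - if i = l then M i j * P j + P j * M i j else 0 := by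
    intro i j
    have : M i j * M i j * P l - P l * (M i j * M i j)
        = M i j * (M i j * P l - P l * M i j) + (M i j * P l - P l * M i j) * M i j := by
      noncomm_ring
    rw [this, hM]
    split_ifs <;> noncomm_ring
  have e4 : (∑ i, ∑ j, M i j * M i j) * P l - P l * (∑ i, ∑ j, M i j * M i j)
      = (2 : ℂ) • ∑ i, (M i l * P i + P i * M i l) := by
    simp only [Finset.sum_mul, Finset.mul_sum, ← Finset.sum_sub_distrib, e3]
    simp only [Finset.sum_sub_distrib, Finset.sum_ite_eq', Finset.mem_univ, if_true]
    rw [two_smul, sub_eq_add_neg]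
    congr 1
    rw [Finset.sum_comm, ← Finset.sum_neg_distrib]
    refine Finset.sum_congr rfl fun j _ => ?_
    rw [Finset.sum_ite_eq', if_pos (Finset.mem_univ l), hMs l j]
    noncomm_ring
  rw [← sub_eq_zero]
  have : ∀ a b d : R, (a + b - (1 / 2 : ℂ) • d) * P l - P l * (a + b - (1 / 2 : ℂ) • d)
      = (a * P l - P l * a) + (b * P l - P l * b) - (1 / 2 : ℂ) • (d * P l - P l * d) := by
    intro a b d
    rw [sub_mul, mul_sub, add_mul, mul_add, smul_mul_assoc, mul_smul_comm, smul_sub]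
    abel
  rw [this, e1, e4, Finset.sum_mul, Finset.mul_sum, ← Finset.sum_sub_distrib,
    Finset.sum_congr rfl fun i _ => e2 i, Finset.sum_add_distrib, Finset.sum_ite_eq',
    if_pos (Finset.mem_univ l), smul_smul]
  norm_num
  abel

variable {m : ℕ} {𝔤 : Type} [LieRing 𝔤] [LieAlgebra ℂ 𝔤] (c : ConfCoords m 𝔤)

theorem ConfCoords.lie_H_Y (l : Fin m) : ⁅c.H, c.Y l⁆ = -c.Y l := by
  refine c.ext _ _ ?_ ?_ ?_ ?_
  · simp [c.lie_a, c.Y_spec, c.H_spec]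
  · ext k; simp [c.lie_x, c.Y_spec, c.H_spec]
  · ext k; simp [c.lie_y, c.Y_spec, c.H_spec]
  · ext k l; simp [c.lie_B, c.Y_spec, c.H_spec]

theorem ConfCoords.lie_H_X (l : Fin m) : ⁅c.H, c.X l⁆ = c.X l := by
  refine c.ext _ _ ?_ ?_ ?_ ?_
  · simp [c.lie_a, c.X_spec, c.H_spec]
  · ext k; simp [c.lie_x, c.X_spec, c.H_spec]
  · ext k; simp [c.lie_y, c.X_spec, c.H_spec]
  · ext k l; simp [c.lie_B, c.X_spec, c.H_spec]

theorem ConfCoords.lie_H_M (i j : Fin m) : ⁅c.H, c.M i j⁆ = 0 := by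
  refine c.ext _ _ ?_ ?_ ?_ ?_
  · simp [c.lie_a, c.M_spec, c.H_spec]
  · ext k; simp [c.lie_x, c.M_spec, c.H_spec]
  · ext k; simp [c.lie_y, c.M_spec, c.H_spec]
  · ext k l; simp [c.lie_B, c.M_spec, c.H_spec]

theorem ConfCoords.lie_X_X (i l : Fin m) : ⁅c.X i, c.X l⁆ = 0 := by
  refine c.ext _ _ ?_ ?_ ?_ ?_
  · simp [c.lie_a, c.X_spec]
  · ext k; simp [c.lie_x, c.X_spec]
  · ext k; simp [c.lie_y, c.X_spec]
  · ext k l; simp [c.lie_B, c.X_spec]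

theorem ConfCoords.lie_X_Y (i l : Fin m) :
    ⁅c.X i, c.Y l⁆ = (if i = l then c.H else 0) + c.M i l := by
  refine c.ext _ _ ?_ ?_ ?_ ?_
  · rw [map_add, (c.M_spec i l).1, apply_ite c.a, c.H_spec.1]
    simp [c.lie_a, c.X_spec, c.Y_spec, Pi.single_apply, eq_comm]
  · rw [map_add, (c.M_spec i l).2.1, apply_ite c.x, c.H_spec.2.1]
    ext k; simp [c.lie_x, c.X_spec, c.Y_spec]
  · rw [map_add, (c.M_spec i l).2.2.1, apply_ite c.y, c.H_spec.2.2.1]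
    ext k; simp [c.lie_y, c.X_spec, c.Y_spec]
  · rw [map_add, (c.M_spec i l).2.2.2, apply_ite c.B, c.H_spec.2.2.2]
    ext p q
    simp only [c.lie_B, c.X_spec, c.Y_spec, skewUnit_apply, Pi.single_apply, Matrix.zero_apply,
      Pi.zero_apply, Matrix.add_apply, map_zero, ite_self]
    simp only [Finset.sum_const_zero, mul_zero, zero_add, ite_and, mul_ite, mul_one, sub_self]
    grind

theorem ConfCoords.lie_M_Y (i j l : Fin m) :
    ⁅c.M i j, c.Y l⁆ = (if j = l then c.Y i else 0) - if i = l then c.Y j else 0 := by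
  refine c.ext _ _ ?_ ?_ ?_ ?_
  · rw [map_sub, apply_ite c.a, apply_ite c.a]
    simp [c.lie_a, c.M_spec, c.Y_spec]
  · rw [map_sub, apply_ite c.x, apply_ite c.x]
    ext k; simp [c.lie_x, c.M_spec, c.Y_spec]
  · rw [map_sub, apply_ite c.y, apply_ite c.y]
    ext k
    simp only [c.lie_y, c.M_spec, c.Y_spec, skewUnit_apply, Pi.single_apply, Pi.sub_apply]
    split_ifs <;> simp_all [Pi.single_apply, eq_comm, ite_and]
  · rw [map_sub, apply_ite c.B, apply_ite c.B]
    ext p q; simp [c.lie_B, c.M_spec, c.Y_spec]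

theorem ConfCoords.lie_M_X (i j l : Fin m) :
    ⁅c.M i j, c.X l⁆ = (if j = l then c.X i else 0) - if i = l then c.X j else 0 := by
  refine c.ext _ _ ?_ ?_ ?_ ?_
  · rw [map_sub, apply_ite c.a, apply_ite c.a]
    simp [c.lie_a, c.M_spec, c.X_spec]
  · rw [map_sub, apply_ite c.x, apply_ite c.x]
    ext k
    simp only [c.lie_x, c.M_spec, c.X_spec, skewUnit_apply, Pi.single_apply, Pi.sub_apply]
    split_ifs <;> simp_all [Pi.single_apply, eq_comm, ite_and]
  · rw [map_sub, apply_ite c.y, apply_ite c.y]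
    ext k; simp [c.lie_y, c.M_spec, c.X_spec]
  · rw [map_sub, apply_ite c.B, apply_ite c.B]
    ext p q; simp [c.lie_B, c.M_spec, c.X_spec]

theorem ConfCoords.M_skew (i j : Fin m) : c.M i j = -c.M j i := by
  refine c.ext _ _ ?_ ?_ ?_ ?_
  · simp [c.M_spec]
  · simp [c.M_spec]
  · simp [c.M_spec]
  · rw [map_neg, (c.M_spec i j).2.2.2, (c.M_spec j i).2.2.2, skewUnit, skewUnit, neg_sub]

/-- The factor ½ accounts for M_ij and M_ji = -M_ij both occurring in the double sum. -/
theorem ConfCoords.eq_sum (A : 𝔤) : A = c.a A • c.H + ∑ i, c.x A i • c.X i + ∑ i, c.y A i • c.Y i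
    + (1 / 2 : ℂ) • ∑ i, ∑ j, c.B A i j • c.M i j := by
  refine c.ext _ _ ?_ ?_ ?_ ?_
  · simp [c.H_spec, c.X_spec, c.Y_spec, c.M_spec]
  · ext k
    simp [c.H_spec, c.X_spec, c.Y_spec, c.M_spec, Finset.sum_apply, Pi.single_apply]
  · ext k
    simp [c.H_spec, c.X_spec, c.Y_spec, c.M_spec, Finset.sum_apply, Pi.single_apply]
  · ext p q
    simp only [map_add, map_smul, map_sum, c.H_spec, c.X_spec, c.Y_spec, c.M_spec, smul_zero,
      Finset.sum_const_zero, zero_add, Matrix.smul_apply, Matrix.sum_apply, skewUnit_apply,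
      smul_eq_mul, mul_sub, Finset.sum_sub_distrib, ite_and]
    simp
    rw [c.skew A q p]
    ring

variable (W : Type) [AddCommGroup W] [Module ℂ W] [LieRingModule 𝔤 W] [LieModule ℂ 𝔤 W]

/-- The Casimir operator. -/
def casimir : Module.End ℂ W :=
  LieModule.toEnd ℂ 𝔤 W c.H * LieModule.toEnd ℂ 𝔤 W c.H
    + ∑ i, (LieModule.toEnd ℂ 𝔤 W (c.X i) * LieModule.toEnd ℂ 𝔤 W (c.Y i)
      + LieModule.toEnd ℂ 𝔤 W (c.Y i) * LieModule.toEnd ℂ 𝔤 W (c.X i))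
    - (1 / 2 : ℂ) • ∑ i, ∑ j, LieModule.toEnd ℂ 𝔤 W (c.M i j) * LieModule.toEnd ℂ 𝔤 W (c.M i j)

theorem toEnd_comm (A B : 𝔤) : LieModule.toEnd ℂ 𝔤 W A * LieModule.toEnd ℂ 𝔤 W B
    - LieModule.toEnd ℂ 𝔤 W B * LieModule.toEnd ℂ 𝔤 W A = LieModule.toEnd ℂ 𝔤 W ⁅A, B⁆ := by
  rw [LieHom.map_lie, LieRing.of_associative_ring_bracket]

/-- Commutation with X_l and Y_l is the abstract computation, and with H a weight count. The
rotations follow because M_ij is [X_i, Y_j] up to a multiple of H. -/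
theorem casimir_commute (A : 𝔤) : casimir c W * LieModule.toEnd ℂ 𝔤 W A
    = LieModule.toEnd ℂ 𝔤 W A * casimir c W := by
  set r := LieModule.toEnd ℂ 𝔤 W with hr
  have hX : ∀ l, casimir c W * r (c.X l) = r (c.X l) * casimir c W := fun l => by
    refine casimir_comm 1 (r c.H) (fun i => r (c.X i)) (fun i => r (c.Y i))
      (fun i j => r (c.M i j)) l ?_ (fun i => ?_) (fun i => ?_) (fun i j => ?_) (fun i j => ?_)
    · rw [toEnd_comm, c.lie_H_X, one_smul]
    · rw [toEnd_comm, c.lie_X_X, map_zero]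
    · rw [toEnd_comm, ← lie_skew, c.lie_X_Y, neg_add, ← c.M_skew, map_add, eq_comm]
      congr 1
      by_cases h : i = l
      · subst h; simp [hr]
      · simp [h, Ne.symm h]
    · rw [toEnd_comm, c.lie_M_X, map_sub]
      congr 1 <;> split_ifs <;> simp [hr]
    · rw [c.M_skew, map_neg]
  have hY : ∀ l, casimir c W * r (c.Y l) = r (c.Y l) * casimir c W := fun l => by
    have key := casimir_comm (-1) (r c.H) (fun i => r (c.Y i)) (fun i => r (c.X i))
      (fun i j => r (c.M i j)) l (by rw [toEnd_comm, c.lie_H_Y, map_neg, neg_smul, one_smul])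
      (fun i => by rw [toEnd_comm, c.lie_Y_Y, map_zero])
      (fun i => by
        rw [toEnd_comm, c.lie_X_Y, map_add]
        congr 1
        split_ifs <;> simp [hr])
      (fun i j => by
        rw [toEnd_comm, c.lie_M_Y, map_sub]
        congr 1 <;> split_ifs <;> simp [hr])
      (fun i j => by rw [c.M_skew, map_neg])
    have e : casimir c W = r c.H * r c.H + ∑ i, (r (c.Y i) * r (c.X i) + r (c.X i) * r (c.Y i))
        - (1 / 2 : ℂ) • ∑ i, ∑ j, r (c.M i j) * r (c.M i j) := by
      unfold casimir
      simp only [add_comm (r (c.Y _) * r (c.X _))]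
      rfl
    rw [e]
    exact key
  have hH : casimir c W * r c.H = r c.H * casimir c W := by
    have h1 : ∀ i, r (c.X i) * r c.H = r c.H * r (c.X i) - r (c.X i) := fun i => by
      have := toEnd_comm W c.H (c.X i)
      rw [c.lie_H_X] at this
      rw [← hr] at this
      nth_rewrite 3 [← this]; abel
    have h2 : ∀ i, r (c.Y i) * r c.H = r c.H * r (c.Y i) + r (c.Y i) := fun i => by
      have := toEnd_comm W c.H (c.Y i)
      rw [c.lie_H_Y, map_neg] at this
      rw [← hr] at this
      rw [← sub_eq_zero] at this ⊢
      rw [← neg_eq_zero, ← this]; abel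
    have h3 : ∀ i j, r (c.M i j) * r c.H = r c.H * r (c.M i j) := fun i j => by
      have := toEnd_comm W c.H (c.M i j)
      rw [c.lie_H_M, map_zero] at this
      exact (sub_eq_zero.1 this).symm
    unfold casimir
    rw [← hr, sub_mul, mul_sub, add_mul, mul_add, mul_assoc, smul_mul_assoc, mul_smul_comm]
    simp only [Finset.sum_mul, Finset.mul_sum]
    congr 1
    · congr 1
      refine Finset.sum_congr rfl fun i _ => ?_
      rw [add_mul, mul_add, mul_assoc, h2, mul_add, ← mul_assoc, h1, mul_assoc, h1, mul_sub,
        ← mul_assoc, h2]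
      noncomm_ring
    · congr 1
      refine Finset.sum_congr rfl fun i _ => Finset.sum_congr rfl fun j _ => ?_
      rw [mul_assoc, h3, ← mul_assoc, h3, mul_assoc]
  have hlie : ∀ A B, casimir c W * r A = r A * casimir c W →
      casimir c W * r B = r B * casimir c W → casimir c W * r ⁅A, B⁆ = r ⁅A, B⁆ * casimir c W := by
    intro A B hA hB
    rw [hr, ← toEnd_comm, ← hr, mul_sub, sub_mul, ← mul_assoc, hA, mul_assoc, hB, ← mul_assoc,
      ← mul_assoc, hB,
      mul_assoc (r B) (casimir c W) (r A), hA]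
    noncomm_ring
  have hM : ∀ i j, casimir c W * r (c.M i j) = r (c.M i j) * casimir c W := fun i j => by
    have h1 := hlie _ _ (hX i) (hY j)
    rw [c.lie_X_Y, map_add, mul_add, add_mul] at h1
    split_ifs at h1
    · rw [hH] at h1
      exact add_left_cancel h1
    · simpa using h1
  rw [c.eq_sum A]
  simp only [map_add, map_smul, map_sum, mul_add, add_mul, mul_smul_comm, smul_mul_assoc,
    Finset.mul_sum, Finset.sum_mul, hH, hX, hY, hM]

theorem casimir_lie (A : 𝔤) (w : W) : casimir c W ⁅A, w⁆ = ⁅A, casimir c W w⁆ :=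
  LinearMap.congr_fun (casimir_commute c W A) w

theorem casimir_apply (w : W) : casimir c W w = ⁅c.H, ⁅c.H, w⁆⁆
    + ∑ i, (⁅c.X i, ⁅c.Y i, w⁆⁆ + ⁅c.Y i, ⁅c.X i, w⁆⁆)
    - (1 / 2 : ℂ) • ∑ i, ∑ j, ⁅c.M i j, ⁅c.M i j, w⁆⁆ := by
  simp only [casimir, LinearMap.sub_apply, LinearMap.add_apply, LinearMap.smul_apply,
    LinearMap.sum_apply, Module.End.mul_apply]
  rfl

end Casimir

/-! ### The infinitesimal character -/

section CasimirScalar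

variable {m : ℕ} {𝔤 : Type} [LieRing 𝔤] [LieAlgebra ℂ 𝔤]

theorem half_smul_mul_sq {R : Type} [Ring R] [Algebra ℂ R] {g h : R} (hg : g * g = 1)
    (hh : h * h = 1) (hgh : g * h + h * g = 0) :
    ((1 / 2 : ℂ) • (g * h)) * ((1 / 2 : ℂ) • (g * h)) = (-(1 / 4) : ℂ) • (1 : R) := by
  have h1 : h * g = -(g * h) := eq_neg_of_add_eq_zero_right hgh
  have h2 : g * h * (g * h) = -1 := by
    rw [mul_assoc, ← mul_assoc h, h1, neg_mul, mul_assoc, hh, mul_one, mul_neg, hg]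
  rw [smul_mul_smul_comm, h2, smul_neg, neg_smul]
  norm_num

theorem spinAct_skewUnit_sq (i j : Fin m) (v : Spinor m) :
    spinAct m (skewUnit i j) (spinAct m (skewUnit i j) v)
      = (if i = j then 0 else -(1 / 4 : ℂ)) • v := by
  have h : spinAct m (skewUnit i j) * spinAct m (skewUnit i j)
      = (if i = j then 0 else -(1 / 4 : ℂ)) • (1 : Module.End ℂ (Spinor m)) := by
    rw [spinAct_skewUnit]
    by_cases hij : i = j
    · subst hij
      rw [gamma_sq]
      simp
    · have h := gamma_clifford m i j
      rw [if_neg hij] at h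
      rw [if_neg hij, if_neg hij, sub_zero]
      exact half_smul_mul_sq (gamma_sq m i) (gamma_sq m j) h
  exact LinearMap.congr_fun h v

variable {c : ConfCoords m 𝔤} {μ : ℂ} {X : Type} [AddCommGroup X] [Module ℂ X] [LieRingModule 𝔤 X]
  [LieModule ℂ 𝔤 X]

/-- As the Casimir operator commutes with the Y_l, it suffices to evaluate it on constants. There H²
gives μ², each X_i Y_i gives μ, and every rotation with i ≠ j squares to -1/4, for a total of m(m -
1)/8. -/
theorem casimir_of_model (e : X ≃ₗ[ℂ] PolyTensor m (Spinor m))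
    (he : ∀ (A : 𝔤) z, e ⁅A, z⁆ = modelAct (spinAct m) μ c A (e z)) (z : X) :
    casimir c X z = (μ ^ 2 + m * μ + m * (m - 1) / 8) • z := by
  have key : ∀ u, casimir c X (e.symm u) = (μ ^ 2 + m * μ + m * (m - 1) / 8) • e.symm u := by
    intro u
    induction u using polyTensor_induction with
    | add u w hu hw => rw [map_add, map_add, hu, hw, smul_add]
    | mul i u hu =>
      have : e.symm (yOp (Spinor m) i u) = ⁅c.Y i, e.symm u⁆ := by
        rw [LinearEquiv.symm_apply_eq, he, modelAct_Y, LinearEquiv.apply_symm_apply]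
      rw [this, casimir_lie, hu, lie_smul]
    | one v =>
      apply e.injective
      have hXY : ∀ i, xOp (spinAct m) μ i (yOp (Spinor m) i (pt 1 v)) = μ • pt 1 v := fun i => by
        have h := LinearMap.congr_fun (xOp_y (spinAct m) μ i i) (pt 1 v)
        rw [LinearMap.add_apply, Module.End.mul_apply, Module.End.mul_apply, xOp_one, map_zero,
          zero_add, LinearMap.add_apply, if_pos rfl, hOp_one, mOp_one] at h
        rw [h, skewUnit, sub_self, map_zero, LinearMap.zero_apply, pt_zero_right, add_zero]
      rw [casimir_apply]
      simp only [map_sub, map_add, map_sum, map_smul, he, LinearEquiv.apply_symm_apply, modelAct_H,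
        modelAct_X, modelAct_Y, modelAct_M, hOp_one, hXY, xOp_one, map_zero, add_zero, mOp_one,
        spinAct_skewUnit_sq, pt_smul_right]
      simp only [← Finset.sum_smul, smul_smul, ← add_smul, ← sub_smul]
      congr 1
      have : ∀ i : Fin m, ∑ j, (if i = j then 0 else -(1 / 4 : ℂ)) = -(1 / 4) * (m - 1) := by
        intro i
        have : ∀ j : Fin m, (if i = j then 0 else -(1 / 4 : ℂ))
            = -(1 / 4) - if i = j then -(1 / 4 : ℂ) else 0 := fun j => by split_ifs <;> ring
        simp only [this, Finset.sum_sub_distrib, Finset.sum_ite_eq, Finset.mem_univ, if_true,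
          Finset.sum_const, Finset.card_univ, Fintype.card_fin, nsmul_eq_mul]
        ring
      simp only [this, Finset.sum_const, Finset.card_univ, Fintype.card_fin, nsmul_eq_mul]
      ring
  have := key (e z)
  rwa [e.symm_apply_apply] at this

variable {V : ℕ → Type} [∀ b, AddCommGroup (V b)] [∀ b, Module ℂ (V b)]
  [∀ b, LieRingModule 𝔤 (V b)] [∀ b, LieModule ℂ 𝔤 (V b)] {emb : ∀ b, V b →ₗ[ℂ] X}

/-- The Casimir operators of the module and of the subquotients are compatible. -/
theorem Splitting.casimir_sub_mem (h : Splitting 𝔤 emb) (c : ConfCoords m 𝔤) (b : ℕ) (z : V b) :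
    casimir c X (emb b z) - emb b (casimir c (V b) z) ∈ partialSum emb b := by
  have h2 : ∀ A C : 𝔤, ⁅A, ⁅C, emb b z⁆⁆ - emb b ⁅A, ⁅C, z⁆⁆ ∈ partialSum emb b := fun A C => by
    have : ⁅A, ⁅C, emb b z⁆⁆ - emb b ⁅A, ⁅C, z⁆⁆ = ⁅A, ⁅C, emb b z⁆ - emb b ⁅C, z⁆⁆
        + (⁅A, emb b ⁅C, z⁆⁆ - emb b ⁅A, ⁅C, z⁆⁆) := by rw [lie_sub]; abel
    rw [this]
    exact add_mem (h.lie_mem A (h.lie C b z)) (h.lie A b _)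
  have e : casimir c X (emb b z) - emb b (casimir c (V b) z)
      = (⁅c.H, ⁅c.H, emb b z⁆⁆ - emb b ⁅c.H, ⁅c.H, z⁆⁆)
        + ∑ i, ((⁅c.X i, ⁅c.Y i, emb b z⁆⁆ - emb b ⁅c.X i, ⁅c.Y i, z⁆⁆)
          + (⁅c.Y i, ⁅c.X i, emb b z⁆⁆ - emb b ⁅c.Y i, ⁅c.X i, z⁆⁆))
        - (1 / 2 : ℂ) • ∑ i, ∑ j, (⁅c.M i j, ⁅c.M i j, emb b z⁆⁆ - emb b ⁅c.M i j, ⁅c.M i j, z⁆⁆) := by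
    rw [casimir_apply, casimir_apply]
    simp only [map_sub, map_add, map_sum, map_smul, Finset.sum_add_distrib, Finset.sum_sub_distrib,
      smul_sub]
    abel
  rw [e]
  exact sub_mem (add_mem (h2 _ _) (sum_mem fun i _ => add_mem (h2 _ _) (h2 _ _)))
    (Submodule.smul_mem _ _ (sum_mem fun i _ => sum_mem fun j _ => h2 _ _))

end CasimirScalar

/-! ### Splitting off the last variable -/

section LastVariable

variable {m : ℕ} {F F' : Type} [AddCommGroup F] [Module ℂ F] [AddCommGroup F'] [Module ℂ F']
  (Q : F' ≃ₗ[ℂ] F)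

/-- Multiplication of a polynomial in the first `m` variables by the `b`-th power of the last
variable. -/
def ptEmb (b : ℕ) : PolyTensor m F' →ₗ[ℂ] PolyTensor (m + 1) F :=
  TensorProduct.map (LinearMap.mulLeft ℂ (MvPolynomial.X (Fin.last m) ^ b)
    ∘ₗ (MvPolynomial.rename Fin.castSucc).toLinearMap) Q.toLinearMap

theorem ptEmb_pt (b : ℕ) (p : MvPolynomial (Fin m) ℂ) (v : F') : ptEmb Q b (pt p v)
    = pt (MvPolynomial.X (Fin.last m) ^ b * MvPolynomial.rename Fin.castSucc p) (Q v) := rfl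

theorem ptEmb_y (b : ℕ) (i : Fin m) (u : PolyTensor m F') :
    yOp F i.castSucc (ptEmb Q b u) = ptEmb Q b (yOp F' i u) :=
  LinearMap.congr_fun (pt_ext (f := yOp F i.castSucc ∘ₗ ptEmb Q b) (g := ptEmb Q b ∘ₗ yOp F' i)
    fun p v => by
      simp only [LinearMap.comp_apply, ptEmb_pt, yOp_pt, map_mul, MvPolynomial.rename_X]
      rw [mul_left_comm]) u

theorem ptEmb_y_last (b : ℕ) (u : PolyTensor m F') :
    yOp F (Fin.last m) (ptEmb Q b u) = ptEmb Q (b + 1) u :=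
  LinearMap.congr_fun (pt_ext (f := yOp F (Fin.last m) ∘ₗ ptEmb Q b) (g := ptEmb Q (b + 1))
    fun p v => by
      simp only [LinearMap.comp_apply, ptEmb_pt, yOp_pt]
      rw [← mul_assoc, ← pow_succ']) u

theorem ptEmb_d (b : ℕ) (i : Fin m) (u : PolyTensor m F') :
    dOp F i.castSucc (ptEmb Q b u) = ptEmb Q b (dOp F' i u) :=
  LinearMap.congr_fun (pt_ext (f := dOp F i.castSucc ∘ₗ ptEmb Q b) (g := ptEmb Q b ∘ₗ dOp F' i)
    fun p v => by
      simp only [LinearMap.comp_apply, ptEmb_pt, dOp_pt]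
      rw [Derivation.leibniz, Derivation.leibniz_pow, MvPolynomial.pderiv_X_of_ne
        (Fin.castSucc_ne_last i).symm, MvPolynomial.pderiv_rename (Fin.castSucc_injective m)]
      simp) u

/-- For b = 0 the truncated exponent is harmless, since its coefficient is zero. -/
theorem ptEmb_d_last (b : ℕ) (u : PolyTensor m F') :
    dOp F (Fin.last m) (ptEmb Q b u) = (b : ℂ) • ptEmb Q (b - 1) u :=
  LinearMap.congr_fun (pt_ext (f := dOp F (Fin.last m) ∘ₗ ptEmb Q b) (g := (b : ℂ) • ptEmb Q (b - 1))
    fun p v => by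
      have h0 : MvPolynomial.pderiv (Fin.last m) (MvPolynomial.rename Fin.castSucc p) = 0 := by
        refine MvPolynomial.pderiv_eq_zero_of_notMem_vars fun h => ?_
        obtain ⟨j, -, hj⟩ := MvPolynomial.mem_vars_rename _ _ h
        exact Fin.castSucc_ne_last j hj
      simp only [LinearMap.comp_apply, LinearMap.smul_apply, ptEmb_pt, dOp_pt]
      rw [Derivation.leibniz, Derivation.leibniz_pow, MvPolynomial.pderiv_X_self, h0, ← pt_smul_left]
      congr 1
      rw [smul_zero, zero_add, smul_eq_mul, smul_eq_mul, mul_one, nsmul_eq_mul, Algebra.smul_def,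
        map_natCast]
      ring) u

theorem ptEmb_s (b : ℕ) (T : Module.End ℂ F) (T' : Module.End ℂ F')
    (h : ∀ v, T (Q v) = Q (T' v)) (u : PolyTensor m F') :
    sOp (m + 1) T (ptEmb Q b u) = ptEmb Q b (sOp m T' u) :=
  LinearMap.congr_fun (pt_ext (f := sOp (m + 1) T ∘ₗ ptEmb Q b) (g := ptEmb Q b ∘ₗ sOp m T')
    fun p v => by
      simp only [LinearMap.comp_apply, ptEmb_pt, sOp_pt, h]) u

theorem ptEmb_zero_injective : Function.Injective (ptEmb (m := m) Q 0) := by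
  refine TensorProduct.map_injective_of_flat_flat _ _ ?_ Q.injective
  rw [pow_zero, LinearMap.mulLeft_one, LinearMap.id_comp]
  exact MvPolynomial.rename_injective _ (Fin.castSucc_injective m)

theorem ptEmb_d_last_pow (k b : ℕ) (u : PolyTensor m F') :
    (dOp F (Fin.last m) ^ k) (ptEmb Q b u) = (b.descFactorial k : ℂ) • ptEmb Q (b - k) u := by
  induction k with
  | zero => simp
  | succ k ih =>
    rw [pow_succ', Module.End.mul_apply, ih, map_smul, ptEmb_d_last, smul_smul,
      Nat.descFactorial_succ, Nat.cast_mul, mul_comm, Nat.sub_sub]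

theorem ptEmb_h (μ : ℂ) (b : ℕ) (u : PolyTensor m F') :
    hOp (m + 1) F μ (ptEmb Q b u) = ptEmb Q b (hOp m F' (μ - b) u) := by
  have hl : yOp F (Fin.last m) (dOp F (Fin.last m) (ptEmb Q b u)) = (b : ℂ) • ptEmb Q b u := by
    rw [ptEmb_d_last, map_smul, ptEmb_y_last]
    rcases b with _ | b
    · simp
    · simp
  simp only [hOp, euler, LinearMap.sub_apply, LinearMap.smul_apply, Module.End.one_apply,
    LinearMap.sum_apply, LinearMap.add_apply, Module.End.mul_apply, Fin.sum_univ_castSucc, hl,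
    ptEmb_d, ptEmb_y, map_sub, map_smul, map_sum, sub_smul]
  abel

variable {σ : Matrix (Fin (m + 1)) (Fin (m + 1)) ℂ →ₗ[ℂ] Module.End ℂ F}
  {σ' : Matrix (Fin m) (Fin m) ℂ →ₗ[ℂ] Module.End ℂ F'}
  (hQ : ∀ (B : Matrix (Fin m) (Fin m) ℂ) (B' : Matrix (Fin (m + 1)) (Fin (m + 1)) ℂ),
    (∀ i j : Fin m, B' i.castSucc j.castSucc = B i j) → (∀ i, B' i (Fin.last m) = 0) →
    (∀ i, B' (Fin.last m) i = 0) → ∀ v, σ B' (Q v) = Q (σ' B v))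

include hQ

theorem ptEmb_m (b : ℕ) (B : Matrix (Fin m) (Fin m) ℂ) (B' : Matrix (Fin (m + 1)) (Fin (m + 1)) ℂ)
    (h1 : ∀ i j : Fin m, B' i.castSucc j.castSucc = B i j) (h2 : ∀ i, B' i (Fin.last m) = 0)
    (h3 : ∀ i, B' (Fin.last m) i = 0) (u : PolyTensor m F') :
    mOp σ B' (ptEmb Q b u) = ptEmb Q b (mOp σ' B u) := by
  change (vecField (yOp F) (dOp F) B' + sOp (m + 1) (σ B')) _
    = ptEmb Q b ((vecField (yOp F') (dOp F') B + sOp m (σ' B)) u)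
  simp only [vecField, LinearMap.add_apply, LinearMap.smul_apply, LinearMap.sum_apply,
    Module.End.mul_apply, Fin.sum_univ_castSucc, h1, h2, h3, zero_smul, Finset.sum_const_zero,
    add_zero, ptEmb_d, ptEmb_y, ptEmb_s Q b _ _ (hQ B B' h1 h2 h3), map_add, map_sum, map_smul]

/-- The Euler term in the last variable is absorbed into the shift of μ to μ - b. What remains is
the rotation between e_i and the last direction, applied with one derivative in the last variable,
and ½ y_i times the second such derivative. Both lower the power b, so the action is triangular. -/
theorem ptEmb_x (μ : ℂ) (b : ℕ) (i : Fin m) (u : PolyTensor m F') :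
    xOp σ μ i.castSucc (ptEmb Q b u) = ptEmb Q b (xOp σ' (μ - b) i u)
      + ((b : ℂ) • ptEmb Q (b - 1)
          (sOp m (Q.symm.conj (σ (skewUnit i.castSucc (Fin.last m)))) u)
        + (1 / 2 * b * (b - 1 : ℕ) : ℂ) • ptEmb Q (b - 1 - 1) (yOp F' i u)) := by
  have hs : ∀ j : Fin m, ∀ u : PolyTensor m F', sOp (m + 1) (σ (skewUnit i.castSucc j.castSucc))
      (ptEmb Q b u) = ptEmb Q b (sOp m (σ' (skewUnit i j)) u) := fun j =>
    ptEmb_s Q b _ _ (hQ _ _ (fun k l => by simp [skewUnit_apply])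
      (fun k => by simp [skewUnit_apply, Fin.castSucc_ne_last])
      (fun k => by simp [skewUnit_apply, Fin.castSucc_ne_last]))
  have hτ : ∀ u : PolyTensor m F', sOp (m + 1) (σ (skewUnit i.castSucc (Fin.last m)))
      (ptEmb Q (b - 1) u) = ptEmb Q (b - 1)
        (sOp m (Q.symm.conj (σ (skewUnit i.castSucc (Fin.last m)))) u) :=
    ptEmb_s Q _ _ _ fun v => by simp [LinearEquiv.conj_apply]
  simp only [xOp, lapl, LinearMap.add_apply, LinearMap.smul_apply, LinearMap.sum_apply,
    Module.End.mul_apply, Fin.sum_univ_castSucc, ptEmb_d, ptEmb_d_last, ptEmb_h, hs, hτ, map_add,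
    map_sum, map_smul, ptEmb_y]
  module

end LastVariable

/-! ### The filtration of the restriction -/

section Restriction

variable {m : ℕ} {F F' : Type} [AddCommGroup F] [Module ℂ F] [AddCommGroup F'] [Module ℂ F']
  (Q : F' ≃ₗ[ℂ] F) {X : Type} [AddCommGroup X] [Module ℂ X]
  {V : ℕ → Type} [∀ b, AddCommGroup (V b)] [∀ b, Module ℂ (V b)]
  (e : X ≃ₗ[ℂ] PolyTensor (m + 1) F) (e' : ∀ b, V b ≃ₗ[ℂ] PolyTensor m F')

/-- The vectors whose degree in the last variable is `b`. -/
def embModel (b : ℕ) : V b →ₗ[ℂ] X :=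
  e.symm.toLinearMap ∘ₗ ptEmb Q b ∘ₗ (e' b).toLinearMap

theorem embModel_apply (b : ℕ) (z : V b) : e (embModel Q e e' b z) = ptEmb Q b (e' b z) :=
  e.apply_symm_apply _

/-- For injectivity, differentiating b times in the last variable, with b the largest index present,
isolates the top component up to b!. The image contains the constants and is stable under all
variables, hence is everything. -/
theorem embModel_bijective :
    Function.Bijective (DirectSum.toModule ℂ ℕ X (embModel Q e e')) := by
  classical
  set Φ := DirectSum.toModule ℂ ℕ X (embModel Q e e') with hΦd
  have hΦ : ∀ b z, Φ (DirectSum.of V b z) = embModel Q e e' b z :=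
    fun b z => DirectSum.toModule_lof ℂ b z
  constructor
  · rw [← LinearMap.ker_eq_bot, LinearMap.ker_eq_bot']
    intro f hf
    by_contra hne
    have hsupp : (DFinsupp.support f).Nonempty := by
      rw [Finset.nonempty_iff_ne_empty]
      exact fun e => hne (DFinsupp.support_eq_empty.1 e)
    set b := (DFinsupp.support f).max' hsupp with hb
    have hbf : f b ≠ 0 := DFinsupp.mem_support_iff.1 (Finset.max'_mem _ hsupp)
    have hsum : ∑ c ∈ DFinsupp.support f, DirectSum.of V c (f c) = f :=
      DirectSum.sum_support_of f
    have h1 : (dOp F (Fin.last m) ^ b) (e (Φ f)) = (b.factorial : ℂ) • ptEmb Q 0 (e' b (f b)) := by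
      rw [← hsum, map_sum, map_sum, map_sum]
      simp only [hΦ, embModel_apply, ptEmb_d_last_pow]
      rw [hsum, Finset.sum_eq_single b]
      · rw [Nat.descFactorial_self, Nat.sub_self]
      · intro c hc hcb
        have hlt : c < b := lt_of_le_of_ne (Finset.le_max' _ c hc) hcb
        rw [Nat.descFactorial_of_lt hlt, Nat.cast_zero, zero_smul]
      · intro hb'
        exact absurd (Finset.max'_mem _ hsupp) hb'
    rw [hf, map_zero, map_zero, eq_comm, smul_eq_zero] at h1
    have h2 := h1.resolve_left (Nat.cast_ne_zero.2 b.factorial_ne_zero)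
    rw [map_eq_zero_iff _ (ptEmb_zero_injective Q), map_eq_zero_iff _ (e' b).injective] at h2
    exact hbf h2
  · have key : ∀ u : PolyTensor (m + 1) F, ∃ f, e (Φ f) = u := by
      intro u
      induction u using polyTensor_induction with
      | add u w hu hw =>
        obtain ⟨f, rfl⟩ := hu
        obtain ⟨g, rfl⟩ := hw
        exact ⟨f + g, by rw [map_add, map_add]⟩
      | one v =>
        refine ⟨DirectSum.of V 0 ((e' 0).symm (pt 1 (Q.symm v))), ?_⟩
        rw [hΦ, embModel_apply, LinearEquiv.apply_symm_apply, ptEmb_pt, Q.apply_symm_apply, map_one,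
          pow_zero, mul_one]
      | mul i u hu =>
        obtain ⟨f, rfl⟩ := hu
        induction f using DirectSum.induction_on with
        | zero => exact ⟨0, by simp⟩
        | add f g hf hg =>
          obtain ⟨f', hf⟩ := hf
          obtain ⟨g', hg⟩ := hg
          exact ⟨f' + g', by rw [map_add, map_add, hf, hg, map_add, map_add, map_add]⟩
        | of b z =>
          rw [hΦ, embModel_apply]
          refine Fin.lastCases ?_ (fun i => ?_) i
          · exact ⟨DirectSum.of V (b + 1) ((e' (b + 1)).symm (e' b z)), by
              rw [hΦ, embModel_apply, LinearEquiv.apply_symm_apply, ptEmb_y_last]⟩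
          · exact ⟨DirectSum.of V b ((e' b).symm (yOp F' i (e' b z))), by
              rw [hΦ, embModel_apply, LinearEquiv.apply_symm_apply, ptEmb_y]⟩
    intro x
    obtain ⟨f, hf⟩ := key (e x)
    exact ⟨f, e.injective hf⟩

variable {𝔤 : Type} [LieRing 𝔤] [LieAlgebra ℂ 𝔤] [LieRingModule 𝔤 X] [LieModule ℂ 𝔤 X]
  [∀ b, LieRingModule 𝔤 (V b)] [∀ b, LieModule ℂ 𝔤 (V b)] (c : ConfCoords m 𝔤)
  {σ : Matrix (Fin (m + 1)) (Fin (m + 1)) ℂ →ₗ[ℂ] Module.End ℂ F}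
  {σ' : Matrix (Fin m) (Fin m) ℂ →ₗ[ℂ] Module.End ℂ F'} {μ : ℂ}
  (hQ : ∀ (B : Matrix (Fin m) (Fin m) ℂ) (B' : Matrix (Fin (m + 1)) (Fin (m + 1)) ℂ),
    (∀ i j : Fin m, B' i.castSucc j.castSucc = B i j) → (∀ i, B' i (Fin.last m) = 0) →
    (∀ i, B' (Fin.last m) i = 0) → ∀ v, σ B' (Q v) = Q (σ' B v))
  (ext : 𝔤 → Matrix (Fin (m + 1)) (Fin (m + 1)) ℂ)
  (hext : ∀ A, (∀ i j : Fin m, ext A i.castSucc j.castSucc = c.B A i j) ∧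
    (∀ i, ext A i (Fin.last m) = 0) ∧ ∀ i, ext A (Fin.last m) i = 0)
  (he : ∀ (A : 𝔤) z, e ⁅A, z⁆ = c.a A • hOp (m + 1) F μ (e z)
    + ∑ i, c.x A i • xOp σ μ (Fin.castSucc i) (e z) + ∑ i, c.y A i • yOp F (Fin.castSucc i) (e z)
    + mOp σ (ext A) (e z))
  (he' : ∀ b (A : 𝔤) z, e' b ⁅A, z⁆ = modelAct σ' (μ - b) c A (e' b z))

include hQ hext he he'

theorem embModel_lie (A : 𝔤) (b : ℕ) (z : V b) :
    ⁅A, embModel Q e e' b z⁆ - embModel Q e e' b ⁅A, z⁆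
      = ∑ i, c.x A i • ((b : ℂ) • embModel Q e e' (b - 1) ((e' (b - 1)).symm
          (sOp m (Q.symm.conj (σ (skewUnit i.castSucc (Fin.last m)))) (e' b z)))
        + (1 / 2 * b * (b - 1 : ℕ) : ℂ) • embModel Q e e' (b - 1 - 1)
          ((e' (b - 1 - 1)).symm (yOp F' i (e' b z)))) := by
  apply e.injective
  obtain ⟨h1, h2, h3⟩ := hext A
  simp only [map_sub, map_sum, map_smul, map_add, he, embModel_apply, he',
    LinearEquiv.apply_symm_apply, ptEmb_h, ptEmb_x Q hQ, ptEmb_y,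
    ptEmb_m Q hQ b _ _ h1 h2 h3, modelAct_apply, LinearMap.add_apply, LinearMap.sum_apply,
    LinearMap.smul_apply, smul_add, Finset.sum_add_distrib]
  abel

theorem splitting_embModel : Splitting 𝔤 (embModel Q e e') := by
  refine ⟨embModel_bijective Q e e', fun A b z => ?_⟩
  rw [embModel_lie Q e e' c hQ ext hext he he']
  refine sum_mem fun i _ => Submodule.smul_mem _ _ (add_mem ?_ ?_)
  · rcases b with _ | b
    · rw [Nat.cast_zero, zero_smul]; exact zero_mem _
    · exact Submodule.smul_mem _ _ (emb_mem_partialSum _ (by omega) _)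
  -- For b = 0 and b = 1 the coefficient b(b - 1) vanishes, and the truncated exponent b - 1 - 1
  -- plays no role.
  · rcases b with _ | _ | b
    · simp
    · simp
    · exact Submodule.smul_mem _ _ (emb_mem_partialSum _ (by omega) _)

/-- Only the X_i disturb the power of the last variable; the Levi subalgebra has no such component.
-/
theorem embModel_lie_of_x_eq_zero (A : 𝔤) (hA : c.x A = 0) (b : ℕ) (z : V b) :
    ⁅A, embModel Q e e' b z⁆ = embModel Q e e' b ⁅A, z⁆ := by
  rw [← sub_eq_zero, embModel_lie Q e e' c hQ ext hext he he', hA]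
  simp

end Restriction

/-! ### Models of the modules in the branching law -/

section Models

theorem halfSpinRep_coords (n : ℕ) (hn : Even n) (ε : ℤˣ) (lam : ℂ) (A : parab n)
    (v : HalfSpinor n ε) : halfSpinRep n hn ε lam A v
      = ((coordsG n).a A * lam) • v + halfAct hn ε ((coordsG n).B A) v :=
  Subtype.ext (spinRep_coords lam A v.1)

/-- The coordinates on `𝔤'`, for `n = m + 1`. -/
def coordsPrime (m : ℕ) : ConfCoords m (gPrime (m + 1)) := coordsG' (m + 1) (Nat.le_add_left 1 m)

/-- The module `M(S^m_μ)` of `𝔤'`. -/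
abbrev SpinVerma (m : ℕ) (μ : ℂ) : Type := GenVerma (parab' (m + 1)) (spinRep' (m + 1) μ)

/-- The module `M(S^m_{ε,μ})` of `𝔤'`. -/
abbrev HalfSpinVerma (m : ℕ) (ho : Odd (m + 1)) (ε : ℤˣ) (μ : ℂ) : Type :=
  GenVerma (parab' (m + 1)) (halfSpinRep' (m + 1) ho ε μ)

theorem exists_spinVerma_model (m : ℕ) (μ : ℂ) :
    ∃ e : SpinVerma m μ ≃ₗ[ℂ] PolyTensor m (Spinor m),
      ∀ (A : gPrime (m + 1)) z, e ⁅A, z⁆ = modelAct (spinAct m) μ (coordsPrime m) A (e z) := by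
  obtain ⟨e, -, he⟩ := exists_verma_equiv (coordsPrime m) μ (isSkewRep_spinAct m)
    (P := parab' (m + 1)) (ρ := spinRep' (m + 1) μ) (mem_parab'_coords (Nat.le_add_left 1 m))
    (spinRep'_coords (Nat.le_add_left 1 m) μ)
  exact ⟨e, he⟩

theorem exists_halfSpinVerma_model (m : ℕ) (ho : Odd (m + 1)) (hm : Even m) (ε : ℤˣ) (μ : ℂ) :
    ∃ e : HalfSpinVerma m ho ε μ ≃ₗ[ℂ] PolyTensor m (HalfSpinor m ε),
      ∀ (A : gPrime (m + 1)) z, e ⁅A, z⁆ = modelAct (halfAct hm ε) μ (coordsPrime m) A (e z) := by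
  obtain ⟨e, -, he⟩ := exists_verma_equiv (coordsPrime m) μ (isSkewRep_halfAct hm ε)
    (P := parab' (m + 1)) (ρ := halfSpinRep' (m + 1) ho ε μ)
    (mem_parab'_coords (Nat.le_add_left 1 m))
    (fun A v => Subtype.ext (spinRep'_coords (Nat.le_add_left 1 m) μ A v.1))
  exact ⟨e, he⟩

theorem exists_model_spinRep (n : ℕ) (lam : ℂ) :
    ∃ e : GenVerma (parab n) (spinRep n lam) ≃ₗ[ℂ] PolyTensor n (Spinor n),
      ∀ (A : soG n) z, e ⁅A, z⁆ = modelAct (spinAct n) lam (coordsG n) A (e z) := by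
  obtain ⟨e, -, he⟩ := exists_verma_equiv (coordsG n) lam (isSkewRep_spinAct n)
    (P := parab n) (ρ := spinRep n lam) mem_parab_coords (spinRep_coords lam)
  exact ⟨e, he⟩

theorem exists_model_halfSpinRep (n : ℕ) (hn : Even n) (ε : ℤˣ) (lam : ℂ) :
    ∃ e : GenVerma (parab n) (halfSpinRep n hn ε lam) ≃ₗ[ℂ] PolyTensor n (HalfSpinor n ε),
      ∀ (A : soG n) z, e ⁅A, z⁆ = modelAct (halfAct hn ε) lam (coordsG n) A (e z) := by
  obtain ⟨e, -, he⟩ := exists_verma_equiv (coordsG n) lam (isSkewRep_halfAct hn ε)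
    (P := parab n) (ρ := halfSpinRep n hn ε lam) mem_parab_coords
    (halfSpinRep_coords n hn ε lam)
  exact ⟨e, he⟩

theorem coordsG_gPrime (m : ℕ) (A : gPrime (m + 1)) :
    (∀ i j : Fin m, (coordsG (m + 1)).B A.1 i.castSucc j.castSucc = (coordsPrime m).B A i j) ∧
    (∀ i, (coordsG (m + 1)).B A.1 i (Fin.last m) = 0) ∧
    ∀ i, (coordsG (m + 1)).B A.1 (Fin.last m) i = 0 := by
  have h : ∀ i, (coordsG (m + 1)).B A.1 i (Fin.last m) = 0 := fun i => A.2 _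
  exact ⟨fun i j => rfl, h, fun i => by rw [(coordsG (m + 1)).skew, h, neg_zero]⟩

theorem modelAct_gPrime (m : ℕ) {F : Type} [AddCommGroup F] [Module ℂ F]
    (σ : Matrix (Fin (m + 1)) (Fin (m + 1)) ℂ →ₗ[ℂ] Module.End ℂ F) (lam : ℂ)
    (A : gPrime (m + 1)) (u : PolyTensor (m + 1) F) :
    modelAct σ lam (coordsG (m + 1)) A.1 u = (coordsPrime m).a A • hOp (m + 1) F lam u
      + ∑ i, (coordsPrime m).x A i • xOp σ lam (Fin.castSucc i) u
      + ∑ i, (coordsPrime m).y A i • yOp F (Fin.castSucc i) u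
      + mOp σ ((coordsG (m + 1)).B A.1) u := by
  -- The last of the m + 1 middle coordinates belongs to the column m + 1 = n, which is zero in 𝔤'.
  have hx : (coordsG (m + 1)).x A.1 (Fin.last m) = 0 := A.2 _
  have hy : (coordsG (m + 1)).y A.1 (Fin.last m) = 0 := by
    have h := soG_entry (m + 1) A.1 (midIdx (m + 1) (m + 1) le_rfl (Fin.last m)) 0
    rw [dual_midIdx] at h
    exact h.trans (neg_eq_zero.2 (A.2 _))
  rw [modelAct_apply]
  simp only [LinearMap.add_apply, LinearMap.sum_apply, LinearMap.smul_apply, Fin.sum_univ_castSucc,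
    hx, hy, zero_smul, add_zero]
  rfl

end Models

/-! ### Homomorphisms between models -/

section ModelHom

variable {m : ℕ} {F F' : Type} [AddCommGroup F] [Module ℂ F] [AddCommGroup F'] [Module ℂ F']
  {σ : Matrix (Fin m) (Fin m) ℂ →ₗ[ℂ] Module.End ℂ F}
  {σ' : Matrix (Fin m) (Fin m) ℂ →ₗ[ℂ] Module.End ℂ F'} {μ : ℂ}
  {𝔤 : Type} [LieRing 𝔤] [LieAlgebra ℂ 𝔤] {c : ConfCoords m 𝔤}
  {X X' : Type} [AddCommGroup X] [Module ℂ X] [LieRingModule 𝔤 X] [LieModule ℂ 𝔤 X]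
  [AddCommGroup X'] [Module ℂ X'] [LieRingModule 𝔤 X'] [LieModule ℂ 𝔤 X']
  (e : X ≃ₗ[ℂ] PolyTensor m F) (he : ∀ (A : 𝔤) z, e ⁅A, z⁆ = modelAct σ μ c A (e z))
  (e' : X' ≃ₗ[ℂ] PolyTensor m F') (he' : ∀ (A : 𝔤) z, e' ⁅A, z⁆ = modelAct σ' μ c A (e' z))

/-- The homomorphism induced by an equivariant map of values. -/
def modelHom (f : F →ₗ[ℂ] F')
    (hf : ∀ B : Matrix (Fin m) (Fin m) ℂ, (∀ i j, B i j = -B j i) → ∀ v, f (σ B v) = σ' B (f v)) :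
    X →ₗ⁅ℂ,𝔤⁆ X' :=
  { e'.symm.toLinearMap ∘ₗ ptMap m f ∘ₗ e.toLinearMap with
    map_lie' := fun {A z} => by
      change e'.symm (ptMap m f (e ⁅A, z⁆)) = ⁅A, e'.symm (ptMap m f (e z))⁆
      rw [LinearEquiv.symm_apply_eq, he, he', LinearEquiv.apply_symm_apply,
        ptMap_modelAct f hf] }

theorem modelHom_apply (f : F →ₗ[ℂ] F')
    (hf : ∀ B : Matrix (Fin m) (Fin m) ℂ, (∀ i j, B i j = -B j i) → ∀ v, f (σ B v) = σ' B (f v))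
    (z : X) : modelHom e he e' he' f hf z = e'.symm (ptMap m f (e z)) := rfl

end ModelHom

/-! ### Decomposition of the full spin module into its half-spin parts -/

section HalfSpinVermaHoms

theorem halfProj_halfIncl_of_ne {m : ℕ} {ε ε' : ℤˣ} (h : ε' ≠ ε) (f : HalfSpinor m ε') :
    halfProj m ε (halfIncl m ε' f) = 0 := by
  obtain rfl : ε = -ε' := Int.units_ne_iff_eq_neg.1 h.symm
  exact halfProj_neg_halfIncl m ε' f

/-- The inclusions and projections of half-spinors are so(m)-equivariant, so by functoriality of the
model they induce a decomposition of the modules. -/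
theorem exists_halfSpinVerma_homs (m : ℕ) (ho : Odd (m + 1)) (hm : Even m) (μ : ℂ) :
    ∃ (i : ∀ ε, HalfSpinVerma m ho ε μ →ₗ⁅ℂ,gPrime (m + 1)⁆ SpinVerma m μ)
      (p : ∀ ε, SpinVerma m μ →ₗ⁅ℂ,gPrime (m + 1)⁆ HalfSpinVerma m ho ε μ),
      (∀ ε z, p ε (i ε z) = z) ∧ (∀ ε ε', ε' ≠ ε → ∀ z, p ε (i ε' z) = 0) ∧
      ∀ z, i 1 (p 1 z) + i (-1) (p (-1) z) = z := by
  obtain ⟨e, he⟩ := exists_spinVerma_model m μ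
  choose e' he' using fun ε => exists_halfSpinVerma_model m ho hm ε μ
  have hpt : ∀ {F : Type} [AddCommGroup F] [Module ℂ F] (f g : F →ₗ[ℂ] Spinor m) (u),
      ptMap m (f + g) u = ptMap m f u + ptMap m g u := fun f g u => by
    rw [ptMap, LinearMap.lTensor_add]; rfl
  have hcomp : ∀ {F F' F'' : Type} [AddCommGroup F] [Module ℂ F] [AddCommGroup F'] [Module ℂ F']
      [AddCommGroup F''] [Module ℂ F''] (g : F' →ₗ[ℂ] F'') (f : F →ₗ[ℂ] F') (u),
      ptMap m g (ptMap m f u) = ptMap m (g ∘ₗ f) u := fun g f u => by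
    rw [ptMap, ptMap, ptMap, LinearMap.lTensor_comp]; rfl
  have hid : ∀ {F : Type} [AddCommGroup F] [Module ℂ F] (u : PolyTensor m F),
      ptMap m LinearMap.id u = u := fun u => by
    rw [ptMap, LinearMap.lTensor_id]; rfl
  refine ⟨fun ε => modelHom (e' ε) (he' ε) e he (halfIncl m ε)
      fun B _ v => halfIncl_halfAct hm ε B v,
    fun ε => modelHom e he (e' ε) (he' ε) (halfProj m ε) fun B _ v => halfProj_spinAct hm ε B v,
    fun ε z => ?_, fun ε ε' h z => ?_, fun z => ?_⟩
  · rw [modelHom_apply, modelHom_apply, e.apply_symm_apply, hcomp,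
      show halfProj m ε ∘ₗ halfIncl m ε = LinearMap.id from
        LinearMap.ext (halfProj_halfIncl m ε), hid, LinearEquiv.symm_apply_apply]
  · rw [modelHom_apply, modelHom_apply, e.apply_symm_apply, hcomp,
      show halfProj m ε ∘ₗ halfIncl m ε' = 0 from
        LinearMap.ext (halfProj_halfIncl_of_ne h), ptMap, LinearMap.lTensor_zero]
    exact map_zero _
  · simp only [modelHom_apply, LinearEquiv.apply_symm_apply, hcomp]
    rw [← map_add, ← hpt, show halfIncl m 1 ∘ₗ halfProj m 1 + halfIncl m (-1) ∘ₗ halfProj m (-1)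
      = LinearMap.id from LinearMap.ext (add_halfProj m 1), hid, LinearEquiv.symm_apply_apply]

end HalfSpinVermaHoms

/-! ### Finiteness and irreducibility -/

section Properties

variable (m : ℕ)

theorem finiteLengthObj_spinVerma (μ : ℂ) :
    FiniteLengthObj (levi' (m + 1)) (nilrad' (m + 1)) (SpinVerma m μ) := by
  obtain ⟨e, he⟩ := exists_spinVerma_model m μ
  obtain ⟨h1, h2⟩ := wellFounded_of_model e he
  refine ⟨h1, h2, finSocle_of_model e he (levi' (m + 1))
    (mem_levi'_coords (Nat.le_add_left 1 m)), fun x => ?_⟩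
  obtain ⟨W, hW, hx, h⟩ := nil_finite_of_model e he x
  refine ⟨W, hW, hx, fun A hA => ?_⟩
  obtain ⟨hy, ha, hB⟩ := (mem_nilrad'_coords (Nat.le_add_left 1 m) A).1 hA
  exact h A hy ha hB

theorem finiteLengthObj_halfSpinVerma (ho : Odd (m + 1)) (hm : Even m) (ε : ℤˣ) (μ : ℂ) :
    FiniteLengthObj (levi' (m + 1)) (nilrad' (m + 1)) (HalfSpinVerma m ho ε μ) := by
  obtain ⟨i, p, hpi, -, -⟩ := exists_halfSpinVerma_homs m ho hm μ
  exact (finiteLengthObj_spinVerma m μ).of_surjective (p ε) fun z => ⟨i ε z, hpi ε z⟩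

theorem multIrr_spinVerma (ho : Odd (m + 1)) (hm : Even m) (μ : ℂ)
    (T : Irr (levi' (m + 1)) (nilrad' (m + 1))) :
    multIrr _ _ (SpinVerma m μ) T
      = multIrr _ _ (HalfSpinVerma m ho 1 μ) T + multIrr _ _ (HalfSpinVerma m ho (-1) μ) T := by
  obtain ⟨i, p, hpi, hne, hadd⟩ := exists_halfSpinVerma_homs m ho hm μ
  induction T using Quotient.inductionOn with
  | h S =>
    refine mult_exact (S := S.carrier) (i 1) (fun x y h => by rw [← hpi 1 x, h, hpi])
      (p (-1)) (fun z => ⟨i (-1) z, hpi _ z⟩) fun b => ⟨fun h => ⟨p 1 b, ?_⟩, ?_⟩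
    · have := hadd b
      rwa [h, map_zero, add_zero] at this
    · rintro ⟨a, rfl⟩
      exact hne _ _ (by decide) a

variable {m} {μ : ℂ} (h1 : ∀ k : ℕ, 1 ≤ k → 2 * μ + m ≠ k) (h2 : ∀ k : ℕ, μ + m - 3 / 2 ≠ k)

include h1 h2

theorem irreducible_spinVerma (hm : Odd m) :
    LieModule.IsIrreducible ℂ (gPrime (m + 1)) (SpinVerma m μ) := by
  obtain ⟨e, he⟩ := exists_spinVerma_model m μ
  exact irreducible_of_model e he LinearMap.id Function.injective_id (fun _ _ _ => rfl)
    (spinor_irreducible hm) h1 h2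

theorem irreducible_halfSpinVerma (ho : Odd (m + 1)) (hm : Even m) (ε : ℤˣ) (hε : m = 0 → ε = 1) :
    LieModule.IsIrreducible ℂ (gPrime (m + 1)) (HalfSpinVerma m ho ε μ) := by
  obtain ⟨e, he⟩ := exists_halfSpinVerma_model m ho hm ε μ
  have hnt : Nontrivial (HalfSpinor m ε) :=
    Submodule.nontrivial_iff_ne_bot.2 (halfSpinor_ne_bot fun h => hε (by
      obtain ⟨r, rfl⟩ := hm; omega))
  refine irreducible_of_model e he (halfIncl m ε) (halfIncl_injective m ε)
    (fun B _ v => halfIncl_halfAct hm ε B v) (fun W hW hne => ?_) h1 h2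
  have h := halfSpinor_irreducible hm ε (W.map (halfIncl m ε)) (fun B hB w hw => by
    obtain ⟨v, hv, rfl⟩ := hw
    exact ⟨_, hW B hB v hv, halfIncl_halfAct hm ε B v⟩) (by
    rw [← range_halfIncl]; exact LinearMap.map_le_range) fun h =>
    hne (Submodule.map_injective_of_injective (halfIncl_injective m ε)
      (h.trans (Submodule.map_bot _).symm))
  rw [← range_halfIncl, ← Submodule.map_top] at h
  exact Submodule.map_injective_of_injective (halfIncl_injective m ε) h

end Properties

/-! ### The branching laws -/

section Branching

variable {m : ℕ} {F X : Type} [AddCommGroup F] [Module ℂ F] [AddCommGroup X] [Module ℂ X]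
  [LieRingModule (soG (m + 1)) X] [LieModule ℂ (soG (m + 1)) X]
  {σ : Matrix (Fin (m + 1)) (Fin (m + 1)) ℂ →ₗ[ℂ] Module.End ℂ F} {lam : ℂ}
  (e : X ≃ₗ[ℂ] PolyTensor (m + 1) F)
  (he : ∀ (A : soG (m + 1)) z, e ⁅A, z⁆ = modelAct σ lam (coordsG (m + 1)) A (e z))
  (Q : Spinor m ≃ₗ[ℂ] F)
  (hQ : ∀ (B : Matrix (Fin m) (Fin m) ℂ) (B' : Matrix (Fin (m + 1)) (Fin (m + 1)) ℂ),
    (∀ i j : Fin m, B' i.castSucc j.castSucc = B i j) → (∀ i, B' i (Fin.last m) = 0) →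
    (∀ i, B' (Fin.last m) i = 0) → ∀ v, σ B' (Q v) = Q (spinAct m B v))

include he hQ

/-- `Q` identifies F, restricted to so(m), with the full spinors in dimension m. This single input
covers both parities of n. -/
theorem exists_splitting : ∃ emb : ∀ b : ℕ, SpinVerma m (lam - b) →ₗ[ℂ] X,
    Splitting (gPrime (m + 1)) emb ∧
    ∀ (A : levi' (m + 1)) b z, ⁅(A : gPrime (m + 1)), emb b z⁆ = emb b ⁅(A : gPrime (m + 1)), z⁆ := by
  choose e' he' using fun b : ℕ => exists_spinVerma_model m (lam - b)
  have heX : ∀ (A : gPrime (m + 1)) (z : X), e ⁅A, z⁆ = (coordsPrime m).a A • hOp (m + 1) F lam (e z)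
      + ∑ i, (coordsPrime m).x A i • xOp σ lam (Fin.castSucc i) (e z)
      + ∑ i, (coordsPrime m).y A i • yOp F (Fin.castSucc i) (e z)
      + mOp σ ((coordsG (m + 1)).B A.1) (e z) := fun A z => by
    rw [← modelAct_gPrime]
    exact he A.1 z
  exact ⟨embModel Q e e', splitting_embModel Q e e' (coordsPrime m) hQ
      (fun A => (coordsG (m + 1)).B A.1) (coordsG_gPrime m) heX he', fun A b z =>
    embModel_lie_of_x_eq_zero Q e e' (coordsPrime m) hQ
      (fun A => (coordsG (m + 1)).B A.1) (coordsG_gPrime m) heX he' A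
      ((mem_levi'_coords (Nat.le_add_left 1 m) A.1).1 A.2).1 b z⟩

theorem hasClass_restriction [FiniteDimensional ℂ F] :
    HasClass (levi' (m + 1)) (nilrad' (m + 1)) X ∧
      ∀ T : Irr (levi' (m + 1)) (nilrad' (m + 1)), ∃ b : ℕ,
        (∀ c : ℕ, b ≤ c → multIrr _ _ (SpinVerma m (lam - c)) T = 0) ∧
        multIrr _ _ X T = ∑ c ∈ Finset.range b, multIrr _ _ (SpinVerma m (lam - c)) T := by
  obtain ⟨emb, h, hL⟩ := exists_splitting e he Q hQ
  refine h.hasClass hL (fun x => ?_) (fun c => finiteLengthObj_spinVerma m _) (coordsPrime m).H lam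
    fun c => ?_
  · obtain ⟨W, hW, hx, hst⟩ := nil_finite_of_model e he x
    refine ⟨W, hW, hx, fun A hA w hw => ?_⟩
    -- Local finiteness is inherited from 𝔤, because the nilradical of 𝔭' lies in that of 𝔭.
    have hA' : A.1 ∈ nilrad (m + 1) := hA
    exact hst A.1 ((mem_parab_coords A.1).1 hA'.1) hA'.2.1 hA'.2.2 w hw
  · obtain ⟨e', he'⟩ := exists_spinVerma_model m (lam - c)
    exact hasWeights_of_model e' he'

theorem exists_homs_restriction (hlam : ∀ k : ℕ, 1 ≤ k → 2 * lam + m ≠ k) :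
    ∃ φ : ∀ b : ℕ, SpinVerma m (lam - b) →ₗ⁅ℂ,gPrime (m + 1)⁆ X,
      (∀ i : ℕ, ∃ q : X →ₗ[ℂ] SpinVerma m (lam - i), (∀ z, q (φ i z) = z) ∧
        ∀ j, j ≠ i → ∀ z, q (φ j z) = 0) ∧
      ∀ x, x ∈ ⨆ i, LinearMap.range (φ i).toLinearMap := by
  obtain ⟨emb, h, -⟩ := exists_splitting e he Q hQ
  refine h.exists_hom (casimir (coordsPrime m) X) (casimir_lie (coordsPrime m) X)
    (fun b : ℕ => (lam - b) ^ 2 + m * (lam - b) + m * (m - 1) / 8) (fun b b' hbb => ?_) fun b z => ?_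
  · have h1 : ((b' : ℂ) - b) * (2 * lam + m - (b + b' : ℕ)) = 0 := by
      push_cast
      linear_combination hbb
    rcases mul_eq_zero.1 h1 with h2 | h2
    · exact (Nat.cast_injective (sub_eq_zero.1 h2)).symm
    · by_contra hne
      exact hlam (b + b') (by omega) (sub_eq_zero.1 h2)
  · obtain ⟨e', he'⟩ := exists_spinVerma_model m (lam - b)
    have := h.casimir_sub_mem (coordsPrime m) b z
    rwa [casimir_of_model e' he', map_smul] at this

end Branching

/-! ### Refining a direct sum decomposition -/

section Refinement

variable {𝔤 : Type} [LieRing 𝔤] [LieAlgebra ℂ 𝔤] {X : Type}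
  [AddCommGroup X] [Module ℂ X] [LieRingModule 𝔤 X] [LieModule ℂ 𝔤 X]
  {ι κ : Type} {Y : ι → Type} [∀ b, AddCommGroup (Y b)] [∀ b, Module ℂ (Y b)]
  [∀ b, LieRingModule 𝔤 (Y b)] [∀ b, LieModule ℂ 𝔤 (Y b)]
  {Z : κ → ι → Type} [∀ k b, AddCommGroup (Z k b)] [∀ k b, Module ℂ (Z k b)]
  [∀ k b, LieRingModule 𝔤 (Z k b)] [∀ k b, LieModule ℂ 𝔤 (Z k b)]

theorem nonempty_equiv_directSum_prod (φ : ∀ b, Y b →ₗ⁅ℂ,𝔤⁆ X)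
    (hφ : ∀ b, ∃ q : X →ₗ[ℂ] Y b, (∀ z, q (φ b z) = z) ∧ ∀ j, j ≠ b → ∀ z, q (φ j z) = 0)
    (hspan : ∀ x, x ∈ ⨆ b, LinearMap.range (φ b).toLinearMap)
    (i : ∀ b k, Z k b →ₗ⁅ℂ,𝔤⁆ Y b) (p : ∀ b k, Y b →ₗ⁅ℂ,𝔤⁆ Z k b)
    (hpi : ∀ b k z, p b k (i b k z) = z) (hne : ∀ b k k', k' ≠ k → ∀ z, p b k (i b k' z) = 0)
    (hi : ∀ b z, z ∈ ⨆ k, LinearMap.range (i b k).toLinearMap) :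
    Nonempty (X ≃ₗ⁅ℂ,𝔤⁆ ⨁ a : κ × ι, Z a.1 a.2) := by
  refine nonempty_equiv_directSum (fun a : κ × ι => (φ a.2).comp (i a.2 a.1)) (fun a => ?_)
    fun x => ?_
  · obtain ⟨k, b⟩ := a
    obtain ⟨q, hq1, hq2⟩ := hφ b
    refine ⟨(p b k).toLinearMap ∘ₗ q, fun z => ?_, fun j hj z => ?_⟩
    · change p b k (q (φ b (i b k z))) = z
      rw [hq1, hpi]
    · obtain ⟨k', b'⟩ := j
      change p b k (q (φ b' (i b' k' z))) = 0
      by_cases hbb : b' = b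
      · subst hbb
        rw [hq1, hne _ _ _ fun h => hj (by rw [h])]
      · rw [hq2 _ hbb, map_zero]
  · have hle : (⨆ b, LinearMap.range (φ b).toLinearMap)
        ≤ ⨆ a : κ × ι, LinearMap.range ((φ a.2).comp (i a.2 a.1)).toLinearMap := by
      refine iSup_le fun b => ?_
      rintro _ ⟨z, rfl⟩
      refine Submodule.iSup_induction _ (motive := fun z => (φ b).toLinearMap z
        ∈ ⨆ a : κ × ι, LinearMap.range ((φ a.2).comp (i a.2 a.1)).toLinearMap) (hi b z) ?_
        (by rw [map_zero]; exact zero_mem _) fun z w hz hw => by rw [map_add]; exact add_mem hz hw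
      rintro k _ ⟨w, rfl⟩
      exact Submodule.mem_iSup_of_mem ((k, b) : κ × ι) ⟨w, rfl⟩
    exact hle (hspan x)

end Refinement

/-! ### From multiplicities to identities in the Grothendieck group -/

section Classes

variable {𝔤 : Type} [LieRing 𝔤] [LieAlgebra ℂ 𝔤] {L N : LieSubalgebra ℂ 𝔤} {ι : Type}
  {X : Type} [AddCommGroup X] [Module ℂ X] [LieRingModule 𝔤 X] [LieModule ℂ 𝔤 X]
  {Y : ι → Type} [∀ i, AddCommGroup (Y i)] [∀ i, Module ℂ (Y i)]
  [∀ i, LieRingModule 𝔤 (Y i)] [∀ i, LieModule ℂ 𝔤 (Y i)]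

/-- Convergence is pointwise, and at each simple object all but finitely many terms vanish, so the
sum there is finite. -/
theorem eqInK_of_multIrr (hX : HasClass L N X) (hY : ∀ i, FiniteLengthObj L N (Y i))
    (h : ∀ T : Irr L N, ∃ s : Finset ι, (∀ i, i ∉ s → multIrr L N (Y i) T = 0) ∧
      multIrr L N X T = ∑ i ∈ s, multIrr L N (Y i) T) : EqInK L N X Y := by
  refine ⟨hX, fun i => ⟨(hY i).inCatO, (hY i).hasClass⟩, Pi.hasSum.2 fun T => ?_⟩
  obtain ⟨s, hs, hsum⟩ := h T
  have hnat : multIrr L N X T = ((∑ i ∈ s, (multIrr L N (Y i) T).toNat : ℕ) : ℕ∞) := by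
    rw [hsum, Nat.cast_sum]
    exact Finset.sum_congr rfl fun i _ =>
      (ENat.natCast_toNat ((hY i).hasClass.mult_finite T)).symm
  have : ch L N X T = ∑ i ∈ s, ch L N (Y i) T := by
    rw [ch, hnat, ENat.toNat_natCast, Nat.cast_sum]
    rfl
  rw [this]
  exact hasSum_sum_of_ne_finset_zero fun i hi => by simp [ch, hs i hi]

end Classes

theorem sub_natCast_ne {m : ℕ} {lam : ℂ}
    (h2 : ∀ k : ℕ, 1 ≤ k → 2 * lam + ((m + 1 : ℕ) : ℂ) - 1 ≠ k) (b k : ℕ) (hk : 1 ≤ k) :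
    2 * (lam - b) + m ≠ k := fun h => h2 (2 * b + k) (by omega) (by
  push_cast
  linear_combination h)

/-- With n = m + 1, the value k for the b-th summand corresponds to b + k + 1 for lam itself. This
is why excluding positive integers for lam excludes all naturals, including 0, for every summand. -/
theorem sub_natCast_ne' {m : ℕ} {lam : ℂ}
    (h1 : ∀ k : ℕ, 1 ≤ k → lam + ((m + 1 : ℕ) : ℂ) - 3 / 2 ≠ k) (b k : ℕ) :
    lam - b + m - 3 / 2 ≠ k := fun h => h1 (b + k + 1) (by omega) (by
  push_cast
  linear_combination h)

/-- The branching law for `n` odd. -/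
theorem branching_odd (m : ℕ) (ho : Odd (m + 1)) (lam : ℂ) :
    EqInK (levi' (m + 1)) (nilrad' (m + 1)) (GenVerma (parab (m + 1)) (spinRep (m + 1) lam))
      (fun i : ℤˣ × ℕ => HalfSpinVerma m ho i.1 (lam - i.2)) ∧
    ((∀ k : ℕ, 1 ≤ k → 2 * lam + m ≠ k) →
      Nonempty (GenVerma (parab (m + 1)) (spinRep (m + 1) lam) ≃ₗ⁅ℂ,gPrime (m + 1)⁆
        ⨁ i : ℤˣ × ℕ, HalfSpinVerma m ho i.1 (lam - i.2))) := by
  have hm : Even m := by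
    rcases Nat.even_or_odd m with h | h
    · exact h
    · exact absurd ho (Nat.not_odd_iff_even.2 h.add_one)
  obtain ⟨e, he⟩ := exists_model_spinRep (m + 1) lam
  -- For n odd the full spinors in dimensions n and n - 1 have the same modes.
  let Q := LinearEquiv.ofBijective _ (pullSpinor_bijective (Nat.le_succ m) hm)
  have hQ : ∀ (B : Matrix (Fin m) (Fin m) ℂ) (B' : Matrix (Fin (m + 1)) (Fin (m + 1)) ℂ),
      (∀ i j : Fin m, B' i.castSucc j.castSucc = B i j) → (∀ i, B' i (Fin.last m) = 0) →
      (∀ i, B' (Fin.last m) i = 0) → ∀ v, spinAct (m + 1) B' (Q v) = Q (spinAct m B v) :=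
    fun B B' h1 h2 h3 v => (pullSpinor_spinAct (Nat.le_succ m) B B' h1 h2 h3 v).symm
  refine ⟨?_, fun hlam => ?_⟩
  · obtain ⟨hX, hT⟩ := hasClass_restriction e he Q hQ
    refine eqInK_of_multIrr hX (fun i => finiteLengthObj_halfSpinVerma m ho hm _ _) fun T => ?_
    obtain ⟨b, hb, hsum⟩ := hT T
    refine ⟨Finset.univ ×ˢ Finset.range b, fun i hi => ?_, ?_⟩
    · have hle : b ≤ i.2 := by
        simpa [Int.units_eq_one_or] using hi
      have h0 := hb _ hle
      rw [multIrr_spinVerma m ho hm, add_eq_zero] at h0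
      obtain ⟨ε, c⟩ := i
      rcases Int.units_eq_one_or ε with rfl | rfl
      · exact h0.1
      · exact h0.2
    · rw [hsum, Finset.sum_product_right]
      refine Finset.sum_congr rfl fun c _ => ?_
      rw [multIrr_spinVerma m ho hm, UnitsInt.univ, Finset.sum_pair (by decide)]
  · obtain ⟨φ, hφ, hspan⟩ := exists_homs_restriction e he Q hQ hlam
    choose i p hpi hne hadd using fun b : ℕ => exists_halfSpinVerma_homs m ho hm (lam - b)
    refine nonempty_equiv_directSum_prod (Z := fun ε b => HalfSpinVerma m ho ε (lam - (b : ℕ))) φ hφ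
      hspan i p hpi hne fun b z => ?_
    rw [← hadd b z]
    exact add_mem (Submodule.mem_iSup_of_mem 1 ⟨p b 1 z, rfl⟩)
      (Submodule.mem_iSup_of_mem (-1) ⟨p b (-1) z, rfl⟩)

/-- The branching law for `n` even. -/
theorem branching_even (m : ℕ) (hn : Even (m + 1)) (δ : ℤˣ) (lam : ℂ) :
    EqInK (levi' (m + 1)) (nilrad' (m + 1))
      (GenVerma (parab (m + 1)) (halfSpinRep (m + 1) hn δ lam))
      (fun b : ℕ => SpinVerma m (lam - b)) ∧
    ((∀ k : ℕ, 1 ≤ k → 2 * lam + m ≠ k) →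
      Nonempty (GenVerma (parab (m + 1)) (halfSpinRep (m + 1) hn δ lam) ≃ₗ⁅ℂ,gPrime (m + 1)⁆
        ⨁ b : ℕ, SpinVerma m (lam - b))) := by
  have hm : Odd m := by
    rcases Nat.even_or_odd m with h | h
    · exact absurd h.add_one (Nat.not_odd_iff_even.2 hn)
    · exact h
  obtain ⟨e, he⟩ := exists_model_halfSpinRep (m + 1) hn δ lam
  -- For n even each half-spin space restricts to the full spinors in dimension n - 1.
  let Q := LinearEquiv.ofBijective _ (halfProj_pullSpinor_bijective (Nat.le_succ m) hm δ)
  have hQ : ∀ (B : Matrix (Fin m) (Fin m) ℂ) (B' : Matrix (Fin (m + 1)) (Fin (m + 1)) ℂ),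
      (∀ i j : Fin m, B' i.castSucc j.castSucc = B i j) → (∀ i, B' i (Fin.last m) = 0) →
      (∀ i, B' (Fin.last m) i = 0) → ∀ v, halfAct hn δ B' (Q v) = Q (spinAct m B v) :=
    fun B B' h1 h2 h3 v => by
      change halfAct hn δ B' (halfProj (m + 1) δ (pullSpinor _ v))
        = halfProj (m + 1) δ (pullSpinor _ (spinAct m B v))
      rw [pullSpinor_spinAct (Nat.le_succ m) B B' h1 h2 h3, halfProj_spinAct]
  refine ⟨?_, fun hlam => ?_⟩
  · obtain ⟨hX, hT⟩ := hasClass_restriction e he Q hQ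
    refine eqInK_of_multIrr hX (fun b => finiteLengthObj_spinVerma m _) fun T => ?_
    obtain ⟨b, hb, hsum⟩ := hT T
    exact ⟨Finset.range b, fun i hi => hb i (by simpa using hi), hsum⟩
  · obtain ⟨φ, hφ, hspan⟩ := exists_homs_restriction e he Q hQ hlam
    exact nonempty_equiv_directSum φ hφ hspan

end

end SpinBranch

/-! ### The branching theorem -/

theorem mainTheorem10 (n : ℕ) (hn : 1 ≤ n) (lam : ℂ) :
    (∀ hodd : Odd n,
      EqInK (levi' n) (nilrad' n)
        (GenVerma (parab n) (spinRep n lam))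
        (fun i : ℤˣ × ℕ => GenVerma (parab' n) (halfSpinRep' n hodd i.1 (lam - i.2))) ∧
      ((∀ k : ℕ, 1 ≤ k → lam + n - 3 / 2 ≠ k) → (∀ k : ℕ, 1 ≤ k → 2 * lam + n - 1 ≠ k) →
        Nonempty (GenVerma (parab n) (spinRep n lam) ≃ₗ⁅ℂ,gPrime n⁆
          ⨁ i : ℤˣ × ℕ, GenVerma (parab' n) (halfSpinRep' n hodd i.1 (lam - i.2))) ∧
        ∀ (ε : ℤˣ) (b : ℕ), (n = 1 → ε = 1) →
          LieModule.IsIrreducible ℂ (gPrime n)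
            (GenVerma (parab' n) (halfSpinRep' n hodd ε (lam - b))))) ∧
    (∀ (heven : Even n) (δ : ℤˣ),
      EqInK (levi' n) (nilrad' n)
        (GenVerma (parab n) (halfSpinRep n heven δ lam))
        (fun b : ℕ => GenVerma (parab' n) (spinRep' n (lam - b))) ∧
      ((∀ k : ℕ, 1 ≤ k → lam + n - 3 / 2 ≠ k) → (∀ k : ℕ, 1 ≤ k → 2 * lam + n - 1 ≠ k) →
        Nonempty (GenVerma (parab n) (halfSpinRep n heven δ lam) ≃ₗ⁅ℂ,gPrime n⁆
          ⨁ b : ℕ, GenVerma (parab' n) (spinRep' n (lam - b))) ∧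
        ∀ b : ℕ,
          LieModule.IsIrreducible ℂ (gPrime n)
            (GenVerma (parab' n) (spinRep' n (lam - b))))) := by
  obtain ⟨m, rfl⟩ : ∃ m, n = m + 1 := ⟨n - 1, by omega⟩
  refine ⟨fun ho => ?_, fun hn δ => ?_⟩
  · obtain ⟨hK, hiso⟩ := branching_odd m ho lam
    refine ⟨hK, fun h1 h2 => ⟨hiso fun k hk => ?_, fun ε b hε => ?_⟩⟩
    · simpa using sub_natCast_ne h2 0 k hk
    · exact irreducible_halfSpinVerma (sub_natCast_ne h2 b) (sub_natCast_ne' h1 b) ho (by grind) ε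
        fun h => hε (by omega)
  · obtain ⟨hK, hiso⟩ := branching_even m hn δ lam
    refine ⟨hK, fun h1 h2 => ⟨hiso fun k hk => ?_, fun b => ?_⟩⟩
    · simpa using sub_natCast_ne h2 0 k hk
    · exact irreducible_spinVerma (sub_natCast_ne h2 b) (sub_natCast_ne' h1 b) (by grind)
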